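/- Let $G$ be a connected linear real reductive Lie group with compact centre, realised as a closed connected subgroup of $GL(n,\mathbb R)$ that is stable under transposition. Let $\theta X=-X^T$ be the Cartan involution of $\mathfrak g$, $K=G\cap O(n)$ the corresponding maximal compact subgroup, and $\mathfrak g=\mathfrak k\oplus\mathfrak s$ the Cartan decomposition. Let $\mathfrak h=\mathfrak t_M\oplus\mathfrak a$ be a $\theta$-stable Cartan subalgebra, with $\mathfrak t_M=\mathfrak h\cap\mathfrak k$ and $\mathfrak a=\mathfrak h\cap\mathfrak s$, let $H=Z_G(\mathfrak h)$ be the corresponding Cartan subgroup, and let $Z_G(\mathfrak a)=MA$ with $A=\exp\mathfrak a$ be the Langlands decomposition; $\mathfrak m$ is the Lie algebra of $M$, $\mathfrak s_M=\mathfrak m\cap\mathfrak s$, $T_M=\exp\mathfrak t_M$, and $Z_M$ is the centre of $M$. Let $\Sigma$ be the set of nonzero weights of $\mathfrak a$ in $\mathfrak g$, let $\zeta\in\mathfrak a$ with $\langle\beta,\zeta\rangle\neq0$ for all $\beta\in\Sigma$, and set $\Sigma^+=\{\beta\in\Sigma:\langle\beta,\zeta\rangle>0\}$, $\mathfrak n=\mathfrak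 n^+=\bigoplus_{\beta\in\Sigma^+}\mathfrak g_\beta$, $\mathfrak n^-=\theta\mathfrak n^+$, so that $P=MAN$, $N=\exp\mathfrak n$, is a cuspidal parabolic subgroup. Let $R_M^+$ be a system of positive roots of $(\mathfrak m^{\mathbb C},\mathfrak t_M^{\mathbb C})$, with half sum $\rho^M$, let $\lambda\in i\mathfrak t_M^*$ be such that $\lambda-\rho^M$ is integral, and let $\chi_M$ be a one-dimensional (unitary) representation of $Z_M$ which agrees with $\mathbb C_{\lambda-\rho^M}$ on $T_M\cap Z_M$. Extend the representation $\mathbb C_{\lambda-\rho^M}\boxtimes\chi_M$ of $T_MZ_M$ to $H=T_MZ_MA$ trivially on $A$, and let $L_{\lambda-\rho^M,\chi_M}=G\times_H(\mathbb C_{\lambda-\rho^M}\boxtimes\chi_M)\to G/H$. Let $J_{\mathfrak g/\mathfrak h}$ be the complex structure on $\mathfrak g/\mathfrak h\cong\mathfrak m/\mathfrak t_M\oplus\mathfrak n^-\oplus\mathfrak n^+$ for which $\mathfrak m/\mathfrak t_M=\bigoplus_{\alpha\in R_M^+}\mathfrak m^{\mathbb C}_\alpha$ as complex vector spaces and which is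 $\theta|\mathrm{ad}(\zeta)|^{-1}\mathrm{ad}(\zeta)$ on $\mathfrak n^-\oplus\mathfrak n^+$. Let $J$ be the $K$-invariant almost complex structure on $G/H$ that corresponds to $J_{\mathfrak g/\mathfrak h}$ at $k\exp(X)\exp(Y)H$ under the tangent map of left translation by $k\exp(X)\exp(Y)$, for all $k\in K$, $X\in\mathfrak s_M$, $Y\in\mathfrak n$. The determinant line bundle of the $\mathrm{Spin}^c$-structure on $G/H$ with spinor bundle $\bigwedge_JT(G/H)\otimes L_{\lambda-\rho^M,\chi_M}$ is $$L_{\det}=\textstyle\bigwedge_J^{\dim(G/H)/2}T(G/H)\otimes L_{\lambda-\rho^M,\chi_M}^{\otimes2}\to G/H .$$ Let $R_G^+$ be the set of roots $\alpha$ of $(\mathfrak g^{\mathbb C},\mathfrak h^{\mathbb C})$ such that either $\alpha|_{\mathfrak a}=0$ and $\alpha|_{\mathfrak t_M}\in R_M^+$, or $\alpha|_{\mathfrak a}\in\Sigma^+$. Let $\rho^G$ be half the sum of $R_G^+$, and set $\rho^{G,M}=\rho^G|_{\mathfrak t_M}-\rho^M$ and $\xi=(\lambda+\rho^{G,M})/i\in\mathfrak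 t_M^*$. Let $\zeta'\in\mathfrak a^*$ be any functional, for instance the one that is identified with $\zeta$ by an invariant bilinear form. View $\xi+\zeta'\in\mathfrak h^*$ as an element of $\mathfrak g^*$ by extending it by zero on the sum of the root spaces. Then $L_{\det}$ has $K$-invariant Hermitian metrics, and for every such metric there is a $K$-invariant Hermitian connection $\nabla$ on $L_{\det}$ whose moment map $\Phi\colon G/H\to\mathfrak k^*$, defined by $$2i\langle\Phi,X\rangle=\mathcal L_X-\nabla_{X^{G/H}}\quad(X\in\mathfrak k),\qquad X^{G/H}(m)=\tfrac{d}{dt}\big|_{t=0}\exp(-tX)m,$$ where $\mathcal L_X$ is the Lie derivative of sections of $L_{\det}$, is given by $$\Phi(gH)=\bigl(\mathrm{Ad}^*(g)(\xi+\zeta')\bigr)\big|_{\mathfrak k}\qquad(g\in G).$$ -/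

import Mathlib

open Filter Topology
open scoped TensorProduct Matrix ContDiff

noncomputable section

namespace SpincMoment

/-! ### Closed matrix groups and their Lie algebras -/

/-- Product formula for the exponential in a Banach algebra. -/
theorem tendsto_exp_mul_exp_pow {𝔸 : Type*} [NormedRing 𝔸] [NormedAlgebra ℝ 𝔸] [CompleteSpace 𝔸]
    (X Y : 𝔸) :
    Tendsto (fun m : ℕ => (NormedSpace.exp ((((m : ℝ) + 1)⁻¹) • X) *
      NormedSpace.exp ((((m : ℝ) + 1)⁻¹) • Y)) ^ (m + 1)) atTop (𝓝 (NormedSpace.exp (X + Y))) := by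
  let _ : NormedAlgebra ℚ 𝔸 := NormedAlgebra.restrictScalars ℚ ℝ 𝔸
  have h0 : HasStrictFDerivAt (NormedSpace.exp : 𝔸 → 𝔸)
      ((ContinuousLinearEquiv.refl ℝ 𝔸) : 𝔸 →L[ℝ] 𝔸) 0 :=
    hasStrictFDerivAt_exp_zero
  let lg := h0.localInverse NormedSpace.exp _ _
  have hl : HasStrictFDerivAt lg ((ContinuousLinearEquiv.refl ℝ 𝔸).symm : 𝔸 →L[ℝ] 𝔸)
      (NormedSpace.exp (0 : 𝔸)) := h0.to_localInverse
  have hr : ∀ᶠ y in 𝓝 (NormedSpace.exp (0 : 𝔸)),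
      NormedSpace.exp (lg y) = y := h0.eventually_right_inverse
  have hl0 : lg (NormedSpace.exp 0) = 0 := h0.localInverse_apply_image
  rw [NormedSpace.exp_zero] at hl hr hl0
  let c : ℝ → 𝔸 := fun t => NormedSpace.exp (t • X) * NormedSpace.exp (t • Y)
  have hc0 : c 0 = 1 := by simp [c]
  have hc : HasDerivAt c (X + Y) 0 := by
    have h1 := (hasDerivAt_exp_smul_const (𝕂 := ℝ) X (0 : ℝ)).mul
      (hasDerivAt_exp_smul_const (𝕂 := ℝ) Y (0 : ℝ))
    simp only [zero_smul, NormedSpace.exp_zero, one_mul, mul_one] at h1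
    exact h1
  have hlc : HasDerivAt (fun t => lg (c t)) (X + Y) 0 := by
    have h1 := hl.hasFDerivAt
    rw [← hc0] at h1
    exact h1.comp_hasDerivAt (0 : ℝ) hc
  have hseq : Tendsto (fun m : ℕ => ((m : ℝ) + 1)⁻¹) atTop (𝓝[≠] 0) := by
    refine tendsto_nhdsWithin_iff.2 ⟨?_, Eventually.of_forall fun m => ?_⟩
    · simpa using tendsto_one_div_add_atTop_nhds_zero_nat (𝕜 := ℝ)
    · have : (0 : ℝ) < (m : ℝ) + 1 := by positivity
      simpa using this.ne'
  have hlim : Tendsto (fun m : ℕ => ((m + 1 : ℕ)) • lg (c (((m : ℝ) + 1)⁻¹))) atTop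
      (𝓝 (X + Y)) := by
    have h1 := (hlc.tendsto_slope_zero).comp hseq
    refine h1.congr fun m => ?_
    simp only [Function.comp, zero_add, hc0, hl0, inv_inv, sub_zero]
    rw [← Nat.cast_smul_eq_nsmul ℝ]
    push_cast
    rfl
  have hexp := (NormedSpace.exp_continuous.tendsto (X + Y)).comp hlim
  have hcc : Tendsto (fun m : ℕ => c (((m : ℝ) + 1)⁻¹)) atTop (𝓝 1) := by
    have := (hc.continuousAt.tendsto).comp (hseq.mono_right nhdsWithin_le_nhds)
    rwa [hc0] at this
  refine hexp.congr' ?_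
  filter_upwards [hcc.eventually hr] with m hm
  simp only [Function.comp]
  rw [NormedSpace.exp_nsmul, hm]

/-- The matrix exponential as an element of the general linear group. -/
def expGL {n : ℕ} (X : Matrix (Fin n) (Fin n) ℝ) : GL (Fin n) ℝ where
  val := NormedSpace.exp X
  inv := NormedSpace.exp (-X)
  val_inv := by
    rw [← Matrix.exp_add_of_commute _ _ (Commute.neg_right (Commute.refl X))]; simp
  inv_val := by
    rw [← Matrix.exp_add_of_commute _ _ (Commute.neg_left (Commute.refl X))]; simp

section
attribute [local instance] Matrix.linftyOpNormedRing Matrix.linftyOpNormedAlgebra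

theorem tendsto_matrix_exp_mul_exp_pow {n : ℕ} (X Y : Matrix (Fin n) (Fin n) ℝ) :
    Tendsto (fun m : ℕ => (NormedSpace.exp ((((m : ℝ) + 1)⁻¹) • X) *
      NormedSpace.exp ((((m : ℝ) + 1)⁻¹) • Y)) ^ (m + 1)) atTop (𝓝 (NormedSpace.exp (X + Y))) :=
  tendsto_exp_mul_exp_pow X Y

theorem isEmbedding_GL_val (n : ℕ) :
    IsEmbedding (fun g : GL (Fin n) ℝ => (g : Matrix (Fin n) (Fin n) ℝ)) :=
  (Units.isOpenEmbedding_val (R := Matrix (Fin n) (Fin n) ℝ)).isEmbedding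

end

/-- A closed group that contains the one-parameter groups of `X` and `Y`
contains `exp (X + Y)`. -/
theorem expGL_add_mem {n : ℕ} (S : Subgroup (GL (Fin n) ℝ))
    (hS : IsClosed (S : Set (GL (Fin n) ℝ))) (X Y : Matrix (Fin n) (Fin n) ℝ)
    (hX : ∀ t : ℝ, expGL (t • X) ∈ S) (hY : ∀ t : ℝ, expGL (t • Y) ∈ S) :
    expGL (X + Y) ∈ S := by
  let u : ℕ → GL (Fin n) ℝ := fun m =>
    (expGL ((((m : ℝ) + 1)⁻¹) • X) * expGL ((((m : ℝ) + 1)⁻¹) • Y)) ^ (m + 1)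
  have hu : ∀ m, u m ∈ S := fun m => S.pow_mem (S.mul_mem (hX _) (hY _)) _
  have hut : Tendsto u atTop (𝓝 (expGL (X + Y))) :=
    (isEmbedding_GL_val n).tendsto_nhds_iff.2 (tendsto_matrix_exp_mul_exp_pow X Y)
  exact hS.mem_of_tendsto hut (Eventually.of_forall hu)

/-- A connected linear real reductive Lie group with compact centre: a closed connected group
of real matrices which is stable under transposition and has compact centre. -/
structure LinearReductiveGroup (n : ℕ) where
  /-- The group, as a subgroup of the general linear group. -/
  toSubgroup : Subgroup (GL (Fin n) ℝ)
  isClosed : IsClosed (toSubgroup : Set (GL (Fin n) ℝ))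
  isConnected : IsConnected (toSubgroup : Set (GL (Fin n) ℝ))
  transpose_mem : ∀ g ∈ toSubgroup, ∀ g' : GL (Fin n) ℝ,
    (g' : Matrix (Fin n) (Fin n) ℝ) = (g : Matrix (Fin n) (Fin n) ℝ)ᵀ → g' ∈ toSubgroup
  isCompact_center : IsCompact (Subgroup.center toSubgroup : Set toSubgroup)

namespace LinearReductiveGroup

variable {n : ℕ} (𝒢 : LinearReductiveGroup n)

/-- The underlying group `G`. -/
abbrev Grp : Type := 𝒢.toSubgroup

/-- The matrix of an element of `G`. -/
abbrev mat (g : 𝒢.Grp) : Matrix (Fin n) (Fin n) ℝ := ((g : GL (Fin n) ℝ) : Matrix (Fin n) (Fin n) ℝ)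

/-- The Lie algebra `𝔤` of `G`: all matrices `X` with `exp (tX) ∈ G` for all real `t`. -/
def 𝔤 : Submodule ℝ (Matrix (Fin n) (Fin n) ℝ) where
  carrier := {X | ∀ t : ℝ, expGL (t • X) ∈ 𝒢.toSubgroup}
  add_mem' := by
    intro X Y hX hY t
    rw [smul_add]
    refine expGL_add_mem _ 𝒢.isClosed _ _ (fun s => ?_) (fun s => ?_)
    · rw [smul_smul]; exact hX _
    · rw [smul_smul]; exact hY _
  zero_mem' := by
    intro t
    have : expGL (t • (0 : Matrix (Fin n) (Fin n) ℝ)) = 1 := by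
      ext1; simp [expGL]
    rw [this]; exact one_mem _
  smul_mem' := by
    intro c X hX t
    rw [smul_smul]; exact hX _

/-- The exponential map `𝔤 → G`. -/
def expG (X : 𝒢.𝔤) : 𝒢.Grp :=
  ⟨expGL (X : Matrix (Fin n) (Fin n) ℝ), by simpa using X.2 1⟩

theorem conj_mem (g : 𝒢.Grp) {X : Matrix (Fin n) (Fin n) ℝ} (hX : X ∈ 𝒢.𝔤) :
    𝒢.mat g * X * 𝒢.mat g⁻¹ ∈ 𝒢.𝔤 := by
  intro t
  have : expGL (t • (𝒢.mat g * X * 𝒢.mat g⁻¹)) =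
      (g : GL (Fin n) ℝ) * expGL (t • X) * ((g⁻¹ : 𝒢.Grp) : GL (Fin n) ℝ) := by
    ext1
    simp only [expGL, Units.val_mul, mat, Subgroup.coe_inv]
    rw [← Matrix.exp_units_conj, Matrix.mul_smul, Matrix.smul_mul]
  rw [this]
  exact mul_mem (mul_mem g.2 (hX t)) (g⁻¹).2

/-- The adjoint representation of `G` on `𝔤`. -/
def Ad (g : 𝒢.Grp) : 𝒢.𝔤 →ₗ[ℝ] 𝒢.𝔤 where
  toFun X := ⟨𝒢.mat g * X * 𝒢.mat g⁻¹, 𝒢.conj_mem g X.2⟩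
  map_add' X Y := by ext1; simp [mul_add, add_mul]
  map_smul' c X := by ext1; simp

theorem Ad_mul (g h : 𝒢.Grp) (X : 𝒢.𝔤) : 𝒢.Ad (g * h) X = 𝒢.Ad g (𝒢.Ad h X) := by
  ext1; simp [Ad, mat, mul_assoc]

theorem neg_transpose_mem {X : Matrix (Fin n) (Fin n) ℝ} (hX : X ∈ 𝒢.𝔤) : -Xᵀ ∈ 𝒢.𝔤 := by
  refine neg_mem fun t => 𝒢.transpose_mem _ (hX t) _ ?_
  simp [expGL, ← Matrix.transpose_smul, Matrix.exp_transpose]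

/-- The Cartan involution `θ X = -Xᵀ` of `𝔤`. -/
def θ : 𝒢.𝔤 →ₗ[ℝ] 𝒢.𝔤 where
  toFun X := ⟨-(X : Matrix (Fin n) (Fin n) ℝ)ᵀ, 𝒢.neg_transpose_mem X.2⟩
  map_add' X Y := by ext1; simp [add_comm]
  map_smul' c X := by ext1; simp

/-- The maximal compact subgroup `K`, the orthogonal matrices in `G`. -/
def K : Subgroup 𝒢.Grp where
  carrier := {g | (𝒢.mat g)ᵀ * 𝒢.mat g = 1}
  mul_mem' := by
    intro g h hg hh
    simp only [Set.mem_ofPred_eq, mat, Subgroup.coe_mul, Units.val_mul,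
      Matrix.transpose_mul] at *
    rw [Matrix.mul_assoc, ← Matrix.mul_assoc _ _ ((h : GL (Fin n) ℝ) : Matrix (Fin n) (Fin n) ℝ),
      hg, Matrix.one_mul, hh]
  one_mem' := by simp [mat]
  inv_mem' := by
    intro g hg
    simp only [Set.mem_ofPred_eq, mat] at *
    have h1 : (((g⁻¹ : 𝒢.Grp) : GL (Fin n) ℝ) : Matrix (Fin n) (Fin n) ℝ) =
        ((g : GL (Fin n) ℝ) : Matrix (Fin n) (Fin n) ℝ)ᵀ := by
      rw [Subgroup.coe_inv]
      exact (left_inv_eq_right_inv hg (Units.mul_inv _)).symm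
    rw [h1, Matrix.transpose_transpose]
    exact mul_eq_one_comm.1 hg

/-- The Lie algebra `𝔨` of `K`, the fixed points of `θ`. -/
def 𝔨 : Submodule ℝ 𝒢.𝔤 := LinearMap.ker (𝒢.θ - LinearMap.id)

/-- The complement `𝔰` in the Cartan decomposition `𝔤 = 𝔨 ⊕ 𝔰`. -/
def 𝔰 : Submodule ℝ 𝒢.𝔤 := LinearMap.ker (𝒢.θ + LinearMap.id)

/-- The complexification of `𝔤`: the pairs `(X, Y)`, standing for `X + iY`, are realised as the
complex matrices with real and imaginary part in `𝔤`. -/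
def 𝔤ℂ : Submodule ℂ (Matrix (Fin n) (Fin n) ℂ) where
  carrier := {Z | Z.map Complex.re ∈ 𝒢.𝔤 ∧ Z.map Complex.im ∈ 𝒢.𝔤}
  add_mem' := by
    rintro Z W ⟨h1, h2⟩ ⟨h3, h4⟩
    refine ⟨?_, ?_⟩
    · convert add_mem h1 h3 using 1
      ext i j; simp
    · convert add_mem h2 h4 using 1
      ext i j; simp
  zero_mem' := by
    constructor
    · convert zero_mem 𝒢.𝔤 using 1
      ext i j; simp
    · convert zero_mem 𝒢.𝔤 using 1
      ext i j; simp
  smul_mem' := by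
    rintro c Z ⟨h1, h2⟩
    constructor
    · convert sub_mem (Submodule.smul_mem _ c.re h1) (Submodule.smul_mem _ c.im h2) using 1
      ext i j; simp
    · convert add_mem (Submodule.smul_mem _ c.re h2) (Submodule.smul_mem _ c.im h1) using 1
      ext i j; simp

/-- The inclusion `𝔤 → 𝔤ℂ`. -/
def toℂ : 𝒢.𝔤 →ₗ[ℝ] 𝒢.𝔤ℂ where
  toFun X := ⟨(X : Matrix (Fin n) (Fin n) ℝ).map Complex.ofReal, by
    constructor
    · convert X.2 using 1
      ext i j; simp
    · convert zero_mem 𝒢.𝔤 using 1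
      ext i j; simp⟩
  map_add' X Y := by ext i j; simp
  map_smul' c X := by ext i j; simp

/-- The real part `𝔤ℂ → 𝔤`. -/
def rePart : 𝒢.𝔤ℂ →ₗ[ℝ] 𝒢.𝔤 where
  toFun Z := ⟨(Z : Matrix (Fin n) (Fin n) ℂ).map Complex.re, Z.2.1⟩
  map_add' X Y := by ext i j; simp
  map_smul' c X := by ext i j; simp

/-- The imaginary part `𝔤ℂ → 𝔤`. -/
def imPart : 𝒢.𝔤ℂ →ₗ[ℝ] 𝒢.𝔤 where
  toFun Z := ⟨(Z : Matrix (Fin n) (Fin n) ℂ).map Complex.im, Z.2.2⟩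
  map_add' X Y := by ext i j; simp
  map_smul' c X := by ext i j; simp

/-- For subspaces `𝔱, 𝔭` of `𝔤`, the weight space in the complexification of `𝔭`
for the adjoint action of `𝔱` and the weight `α`. -/
def weightSpace (𝔭 𝔱 : Submodule ℝ 𝒢.𝔤) (α : 𝔱 →ₗ[ℝ] ℂ) : Submodule ℂ 𝒢.𝔤ℂ where
  carrier := {Z | 𝒢.rePart Z ∈ 𝔭 ∧ 𝒢.imPart Z ∈ 𝔭 ∧ ∀ Y : 𝔱,
    (𝒢.toℂ Y : Matrix (Fin n) (Fin n) ℂ) * Z - Z * (𝒢.toℂ Y : Matrix (Fin n) (Fin n) ℂ) =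
      α Y • (Z : Matrix (Fin n) (Fin n) ℂ)}
  add_mem' := by
    rintro Z W ⟨h1, h2, h3⟩ ⟨h4, h5, h6⟩
    refine ⟨by rw [map_add]; exact add_mem h1 h4, by rw [map_add]; exact add_mem h2 h5,
      fun Y => ?_⟩
    rw [Submodule.coe_add, smul_add, ← h3 Y, ← h6 Y, mul_add, add_mul]
    abel
  zero_mem' := by simp
  smul_mem' := by
    rintro c Z ⟨h1, h2, h3⟩
    have e1 : 𝒢.rePart (c • Z) = c.re • 𝒢.rePart Z - c.im • 𝒢.imPart Z := by
      ext i j; simp [rePart, imPart]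
    have e2 : 𝒢.imPart (c • Z) = c.re • 𝒢.imPart Z + c.im • 𝒢.rePart Z := by
      ext i j; simp [rePart, imPart]
    refine ⟨?_, ?_, fun Y => ?_⟩
    · rw [e1]; exact sub_mem (Submodule.smul_mem _ _ h1) (Submodule.smul_mem _ _ h2)
    · rw [e2]; exact add_mem (Submodule.smul_mem _ _ h2) (Submodule.smul_mem _ _ h1)
    · rw [Submodule.coe_smul, smul_comm, ← h3 Y, Matrix.mul_smul, Matrix.smul_mul, smul_sub]

/-- The nonzero weights of `𝔱` in the complexification of `𝔭`. -/
def roots (𝔭 𝔱 : Submodule ℝ 𝒢.𝔤) : Set (𝔱 →ₗ[ℝ] ℂ) :=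
  {α | α ≠ 0 ∧ 𝒢.weightSpace 𝔭 𝔱 α ≠ ⊥}

end LinearReductiveGroup

/-! ### Orthogonal projections for the Frobenius inner product `tr (A* B)` -/

/-- The matrix `A` as a vector of the Euclidean space of all entries. -/
def vec (𝕜 : Type) [RCLike 𝕜] (n : ℕ) :
    Matrix (Fin n) (Fin n) 𝕜 →ₗ[𝕜] EuclideanSpace 𝕜 (Fin n × Fin n) where
  toFun A := WithLp.toLp 2 fun p => A p.1 p.2
  map_add' _ _ := rfl
  map_smul' _ _ := rfl

theorem vec_injective (𝕜 : Type) [RCLike 𝕜] (n : ℕ) : Function.Injective (vec 𝕜 n) := by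
  intro A B h
  ext i j
  exact congrArg (fun v : EuclideanSpace 𝕜 (Fin n × Fin n) => v (i, j)) h

/-- The orthogonal projection of a space `V` of matrices onto its subspace `S`, for the inner
product `⟪A, B⟫ = tr (A* B)`. -/
def orthProj {𝕜 : Type} [RCLike 𝕜] {n : ℕ} {V : Submodule 𝕜 (Matrix (Fin n) (Fin n) 𝕜)}
    (S : Submodule 𝕜 V) : V →ₗ[𝕜] S :=
  (S.equivMapOfInjective (vec 𝕜 n ∘ₗ V.subtype)
      ((vec_injective 𝕜 n).comp V.injective_subtype)).symm.toLinearMap ∘ₗ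
    (S.map (vec 𝕜 n ∘ₗ V.subtype)).orthogonalProjectionOnto.toLinearMap ∘ₗ
      (vec 𝕜 n ∘ₗ V.subtype)

/-! ### The Cartan subgroup `H` and the cuspidal parabolic subgroup `P = MAN` -/

/-- A `θ`-stable Cartan subalgebra of `𝔤`: a `θ`-stable subspace which is its own centraliser.
(Its elements are sums of commuting symmetric and skew-symmetric matrices, hence semisimple.) -/
structure CartanSubalgebra {n : ℕ} (𝒢 : LinearReductiveGroup n) where
  𝔥 : Submodule ℝ 𝒢.𝔤
  θ_mem : ∀ X ∈ 𝔥, 𝒢.θ X ∈ 𝔥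
  mem_iff : ∀ X : 𝒢.𝔤, X ∈ 𝔥 ↔ ∀ Y ∈ 𝔥, (X : Matrix (Fin n) (Fin n) ℝ) * Y = Y * X

namespace CartanSubalgebra

variable {n : ℕ} {𝒢 : LinearReductiveGroup n} (C : CartanSubalgebra 𝒢)

/-- The subgroup of elements of `G` that centralise a subspace of `𝔤`. -/
def fixer (𝔟 : Submodule ℝ 𝒢.𝔤) : Subgroup 𝒢.Grp where
  carrier := {g | ∀ X ∈ 𝔟, 𝒢.Ad g X = X}
  mul_mem' := by
    intro g h hg hh X hX
    rw [𝒢.Ad_mul, hh X hX, hg X hX]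
  one_mem' := by
    intro X _
    ext1; simp [LinearReductiveGroup.Ad, LinearReductiveGroup.mat]
  inv_mem' := by
    intro g hg X hX
    conv_lhs => rw [← hg X hX]
    rw [← 𝒢.Ad_mul, inv_mul_cancel]
    ext1; simp [LinearReductiveGroup.Ad, LinearReductiveGroup.mat]

/-- The Cartan subgroup `H = Z_G(𝔥)`. -/
def H : Subgroup 𝒢.Grp := fixer C.𝔥

/-- The compact part `𝔱_M` of `𝔥`. -/
def 𝔱M : Submodule ℝ 𝒢.𝔤 := C.𝔥 ⊓ 𝒢.𝔨

/-- The noncompact part `𝔞` of `𝔥`, the Lie algebra of `A`. -/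
def 𝔞 : Submodule ℝ 𝒢.𝔤 := C.𝔥 ⊓ 𝒢.𝔰

/-- The centraliser `Z_G(𝔞) = MA`. -/
def ZA : Subgroup 𝒢.Grp := fixer C.𝔞

/-- The group `M` in the Langlands decomposition `Z_G(𝔞) = MA`: the common kernel of all
continuous homomorphisms from `Z_G(𝔞)` to the positive real numbers. -/
def M : Subgroup 𝒢.Grp where
  carrier := {g | ∃ hg : g ∈ C.ZA, ∀ χ : C.ZA →* ℝˣ, Continuous χ → |(χ ⟨g, hg⟩ : ℝ)| = 1}
  mul_mem' := by
    rintro g h ⟨hg, hg'⟩ ⟨hh, hh'⟩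
    refine ⟨mul_mem hg hh, fun χ hχ => ?_⟩
    have : (⟨g * h, mul_mem hg hh⟩ : C.ZA) = ⟨g, hg⟩ * ⟨h, hh⟩ := rfl
    rw [this, map_mul, Units.val_mul, abs_mul, hg' χ hχ, hh' χ hχ, one_mul]
  one_mem' := by
    refine ⟨one_mem _, fun χ _ => ?_⟩
    have : (⟨1, one_mem _⟩ : C.ZA) = 1 := rfl
    rw [this, map_one]; simp
  inv_mem' := by
    rintro g ⟨hg, hg'⟩
    refine ⟨inv_mem hg, fun χ hχ => ?_⟩
    have : (⟨g⁻¹, inv_mem hg⟩ : C.ZA) = (⟨g, hg⟩ : C.ZA)⁻¹ := rfl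
    rw [this, map_inv, Units.val_inv_eq_inv_val, abs_inv, hg' χ hχ, inv_one]

/-- The centre `Z_M` of `M`. -/
def ZM : Subgroup 𝒢.Grp := C.M ⊓ Subgroup.centralizer (C.M : Set 𝒢.Grp)

/-- The Lie algebra `𝔪` of `M`: the orthogonal complement of `𝔞` in the centraliser of `𝔞`,
for the invariant form `tr (XY)`. -/
def 𝔪 : Submodule ℝ 𝒢.𝔤 where
  carrier := {X | ∀ Y ∈ C.𝔞, (X : Matrix (Fin n) (Fin n) ℝ) * Y = Y * X ∧
    ((X : Matrix (Fin n) (Fin n) ℝ) * Y).trace = 0}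
  add_mem' := by
    intro X X' hX hX' Y hY
    simp [add_mul, mul_add, hX Y hY, hX' Y hY, (hX Y hY).1 ▸ (hX Y hY).2,
      (hX' Y hY).1 ▸ (hX' Y hY).2]
  zero_mem' := by simp
  smul_mem' := by
    intro c X hX Y hY
    simp [hX Y hY, (hX Y hY).1 ▸ (hX Y hY).2]

/-- The symmetric part `𝔰_M` of `𝔪`. -/
def 𝔰M : Submodule ℝ 𝒢.𝔤 := C.𝔪 ⊓ 𝒢.𝔰

/-- The weight space `𝔤_β` for the adjoint action of `𝔞` on `𝔤`. -/
def restrictedRootSpace (β : C.𝔞 →ₗ[ℝ] ℝ) : Submodule ℝ 𝒢.𝔤 where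
  carrier := {X | ∀ Y : C.𝔞, ((Y : 𝒢.𝔤) : Matrix (Fin n) (Fin n) ℝ) * X - X * (Y : 𝒢.𝔤) =
    β Y • (X : Matrix (Fin n) (Fin n) ℝ)}
  add_mem' := by
    intro X X' hX hX' Y
    rw [Submodule.coe_add, smul_add, ← hX Y, ← hX' Y, mul_add, add_mul]
    abel
  zero_mem' := by simp
  smul_mem' := by
    intro c X hX Y
    rw [Submodule.coe_smul, smul_comm, ← hX Y, Matrix.mul_smul, Matrix.smul_mul, smul_sub]

/-- The set `Σ` of nonzero weights of `𝔞` in `𝔤`. -/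
def restrictedRoots : Set (C.𝔞 →ₗ[ℝ] ℝ) := {β | β ≠ 0 ∧ C.restrictedRootSpace β ≠ ⊥}

/-- The positive restricted roots `Σ⁺` determined by an element `ζ` of `𝔞`. -/
def posRestrictedRoots (ζ : C.𝔞) : Set (C.𝔞 →ₗ[ℝ] ℝ) := {β | β ∈ C.restrictedRoots ∧ 0 < β ζ}

/-- The Lie algebra `𝔫 = 𝔫⁺` of `N`, the sum of the `𝔤_β` over `β ∈ Σ⁺`. -/
def 𝔫 (ζ : C.𝔞) : Submodule ℝ 𝒢.𝔤 := ⨆ β ∈ C.posRestrictedRoots ζ, C.restrictedRootSpace β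

/-- The opposite `𝔫⁻ = θ 𝔫⁺`. -/
def 𝔫bar (ζ : C.𝔞) : Submodule ℝ 𝒢.𝔤 := (C.𝔫 ζ).map 𝒢.θ

/-- The roots of `(𝔪ℂ, 𝔱_Mℂ)`, as functionals on `𝔱_M`. -/
def rootsM : Set (C.𝔱M →ₗ[ℝ] ℂ) := 𝒢.roots C.𝔪 C.𝔱M

/-- Systems of positive roots of `(𝔪ℂ, 𝔱_Mℂ)`. -/
structure IsPositiveSystem (P : Set (C.𝔱M →ₗ[ℝ] ℂ)) : Prop where
  subset : P ⊆ C.rootsM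
  mem_or_neg_mem : ∀ α ∈ C.rootsM, α ∈ P ∨ -α ∈ P
  not_neg_mem : ∀ α ∈ P, -α ∉ P
  add_mem : ∀ α ∈ P, ∀ β ∈ P, α + β ∈ C.rootsM → α + β ∈ P

/-- The roots of `(𝔤ℂ, 𝔥ℂ)`, as functionals on `𝔥`. -/
def rootsG : Set (C.𝔥 →ₗ[ℝ] ℂ) := 𝒢.roots ⊤ C.𝔥

/-- Restriction of functionals from `𝔥` to `𝔱_M`. -/
def resT (α : C.𝔥 →ₗ[ℝ] ℂ) : C.𝔱M →ₗ[ℝ] ℂ := α ∘ₗ Submodule.inclusion inf_le_left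

/-- Restriction of functionals from `𝔥` to `𝔞`. -/
def resA (α : C.𝔥 →ₗ[ℝ] ℂ) : C.𝔞 →ₗ[ℝ] ℂ := α ∘ₗ Submodule.inclusion inf_le_left

/-- The positive system `R⁺_G` determined by `R⁺_M = P` and by `Σ⁺`. -/
def posRootsG (P : Set (C.𝔱M →ₗ[ℝ] ℂ)) (ζ : C.𝔞) : Set (C.𝔥 →ₗ[ℝ] ℂ) :=
  {α | α ∈ C.rootsG ∧ ((C.resA α = 0 ∧ C.resT α ∈ P) ∨
    (C.resA α ≠ 0 ∧ ∃ β ∈ C.posRestrictedRoots ζ, ∀ Y, C.resA α Y = (β Y : ℂ)))}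

/-- `ρ^M`, half the sum of the roots in `P`. -/
def ρM (P : Set (C.𝔱M →ₗ[ℝ] ℂ)) : C.𝔱M →ₗ[ℝ] ℂ := (1 / 2 : ℂ) • ∑ᶠ α ∈ P, α

/-- `ρ^G`, half the sum of the roots in `R⁺_G`. -/
def ρG (P : Set (C.𝔱M →ₗ[ℝ] ℂ)) (ζ : C.𝔞) : C.𝔥 →ₗ[ℝ] ℂ :=
  (1 / 2 : ℂ) • ∑ᶠ α ∈ C.posRootsG P ζ, α

/-- `ρ^{G,M} = ρ^G|_{𝔱_M} - ρ^M`. -/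
def ρGM (P : Set (C.𝔱M →ₗ[ℝ] ℂ)) (ζ : C.𝔞) : C.𝔱M →ₗ[ℝ] ℂ := C.resT (C.ρG P ζ) - C.ρM P

/-! ### The complex structure on `𝔤/𝔥` -/

/-- The sum of the root spaces of `𝔪ℂ` over the roots in `P`. -/
def 𝔪plus (P : Set (C.𝔱M →ₗ[ℝ] ℂ)) : Submodule ℂ 𝒢.𝔤ℂ := ⨆ α ∈ P, 𝒢.weightSpace C.𝔪 C.𝔱M α

/-- The real linear endomorphism of `𝔤` that induces `J_{𝔤/𝔥}` on `𝔤/𝔥`.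
The spaces `𝔥`, `𝔫⁺`, `𝔫⁻` and the root spaces of `𝔪ℂ` are mutually orthogonal. On the real
elements `X = Z + conj Z = 2 Re Z` of `𝔪`, with `Z` in the sum of the root spaces for `R⁺_M`, this
is `X ↦ 2 Re (i Z)`, which is multiplication by `i` for the identification
`𝔪/𝔱_M = ⨁_{α ∈ R⁺_M} 𝔪ℂ_α`.
On `𝔫⁻ ⊕ 𝔫⁺` it is `θ |ad ζ|⁻¹ ad ζ`, that is, `θ` on `𝔫⁺` and `-θ` on `𝔫⁻`. -/
def Jlift (P : Set (C.𝔱M →ₗ[ℝ] ℂ)) (ζ : C.𝔞) : 𝒢.𝔤 →ₗ[ℝ] 𝒢.𝔤 where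
  toFun X := (2 : ℝ) • 𝒢.rePart (Complex.I • (orthProj (C.𝔪plus P) (𝒢.toℂ X) : 𝒢.𝔤ℂ)) +
    𝒢.θ (orthProj (C.𝔫 ζ) X) - 𝒢.θ (orthProj (C.𝔫bar ζ) X)
  map_add' X Y := by
    simp only [map_add, Submodule.coe_add, smul_add]
    abel
  map_smul' c X := by
    have h : orthProj (C.𝔪plus P) (𝒢.toℂ (c • X)) = (c : ℂ) • orthProj (C.𝔪plus P) (𝒢.toℂ X) := by
      rw [← map_smul]; congr 1; ext i j; simp
    have h0 : 𝒢.toℂ (c • X) = c • 𝒢.toℂ X := map_smul _ _ _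
    rw [h0] at h
    have h' : ∀ Z : 𝒢.𝔤ℂ, 𝒢.rePart (Complex.I • ((c : ℂ) • Z)) = c • 𝒢.rePart (Complex.I • Z) := by
      intro Z
      rw [← map_smul]; congr 1; ext i j; simp; ring
    simp only [h, map_smul, Submodule.coe_smul, smul_add, smul_sub, RingHom.id_apply, h']
    rw [smul_comm]

theorem orthProj_eq_zero {𝕜 : Type} [RCLike 𝕜] {V : Submodule 𝕜 (Matrix (Fin n) (Fin n) 𝕜)}
    (S : Submodule 𝕜 V) (X : V)
    (h : ∀ Z ∈ S, ((X : Matrix (Fin n) (Fin n) 𝕜)ᴴ * (Z : Matrix (Fin n) (Fin n) 𝕜)).trace = 0) :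
    orthProj S X = 0 := by
  have key : (S.map (vec 𝕜 n ∘ₗ V.subtype)).orthogonalProjectionOnto
      ((vec 𝕜 n ∘ₗ V.subtype) X) = 0 := by
    rw [Submodule.orthogonalProjectionOnto_eq_zero_iff]
    rintro _ ⟨Z, hZ, rfl⟩
    rw [← inner_conj_symm, ← map_zero (starRingEnd 𝕜)]
    congr 1
    rw [← h Z hZ]
    simp only [vec, LinearMap.comp_apply, Submodule.subtype_apply, PiLp.inner_apply, RCLike.inner_apply, Matrix.trace, Matrix.diag_apply,
      Matrix.mul_apply, Matrix.conjTranspose_apply, Fintype.sum_prod_type]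
    rw [Finset.sum_comm]
    refine Finset.sum_congr rfl fun i _ => Finset.sum_congr rfl fun j _ => ?_
    rw [mul_comm]; rfl
  simp only [orthProj, LinearMap.comp_apply]
  erw [key]
  exact map_zero _

theorem trace_mul_eq_zero {𝕜 : Type} [Field 𝕜] {A Y Z : Matrix (Fin n) (Fin n) 𝕜} {c : 𝕜}
    (hc : c ≠ 0) (hA : A * Y = Y * A) (hZ : Y * Z - Z * Y = c • Z) : (A * Z).trace = 0 := by
  have h : c * (A * Z).trace = 0 := by
    rw [← smul_eq_mul, ← Matrix.trace_smul, ← Matrix.mul_smul, ← hZ, Matrix.mul_sub,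
      Matrix.trace_sub, ← Matrix.mul_assoc, hA, Matrix.mul_assoc, Matrix.trace_mul_comm Y,
      Matrix.mul_assoc, sub_self]
  exact (mul_eq_zero.1 h).resolve_left hc

theorem transpose_comm {X Y : 𝒢.𝔤} (hX : X ∈ C.𝔥) (hY : Y ∈ C.𝔥) :
    (X : Matrix (Fin n) (Fin n) ℝ)ᵀ * Y = Y * (X : Matrix (Fin n) (Fin n) ℝ)ᵀ := by
  have h := (C.mem_iff _).1 (C.θ_mem X hX) Y hY
  simpa [LinearReductiveGroup.θ] using h

theorem trace_𝔫 (ζ : C.𝔞) {X : 𝒢.𝔤} (hX : X ∈ C.𝔥) {Z : 𝒢.𝔤} (hZ : Z ∈ C.𝔫 ζ) :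
    ((X : Matrix (Fin n) (Fin n) ℝ)ᵀ * (Z : Matrix (Fin n) (Fin n) ℝ)).trace = 0 := by
  let f : 𝒢.𝔤 →ₗ[ℝ] ℝ := Matrix.traceLinearMap (Fin n) ℝ ℝ ∘ₗ
    LinearMap.mulLeft ℝ ((X : Matrix (Fin n) (Fin n) ℝ)ᵀ) ∘ₗ 𝒢.𝔤.subtype
  have h : C.𝔫 ζ ≤ LinearMap.ker f := by
    refine iSup₂_le fun β hβ Z hZ => ?_
    obtain ⟨Y, hY⟩ : ∃ Y, β Y ≠ 0 := by
      by_contra! h0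
      exact hβ.1.1 (LinearMap.ext h0)
    exact trace_mul_eq_zero hY (C.transpose_comm hX Y.2.1) (hZ Y)
  exact h hZ

theorem Jlift_eq_zero (P : Set (C.𝔱M →ₗ[ℝ] ℂ)) (hP : P ⊆ C.rootsM) (ζ : C.𝔞) {X : 𝒢.𝔤}
    (hX : X ∈ C.𝔥) : C.Jlift P ζ X = 0 := by
  have h1 : orthProj (C.𝔪plus P) (𝒢.toℂ X) = 0 := by
    apply orthProj_eq_zero
    intro Z hZ
    let f : 𝒢.𝔤ℂ →ₗ[ℂ] ℂ := Matrix.traceLinearMap (Fin n) ℂ ℂ ∘ₗ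
      LinearMap.mulLeft ℂ ((𝒢.toℂ X : Matrix (Fin n) (Fin n) ℂ)ᴴ) ∘ₗ 𝒢.𝔤ℂ.subtype
    have h : C.𝔪plus P ≤ LinearMap.ker f := by
      refine iSup₂_le fun α hα Z hZ => ?_
      obtain ⟨Y, hY⟩ : ∃ Y, α Y ≠ 0 := by
        by_contra! h0
        exact (hP hα).1 (LinearMap.ext h0)
      refine trace_mul_eq_zero hY ?_ (hZ.2.2 Y)
      have h2 := congrArg (fun B : Matrix (Fin n) (Fin n) ℝ => B.map Complex.ofRealHom)
        (C.transpose_comm hX Y.2.1)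
      simp only [Matrix.map_mul] at h2
      convert h2 using 2 <;>
      · ext i j
        simp [LinearReductiveGroup.toℂ]
    exact h hZ
  have h2 : orthProj (C.𝔫 ζ) X = 0 := by
    apply orthProj_eq_zero
    intro Z hZ
    rw [Matrix.conjTranspose_eq_transpose_of_trivial]
    exact C.trace_𝔫 ζ hX hZ
  have h3 : orthProj (C.𝔫bar ζ) X = 0 := by
    apply orthProj_eq_zero
    rintro _ ⟨Z, hZ, rfl⟩
    have h4 := C.trace_𝔫 ζ (C.θ_mem X hX) hZ
    rw [Matrix.conjTranspose_eq_transpose_of_trivial]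
    simp only [LinearReductiveGroup.θ, LinearMap.coe_mk, AddHom.coe_mk, Matrix.transpose_neg,
      Matrix.transpose_transpose, neg_mul, mul_neg, Matrix.trace_neg] at h4 ⊢
    rw [← Matrix.transpose_mul, Matrix.trace_transpose, Matrix.trace_mul_comm]
    exact h4
  simp [Jlift, h1, h2, h3]

/-- The tangent space `T_{eH}(G/H) = 𝔤/𝔥`. -/
abbrev T : Type := 𝒢.𝔤 ⧸ C.𝔥

/-- The complex structure `J_{𝔤/𝔥}`. -/
def J (P : Set (C.𝔱M →ₗ[ℝ] ℂ)) (hP : P ⊆ C.rootsM) (ζ : C.𝔞) : C.T →ₗ[ℝ] C.T :=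
  C.𝔥.mapQ C.𝔥 (C.Jlift P ζ) fun X hX => by
    rw [Submodule.mem_comap, C.Jlift_eq_zero P hP ζ hX]
    exact zero_mem _

/-- The action of `H` on `𝔤/𝔥` induced by the adjoint representation. -/
def AdT (h : C.H) : C.T →ₗ[ℝ] C.T :=
  C.𝔥.mapQ C.𝔥 (𝒢.Ad h) fun X hX => by
    rw [Submodule.mem_comap, h.2 X hX]
    exact hX

end CartanSubalgebra

/-! ### Parameters of the representation -/

/-- The data that define the spinor bundle on `G/H`. -/
structure Datum {n : ℕ} (𝒢 : LinearReductiveGroup n) extends CartanSubalgebra 𝒢 where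
  /-- An element `ζ` of `𝔞` on which no restricted root vanishes. It determines
  `Σ⁺ = {β ∈ Σ | β(ζ) > 0}`, hence `N` and the cuspidal parabolic subgroup `P = MAN`. -/
  ζ : toCartanSubalgebra.𝔞
  ζ_regular : ∀ β ∈ toCartanSubalgebra.restrictedRoots, β ζ ≠ 0
  /-- The positive roots `R⁺_M` of `(𝔪ℂ, 𝔱_Mℂ)`. -/
  RM : Set (toCartanSubalgebra.𝔱M →ₗ[ℝ] ℂ)
  isPositiveSystem : toCartanSubalgebra.IsPositiveSystem RM
  /-- The parameter `λ ∈ i 𝔱_M^*`. -/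
  lam : toCartanSubalgebra.𝔱M →ₗ[ℝ] ℂ
  lam_imaginary : ∀ X, (lam X).re = 0
  /-- The one-dimensional representation `χ_M` of `Z_M`. -/
  χM : toCartanSubalgebra.ZM →* Circle
  χM_continuous : Continuous χM
  /-- The representation `ℂ_{λ - ρ^M} ⊠ χ_M` of `H = T_M Z_M A`, trivial on `A`. (That it exists
  says that `λ - ρ^M` is integral and that `χ_M` and `e^{λ - ρ^M}` agree on `T_M ∩ Z_M`.) -/
  σ : toCartanSubalgebra.H →* Circle
  σ_apply : ∀ (h : toCartanSubalgebra.H) (X : toCartanSubalgebra.𝔱M) (z : toCartanSubalgebra.ZM)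
    (Y : toCartanSubalgebra.𝔞), (h : 𝒢.Grp) = 𝒢.expG X * z * 𝒢.expG Y →
      (σ h : ℂ) = Complex.exp (lam X - toCartanSubalgebra.ρM RM X) * χM z

/-! ### Smooth functions on `G` -/

/-- Smoothness of a map from `G` to a finite-dimensional vector space `V` over `𝕜 = ℝ` or `ℂ`:
in the exponential charts `X ↦ g exp X` of `G` and in linear coordinates on `V`. -/
def IsSmooth {n : ℕ} {𝒢 : LinearReductiveGroup n} (𝕜 : Type) [RCLike 𝕜] {V : Type*}
    [AddCommGroup V] [Module 𝕜 V] (f : 𝒢.Grp → V) : Prop :=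
  ∀ (ℓ : V →ₗ[𝕜] 𝕜) (g : 𝒢.Grp) (m : ℕ) (X : Fin m → 𝒢.𝔤),
    ContDiff ℝ ∞ fun c : Fin m → ℝ => ℓ (f (g * 𝒢.expG (∑ i, c i • X i)))

section
attribute [local instance] Matrix.linftyOpNormedRing Matrix.linftyOpNormedAlgebra

theorem contDiff_conj_exp {n m : ℕ} (B : Matrix (Fin n) (Fin n) ℝ →ₗ[ℝ] ℝ)
    (A : Matrix (Fin n) (Fin n) ℝ) (S : (Fin m → ℝ) →ₗ[ℝ] Matrix (Fin n) (Fin n) ℝ) :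
    ContDiff ℝ ∞ fun c : Fin m → ℝ =>
      B (NormedSpace.exp (-S c) * A * NormedSpace.exp (S c)) := by
  have hB : ContDiff ℝ ∞ fun Z : Matrix (Fin n) (Fin n) ℝ => B Z :=
    (LinearMap.toContinuousLinearMap B).contDiff
  have hS : ContDiff ℝ ∞ fun c : Fin m → ℝ => S c :=
    (LinearMap.toContinuousLinearMap S).contDiff
  have he : ContDiff ℝ ∞ fun Z : Matrix (Fin n) (Fin n) ℝ => NormedSpace.exp Z :=
    contDiff_iff_contDiffAt.2 fun Z => (NormedSpace.exp_analytic (𝕂 := ℝ) Z).contDiffAt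
  exact hB.comp (((he.comp hS.neg).mul contDiff_const).mul (he.comp hS))

end

theorem contDiff_Ad {n m : ℕ} {𝒢 : LinearReductiveGroup n} (ℓ : 𝒢.𝔤 →ₗ[ℝ] ℝ) (g : 𝒢.Grp)
    (X : 𝒢.𝔤) (Z : Fin m → 𝒢.𝔤) :
    ContDiff ℝ ∞ fun c : Fin m → ℝ => ℓ (𝒢.Ad (g * 𝒢.expG (∑ i, c i • Z i))⁻¹ X) := by
  obtain ⟨B, hB⟩ := ℓ.exists_extend
  have key := contDiff_conj_exp B (𝒢.mat g⁻¹ * X * 𝒢.mat g)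
    (Fintype.linearCombination ℝ fun i => (Z i : Matrix (Fin n) (Fin n) ℝ))
  refine (congrArg (ContDiff ℝ ∞) (funext fun c => ?_)).mpr key
  have h1 := LinearMap.congr_fun hB (𝒢.Ad (g * 𝒢.expG (∑ i, c i • Z i))⁻¹ X)
  rw [← h1, LinearMap.comp_apply, Submodule.subtype_apply]
  congr 1
  have h2 : ((∑ i, c i • Z i : 𝒢.𝔤) : Matrix (Fin n) (Fin n) ℝ) =
      ∑ i, c i • (Z i : Matrix (Fin n) (Fin n) ℝ) := by simp
  have h3 : 𝒢.mat (𝒢.expG (∑ i, c i • Z i)) =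
      NormedSpace.exp (∑ i, c i • (Z i : Matrix (Fin n) (Fin n) ℝ)) := by
    rw [← h2]; rfl
  have h4 : 𝒢.mat (𝒢.expG (∑ i, c i • Z i))⁻¹ =
      NormedSpace.exp (-∑ i, c i • (Z i : Matrix (Fin n) (Fin n) ℝ)) := by
    rw [← h2]; rfl
  have h5 : ∀ a b : 𝒢.Grp, 𝒢.mat (a * b) = 𝒢.mat a * 𝒢.mat b := fun _ _ => rfl
  change 𝒢.mat (g * 𝒢.expG (∑ i, c i • Z i))⁻¹ * X *
    𝒢.mat ((g * 𝒢.expG (∑ i, c i • Z i))⁻¹)⁻¹ = _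
  rw [inv_inv, mul_inv_rev, h5, h5, h3, h4, Fintype.linearCombination_apply]
  simp only [Matrix.mul_assoc]

theorem neg_Ad_mul_inv {n : ℕ} {𝒢 : LinearReductiveGroup n} (g h : 𝒢.Grp) (X : 𝒢.𝔤) :
    -𝒢.Ad (g * h)⁻¹ X = 𝒢.Ad h⁻¹ (-𝒢.Ad g⁻¹ X) := by
  rw [map_neg, ← 𝒢.Ad_mul, mul_inv_rev]

namespace Datum

variable {n : ℕ} {𝒢 : LinearReductiveGroup n} (D : Datum 𝒢)

/-- `J_{𝔤/𝔥}` for the given data. -/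
def J₀ : D.T →ₗ[ℝ] D.T := D.J D.RM D.isPositiveSystem.subset D.ζ

/-- The functional `ξ = (λ + ρ^{G,M}) / i` on `𝔱_M`. -/
def ξ : D.𝔱M →ₗ[ℝ] ℝ := Complex.reLm ∘ₗ (Complex.I⁻¹ • (D.lam + D.ρGM D.RM D.ζ))

/-- The functional `ξ + η` on `𝔤`, for `ξ` as above and a functional `η` on `𝔞`, extended by zero
on the orthogonal complement of `𝔥 = 𝔱_M ⊕ 𝔞`, that is, on the sum of the root spaces. -/
def extend (η : D.𝔞 →ₗ[ℝ] ℝ) : 𝒢.𝔤 →ₗ[ℝ] ℝ := D.ξ ∘ₗ orthProj D.𝔱M + η ∘ₗ orthProj D.𝔞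

/-! ### `T(G/H)`, the almost complex structure `J` and the determinant line bundle

The tangent bundle of `G/H` is `G ×_H 𝔤/𝔥`, with `[g, X + 𝔥]` the velocity of `g exp(tX) H` at
`t = 0`, and `L = G ×_H ℂ_σ`. Sections of such bundles are written as `H`-equivariant functions
on `G`; functions on `G/H` are right `H`-invariant functions on `G`. -/

/-- The almost complex structure on `G/H`. At the point `gH`, with `T_{gH}(G/H)` identified with
`𝔤/𝔥` by the tangent map of left translation by `g`, it is `Ad(h)⁻¹ J_{𝔤/𝔥} Ad(h)`, where
`g = k exp(X) exp(Y) h` with `k ∈ K`, `X ∈ 𝔰_M`, `Y ∈ 𝔫` and `h ∈ H`. So, at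
`k exp(X) exp(Y) H`, it corresponds to `J_{𝔤/𝔥}` under the tangent map of
left translation by `k exp(X) exp(Y)`. -/
def acs (g : 𝒢.Grp) : D.T →ₗ[ℝ] D.T :=
  open Classical in
  if hd : ∃ h : D.H, ∃ k ∈ 𝒢.K, ∃ X ∈ D.𝔰M, ∃ Y ∈ D.𝔫 D.ζ,
      g = k * 𝒢.expG X * 𝒢.expG Y * h then
    D.AdT hd.choose⁻¹ ∘ₗ D.J₀ ∘ₗ D.AdT hd.choose
  else 0

/-- Half the real dimension of `G/H`. -/
def d : ℕ := Module.finrank ℝ D.T / 2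

/-- The top degree complex exterior power `⋀^d` of the complexification of `𝔤/𝔥`, in degree
`d = dim(G/H)/2`. It contains all the fibres of the determinant line bundle. -/
abbrev E : Type := ⋀[ℂ]^D.d (ℂ ⊗[ℝ] D.T)

/-- The holomorphic tangent space at `gH`, the `i`-eigenspace of `J`, to which
`(T_{gH}(G/H), J)` is isomorphic as a complex vector space by `w ↦ (w - i J w) / 2`. -/
def T10 (g : 𝒢.Grp) : Submodule ℂ (ℂ ⊗[ℝ] D.T) :=
  Module.End.eigenspace ((D.acs g).baseChange ℂ) Complex.I

/-- The fibre of `⋀_J^d T(G/H) ⊗ L^{⊗2}` at `gH`, pulled back to `g`. -/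
def fibre (g : 𝒢.Grp) : Submodule ℂ D.E :=
  LinearMap.range (exteriorPower.map D.d (D.T10 g).subtype)

/-- The action of `h ∈ H` on fibres: `⋀^d Ad(h) ⊗ σ(h)²`. -/
def act (h : D.H) : D.E →ₗ[ℂ] D.E :=
  ((D.σ h : ℂ) ^ 2) • exteriorPower.map D.d ((D.AdT h).baseChange ℂ)

/-- Smooth vector fields on `G/H`. -/
def VectorField : Submodule ℝ (𝒢.Grp → D.T) where
  carrier := {v | IsSmooth ℝ v ∧ ∀ (g : 𝒢.Grp) (h : D.H), v (g * h) = D.AdT h⁻¹ (v g)}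
  add_mem' := by
    rintro v w ⟨h1, h2⟩ ⟨h3, h4⟩
    refine ⟨fun ℓ g m X => ?_, fun g h => by simp [h2, h4]⟩
    simpa using (h1 ℓ g m X).add (h3 ℓ g m X)
  zero_mem' := ⟨fun ℓ g m X => by simpa using contDiff_const, fun g h => by simp⟩
  smul_mem' := by
    rintro c v ⟨h1, h2⟩
    refine ⟨fun ℓ g m X => ?_, fun g h => by simp [h2]⟩
    simpa using contDiff_const.mul (h1 ℓ g m X)

/-- Smooth sections of the determinant line bundle `L_det = ⋀_J^d T(G/H) ⊗ L^{⊗2}`. -/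
def Sect : Submodule ℂ (𝒢.Grp → D.E) where
  carrier := {s | IsSmooth ℂ s ∧ (∀ g, s g ∈ D.fibre g) ∧
    ∀ (g : 𝒢.Grp) (h : D.H), s (g * h) = D.act h⁻¹ (s g)}
  add_mem' := by
    rintro v w ⟨h1, h2, h3⟩ ⟨h4, h5, h6⟩
    refine ⟨fun ℓ g m X => ?_, fun g => add_mem (h2 g) (h5 g), fun g h => by simp [h3, h6]⟩
    simpa using (h1 ℓ g m X).add (h4 ℓ g m X)
  zero_mem' := ⟨fun ℓ g m X => by simpa using contDiff_const, fun g => zero_mem _,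
    fun g h => by simp⟩
  smul_mem' := by
    rintro c v ⟨h1, h2, h3⟩
    refine ⟨fun ℓ g m X => ?_, fun g => Submodule.smul_mem _ _ (h2 g), fun g h => by simp [h3]⟩
    simpa using contDiff_const.mul (h1 ℓ g m X)

/-- Smooth functions on `G/H`, with real or complex values. -/
def IsSmoothFunction (𝕜 : Type) [RCLike 𝕜] (f : 𝒢.Grp → 𝕜) : Prop :=
  IsSmooth 𝕜 f ∧ ∀ (g : 𝒢.Grp) (h : D.H), f (g * h) = f g

/-- The vector field on `G/H` induced by `X ∈ 𝔤`, with value at `gH` the velocity at `t = 0` of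
`exp(-tX) g H = g exp(-t Ad(g⁻¹) X) H`. -/
def inducedField (X : 𝒢.𝔤) : D.VectorField :=
  ⟨fun g => Submodule.Quotient.mk (-𝒢.Ad g⁻¹ X),
    fun ℓ g _ Z => contDiff_Ad (ℓ ∘ₗ D.𝔥.mkQ ∘ₗ (-LinearMap.id)) g X Z,
    fun g h => congrArg Submodule.Quotient.mk (neg_Ad_mul_inv g (h : 𝒢.Grp) X)⟩

/-! ### Hermitian metrics, connections and moment maps -/

/-- `K`-invariant smooth Hermitian metrics on `L_det`. The group `K` acts by left translation, so
that `(k · s)(g) = s(k⁻¹ g)`. -/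
structure KInvariantMetric where
  form : (g : 𝒢.Grp) → D.fibre g →ₗ⋆[ℂ] D.fibre g →ₗ[ℂ] ℂ
  conj_symm : ∀ g u v, starRingEnd ℂ (form g u v) = form g v u
  pos : ∀ g u, u ≠ 0 → 0 < (form g u u).re
  equivariant : ∀ (g : 𝒢.Grp) (h : D.H) (u v : D.fibre g) (u' v' : D.fibre (g * h)),
    (u' : D.E) = D.act h⁻¹ u → (v' : D.E) = D.act h⁻¹ v → form (g * h) u' v' = form g u v
  smooth : ∀ s t : D.Sect, D.IsSmoothFunction ℂ
    fun g => form g ⟨s.1 g, s.2.2.1 g⟩ ⟨t.1 g, t.2.2.1 g⟩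
  invariant : ∀ k ∈ 𝒢.K, ∀ (g : 𝒢.Grp) (u v : D.fibre g) (u' v' : D.fibre (k * g)),
    (u' : D.E) = u → (v' : D.E) = v → form (k * g) u' v' = form g u v

/-- The pairing of two sections, a function on `G/H`. -/
def KInvariantMetric.pair {D : Datum 𝒢} (b : D.KInvariantMetric) (s t : D.Sect) (g : 𝒢.Grp) : ℂ :=
  b.form g ⟨s.1 g, s.2.2.1 g⟩ ⟨t.1 g, t.2.2.1 g⟩

/-- The derivative at `g` of a function on `G` (or on `G/H`) in the direction of `X ∈ 𝔤`,
or of `[g, X + 𝔥]`. -/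
def dirDeriv (f : 𝒢.Grp → ℂ) (g : 𝒢.Grp) (X : 𝒢.𝔤) : ℂ :=
  deriv (fun t : ℝ => f (g * 𝒢.expG (t • X))) 0

/-- Connections on `L_det`: maps `(v, s) ↦ ∇_v s`, linear over smooth functions in `v` and
satisfying the Leibniz rule in `s`. -/
structure Connection where
  toFun : D.VectorField → D.Sect →ₗ[ℂ] D.Sect
  add_field : ∀ v w s, toFun (v + w) s = toFun v s + toFun w s
  smul_field : ∀ f : 𝒢.Grp → ℝ, D.IsSmoothFunction ℝ f → ∀ v w : D.VectorField,
    (∀ g, w.1 g = f g • v.1 g) → ∀ s g, (toFun w s).1 g = (f g : ℂ) • (toFun v s).1 g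
  leibniz : ∀ f : 𝒢.Grp → ℂ, D.IsSmoothFunction ℂ f → ∀ s t : D.Sect,
    (∀ g, t.1 g = f g • s.1 g) → ∀ (v : D.VectorField) (g : 𝒢.Grp) (X : 𝒢.𝔤),
      v.1 g = Submodule.Quotient.mk X →
      (toFun v t).1 g = dirDeriv f g X • s.1 g + f g • (toFun v s).1 g

namespace Connection

variable {D} (nabla : D.Connection)

/-- A connection is Hermitian if `v⟨s, t⟩ = ⟨∇_v s, t⟩ + ⟨s, ∇_v t⟩`. -/
def IsHermitian (b : D.KInvariantMetric) : Prop :=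
  ∀ (v : D.VectorField) (s t : D.Sect) (g : 𝒢.Grp) (X : 𝒢.𝔤),
    v.1 g = Submodule.Quotient.mk X →
      dirDeriv (b.pair s t) g X = b.pair (nabla.toFun v s) t g + b.pair s (nabla.toFun v t) g

/-- A connection is `K`-invariant if `∇_{k·v}(k·s) = k·(∇_v s)`. -/
def IsKInvariant : Prop :=
  ∀ k ∈ 𝒢.K, ∀ (v v' : D.VectorField) (s s' : D.Sect),
    (∀ g, v'.1 g = v.1 (k⁻¹ * g)) → (∀ g, s'.1 g = s.1 (k⁻¹ * g)) →
      ∀ g, (nabla.toFun v' s').1 g = (nabla.toFun v s).1 (k⁻¹ * g)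

/-- `Φ` is the moment map of `∇`: for all `X ∈ 𝔨` and all sections `s`, the Lie derivative
`𝓛_X s = d/dt|_{t=0} (exp(tX) · s)`, which is `d/dt|_{t=0} s(exp(-tX) g)` at `g`, exists and
equals `∇_{X^{G/H}} s + 2i ⟨Φ, X⟩ s`. -/
def IsMomentMap (Φ : 𝒢.Grp ⧸ D.H → Module.Dual ℝ 𝒢.𝔨) : Prop :=
  ∀ (X : 𝒢.𝔨) (s : D.Sect) (g : 𝒢.Grp) (ℓ : D.E →ₗ[ℂ] ℂ),
    HasDerivAt (fun t : ℝ => ℓ (s.1 (𝒢.expG (-(t • (X : 𝒢.𝔤))) * g)))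
      (ℓ ((nabla.toFun (D.inducedField X) s).1 g +
        (2 * Complex.I * (Φ (g : 𝒢.Grp ⧸ D.H) X : ℝ)) • s.1 g)) 0

end Connection

end Datum

end SpincMoment

end

/-!
The determinant line bundle, pulled back to `G`, has a smooth `K`-invariant frame which transforms
by a character of `H`. In such a frame a connection is a one-form, and the moment map is read off
from it; the point is to find the frame and to compute the character.

*The frame.* There is a smooth map `Z : G → 𝔞` which is left invariant under `K`, right invariant
under `exp 𝔰_M`, `N` and `H ∩ K`, and satisfies `Z (g exp W) = Z g + W` for `W ∈ 𝔞`
(`exists_projection`). Its components are combinations of the functions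
`log det (P gᵀ g P + 1 - P)`, where `P` is a spectral projection of an element of `𝔞` in the
positive chamber; as logarithms of principal minors of `gᵀ g` they are visibly smooth. Together with
the decomposition `G = K exp(𝔰_M) N A` (`exists_iwasawa`), which is proved from the polar
decomposition `G = K exp 𝔰` (`exists_polar`) and the Levi decomposition of the group of block upper
triangular elements (`exists_levi`), it gives a formula for the almost complex structure: at `g` it
is the conjugate of `J_{𝔤/𝔥}` by `Ad a⁻¹`, where `a = exp (Z g)` (`acs_apply`). Thus the action of
`a⁻¹` carries a vector `e₀` of the fibre at the base point to a vector of the fibre at `g`, and this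
is the frame.

*The character.* The frame transforms by the character `δ` of `H` that is trivial on `A` and is the
action on the base fibre on `H ∩ K`. On `T_M` the top exterior power contributes
`tr (ad X | T^{1,0}) = 2ρ^M(X)` (`trace_adT`), because the root spaces in `𝔪` are lines and `J ad X`
exchanges `𝔫` and `𝔫⁻`, so that these do not contribute to its trace; the square of the
representation contributes `2(λ - ρ^M)`. Hence `δ (exp X) = exp (2λ(X))`. On the other side
`ρ^{G,M} = 0`, since the roots that do not vanish on `𝔞` come in complex conjugate pairs with
opposite restrictions to `𝔱_M` (`ρGM_eq_zero`), so that `2λ = 2iξ`. Being a character of a compact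
group on `H ∩ K`, `δ` is unitary.

*Metrics and connections.* The frame defines an invariant Hermitian metric (`frameMetric`). For any
invariant metric `b` the frame is rescaled to length one and multiplied by `exp (2iζ'(Z))`
(`unitFactor`), after which it transforms by a unitary character of `H` with differential
`2i(ξ + ζ')` (`unitChar_exp`). Smoothness of the scaling factor is known from the values of `b` on
global sections, so one needs sections that do not vanish at a given point; these are averages of
polynomial functions over the compact group `H ∩ K`, and the Stone-Weierstrass theorem shows that
there are enough of them (`exists_coefFun_ne_zero`). The left invariant one-form `2i(ξ + ζ')` in
this frame agrees with the character on `𝔥`, so it defines a connection on the bundle over `G/H`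
(`frameConnection`, `cov_𝔥`). The frame is `K`-invariant and of length one and the form is purely
imaginary, so the connection is invariant and Hermitian, and `ℒ_X - ∇_X` is multiplication by the
value of `2i(ξ + ζ')` on `Ad(g)⁻¹ X`.
-/

open Filter Topology
open scoped TensorProduct Matrix ContDiff

noncomputable section

namespace SpincMoment

/-! ### One-parameter groups and closed subgroups -/

/-- A smooth local inverse of the exponential map near the identity. -/
theorem exists_local_log (𝔸 : Type*) [NormedRing 𝔸] [NormedAlgebra ℝ 𝔸] [CompleteSpace 𝔸] :
    ∃ lg : 𝔸 → 𝔸, lg 1 = 0 ∧ ContDiffAt ℝ ∞ lg 1 ∧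
      HasStrictFDerivAt lg (ContinuousLinearMap.id ℝ 𝔸) 1 ∧
      (∀ᶠ y in 𝓝 (1 : 𝔸), NormedSpace.exp (lg y) = y) ∧
      ∀ᶠ x in 𝓝 (0 : 𝔸), lg (NormedSpace.exp x) = x := by
  let _ : NormedAlgebra ℚ 𝔸 := NormedAlgebra.restrictScalars ℚ ℝ 𝔸
  have h0 : HasStrictFDerivAt (NormedSpace.exp : 𝔸 → 𝔸)
      ((ContinuousLinearEquiv.refl ℝ 𝔸) : 𝔸 →L[ℝ] 𝔸) 0 := hasStrictFDerivAt_exp_zero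
  have hc : ContDiffAt ℝ ∞ (NormedSpace.exp : 𝔸 → 𝔸) 0 :=
    (NormedSpace.exp_analytic (𝕂 := ℝ) (0 : 𝔸)).contDiffAt
  refine ⟨h0.localInverse NormedSpace.exp _ _, ?_, ?_, ?_, ?_, ?_⟩
  · have := h0.localInverse_apply_image
    rwa [NormedSpace.exp_zero] at this
  · have := hc.to_localInverse (f' := ContinuousLinearEquiv.refl ℝ 𝔸) h0.hasFDerivAt (by simp)
    rw [NormedSpace.exp_zero] at this
    exact this
  · have := h0.to_localInverse
    rw [NormedSpace.exp_zero] at this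
    exact this
  · have := h0.eventually_right_inverse
    rwa [NormedSpace.exp_zero] at this
  · exact h0.eventually_left_inverse

/-- The linear part of the closed subgroup theorem: small logarithms of elements of a closed
group `S` lie in its Lie algebra `L`. Otherwise a limit of directions transverse to `L` would
generate a one-parameter group in `S`. -/
theorem eventually_mem_of_exp_mem {𝔸 : Type*} [NormedRing 𝔸] [NormedAlgebra ℝ 𝔸]
    [FiniteDimensional ℝ 𝔸] (S : Submonoid 𝔸)
    (hinv : ∀ X : 𝔸, NormedSpace.exp X ∈ S → NormedSpace.exp (-X) ∈ S)
    (hcl : ∀ (u : ℕ → 𝔸) (X : 𝔸), (∀ m, u m ∈ S) →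
      Tendsto u atTop (𝓝 (NormedSpace.exp X)) → NormedSpace.exp X ∈ S)
    (L : Submodule ℝ 𝔸) (hL : ∀ X, X ∈ L ↔ ∀ t : ℝ, NormedSpace.exp (t • X) ∈ S) :
    ∀ᶠ X in 𝓝 (0 : 𝔸), NormedSpace.exp X ∈ S → X ∈ L := by
  have : CompleteSpace 𝔸 := FiniteDimensional.complete ℝ 𝔸
  let _ : NormedAlgebra ℚ 𝔸 := NormedAlgebra.restrictScalars ℚ ℝ 𝔸
  by_contra hcon
  rw [Filter.not_eventually] at hcon
  obtain ⟨X, hX0, hX⟩ := Filter.exists_seq_forall_of_frequently hcon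
  simp only [Classical.not_imp] at hX
  obtain ⟨L', hL'⟩ := L.exists_isCompl
  -- `exp X = exp A * exp B` for small `X`, with `A ∈ L` and `B ∈ L'`
  let Ψ : L × L' → 𝔸 := fun p => NormedSpace.exp (p.1 : 𝔸) * NormedSpace.exp (p.2 : 𝔸)
  let eL : (L × L') ≃L[ℝ] 𝔸 := (L.prodEquivOfIsCompl L' hL').toContinuousLinearEquiv
  have hΨ : HasStrictFDerivAt Ψ (eL : (L × L') →L[ℝ] 𝔸) 0 := by
    have h0 : HasStrictFDerivAt (NormedSpace.exp : 𝔸 → 𝔸) (ContinuousLinearMap.id ℝ 𝔸) 0 :=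
      hasStrictFDerivAt_exp_zero
    let F1 : (L × L') →L[ℝ] 𝔸 := L.subtypeL ∘L ContinuousLinearMap.fst ℝ L L'
    let F2 : (L × L') →L[ℝ] 𝔸 := L'.subtypeL ∘L ContinuousLinearMap.snd ℝ L L'
    have h1 : HasStrictFDerivAt (fun p => NormedSpace.exp (F1 p)) F1 0 := by
      have := HasStrictFDerivAt.comp (g := (NormedSpace.exp : 𝔸 → 𝔸)) (0 : L × L')
        (by rw [map_zero]; exact h0) F1.hasStrictFDerivAt
      simpa using this
    have h2 : HasStrictFDerivAt (fun p => NormedSpace.exp (F2 p)) F2 0 := by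
      have := HasStrictFDerivAt.comp (g := (NormedSpace.exp : 𝔸 → 𝔸)) (0 : L × L')
        (by rw [map_zero]; exact h0) F2.hasStrictFDerivAt
      simpa using this
    have h3 := h1.mul' h2
    refine h3.congr_fderiv ?_
    ext p <;> simp [F1, F2, eL, NormedSpace.exp_zero]
  have hΨ0 : Ψ 0 = 1 := by simp [Ψ, NormedSpace.exp_zero]
  let G := hΨ.localInverse Ψ _ _
  have hG1 : G 1 = 0 := by
    have := hΨ.localInverse_apply_image
    rwa [hΨ0] at this
  have hGc : Tendsto G (𝓝 1) (𝓝 0) := by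
    have := hΨ.to_localInverse.continuousAt
    rw [hΨ0] at this
    simpa [ContinuousAt, hG1, G] using this
  have hGr : ∀ᶠ y in 𝓝 (1 : 𝔸), Ψ (G y) = y := by
    have := hΨ.eventually_right_inverse
    rwa [hΨ0] at this
  obtain ⟨lg, hlg1, -, -, -, hlg⟩ := exists_local_log 𝔸
  have hE : Tendsto (fun j => NormedSpace.exp (X j)) atTop (𝓝 (1 : 𝔸)) := by
    have := (NormedSpace.exp_continuous.tendsto (0 : 𝔸)).comp hX0
    rwa [NormedSpace.exp_zero] at this
  have hAB := hGc.comp hE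
  have hA : Tendsto (fun j => ((G (NormedSpace.exp (X j))).1 : 𝔸)) atTop (𝓝 0) := by
    have := ((L.subtypeL ∘L ContinuousLinearMap.fst ℝ L L').continuous.tendsto 0).comp hAB
    simpa [Function.comp_def] using this
  have hB : Tendsto (fun j => (G (NormedSpace.exp (X j))).2) atTop (𝓝 0) := by
    have := ((ContinuousLinearMap.snd ℝ L L').continuous.tendsto 0).comp hAB
    simpa [Function.comp_def] using this
  -- the factor `exp B` lies in `S`, and `B ≠ 0` since `X j ∉ L`
  have hev : ∀ᶠ j in atTop, (G (NormedSpace.exp (X j))).2 ≠ 0 ∧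
      NormedSpace.exp ((G (NormedSpace.exp (X j))).2 : 𝔸) ∈ S := by
    filter_upwards [hE.eventually hGr, hX0.eventually hlg, hA.eventually hlg] with j h1 h2 h3
    have h4 : NormedSpace.exp ((G (NormedSpace.exp (X j))).1 : 𝔸) *
      NormedSpace.exp ((G (NormedSpace.exp (X j))).2 : 𝔸) = NormedSpace.exp (X j) := h1
    generalize G (NormedSpace.exp (X j)) = p at h3 h4
    constructor
    · intro h0
      rw [h0] at h4
      simp only [Submodule.coe_zero, NormedSpace.exp_zero, mul_one] at h4
      rw [← h4, h3] at h2
      exact (hX j).2 (by rw [← h2]; exact p.1.2)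
    · have h6 : NormedSpace.exp (p.2 : 𝔸) =
          NormedSpace.exp (-(p.1 : 𝔸)) * NormedSpace.exp (X j) := by
        rw [← h4, ← mul_assoc, ← NormedSpace.exp_add_of_commute
          (Commute.neg_left (Commute.refl _)), neg_add_cancel, NormedSpace.exp_zero, one_mul]
      rw [h6]
      refine S.mul_mem (hinv _ ?_) (hX j).1
      have := (hL _).1 p.1.2 1
      rwa [one_smul] at this
  obtain ⟨J, hJ⟩ := eventually_atTop.1 hev
  let Bs : ℕ → L' := fun j => (G (NormedSpace.exp (X (j + J)))).2
  have hBs : Tendsto Bs atTop (𝓝 0) := hB.comp (tendsto_add_atTop_nat J)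
  have hBs0 : ∀ j, Bs j ≠ 0 := fun j => (hJ (j + J) (by omega)).1
  have hBsS : ∀ j, NormedSpace.exp (Bs j : 𝔸) ∈ S := fun j => (hJ (j + J) (by omega)).2
  -- `B` is a limit of the directions of the transverse parts
  obtain ⟨B, hB1, φ, hφ, hφB⟩ := (isCompact_sphere (0 : L') 1).tendsto_subseq
    (x := fun j => ‖Bs j‖⁻¹ • Bs j) (fun j => by
      rw [mem_sphere_zero_iff_norm, norm_smul, norm_inv, norm_norm,
        inv_mul_cancel₀ (norm_ne_zero_iff.2 (hBs0 j))])
  have hpos : ∀ t : ℝ, 0 ≤ t → NormedSpace.exp (t • (B : 𝔸)) ∈ S := by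
    intro t ht
    -- powers of `exp (Bs (φ j))` approximate `exp (t B)`
    let m : ℕ → ℕ := fun j => ⌊t / ‖Bs (φ j)‖⌋₊
    refine hcl (fun j => NormedSpace.exp (Bs (φ j) : 𝔸) ^ m j) _
      (fun j => S.pow_mem (hBsS _) _) ?_
    have hn : Tendsto (fun j => ‖Bs (φ j)‖) atTop (𝓝 0) := by
      simpa using (hBs.comp hφ.tendsto_atTop).norm
    have hm : Tendsto (fun j => (m j : ℝ) * ‖Bs (φ j)‖) atTop (𝓝 t) := by
      have hlow : Tendsto (fun j => t - ‖Bs (φ j)‖) atTop (𝓝 t) := by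
        simpa using tendsto_const_nhds.sub hn
      refine tendsto_of_tendsto_of_tendsto_of_le_of_le hlow tendsto_const_nhds
        (fun j => ?_) (fun j => ?_)
      · have hp : 0 < ‖Bs (φ j)‖ := norm_pos_iff.2 (hBs0 _)
        have := Nat.lt_floor_add_one (t / ‖Bs (φ j)‖)
        have h2 : t < ((m j : ℝ) + 1) * ‖Bs (φ j)‖ := by
          rwa [div_lt_iff₀ hp] at this
        simp only
        linarith
      · have hp : 0 < ‖Bs (φ j)‖ := norm_pos_iff.2 (hBs0 _)
        have := Nat.floor_le (div_nonneg ht hp.le)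
        rwa [le_div_iff₀ hp] at this
    have hBB : Tendsto (fun j => ((‖Bs (φ j)‖⁻¹ • Bs (φ j) : L') : 𝔸)) atTop (𝓝 (B : 𝔸)) :=
      (L'.subtypeL.continuous.tendsto B).comp hφB
    have h1 := (NormedSpace.exp_continuous.tendsto _).comp (hm.smul hBB)
    refine h1.congr fun j => ?_
    have hp : ‖Bs (φ j)‖ ≠ 0 := norm_ne_zero_iff.2 (hBs0 _)
    simp only [Function.comp]
    rw [Submodule.coe_smul, smul_smul, mul_assoc, mul_inv_cancel₀ hp, mul_one,
      Nat.cast_smul_eq_nsmul, NormedSpace.exp_nsmul]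
  have hBL : (B : 𝔸) ∈ L := by
    rw [hL]
    intro t
    rcases le_total 0 t with ht | ht
    · exact hpos t ht
    · have := hinv _ (hpos (-t) (by linarith))
      simpa using this
  have : (B : 𝔸) = 0 := by
    have := hL'.disjoint.le_bot (⟨hBL, B.2⟩ : (B : 𝔸) ∈ L ⊓ L')
    simpa using this
  have hB0 : B = 0 := by ext; exact this
  rw [hB0] at hB1
  simp at hB1

/-- A differentiable one-parameter group of scalars is an exponential. -/
theorem eq_exp_of_hasDerivAt {m : ℝ → ℂ} {c : ℂ} (hm : ∀ s t, m (s + t) = m s * m t)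
    (h0 : m 0 = 1) (hd : HasDerivAt m c 0) (s : ℝ) : m s = Complex.exp (s * c) := by
  have hds : ∀ s, HasDerivAt m (m s * c) s := by
    intro s
    have h1 : HasDerivAt (fun t => m s * m (t - s)) (m s * c) s := by
      have h2 : HasDerivAt (fun t : ℝ => m (t - s)) c s := by
        have h3 : HasDerivAt m c (s - s) := by rwa [sub_self]
        simpa using h3.comp_sub_const s s
      exact h2.const_mul _
    refine h1.congr_of_eventuallyEq (Eventually.of_forall fun t => ?_)
    simp only
    rw [← hm]; congr 1; ring
  have he : ∀ s : ℝ, HasDerivAt (fun t : ℝ => Complex.exp (-(t * c)))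
      (-(c * Complex.exp (-(s * c)))) s := by
    intro s
    have h1 : HasDerivAt (fun t : ℝ => (t : ℂ)) 1 s := Complex.ofRealCLM.hasDerivAt
    have := ((h1.mul_const c).neg).cexp
    refine this.congr_deriv ?_
    simp only [Pi.neg_apply]
    ring
  have hconst : ∀ s, m s * Complex.exp (-(s * c)) = 1 := by
    have hz : ∀ s, HasDerivAt (fun t : ℝ => m t * Complex.exp (-(t * c))) 0 s := by
      intro s
      refine ((hds s).mul (he s)).congr_deriv ?_
      ring
    have := is_const_of_deriv_eq_zero (fun s => (hz s).differentiableAt) (fun s => (hz s).deriv)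
    intro s
    rw [this s 0]
    simp [h0]
  have h2 := hconst s
  rw [Complex.exp_neg] at h2
  field_simp at h2
  exact h2

/-- The derivative of the determinant at the identity is the trace. -/
theorem hasDerivAt_det {ι : Type*} [Fintype ι] [DecidableEq ι] {M : ℝ → Matrix ι ι ℂ}
    {A : Matrix ι ι ℂ} (h0 : M 0 = 1) (hM : ∀ i j, HasDerivAt (fun t => M t i j) (A i j) 0) :
    HasDerivAt (fun t => (M t).det) A.trace 0 := by
  simp only [Matrix.det_apply']
  have h : ∀ σ : Equiv.Perm ι, HasDerivAt (fun t => ((Equiv.Perm.sign σ : ℤ) : ℂ) *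
      ∏ i, M t (σ i) i) (((Equiv.Perm.sign σ : ℤ) : ℂ) *
        ∑ i, (∏ j ∈ Finset.univ.erase i, M 0 (σ j) j) • A (σ i) i) 0 := fun σ =>
    (HasDerivAt.fun_finsetProd fun i _ => hM (σ i) i).const_mul _
  have hs := HasDerivAt.fun_sum (u := Finset.univ) fun σ _ => h σ
  refine hs.congr_deriv ?_
  -- Only the identity permutation contributes: any other one moves at least two indices.
  rw [Finset.sum_eq_single (1 : Equiv.Perm ι)]
  · simp [h0, Matrix.trace]
  · intro σ _ hσ
    rw [Finset.sum_eq_zero, mul_zero]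
    intro i _
    rw [Finset.prod_eq_zero_iff.2, zero_smul]
    by_contra hcon
    push Not at hcon
    apply hσ
    ext j
    have hfix : ∀ j, j ≠ i → σ j = j := by
      intro j hj
      by_contra h1
      exact hcon j (Finset.mem_erase.2 ⟨hj, Finset.mem_univ _⟩) (by rw [h0, Matrix.one_apply_ne h1])
    by_cases hj : j = i
    · subst hj
      by_contra h1
      have h2 := hfix (σ j) h1
      exact h1 (σ.injective h2)
    · simp [hfix j hj]
  · simp
section

attribute [local instance] Matrix.linftyOpNormedRing Matrix.linftyOpNormedAlgebra

theorem hasDerivAt_matrix_exp {ι : Type*} [Fintype ι] [DecidableEq ι] (A : Matrix ι ι ℝ) (s : ℝ)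
    (i j : ι) : HasDerivAt (fun t : ℝ => NormedSpace.exp (t • A) i j)
      ((NormedSpace.exp (s • A) * A) i j) s := by
  have h := hasDerivAt_exp_smul_const (𝕂 := ℝ) A s
  exact (LinearMap.toContinuousLinearMap
    (Matrix.entryLinearMap ℝ ℝ i j)).hasFDerivAt.comp_hasDerivAt s h

end

theorem det_exp {ι : Type*} [Fintype ι] [DecidableEq ι] (A : Matrix ι ι ℝ) :
    (NormedSpace.exp A).det = Real.exp A.trace := by
  have h := eq_exp_of_hasDerivAt (m := fun t => ((NormedSpace.exp (t • A)).map Complex.ofReal).det)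
    (c := (A.map Complex.ofReal).trace) ?_ ?_ (hasDerivAt_det ?_ fun i j => ?_) 1
  · rw [one_smul] at h
    have h1 : ∀ B : Matrix ι ι ℝ, (B.map Complex.ofReal).det = (B.det : ℂ) := fun B =>
      (RingHom.map_det Complex.ofRealHom B).symm
    have h2 : (A.map Complex.ofReal).trace = (A.trace : ℂ) := by
      simp [Matrix.trace]
    rw [h1, h2] at h
    simp only [Complex.ofReal_one, one_mul] at h
    exact_mod_cast h
  · intro s t
    rw [add_smul, Matrix.exp_add_of_commute _ _ (((Commute.refl A).smul_left s).smul_right t)]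
    rw [← Matrix.det_mul]
    congr 1
    exact Matrix.map_mul (f := Complex.ofRealHom)
  · simp
  · simp
  · have := (hasDerivAt_matrix_exp A 0 i j).ofReal_comp
    simpa using this

section
attribute [local instance] Matrix.linftyOpNormedRing Matrix.linftyOpNormedAlgebra

theorem continuous_matrix_exp (n : ℕ) :
    Continuous (NormedSpace.exp : Matrix (Fin n) (Fin n) ℝ → Matrix (Fin n) (Fin n) ℝ) := by
  let _ : NormedAlgebra ℚ (Matrix (Fin n) (Fin n) ℝ) := NormedAlgebra.restrictScalars ℚ ℝ _
  exact NormedSpace.exp_continuous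

/-- Small logarithms of elements of a closed matrix group lie in its Lie algebra. -/
theorem eventually_mem_of_expGL_mem {n : ℕ} (S : Subgroup (GL (Fin n) ℝ))
    (hS : IsClosed (S : Set (GL (Fin n) ℝ))) (L : Submodule ℝ (Matrix (Fin n) (Fin n) ℝ))
    (hL : ∀ X, X ∈ L ↔ ∀ t : ℝ, expGL (t • X) ∈ S) :
    ∀ᶠ X in 𝓝 (0 : Matrix (Fin n) (Fin n) ℝ), expGL X ∈ S → X ∈ L := by
  have hiff : ∀ X : Matrix (Fin n) (Fin n) ℝ, expGL X ∈ S ↔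
      NormedSpace.exp X ∈ S.toSubmonoid.map (Units.coeHom (Matrix (Fin n) (Fin n) ℝ)) := by
    intro X
    constructor
    · intro h; exact ⟨_, h, rfl⟩
    · rintro ⟨g, hg, h⟩
      have : g = expGL X := by ext1; exact h
      rwa [← this]
  have key := eventually_mem_of_exp_mem
    (S.toSubmonoid.map (Units.coeHom (Matrix (Fin n) (Fin n) ℝ))) ?_ ?_ L ?_
  · refine key.mono fun X hX h => hX ((hiff X).1 h)
  · intro X hX
    refine (hiff _).1 ?_
    have hX := (hiff X).2 hX
    have : expGL (-X) = (expGL X)⁻¹ := by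
      ext1; rfl
    rw [this]; exact inv_mem hX
  · intro u X hu hlim
    refine (hiff _).1 ?_
    choose v hv hvu using hu
    have : Tendsto v atTop (𝓝 (expGL X)) := by
      refine (isEmbedding_GL_val n).tendsto_nhds_iff.2 (hlim.congr fun m => (hvu m).symm)
    exact hS.mem_of_tendsto this (Eventually.of_forall hv)
  · intro X
    rw [hL]
    exact forall_congr' fun t => hiff _

end

namespace LinearReductiveGroup

variable {n : ℕ} {𝒢 : LinearReductiveGroup n}

@[simp] theorem mat_mul (g h : 𝒢.Grp) : 𝒢.mat (g * h) = 𝒢.mat g * 𝒢.mat h := rfl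

@[simp] theorem mat_one : 𝒢.mat 1 = 1 := rfl

@[simp] theorem mat_mul_mat_inv (g : 𝒢.Grp) : 𝒢.mat g * 𝒢.mat g⁻¹ = 1 := by
  rw [← mat_mul, mul_inv_cancel, mat_one]

@[simp] theorem mat_inv_mul_mat (g : 𝒢.Grp) : 𝒢.mat g⁻¹ * 𝒢.mat g = 1 := by
  rw [← mat_mul, inv_mul_cancel, mat_one]

@[simp] theorem mat_expG (X : 𝒢.𝔤) :
    𝒢.mat (𝒢.expG X) = NormedSpace.exp (X : Matrix (Fin n) (Fin n) ℝ) := rfl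

theorem mat_injective : Function.Injective 𝒢.mat := fun g h hgh => by
  ext1; ext1; exact hgh

theorem isUnit_det_mat (g : 𝒢.Grp) : IsUnit (𝒢.mat g).det :=
  (Matrix.isUnit_iff_isUnit_det _).1 (g : GL (Fin n) ℝ).isUnit

@[simp] theorem expG_zero : 𝒢.expG 0 = 1 := mat_injective (by simp)

theorem expG_add_of_comm {X Y : 𝒢.𝔤}
    (h : (X : Matrix (Fin n) (Fin n) ℝ) * Y = Y * X) :
    𝒢.expG (X + Y) = 𝒢.expG X * 𝒢.expG Y :=
  mat_injective (by simpa using Matrix.exp_add_of_commute _ _ h)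

theorem expG_add_smul (s t : ℝ) (X : 𝒢.𝔤) :
    𝒢.expG ((s + t) • X) = 𝒢.expG (s • X) * 𝒢.expG (t • X) := by
  rw [add_smul]
  exact expG_add_of_comm (by simp [smul_comm s t])

theorem expG_neg (X : 𝒢.𝔤) : 𝒢.expG (-X) = (𝒢.expG X)⁻¹ := by
  rw [eq_inv_iff_mul_eq_one, ← expG_add_of_comm (by simp)]
  simp

@[simp] theorem coe_Ad (g : 𝒢.Grp) (X : 𝒢.𝔤) :
    (𝒢.Ad g X : Matrix (Fin n) (Fin n) ℝ) = 𝒢.mat g * X * 𝒢.mat g⁻¹ := rfl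

@[simp] theorem coe_θ (X : 𝒢.𝔤) :
    (𝒢.θ X : Matrix (Fin n) (Fin n) ℝ) = -(X : Matrix (Fin n) (Fin n) ℝ)ᵀ := rfl

@[simp] theorem Ad_one (X : 𝒢.𝔤) : 𝒢.Ad 1 X = X := by
  ext1; simp

theorem expG_Ad (g : 𝒢.Grp) (X : 𝒢.𝔤) : 𝒢.expG (𝒢.Ad g X) = g * 𝒢.expG X * g⁻¹ := by
  apply mat_injective
  have h : 𝒢.mat g⁻¹ = (((g : GL (Fin n) ℝ)⁻¹ : GL (Fin n) ℝ) : Matrix (Fin n) (Fin n) ℝ) := rfl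
  simp only [mat_expG, coe_Ad, mat_mul]
  rw [h, ← Matrix.exp_units_conj]

@[simp] theorem θ_θ (X : 𝒢.𝔤) : 𝒢.θ (𝒢.θ X) = X := by
  ext1; simp

/-- Elements of `G` close to `1` are exponentials of small elements of `𝔤`. -/
theorem eventually_exists_expG {U : Set (Matrix (Fin n) (Fin n) ℝ)} (hU : U ∈ 𝓝 0) :
    ∀ᶠ g in 𝓝 (1 : 𝒢.Grp), ∃ X : 𝒢.𝔤, (X : Matrix (Fin n) (Fin n) ℝ) ∈ U ∧ g = 𝒢.expG X := by
  let _ := Matrix.linftyOpNormedRing (n := Fin n) (α := ℝ)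
  let _ := Matrix.linftyOpNormedAlgebra (R := ℝ) (n := Fin n) (α := ℝ)
  obtain ⟨lg, h1, h2, -, h3, -⟩ := exists_local_log (Matrix (Fin n) (Fin n) ℝ)
  have hcl := eventually_mem_of_expGL_mem 𝒢.toSubgroup 𝒢.isClosed 𝒢.𝔤 fun X => Iff.rfl
  have hm : Tendsto 𝒢.mat (𝓝 1) (𝓝 1) := by
    have : Continuous 𝒢.mat := (isEmbedding_GL_val n).continuous.comp continuous_subtype_val
    exact this.tendsto 1
  have hl : Tendsto lg (𝓝 1) (𝓝 0) := by
    have := h2.continuousAt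
    rwa [ContinuousAt, h1] at this
  filter_upwards [hm.eventually h3, (hl.comp hm).eventually hcl, (hl.comp hm).eventually hU]
    with g hg hg' hgU
  have he : expGL (lg (𝒢.mat g)) = (g : GL (Fin n) ℝ) := by
    ext1; exact hg
  refine ⟨⟨lg (𝒢.mat g), hg' ?_⟩, hgU, ?_⟩
  · simp only [Function.comp]
    rw [he]; exact g.2
  · ext1; exact he.symm

theorem isClosed_𝔤 : IsClosed (𝒢.𝔤 : Set (Matrix (Fin n) (Fin n) ℝ)) :=
  Submodule.closed_of_finiteDimensional _

/-- `𝔤` is closed under commutators. -/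
theorem bracket_mem {X Y : Matrix (Fin n) (Fin n) ℝ} (hX : X ∈ 𝒢.𝔤) (hY : Y ∈ 𝒢.𝔤) :
    X * Y - Y * X ∈ 𝒢.𝔤 := by
  let _ := Matrix.linftyOpNormedRing (n := Fin n) (α := ℝ)
  let _ := Matrix.linftyOpNormedAlgebra (R := ℝ) (n := Fin n) (α := ℝ)
  have h1 := hasDerivAt_exp_smul_const (𝕂 := ℝ) X (0 : ℝ)
  have h2 := hasDerivAt_exp_smul_const (𝕂 := ℝ) (-X) (0 : ℝ)
  have h3 := (h1.mul_const Y).mul h2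
  simp only [zero_smul, NormedSpace.exp_zero, one_mul, mul_one] at h3
  have h4 := h3.tendsto_slope_zero
  have e : X * Y + Y * -X = X * Y - Y * X := by rw [mul_neg, sub_eq_add_neg]
  rw [e] at h4
  refine isClosed_𝔤.mem_of_tendsto (h4.mono_left (le_refl _)) (Eventually.of_forall fun t => ?_)
  refine Submodule.smul_mem _ _ (sub_mem ?_ (by simpa using hY))
  have := 𝒢.conj_mem (𝒢.expG (t • ⟨X, hX⟩)) hY
  rw [← expG_neg] at this
  have h5 : NormedSpace.exp (t • X) * Y * NormedSpace.exp (-(t • X)) ∈ 𝒢.𝔤 := this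
  simp only [zero_add, Pi.mul_apply, smul_neg] at h5 ⊢
  exact h5

end LinearReductiveGroup

/-! ### Smooth maps on `G` -/

/-- Smoothness in the exponential charts for maps into a normed space. -/
def SmoothMap {n : ℕ} {𝒢 : LinearReductiveGroup n} {W : Type*} [NormedAddCommGroup W]
    [NormedSpace ℝ W] (f : 𝒢.Grp → W) : Prop :=
  ∀ (g : 𝒢.Grp) (m : ℕ) (X : Fin m → 𝒢.𝔤),
    ContDiff ℝ ∞ fun c : Fin m → ℝ => f (g * 𝒢.expG (∑ i, c i • X i))

namespace SmoothMap

variable {n : ℕ} {𝒢 : LinearReductiveGroup n} {W W' : Type*} [NormedAddCommGroup W]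
  [NormedSpace ℝ W] [NormedAddCommGroup W'] [NormedSpace ℝ W']

theorem const (w : W) : SmoothMap (𝒢 := 𝒢) fun _ => w := fun _ _ _ => contDiff_const

theorem add {f f' : 𝒢.Grp → W} (hf : SmoothMap f) (hf' : SmoothMap f') :
    SmoothMap fun g => f g + f' g := fun g m X => (hf g m X).add (hf' g m X)

theorem sum {ι : Type*} {s : Finset ι} {f : ι → 𝒢.Grp → W} (hf : ∀ i ∈ s, SmoothMap (f i)) :
    SmoothMap fun g => ∑ i ∈ s, f i g := fun g m X => ContDiff.sum fun i hi => hf i hi g m X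

theorem mul {A : Type*} [NormedRing A] [NormedAlgebra ℝ A] {f f' : 𝒢.Grp → A}
    (hf : SmoothMap f) (hf' : SmoothMap f') :
    SmoothMap fun g => f g * f' g := fun g m X => (hf g m X).mul (hf' g m X)

theorem comp {F : W → W'} {f : 𝒢.Grp → W} (hf : SmoothMap f) (hF : ∀ g, ContDiffAt ℝ ∞ F (f g)) :
    SmoothMap fun g => F (f g) := fun g m X =>
  contDiff_iff_contDiffAt.2 fun c => (hF _).comp c (hf g m X).contDiffAt

theorem clm {f : 𝒢.Grp → W} (hf : SmoothMap f) (F : W →L[ℝ] W') : SmoothMap fun g => F (f g) :=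
  hf.comp fun _ => F.contDiff.contDiffAt

theorem ofReal {f : 𝒢.Grp → ℝ} (hf : SmoothMap f) : SmoothMap fun g => (f g : ℂ) :=
  hf.clm Complex.ofRealCLM

theorem pi {ι : Type*} [Fintype ι] {f : 𝒢.Grp → ι → ℝ} (hf : ∀ i, SmoothMap fun g => f g i) :
    SmoothMap f := fun g m X => contDiff_pi.2 fun i => hf i g m X

theorem hasDerivAt {f : 𝒢.Grp → ℂ} (hf : SmoothMap f) (g : 𝒢.Grp) (X : 𝒢.𝔤) :
    HasDerivAt (fun t : ℝ => f (g * 𝒢.expG (t • X))) (Datum.dirDeriv f g X) 0 := by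
  have h1 : ContDiff ℝ ∞ fun t : ℝ => f (g * 𝒢.expG (t • X)) := by
    have h2 : ContDiff ℝ ∞ fun t : ℝ => (fun _ : Fin 1 => t) :=
      contDiff_pi.2 fun _ => contDiff_id
    simpa [Function.comp_def] using (hf g 1 fun _ => X).comp h2
  exact (h1.differentiable (by simp)).differentiableAt.hasDerivAt

theorem dirDeriv_sum {f : 𝒢.Grp → ℂ} (hf : SmoothMap f) (g : 𝒢.Grp) {m : ℕ} (X : Fin m → 𝒢.𝔤)
    (c : Fin m → ℝ) :
    Datum.dirDeriv f g (∑ i, c i • X i) = ∑ i, (c i : ℂ) * Datum.dirDeriv f g (X i) := by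
  let F : (Fin m → ℝ) → ℂ := fun c => f (g * 𝒢.expG (∑ i, c i • X i))
  have hF : DifferentiableAt ℝ F 0 := ((hf g m X).differentiable (by simp)).differentiableAt
  have key : ∀ c : Fin m → ℝ, Datum.dirDeriv f g (∑ i, c i • X i) = fderiv ℝ F 0 c := by
    intro c
    have h1 : HasDerivAt (fun t : ℝ => F (t • c)) (fderiv ℝ F 0 c) 0 := by
      have h2 : HasDerivAt (fun t : ℝ => t • c) c 0 := by
        simpa using (hasDerivAt_id (0 : ℝ)).smul_const c
      have h3 : HasFDerivAt F (fderiv ℝ F 0) ((0 : ℝ) • c) := by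
        rw [zero_smul]; exact hF.hasFDerivAt
      exact h3.comp_hasDerivAt (0 : ℝ) h2
    have h4 : (fun t : ℝ => F (t • c)) = fun t : ℝ => f (g * 𝒢.expG (t • ∑ i, c i • X i)) := by
      funext t
      simp [F, Finset.smul_sum, smul_smul]
    rw [h4] at h1
    exact h1.deriv
  rw [key]
  have hc : c = ∑ i, c i • Pi.single i (1 : ℝ) := by
    ext j; simp [Finset.sum_apply, Pi.single_apply]
  conv_lhs => rw [hc, map_sum]
  refine Finset.sum_congr rfl fun i _ => ?_
  rw [map_smul, ← key]
  simp [Pi.single_apply]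

theorem dirDeriv_add {f : 𝒢.Grp → ℂ} (hf : SmoothMap f) (g : 𝒢.Grp) (X Y : 𝒢.𝔤) :
    Datum.dirDeriv f g (X + Y) = Datum.dirDeriv f g X + Datum.dirDeriv f g Y := by
  simpa [Fin.sum_univ_two] using hf.dirDeriv_sum g ![X, Y] 1

theorem dirDeriv_smul {f : 𝒢.Grp → ℂ} (hf : SmoothMap f) (g : 𝒢.Grp) (a : ℝ) (X : 𝒢.𝔤) :
    Datum.dirDeriv f g (a • X) = a * Datum.dirDeriv f g X := by
  simpa using hf.dirDeriv_sum g ![X] ![a]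

/-- Derivatives of smooth functions along left invariant vector fields are smooth. -/
theorem dirDeriv {f : 𝒢.Grp → ℂ} (hf : SmoothMap f) (Y : 𝒢.𝔤) :
    SmoothMap fun g => Datum.dirDeriv f g Y := by
  let _ := Matrix.linftyOpNormedRing (n := Fin n) (α := ℝ)
  let _ := Matrix.linftyOpNormedAlgebra (R := ℝ) (n := Fin n) (α := ℝ)
  intro g m X
  rw [contDiff_iff_contDiffAt]
  intro c₀
  obtain ⟨lg, h1, h2, -, h3, -⟩ := exists_local_log (Matrix (Fin n) (Fin n) ℝ)
  have hcl := eventually_mem_of_expGL_mem 𝒢.toSubgroup 𝒢.isClosed 𝒢.𝔤 fun X => Iff.rfl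
  let S : (Fin m → ℝ) → 𝒢.𝔤 := fun c => ∑ i, c i • X i
  let B := Module.finBasis ℝ 𝒢.𝔤
  choose κ hκ using fun j => (B.coord j).exists_extend
  let Q : (Fin m → ℝ) × ℝ → Matrix (Fin n) (Fin n) ℝ := fun p =>
    NormedSpace.exp (-(S c₀ : Matrix (Fin n) (Fin n) ℝ)) *
      NormedSpace.exp (S p.1 : Matrix (Fin n) (Fin n) ℝ) *
      NormedSpace.exp (p.2 • (Y : Matrix (Fin n) (Fin n) ℝ))
  have hQ0 : Q (c₀, 0) = 1 := by
    simp only [Q, zero_smul, NormedSpace.exp_zero, mul_one]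
    have := LinearReductiveGroup.mat_inv_mul_mat (𝒢.expG (S c₀))
    rw [← LinearReductiveGroup.expG_neg] at this
    exact this
  have hQ : ContDiff ℝ ∞ Q := by
    have he : ContDiff ℝ ∞ fun Z : Matrix (Fin n) (Fin n) ℝ => NormedSpace.exp Z :=
      contDiff_iff_contDiffAt.2 fun Z => (NormedSpace.exp_analytic (𝕂 := ℝ) Z).contDiffAt
    have hS : ContDiff ℝ ∞ fun p : (Fin m → ℝ) × ℝ => (S p.1 : Matrix (Fin n) (Fin n) ℝ) := by
      simp only [S, AddSubmonoidClass.coe_finsetSum, Submodule.coe_smul]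
      exact ContDiff.sum fun i _ => ContDiff.smul
        ((contDiff_apply ℝ ℝ i).comp contDiff_fst) contDiff_const
    exact (contDiff_const.mul (he.comp hS)).mul (he.comp (contDiff_snd.smul contDiff_const))
  have hL : ContDiffAt ℝ ∞ (fun p => lg (Q p)) (c₀, 0) := by
    refine ContDiffAt.comp (c₀, (0 : ℝ)) ?_ hQ.contDiffAt
    rw [hQ0]; exact h2
  let x : (Fin m → ℝ) × ℝ → Fin (Module.finrank ℝ 𝒢.𝔤) → ℝ := fun p j => κ j (lg (Q p))
  have hx : ContDiffAt ℝ ∞ x (c₀, 0) := contDiffAt_pi.2 fun j =>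
    (LinearMap.toContinuousLinearMap (κ j)).contDiff.contDiffAt.comp _ hL
  let ψ : (Fin m → ℝ) × ℝ → ℂ := fun p => f (g * 𝒢.expG (S c₀) * 𝒢.expG (∑ j, x p j • B j))
  have hψ : ContDiffAt ℝ ∞ ψ (c₀, 0) := (hf _ _ B).contDiffAt.comp _ hx
  -- In the chart at `g exp (S c₀)` the points `g exp (S c) exp (tY)` have smooth coordinates.
  have heq : ∀ᶠ p in 𝓝 (c₀, (0 : ℝ)), f (g * 𝒢.expG (S p.1) * 𝒢.expG (p.2 • Y)) = ψ p := by
    have hQt : Tendsto Q (𝓝 (c₀, 0)) (𝓝 1) := by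
      rw [← hQ0]; exact hQ.continuous.tendsto _
    have hlt : Tendsto lg (𝓝 1) (𝓝 0) := by
      have := h2.continuousAt
      rwa [ContinuousAt, h1] at this
    filter_upwards [hQt.eventually h3, (hlt.comp hQt).eventually hcl] with p hp hp'
    have hQG : Q p = 𝒢.mat ((𝒢.expG (S c₀))⁻¹ * 𝒢.expG (S p.1) * 𝒢.expG (p.2 • Y)) := by
      rw [← LinearReductiveGroup.expG_neg]; rfl
    have hmem : lg (Q p) ∈ 𝒢.𝔤 := by
      apply hp'
      have : expGL (lg (Q p)) =
          (((𝒢.expG (S c₀))⁻¹ * 𝒢.expG (S p.1) * 𝒢.expG (p.2 • Y) : 𝒢.Grp) : GL (Fin n) ℝ) := by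
        ext1
        exact hp.trans hQG
      simp only [Function.comp]
      rw [this]
      exact Subtype.prop _
    have hsum : ∑ j, x p j • B j = ⟨lg (Q p), hmem⟩ := by
      have : ∀ j, x p j = B.coord j ⟨lg (Q p), hmem⟩ := fun j => by
        rw [← hκ j]; rfl
      simp only [this]
      exact B.sum_repr _
    simp only [ψ]
    rw [hsum]
    congr 1
    have hE : 𝒢.expG ⟨lg (Q p), hmem⟩ = (𝒢.expG (S c₀))⁻¹ * 𝒢.expG (S p.1) * 𝒢.expG (p.2 • Y) :=
      LinearReductiveGroup.mat_injective (hp.trans hQG)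
    rw [hE]
    group
  have hfd : ContDiffAt ℝ ∞ (fun c : Fin m → ℝ => fderiv ℝ ψ (c, 0) (0, 1)) c₀ := by
    have h4 : ContDiffAt ℝ ∞ (fderiv ℝ ψ) (c₀, 0) := hψ.fderiv_right (by simp)
    have h5 : ContDiffAt ℝ ∞ (fun c : Fin m → ℝ => fderiv ℝ ψ (c, 0)) c₀ :=
      ContDiffAt.comp (g := fderiv ℝ ψ) c₀ h4 (contDiff_id.prodMk contDiff_const).contDiffAt
    exact h5.clm_apply contDiffAt_const
  refine hfd.congr_of_eventuallyEq ?_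
  have hi : Tendsto (fun c : Fin m → ℝ => (c, (0 : ℝ))) (𝓝 c₀) (𝓝 (c₀, 0)) :=
    (Continuous.prodMk_left (0 : ℝ)).tendsto c₀
  have hdiff : ∀ᶠ p in 𝓝 (c₀, (0 : ℝ)), DifferentiableAt ℝ ψ p := by
    have h6 : ContDiffAt ℝ 1 ψ (c₀, 0) := hψ.of_le (by exact_mod_cast le_top)
    exact (h6.eventually (by simp)).mono fun p hp => hp.differentiableAt (by simp)
  filter_upwards [hi.eventually heq.eventually_nhds, hi.eventually hdiff] with c hc hd
  have h7 : HasDerivAt (fun t : ℝ => ψ (c, t)) (fderiv ℝ ψ (c, 0) (0, 1)) 0 := by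
    have h8 : HasDerivAt (fun t : ℝ => (c, t)) ((0 : Fin m → ℝ), (1 : ℝ)) 0 :=
      (hasDerivAt_const (0 : ℝ) c).prodMk (hasDerivAt_id (0 : ℝ))
    exact hd.hasFDerivAt.comp_hasDerivAt (0 : ℝ) h8
  have h9 : Tendsto (fun t : ℝ => (c, t)) (𝓝 0) (𝓝 (c, 0)) :=
    (Continuous.prodMk_right c).tendsto 0
  exact (h7.congr_of_eventuallyEq (h9.eventually hc)).deriv

end SmoothMap

/-! ### Joint eigenspaces of commuting families acting by commutators -/

section Frobenius

variable (𝕜 : Type) [RCLike 𝕜] (n : ℕ)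

open scoped ComplexOrder in
/-- The Frobenius inner product `⟪A, B⟫ = tr (A* B)`. -/
abbrev frobeniusCore : InnerProductSpace.Core 𝕜 (Matrix (Fin n) (Fin n) 𝕜) where
  inner A B := (Aᴴ * B).trace
  conj_inner_symm A B := by
    rw [starRingEnd_apply, ← Matrix.trace_conjTranspose]; simp
  re_inner_nonneg A :=
    (RCLike.nonneg_iff.1 (Matrix.posSemidef_conjTranspose_mul_self A).trace_nonneg).1
  add_left A B C := by simp [add_mul]
  smul_left A B c := by simp
  definite A h := Matrix.trace_conjTranspose_mul_self_eq_zero_iff.1 h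

/-- The Frobenius norm. -/
abbrev frobeniusNormed : NormedAddCommGroup (Matrix (Fin n) (Fin n) 𝕜) :=
  (frobeniusCore 𝕜 n).toNormedAddCommGroup

/-- Matrices as an inner product space, for the Frobenius inner product. -/
abbrev frobeniusInner :
    @InnerProductSpace 𝕜 (Matrix (Fin n) (Fin n) 𝕜) _
      (frobeniusNormed 𝕜 n).toSeminormedAddCommGroup :=
  InnerProductSpace.ofCore (frobeniusCore 𝕜 n).toCore

end Frobenius

section Joint

variable {𝕜 : Type} [RCLike 𝕜] {n : ℕ}

/-- The joint eigenspace in `V` of the commutators with the matrices `A i`. -/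
def jointSpace {ι : Type*} (A : ι → Matrix (Fin n) (Fin n) 𝕜)
    (V : Submodule 𝕜 (Matrix (Fin n) (Fin n) 𝕜)) (χ : ι → 𝕜) :
    Submodule 𝕜 (Matrix (Fin n) (Fin n) 𝕜) where
  carrier := {Z | Z ∈ V ∧ ∀ i, A i * Z - Z * A i = χ i • Z}
  add_mem' := by
    rintro Z W ⟨h1, h2⟩ ⟨h3, h4⟩
    refine ⟨add_mem h1 h3, fun i => ?_⟩
    rw [smul_add, ← h2, ← h4, mul_add, add_mul]; abel
  zero_mem' := by simp
  smul_mem' := by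
    rintro c Z ⟨h1, h2⟩
    refine ⟨Submodule.smul_mem _ _ h1, fun i => ?_⟩
    rw [smul_comm, ← h2, smul_sub, Matrix.mul_smul, Matrix.smul_mul]

/-- A space of matrices that is stable under the commutators with a commuting family of Hermitian
matrices is the sum of its joint eigenspaces. -/
theorem le_iSup_jointSpace {ι : Type*} (A : ι → Matrix (Fin n) (Fin n) 𝕜)
    (hA : ∀ i, (A i)ᴴ = A i) (hc : ∀ i j, A i * A j = A j * A i)
    (V : Submodule 𝕜 (Matrix (Fin n) (Fin n) 𝕜)) (hV : ∀ i, ∀ Z ∈ V, A i * Z - Z * A i ∈ V) :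
    V ≤ ⨆ χ : ι → 𝕜, jointSpace A V χ := by
  let _ := frobeniusNormed 𝕜 n
  let _ := frobeniusInner 𝕜 n
  let T : ι → V →ₗ[𝕜] V := fun i =>
    (LinearMap.mulLeft 𝕜 (A i) - LinearMap.mulRight 𝕜 (A i)).restrict (hV i)
  have hT : ∀ i (Z : V), ((T i Z : V) : Matrix (Fin n) (Fin n) 𝕜) =
      A i * (Z : Matrix (Fin n) (Fin n) 𝕜) - (Z : Matrix (Fin n) (Fin n) 𝕜) * A i := fun i Z => rfl
  -- the commutators are symmetric for the Frobenius inner product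
  have hsym : ∀ i, (T i).IsSymmetric := by
    intro i Z W
    rw [Submodule.coe_inner, Submodule.coe_inner, hT, hT]
    generalize (Z : Matrix (Fin n) (Fin n) 𝕜) = Z
    generalize (W : Matrix (Fin n) (Fin n) 𝕜) = W
    change ((A i * Z - Z * A i)ᴴ * W).trace = (Zᴴ * (A i * W - W * A i)).trace
    rw [Matrix.conjTranspose_sub, Matrix.conjTranspose_mul, Matrix.conjTranspose_mul, hA,
      sub_mul, mul_sub, Matrix.trace_sub, Matrix.trace_sub, mul_assoc, mul_assoc,
      Matrix.trace_mul_comm (A i), mul_assoc]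
  have hcomm : Pairwise (Function.onFun Commute T) := by
    intro i j _
    refine LinearMap.ext fun Z => Subtype.ext ?_
    simp only [Module.End.mul_apply, hT]
    have e2 : ∀ W : Matrix (Fin n) (Fin n) 𝕜, W * A i * A j = W * A j * A i := fun W => by
      rw [mul_assoc, hc, mul_assoc]
    simp only [mul_sub, sub_mul, ← mul_assoc, e2 _]
    rw [hc i j]
    abel
  have htop := LinearMap.IsSymmetric.iSup_iInf_eq_top_of_commute hsym hcomm
  have hmap : V = (⊤ : Submodule 𝕜 V).map V.subtype := by simp
  conv_lhs => rw [hmap, ← htop, Submodule.map_iSup]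
  refine iSup_mono fun χ => ?_
  rintro _ ⟨Z, hZ, rfl⟩
  refine ⟨Z.2, fun i => ?_⟩
  have h1 := (Submodule.mem_iInf _).1 hZ i
  rw [Module.End.mem_eigenspace_iff] at h1
  exact congrArg Subtype.val h1

/-- Eigenvectors of commutators with different eigenvalues are orthogonal. -/
theorem trace_eq_zero_of_comm {Y Z W : Matrix (Fin n) (Fin n) 𝕜} {c d : 𝕜}
    (hZ : Yᴴ * Z - Z * Yᴴ = d • Z) (hW : Y * W - W * Y = c • W) (hne : star d ≠ c) :
    (Zᴴ * W).trace = 0 := by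
  have h1 : (Zᴴ * (Y * W - W * Y)).trace = ((Yᴴ * Z - Z * Yᴴ)ᴴ * W).trace := by
    rw [Matrix.conjTranspose_sub, Matrix.conjTranspose_mul, Matrix.conjTranspose_mul,
      Matrix.conjTranspose_conjTranspose, sub_mul, mul_sub, Matrix.trace_sub, Matrix.trace_sub,
      mul_assoc, mul_assoc, Matrix.trace_mul_comm Y, mul_assoc]
  rw [hZ, hW, Matrix.mul_smul, Matrix.trace_smul, Matrix.conjTranspose_smul, Matrix.smul_mul,
    Matrix.trace_smul, smul_eq_mul, smul_eq_mul] at h1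
  by_contra h0
  exact hne (mul_right_cancel₀ h0 h1).symm

open scoped ComplexOrder in
theorem star_eq_of_comm {Y Z : Matrix (Fin n) (Fin n) 𝕜} {c d : 𝕜} (hZ0 : Z ≠ 0)
    (hZ : Yᴴ * Z - Z * Yᴴ = d • Z) (hW : Y * Z - Z * Y = c • Z) : star d = c := by
  by_contra hne
  exact hZ0 (Matrix.trace_conjTranspose_mul_self_eq_zero_iff.1 (trace_eq_zero_of_comm hZ hW hne))

/-- The eigenvalues of a linear family of commutators on a common eigenvector are linear. -/
theorem exists_linear_weight {B : Type*} [AddCommGroup B] [Module ℝ B]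
    (A : B →ₗ[ℝ] Matrix (Fin n) (Fin n) ℝ) {Z : Matrix (Fin n) (Fin n) ℝ} (hZ : Z ≠ 0)
    {χ : B → ℝ} (h : ∀ b, A b * Z - Z * A b = χ b • Z) : ∃ β : B →ₗ[ℝ] ℝ, ∀ b, β b = χ b := by
  have hinj : ∀ c d : ℝ, c • Z = d • Z → c = d := fun c d h => smul_left_injective ℝ hZ h
  refine ⟨⟨⟨χ, fun a b => hinj _ _ ?_⟩, fun c b => hinj _ _ ?_⟩, fun b => rfl⟩
  · rw [← h, add_smul, ← h, ← h, map_add, add_mul, mul_add]; abel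
  · rw [← h, map_smul, RingHom.id_apply, smul_assoc, ← h, smul_sub, Matrix.smul_mul,
      Matrix.mul_smul]

end Joint

/-! ### Orthogonal projections -/

section OrthProj

variable {𝕜 : Type} [RCLike 𝕜] {n : ℕ} {V : Submodule 𝕜 (Matrix (Fin n) (Fin n) 𝕜)}

theorem inner_vec (A B : Matrix (Fin n) (Fin n) 𝕜) :
    inner 𝕜 (vec 𝕜 n A) (vec 𝕜 n B) = (Aᴴ * B).trace := by
  simp only [vec, PiLp.inner_apply, RCLike.inner_apply, Matrix.trace, Matrix.diag_apply,
    Matrix.mul_apply, Matrix.conjTranspose_apply, Fintype.sum_prod_type]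
  rw [Finset.sum_comm]
  refine Finset.sum_congr rfl fun i _ => Finset.sum_congr rfl fun j _ => ?_
  rw [mul_comm]; rfl

theorem vec_orthProj (S : Submodule 𝕜 V) (X : V) :
    vec 𝕜 n ((orthProj S X : V) : Matrix (Fin n) (Fin n) 𝕜) =
      ((S.map (vec 𝕜 n ∘ₗ V.subtype)).orthogonalProjectionOnto (vec 𝕜 n X) :
        EuclideanSpace 𝕜 (Fin n × Fin n)) := by
  have h := (S.equivMapOfInjective (vec 𝕜 n ∘ₗ V.subtype)
      ((vec_injective 𝕜 n).comp V.injective_subtype)).apply_symm_apply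
    ((S.map (vec 𝕜 n ∘ₗ V.subtype)).orthogonalProjectionOnto (vec 𝕜 n X))
  exact congrArg Subtype.val h

/-- The orthogonal projection onto `S` is characterised by orthogonality. -/
theorem orthProj_eq_of_trace (S : Submodule 𝕜 V) (X : V) {Y : V} (hY : Y ∈ S)
    (h : ∀ Z ∈ S, (((X - Y : V) : Matrix (Fin n) (Fin n) 𝕜)ᴴ *
      (Z : Matrix (Fin n) (Fin n) 𝕜)).trace = 0) :
    (orthProj S X : V) = Y := by
  apply Subtype.ext
  apply vec_injective 𝕜 n
  rw [vec_orthProj, Submodule.coe_orthogonalProjectionOnto_apply]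
  refine Submodule.eq_starProjection_of_mem_of_inner_eq_zero
    ⟨Y, hY, rfl⟩ ?_
  rintro _ ⟨Z, hZ, rfl⟩
  have := h Z hZ
  rw [← inner_vec] at this
  simpa using this

theorem trace_sub_orthProj (S : Submodule 𝕜 V) (X : V) {Z : V} (hZ : Z ∈ S) :
    (((X - orthProj S X : V) : Matrix (Fin n) (Fin n) 𝕜)ᴴ *
      (Z : Matrix (Fin n) (Fin n) 𝕜)).trace = 0 := by
  rw [← inner_vec]
  have h : vec 𝕜 n ((X - orthProj S X : V) : Matrix (Fin n) (Fin n) 𝕜) = vec 𝕜 n X -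
      ((S.map (vec 𝕜 n ∘ₗ V.subtype)).orthogonalProjectionOnto (vec 𝕜 n X) :
        EuclideanSpace 𝕜 (Fin n × Fin n)) := by
    rw [Submodule.coe_sub, map_sub, vec_orthProj]
  rw [h]
  exact Submodule.starProjection_inner_eq_zero _ _ ⟨Z, hZ, rfl⟩

end OrthProj

open LinearReductiveGroup

/-! ### The decomposition of `𝔤` under `𝔥` and the complex structure -/

namespace LinearReductiveGroup

variable {n : ℕ} {𝒢 : LinearReductiveGroup n}

theorem mem_𝔨_iff {X : 𝒢.𝔤} :
    X ∈ 𝒢.𝔨 ↔ (X : Matrix (Fin n) (Fin n) ℝ)ᵀ = -(X : Matrix (Fin n) (Fin n) ℝ) := by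
  rw [𝔨, LinearMap.mem_ker, LinearMap.sub_apply, sub_eq_zero, Subtype.ext_iff]
  simp only [coe_θ, LinearMap.id_apply]
  exact neg_eq_iff_eq_neg

theorem mem_𝔰_iff {X : 𝒢.𝔤} :
    X ∈ 𝒢.𝔰 ↔ (X : Matrix (Fin n) (Fin n) ℝ)ᵀ = (X : Matrix (Fin n) (Fin n) ℝ) := by
  rw [𝔰, LinearMap.mem_ker, LinearMap.add_apply, Subtype.ext_iff]
  simp only [Submodule.coe_add, coe_θ, LinearMap.id_apply, Submodule.coe_zero, neg_add_eq_zero]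

@[simp] theorem coe_toℂ (X : 𝒢.𝔤) : (𝒢.toℂ X : Matrix (Fin n) (Fin n) ℂ) =
    (X : Matrix (Fin n) (Fin n) ℝ).map Complex.ofReal := rfl

@[simp] theorem coe_rePart (Z : 𝒢.𝔤ℂ) : (𝒢.rePart Z : Matrix (Fin n) (Fin n) ℝ) =
    (Z : Matrix (Fin n) (Fin n) ℂ).map Complex.re := rfl

@[simp] theorem coe_imPart (Z : 𝒢.𝔤ℂ) : (𝒢.imPart Z : Matrix (Fin n) (Fin n) ℝ) =
    (Z : Matrix (Fin n) (Fin n) ℂ).map Complex.im := rfl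

@[simp] theorem rePart_toℂ (X : 𝒢.𝔤) : 𝒢.rePart (𝒢.toℂ X) = X := by
  ext i j; simp

@[simp] theorem imPart_toℂ (X : 𝒢.𝔤) : 𝒢.imPart (𝒢.toℂ X) = 0 := by
  ext i j; simp

theorem rePart_smul (c : ℂ) (Z : 𝒢.𝔤ℂ) :
    𝒢.rePart (c • Z) = c.re • 𝒢.rePart Z - c.im • 𝒢.imPart Z := by
  ext i j; simp

theorem imPart_smul (c : ℂ) (Z : 𝒢.𝔤ℂ) :
    𝒢.imPart (c • Z) = c.re • 𝒢.imPart Z + c.im • 𝒢.rePart Z := by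
  ext i j; simp

/-- Complex conjugation of `𝔤ℂ` with respect to `𝔤`. -/
def conj (Z : 𝒢.𝔤ℂ) : 𝒢.𝔤ℂ := 𝒢.toℂ (𝒢.rePart Z) - Complex.I • 𝒢.toℂ (𝒢.imPart Z)

theorem coe_conj (Z : 𝒢.𝔤ℂ) : (conj Z : Matrix (Fin n) (Fin n) ℂ) =
    (Z : Matrix (Fin n) (Fin n) ℂ).map (starRingEnd ℂ) := by
  ext i j
  apply Complex.ext <;> simp [conj]

@[simp] theorem rePart_conj (Z : 𝒢.𝔤ℂ) : 𝒢.rePart (conj Z) = 𝒢.rePart Z := by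
  ext i j; simp [coe_conj]

@[simp] theorem imPart_conj (Z : 𝒢.𝔤ℂ) : 𝒢.imPart (conj Z) = -𝒢.imPart Z := by
  ext i j; simp [coe_conj]

theorem toℂ_two_rePart (Z : 𝒢.𝔤ℂ) : 𝒢.toℂ ((2 : ℝ) • 𝒢.rePart Z) = Z + conj Z := by
  ext i j
  apply Complex.ext <;> simp [coe_conj]
  ring

/-- The commutator of a matrix with real entries commutes with complex conjugation. -/
theorem conj_bracket (Y : Matrix (Fin n) (Fin n) ℝ) (Z : Matrix (Fin n) (Fin n) ℂ) :
    Y.map Complex.ofReal * Z.map (starRingEnd ℂ) - Z.map (starRingEnd ℂ) * Y.map Complex.ofReal =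
      (Y.map Complex.ofReal * Z - Z * Y.map Complex.ofReal).map (starRingEnd ℂ) := by
  have h : Y.map Complex.ofReal = (Y.map Complex.ofReal).map (starRingEnd ℂ) := by
    ext i j; simp
  rw [Matrix.map_sub (f := starRingEnd ℂ) (map_sub _), Matrix.map_mul (f := starRingEnd ℂ),
    Matrix.map_mul (f := starRingEnd ℂ), ← h]

theorem map_re_bracket (Y : Matrix (Fin n) (Fin n) ℝ) (Z : Matrix (Fin n) (Fin n) ℂ) :
    (Y.map Complex.ofReal * Z - Z * Y.map Complex.ofReal).map Complex.re =
      Y * Z.map Complex.re - Z.map Complex.re * Y := by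
  ext i j
  simp [Matrix.mul_apply]

theorem map_im_bracket (Y : Matrix (Fin n) (Fin n) ℝ) (Z : Matrix (Fin n) (Fin n) ℂ) :
    (Y.map Complex.ofReal * Z - Z * Y.map Complex.ofReal).map Complex.im =
      Y * Z.map Complex.im - Z.map Complex.im * Y := by
  ext i j
  simp [Matrix.mul_apply]

theorem map_ofReal_mul (X Y : Matrix (Fin n) (Fin n) ℝ) :
    (X * Y).map Complex.ofReal = X.map Complex.ofReal * Y.map Complex.ofReal :=
  Matrix.map_mul (f := Complex.ofRealHom)

theorem conjTranspose_map_ofReal (X : Matrix (Fin n) (Fin n) ℝ) :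
    (X.map Complex.ofReal)ᴴ = Xᵀ.map Complex.ofReal := by
  ext i j; simp

theorem conj_mem_weightSpace {𝔭 𝔱 : Submodule ℝ 𝒢.𝔤} {α : 𝔱 →ₗ[ℝ] ℂ} {Z : 𝒢.𝔤ℂ}
    (hZ : Z ∈ 𝒢.weightSpace 𝔭 𝔱 α) {α' : 𝔱 →ₗ[ℝ] ℂ} (hα : ∀ Y, α' Y = starRingEnd ℂ (α Y)) :
    conj Z ∈ 𝒢.weightSpace 𝔭 𝔱 α' := by
  refine ⟨by rw [rePart_conj]; exact hZ.1, by rw [imPart_conj]; exact neg_mem hZ.2.1, fun Y => ?_⟩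
  rw [coe_conj, coe_toℂ, conj_bracket, ← coe_toℂ, hZ.2.2 Y, hα]
  ext i j
  simp

theorem exists_weight {𝔱 : Submodule ℝ 𝒢.𝔤} {Z : Matrix (Fin n) (Fin n) ℂ} (hZ : Z ≠ 0)
    {χ : 𝔱 → ℂ} (h : ∀ Y : 𝔱, (𝒢.toℂ Y : Matrix (Fin n) (Fin n) ℂ) * Z -
      Z * (𝒢.toℂ Y : Matrix (Fin n) (Fin n) ℂ) = χ Y • Z) :
    ∃ α : 𝔱 →ₗ[ℝ] ℂ, ∀ Y, α Y = χ Y := by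
  have hinj : ∀ c d : ℂ, c • Z = d • Z → c = d := fun c d h => smul_left_injective ℂ hZ h
  refine ⟨⟨⟨χ, fun Y Y' => hinj _ _ ?_⟩, fun c Y => hinj _ _ ?_⟩, fun b => rfl⟩
  · rw [← h, add_smul, ← h, ← h, Submodule.coe_add, map_add, Submodule.coe_add, add_mul, mul_add]
    abel
  · have e : (𝒢.toℂ (c • Y : 𝔱) : Matrix (Fin n) (Fin n) ℂ) =
        c • (𝒢.toℂ Y : Matrix (Fin n) (Fin n) ℂ) := by
      ext i j; simp
    rw [← h, e, RingHom.id_apply, smul_assoc, ← h, smul_sub, Matrix.smul_mul, Matrix.mul_smul]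

theorem weight_zero_of_ne {𝔭 𝔱 : Submodule ℝ 𝒢.𝔤} {α : 𝔱 →ₗ[ℝ] ℂ} {Z : 𝒢.𝔤ℂ}
    (hZ : Z ∈ 𝒢.weightSpace 𝔭 𝔱 α) (hZ0 : Z ≠ 0) {Y : 𝔱} {s : ℝ}
    (hY : ((Y : 𝒢.𝔤) : Matrix (Fin n) (Fin n) ℝ)ᵀ = s • ((Y : 𝒢.𝔤) : Matrix (Fin n) (Fin n) ℝ)) :
    starRingEnd ℂ ((s : ℂ) * α Y) = α Y := by
  have hz : (Z : Matrix (Fin n) (Fin n) ℂ) ≠ 0 := fun h => hZ0 (Subtype.ext h)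
  refine star_eq_of_comm hz ?_ (hZ.2.2 Y)
  have h1 : (𝒢.toℂ Y : Matrix (Fin n) (Fin n) ℂ)ᴴ =
      (s : ℂ) • (𝒢.toℂ Y : Matrix (Fin n) (Fin n) ℂ) := by
    rw [coe_toℂ, conjTranspose_map_ofReal, hY]
    ext i j; simp
  rw [h1, Matrix.smul_mul, Matrix.mul_smul, ← smul_sub, hZ.2.2 Y, smul_smul]

end LinearReductiveGroup

open LinearReductiveGroup

namespace CartanSubalgebra

variable {n : ℕ} {𝒢 : LinearReductiveGroup n} (C : CartanSubalgebra 𝒢)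

theorem 𝔥_comm {X Y : 𝒢.𝔤} (hX : X ∈ C.𝔥) (hY : Y ∈ C.𝔥) :
    (X : Matrix (Fin n) (Fin n) ℝ) * Y = Y * X := (C.mem_iff X).1 hX Y hY

variable {C}

theorem transpose_𝔞 {W : 𝒢.𝔤} (hW : W ∈ C.𝔞) :
    (W : Matrix (Fin n) (Fin n) ℝ)ᵀ = (W : Matrix (Fin n) (Fin n) ℝ) := mem_𝔰_iff.1 hW.2

theorem transpose_𝔱M {Y : 𝒢.𝔤} (hY : Y ∈ C.𝔱M) :
    (Y : Matrix (Fin n) (Fin n) ℝ)ᵀ = -(Y : Matrix (Fin n) (Fin n) ℝ) := mem_𝔨_iff.1 hY.2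

variable (C)

theorem exists_𝔱M_𝔞 {X : 𝒢.𝔤} (hX : X ∈ C.𝔥) : ∃ Y ∈ C.𝔱M, ∃ W ∈ C.𝔞, X = Y + W := by
  have hθ := C.θ_mem X hX
  refine ⟨(1 / 2 : ℝ) • (X + 𝒢.θ X), ⟨C.𝔥.smul_mem _ (add_mem hX hθ), ?_⟩,
    (1 / 2 : ℝ) • (X - 𝒢.θ X), ⟨C.𝔥.smul_mem _ (sub_mem hX hθ), ?_⟩, ?_⟩
  · refine mem_𝔨_iff.2 ?_; simp
  · refine mem_𝔰_iff.2 ?_; simp [add_comm]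
  · rw [← smul_add]
    simp only [add_add_sub_cancel]
    rw [← two_smul ℝ X, smul_smul]; norm_num

theorem trace_𝔱M_𝔞 {Y W : 𝒢.𝔤} (hY : Y ∈ C.𝔱M) (hW : W ∈ C.𝔞) :
    ((Y : Matrix (Fin n) (Fin n) ℝ) * W).trace = 0 := by
  have h := Matrix.trace_transpose ((Y : Matrix (Fin n) (Fin n) ℝ) *
    (W : Matrix (Fin n) (Fin n) ℝ))
  rw [Matrix.transpose_mul, transpose_𝔞 hW, transpose_𝔱M hY, mul_neg, Matrix.trace_neg,
    Matrix.trace_mul_comm] at h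
  linarith

theorem eq_zero_of_trace_𝔞 {W : 𝒢.𝔤} (hW : W ∈ C.𝔞)
    (h : ((W : Matrix (Fin n) (Fin n) ℝ) * W).trace = 0) : W = 0 := by
  have h1 : ((W : Matrix (Fin n) (Fin n) ℝ)ᴴ * W).trace = 0 := by
    rw [Matrix.conjTranspose_eq_transpose_of_trivial, transpose_𝔞 hW, h]
  exact Subtype.ext (Matrix.trace_conjTranspose_mul_self_eq_zero_iff.1 h1)

/-- An element of `𝔪` that commutes with `𝔱_M` lies in `𝔱_M`. -/
theorem mem_𝔱M_of_comm {X : 𝒢.𝔤} (hX : X ∈ C.𝔪)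
    (h : ∀ Y ∈ C.𝔱M, (X : Matrix (Fin n) (Fin n) ℝ) * Y = Y * X) : X ∈ C.𝔱M := by
  have hh : X ∈ C.𝔥 := by
    rw [C.mem_iff]
    intro Y hY
    obtain ⟨T, hT, W, hW, rfl⟩ := C.exists_𝔱M_𝔞 hY
    rw [Submodule.coe_add, mul_add, add_mul, h T hT, (hX W hW).1]
  obtain ⟨T, hT, W, hW, rfl⟩ := C.exists_𝔱M_𝔞 hh
  have h1 := (hX W hW).2
  rw [Submodule.coe_add, add_mul, Matrix.trace_add, C.trace_𝔱M_𝔞 hT hW, zero_add] at h1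
  rw [C.eq_zero_of_trace_𝔞 hW h1, add_zero]
  exact hT

/-- The centraliser of `𝔞` is `𝔪 + 𝔞`. -/
theorem exists_𝔪_𝔞 {X : 𝒢.𝔤} (hX : ∀ W ∈ C.𝔞, (X : Matrix (Fin n) (Fin n) ℝ) * W = W * X) :
    ∃ Y ∈ C.𝔪, ∃ W ∈ C.𝔞, X = Y + W := by
  refine ⟨X - orthProj C.𝔞 X, fun W hW => ⟨?_, ?_⟩, _, (orthProj C.𝔞 X).2, by simp⟩
  · rw [Submodule.coe_sub, sub_mul, mul_sub, hX W hW,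
      C.𝔥_comm (orthProj C.𝔞 X).2.1 hW.1]
  · have h := trace_sub_orthProj C.𝔞 X hW
    rw [← Matrix.trace_transpose, Matrix.conjTranspose_eq_transpose_of_trivial,
      Matrix.transpose_mul, Matrix.transpose_transpose, transpose_𝔞 hW,
      Matrix.trace_mul_comm] at h
    exact h

theorem bracket_𝔪 {X Y : 𝒢.𝔤} (hX : X ∈ C.𝔪) (hY : Y ∈ C.𝔱M)
    (h : (Y : Matrix (Fin n) (Fin n) ℝ) * X - X * Y ∈ 𝒢.𝔤) :
    (⟨(Y : Matrix (Fin n) (Fin n) ℝ) * X - X * Y, h⟩ : 𝒢.𝔤) ∈ C.𝔪 := by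
  intro W hW
  have h1 := (hX W hW).1
  have h2 := C.𝔥_comm hY.1 hW.1
  constructor
  · simp only [sub_mul, mul_sub]
    rw [mul_assoc, h1, ← mul_assoc, h2, mul_assoc, mul_assoc, h2, ← mul_assoc, ← mul_assoc, h1,
      mul_assoc _ _ (Y : Matrix (Fin n) (Fin n) ℝ)]
  · simp only [sub_mul, Matrix.trace_sub]
    rw [mul_assoc, Matrix.trace_mul_comm, mul_assoc, mul_assoc, h2, sub_self]

variable {C}

theorem weightSpace_𝔪_comm {α : C.𝔱M →ₗ[ℝ] ℂ} {Z : 𝒢.𝔤ℂ} (hZ : Z ∈ 𝒢.weightSpace C.𝔪 C.𝔱M α)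
    {W : 𝒢.𝔤} (hW : W ∈ C.𝔞) : (𝒢.toℂ W : Matrix (Fin n) (Fin n) ℂ) * Z -
      Z * (𝒢.toℂ W : Matrix (Fin n) (Fin n) ℂ) = 0 := by
  have h1 := (hZ.1 W hW).1
  have h2 := (hZ.2.1 W hW).1
  simp only [coe_rePart, coe_imPart] at h1 h2
  have h3 := map_re_bracket (W : Matrix (Fin n) (Fin n) ℝ) (Z : Matrix (Fin n) (Fin n) ℂ)
  have h4 := map_im_bracket (W : Matrix (Fin n) (Fin n) ℝ) (Z : Matrix (Fin n) (Fin n) ℂ)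
  rw [h1, sub_self] at h3
  rw [h2, sub_self] at h4
  ext i j
  apply Complex.ext
  · exact congrFun (congrFun h3 i) j
  · exact congrFun (congrFun h4 i) j

/-- Weights of the compact torus are imaginary. -/
theorem conj_weight_𝔱M {𝔭 : Submodule ℝ 𝒢.𝔤} {α : C.𝔱M →ₗ[ℝ] ℂ} {Z : 𝒢.𝔤ℂ}
    (hZ : Z ∈ 𝒢.weightSpace 𝔭 C.𝔱M α) (hZ0 : Z ≠ 0) (Y : C.𝔱M) :
    starRingEnd ℂ (α Y) = -α Y := by
  have h := weight_zero_of_ne hZ hZ0 (Y := Y) (s := -1) (by simpa using transpose_𝔱M Y.2)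
  rw [map_mul, Complex.conj_ofReal] at h
  push_cast at h
  linear_combination -h

/-- Every element of `𝔪` is the sum of an element of `𝔱_M` and of the real part of an element of
the sum of the root spaces for a positive system. -/
theorem exists_decomp_𝔪 {P : Set (C.𝔱M →ₗ[ℝ] ℂ)} (hP : C.IsPositiveSystem P) {X : 𝒢.𝔤}
    (hX : X ∈ C.𝔪) : ∃ Y ∈ C.𝔱M, ∃ Z ∈ C.𝔪plus P, X = Y + (2 : ℝ) • 𝒢.rePart Z := by
  let 𝔪ℂ : Submodule ℂ 𝒢.𝔤ℂ := 𝒢.weightSpace C.𝔪 ⊥ 0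
  have hmem : ∀ Z : 𝒢.𝔤ℂ, Z ∈ 𝔪ℂ ↔ 𝒢.rePart Z ∈ C.𝔪 ∧ 𝒢.imPart Z ∈ C.𝔪 := by
    refine fun Z => ⟨fun h => ⟨h.1, h.2.1⟩, fun h => ⟨h.1, h.2, fun Y => ?_⟩⟩
    have : (Y : 𝒢.𝔤) = 0 := (Submodule.mem_bot ℝ).1 Y.2
    rw [this]; simp
  have key := le_iSup_jointSpace
    (fun Y : C.𝔱M => Complex.I • (𝒢.toℂ Y : Matrix (Fin n) (Fin n) ℂ)) ?_ ?_
    (𝔪ℂ.map 𝒢.𝔤ℂ.subtype) ?_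
  rotate_left
  · intro Y
    rw [Matrix.conjTranspose_smul, coe_toℂ, conjTranspose_map_ofReal, transpose_𝔱M Y.2]
    ext i j; simp
  · intro Y Y'
    rw [Matrix.smul_mul, Matrix.mul_smul, Matrix.smul_mul, Matrix.mul_smul, coe_toℂ, coe_toℂ,
      ← map_ofReal_mul, C.𝔥_comm Y.2.1 Y'.2.1, map_ofReal_mul]
  · rintro Y _ ⟨Z, hZ, rfl⟩
    rw [SetLike.mem_coe, hmem] at hZ
    have hre : ((𝒢.toℂ Y : Matrix (Fin n) (Fin n) ℂ) * Z -
        Z * (𝒢.toℂ Y : Matrix (Fin n) (Fin n) ℂ)).map Complex.re ∈ 𝒢.𝔤 := by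
      rw [coe_toℂ, map_re_bracket]
      exact bracket_mem (Y : 𝒢.𝔤).2 Z.2.1
    have him : ((𝒢.toℂ Y : Matrix (Fin n) (Fin n) ℂ) * Z -
        Z * (𝒢.toℂ Y : Matrix (Fin n) (Fin n) ℂ)).map Complex.im ∈ 𝒢.𝔤 := by
      rw [coe_toℂ, map_im_bracket]
      exact bracket_mem (Y : 𝒢.𝔤).2 Z.2.2
    refine ⟨Complex.I • ⟨_, hre, him⟩, Submodule.smul_mem _ _ ((hmem _).2 ⟨?_, ?_⟩), ?_⟩
    · convert C.bracket_𝔪 hZ.1 Y.2 (bracket_mem (Y : 𝒢.𝔤).2 Z.2.1) using 1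
      ext1
      rw [coe_rePart]
      exact map_re_bracket _ _
    · convert C.bracket_𝔪 hZ.2 Y.2 (bracket_mem (Y : 𝒢.𝔤).2 Z.2.2) using 1
      ext1
      rw [coe_imPart]
      exact map_im_bracket _ _
    · simp [smul_sub]
  have hQ : ∀ Z ∈ ⨆ χ : C.𝔱M → ℂ, jointSpace
      (fun Y : C.𝔱M => Complex.I • (𝒢.toℂ Y : Matrix (Fin n) (Fin n) ℂ))
      (𝔪ℂ.map 𝒢.𝔤ℂ.subtype) χ,
      ∃ Z' : 𝒢.𝔤ℂ, (Z' : Matrix (Fin n) (Fin n) ℂ) = Z ∧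
        ∃ Y ∈ C.𝔱M, ∃ Z₁ ∈ C.𝔪plus P, 𝒢.rePart Z' = Y + 𝒢.rePart Z₁ := by
    intro Z hZ
    induction hZ using Submodule.iSup_induction' with
    | zero => exact ⟨0, rfl, 0, zero_mem _, 0, zero_mem _, by simp⟩
    | add Z W _ _ h1 h2 =>
      obtain ⟨Z', rfl, Y, hY, Z₁, hZ₁, e1⟩ := h1
      obtain ⟨W', rfl, Y', hY', W₁, hW₁, e2⟩ := h2
      refine ⟨Z' + W', rfl, Y + Y', add_mem hY hY', Z₁ + W₁, add_mem hZ₁ hW₁, ?_⟩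
      rw [map_add, map_add, e1, e2]; abel
    | mem χ Z hZ =>
      obtain ⟨⟨Z', hZ', rfl⟩, hχ⟩ := hZ
      by_cases h0 : Z' = 0
      · subst h0
        exact ⟨0, rfl, 0, zero_mem _, 0, zero_mem _, by simp⟩
      have hz : (Z' : Matrix (Fin n) (Fin n) ℂ) ≠ 0 := fun h => h0 (Subtype.ext h)
      have hχ' : ∀ Y : C.𝔱M, (𝒢.toℂ Y : Matrix (Fin n) (Fin n) ℂ) * Z' -
          Z' * (𝒢.toℂ Y : Matrix (Fin n) (Fin n) ℂ) =
            (-Complex.I * χ Y) • (Z' : Matrix (Fin n) (Fin n) ℂ) := by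
        intro Y
        have := hχ Y
        simp only [Submodule.subtype_apply, Matrix.smul_mul, Matrix.mul_smul] at this
        rw [← smul_sub] at this
        rw [mul_smul, ← this, smul_smul]; simp
      obtain ⟨α, hα⟩ := exists_weight hz hχ'
      have hw : Z' ∈ 𝒢.weightSpace C.𝔪 C.𝔱M α :=
        ⟨((hmem _).1 hZ').1, ((hmem _).1 hZ').2, fun Y => by rw [hα]; exact hχ' Y⟩
      refine ⟨Z', rfl, ?_⟩
      -- weight `0` gives an element of `𝔱_M`, a positive root an element of `𝔪plus`, and for a
      -- negative root the conjugate, which has the same real part, lies in `𝔪plus`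
      by_cases hα0 : α = 0
      · refine ⟨𝒢.rePart Z', C.mem_𝔱M_of_comm hw.1 fun Y hY => ?_, 0, zero_mem _, by simp⟩
        have h1 := hw.2.2 ⟨Y, hY⟩
        rw [hα0, LinearMap.zero_apply, zero_smul] at h1
        have h2 := map_re_bracket (Y : Matrix (Fin n) (Fin n) ℝ) (Z' : Matrix (Fin n) (Fin n) ℂ)
        rw [← coe_toℂ, h1] at h2
        have h3 : Y.1 * (Z' : Matrix (Fin n) (Fin n) ℂ).map Complex.re -
            (Z' : Matrix (Fin n) (Fin n) ℂ).map Complex.re * Y.1 = 0 := by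
          rw [← h2]; ext; simp
        exact (sub_eq_zero.1 h3).symm
      · have hroot : α ∈ C.rootsM := ⟨hα0, fun h => h0 (by rw [h] at hw; simpa using hw)⟩
        rcases hP.mem_or_neg_mem α hroot with hαP | hαP
        · exact ⟨0, zero_mem _, Z', Submodule.mem_iSup_of_mem α
            (Submodule.mem_iSup_of_mem hαP hw), by simp⟩
        · refine ⟨0, zero_mem _, conj Z', Submodule.mem_iSup_of_mem (-α)
            (Submodule.mem_iSup_of_mem hαP (conj_mem_weightSpace hw fun Y => ?_)), by simp⟩
          rw [conj_weight_𝔱M hw h0, LinearMap.neg_apply]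
  have hXV : (𝒢.toℂ X : Matrix (Fin n) (Fin n) ℂ) ∈ 𝔪ℂ.map 𝒢.𝔤ℂ.subtype :=
    ⟨𝒢.toℂ X, (hmem _).2 (by simpa using hX), rfl⟩
  obtain ⟨Z', hZ', Y, hY, Z₁, hZ₁, e⟩ := hQ _ (key hXV)
  have : Z' = 𝒢.toℂ X := Subtype.ext hZ'
  rw [this, rePart_toℂ] at e
  refine ⟨Y, hY, (1 / 2 : ℂ) • Z₁, Submodule.smul_mem _ _ hZ₁, ?_⟩
  rw [e, rePart_smul, smul_sub, smul_smul, smul_smul]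
  norm_num

theorem θ_mem_restrictedRootSpace {β : C.𝔞 →ₗ[ℝ] ℝ} {X : 𝒢.𝔤}
    (hX : X ∈ C.restrictedRootSpace β) : 𝒢.θ X ∈ C.restrictedRootSpace (-β) := by
  intro W
  have h := congrArg Matrix.transpose (hX W)
  rw [Matrix.transpose_sub, Matrix.transpose_mul, Matrix.transpose_mul, transpose_𝔞 W.2,
    Matrix.transpose_smul] at h
  rw [coe_θ, LinearMap.neg_apply, neg_smul_neg, ← h, neg_mul, mul_neg]
  abel

/-- `𝔤` is the sum of the centraliser of `𝔞`, of `𝔫` and of `θ 𝔫`. -/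
theorem exists_decomp_restricted (ζ : C.𝔞) (hζ : ∀ β ∈ C.restrictedRoots, β ζ ≠ 0) (X : 𝒢.𝔤) :
    ∃ X₀ : 𝒢.𝔤, (∀ W ∈ C.𝔞, (X₀ : Matrix (Fin n) (Fin n) ℝ) * W = W * X₀) ∧
      ∃ Y₁ ∈ C.𝔫 ζ, ∃ Y₂ ∈ C.𝔫 ζ, X = X₀ + Y₁ + 𝒢.θ Y₂ := by
  have key := le_iSup_jointSpace
    (fun W : C.𝔞 => ((W : 𝒢.𝔤) : Matrix (Fin n) (Fin n) ℝ)) ?_ ?_ 𝒢.𝔤 ?_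
  rotate_left
  · intro W
    rw [Matrix.conjTranspose_eq_transpose_of_trivial, transpose_𝔞 W.2]
  · exact fun W W' => C.𝔥_comm W.2.1 W'.2.1
  · exact fun W Z hZ => bracket_mem (W : 𝒢.𝔤).2 hZ
  have hQ : ∀ Z ∈ ⨆ χ : C.𝔞 → ℝ, jointSpace
      (fun W : C.𝔞 => ((W : 𝒢.𝔤) : Matrix (Fin n) (Fin n) ℝ)) 𝒢.𝔤 χ,
      ∃ X : 𝒢.𝔤, (X : Matrix (Fin n) (Fin n) ℝ) = Z ∧
      ∃ X₀ : 𝒢.𝔤, (∀ W ∈ C.𝔞, (X₀ : Matrix (Fin n) (Fin n) ℝ) * W = W * X₀) ∧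
      ∃ Y₁ ∈ C.𝔫 ζ, ∃ Y₂ ∈ C.𝔫 ζ, X = X₀ + Y₁ + 𝒢.θ Y₂ := by
    intro Z hZ
    induction hZ using Submodule.iSup_induction' with
    | zero => exact ⟨0, rfl, 0, by simp, 0, zero_mem _, 0, zero_mem _, by simp⟩
    | add Z W _ _ h1 h2 =>
      obtain ⟨X, rfl, X₀, hX₀, Y₁, hY₁, Y₂, hY₂, rfl⟩ := h1
      obtain ⟨X', rfl, X₀', hX₀', Y₁', hY₁', Y₂', hY₂', rfl⟩ := h2
      refine ⟨(X₀ + Y₁ + 𝒢.θ Y₂) + (X₀' + Y₁' + 𝒢.θ Y₂'), rfl, X₀ + X₀',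
        fun W hW => ?_, Y₁ + Y₁', add_mem hY₁ hY₁', Y₂ + Y₂',
        add_mem hY₂ hY₂', ?_⟩
      · rw [Submodule.coe_add, add_mul, mul_add, hX₀ W hW, hX₀' W hW]
      · rw [map_add]; abel
    | mem χ Z hZ =>
      obtain ⟨hZg, hχ⟩ := hZ
      refine ⟨⟨Z, hZg⟩, rfl, ?_⟩
      by_cases h0 : Z = 0
      · subst h0
        exact ⟨0, by simp, 0, zero_mem _, 0, zero_mem _, by ext; simp⟩
      let A : C.𝔞 →ₗ[ℝ] Matrix (Fin n) (Fin n) ℝ := 𝒢.𝔤.subtype ∘ₗ C.𝔞.subtype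
      obtain ⟨β, hβ⟩ := exists_linear_weight A h0 (χ := χ) hχ
      have hmem : (⟨Z, hZg⟩ : 𝒢.𝔤) ∈ C.restrictedRootSpace β := fun W => by
        rw [hβ]; exact hχ W
      have hne : (⟨Z, hZg⟩ : 𝒢.𝔤) ≠ 0 := fun h => h0 (congrArg Subtype.val h)
      by_cases hβ0 : β = 0
      · refine ⟨⟨Z, hZg⟩, fun W hW => ?_, 0, zero_mem _, 0, zero_mem _, by simp⟩
        have := hmem ⟨W, hW⟩
        rw [hβ0, LinearMap.zero_apply, zero_smul] at this
        exact (sub_eq_zero.1 this).symm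
      have hroot : β ∈ C.restrictedRoots :=
        ⟨hβ0, fun h => hne (by rw [h] at hmem; simpa using hmem)⟩
      -- a vector of negative weight is `θ` of a vector of positive weight
      rcases lt_or_gt_of_ne (hζ β hroot) with hlt | hgt
      · have hθ := θ_mem_restrictedRootSpace hmem
        refine ⟨0, by simp, 0, zero_mem _, 𝒢.θ ⟨Z, hZg⟩, ?_, by simp⟩
        refine Submodule.mem_iSup_of_mem (-β) (Submodule.mem_iSup_of_mem ⟨⟨neg_ne_zero.2 hβ0,
          fun h => ?_⟩, by simpa using hlt⟩ hθ)
        rw [h, Submodule.mem_bot] at hθ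
        apply hne
        rw [← θ_θ (⟨Z, hZg⟩ : 𝒢.𝔤), hθ, map_zero]
      · exact ⟨0, by simp, ⟨Z, hZg⟩, Submodule.mem_iSup_of_mem β
          (Submodule.mem_iSup_of_mem ⟨hroot, hgt⟩ hmem), 0, zero_mem _, by simp⟩
  obtain ⟨X', hX', h⟩ := hQ X (key X.2)
  rwa [Subtype.ext hX'] at h

/-- The decomposition `𝔤 = 𝔥 ⊕ 𝔪/𝔱_M ⊕ 𝔫 ⊕ θ 𝔫`. -/
theorem exists_decomp {P : Set (C.𝔱M →ₗ[ℝ] ℂ)} (hP : C.IsPositiveSystem P) (ζ : C.𝔞)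
    (hζ : ∀ β ∈ C.restrictedRoots, β ζ ≠ 0) (X : 𝒢.𝔤) :
    ∃ X₀ ∈ C.𝔥, ∃ Z ∈ C.𝔪plus P, ∃ Y₁ ∈ C.𝔫 ζ, ∃ Y₂ ∈ C.𝔫 ζ,
      X = X₀ + (2 : ℝ) • 𝒢.rePart Z + Y₁ + 𝒢.θ Y₂ := by
  obtain ⟨X', hX', Y₁, hY₁, Y₂, hY₂, rfl⟩ := exists_decomp_restricted ζ hζ X
  obtain ⟨M, hM, W, hW, rfl⟩ := C.exists_𝔪_𝔞 hX'
  obtain ⟨T, hT, Z, hZ, rfl⟩ := exists_decomp_𝔪 hP hM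
  exact ⟨T + W, add_mem hT.1 hW.1, Z, hZ, Y₁, hY₁, Y₂, hY₂, by abel⟩

end CartanSubalgebra

namespace LinearReductiveGroup

variable {n : ℕ} {𝒢 : LinearReductiveGroup n}

/-- The complexified adjoint representation. -/
def Adℂ (g : 𝒢.Grp) (Z : 𝒢.𝔤ℂ) : 𝒢.𝔤ℂ :=
  𝒢.toℂ (𝒢.Ad g (𝒢.rePart Z)) + Complex.I • 𝒢.toℂ (𝒢.Ad g (𝒢.imPart Z))

@[simp] theorem rePart_Adℂ (g : 𝒢.Grp) (Z : 𝒢.𝔤ℂ) :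
    𝒢.rePart (Adℂ g Z) = 𝒢.Ad g (𝒢.rePart Z) := by
  simp [Adℂ, rePart_smul]

@[simp] theorem imPart_Adℂ (g : 𝒢.Grp) (Z : 𝒢.𝔤ℂ) :
    𝒢.imPart (Adℂ g Z) = 𝒢.Ad g (𝒢.imPart Z) := by
  simp [Adℂ, imPart_smul]

theorem eq_of_parts {Z W : 𝒢.𝔤ℂ} (h1 : 𝒢.rePart Z = 𝒢.rePart W) (h2 : 𝒢.imPart Z = 𝒢.imPart W) :
    Z = W := by
  ext i j
  apply Complex.ext
  · exact congrFun (congrFun (congrArg Subtype.val h1) i) j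
  · exact congrFun (congrFun (congrArg Subtype.val h2) i) j

theorem Adℂ_smul (g : 𝒢.Grp) (c : ℂ) (Z : 𝒢.𝔤ℂ) : Adℂ g (c • Z) = c • Adℂ g Z := by
  apply eq_of_parts <;> simp [rePart_smul, imPart_smul]

theorem Adℂ_add (g : 𝒢.Grp) (Z W : 𝒢.𝔤ℂ) : Adℂ g (Z + W) = Adℂ g Z + Adℂ g W := by
  apply eq_of_parts <;> simp

theorem coe_Adℂ (g : 𝒢.Grp) (Z : 𝒢.𝔤ℂ) : (Adℂ g Z : Matrix (Fin n) (Fin n) ℂ) =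
    (𝒢.mat g).map Complex.ofReal * Z * (𝒢.mat g⁻¹).map Complex.ofReal := by
  have h : (Z : Matrix (Fin n) (Fin n) ℂ) =
      (𝒢.rePart Z : Matrix (Fin n) (Fin n) ℝ).map Complex.ofReal +
        Complex.I • (𝒢.imPart Z : Matrix (Fin n) (Fin n) ℝ).map Complex.ofReal := by
    ext i j
    apply Complex.ext <;> simp
  rw [h]
  simp only [Adℂ, Submodule.coe_add, Submodule.coe_smul, coe_toℂ, coe_Ad, map_ofReal_mul, mul_add,
    add_mul, Matrix.mul_smul, Matrix.smul_mul]

theorem θ_Ad {k : 𝒢.Grp} (hk : k ∈ 𝒢.K) (X : 𝒢.𝔤) : 𝒢.θ (𝒢.Ad k X) = 𝒢.Ad k (𝒢.θ X) := by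
  have h1 : (𝒢.mat k)ᵀ * 𝒢.mat k = 1 := hk
  have h2 : 𝒢.mat k⁻¹ = (𝒢.mat k)ᵀ := (left_inv_eq_right_inv h1 (mat_mul_mat_inv k)).symm
  ext1
  simp only [coe_θ, coe_Ad, h2, Matrix.transpose_mul, Matrix.transpose_transpose, mul_neg, neg_mul,
    mul_assoc]

end LinearReductiveGroup

namespace CartanSubalgebra

variable {n : ℕ} {𝒢 : LinearReductiveGroup n} {C : CartanSubalgebra 𝒢}

/-- An induction principle for the sum of the positive restricted root spaces. -/
theorem 𝔫_induction {ζ : C.𝔞} {p : 𝒢.𝔤 → Prop} {Y : 𝒢.𝔤} (hY : Y ∈ C.𝔫 ζ)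
    (mem : ∀ β ∈ C.posRestrictedRoots ζ, ∀ X ∈ C.restrictedRootSpace β, p X) (zero : p 0)
    (add : ∀ X X', p X → p X' → p (X + X')) : p Y := by
  rw [𝔫, iSup_subtype'] at hY
  exact Submodule.iSup_induction _ (motive := p) hY (fun β X hX => mem β β.2 X hX) zero add

theorem 𝔪plus_induction {P : Set (C.𝔱M →ₗ[ℝ] ℂ)} {p : 𝒢.𝔤ℂ → Prop} {Y : 𝒢.𝔤ℂ}
    (hY : Y ∈ C.𝔪plus P)
    (mem : ∀ α ∈ P, ∀ X ∈ 𝒢.weightSpace C.𝔪 C.𝔱M α, p X) (zero : p 0)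
    (add : ∀ X X', p X → p X' → p (X + X')) : p Y := by
  rw [𝔪plus, iSup_subtype'] at hY
  exact Submodule.iSup_induction _ (motive := p) hY (fun β X hX => mem β β.2 X hX) zero add

theorem comm_θ {X : 𝒢.𝔤} (hX : ∀ W ∈ C.𝔞, (X : Matrix (Fin n) (Fin n) ℝ) * W = W * X) :
    ∀ W ∈ C.𝔞, (𝒢.θ X : Matrix (Fin n) (Fin n) ℝ) * W = W * 𝒢.θ X := by
  intro W hW
  have h := congrArg Matrix.transpose (hX W hW)
  rw [Matrix.transpose_mul, Matrix.transpose_mul, transpose_𝔞 hW] at h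
  rw [coe_θ, neg_mul, mul_neg, h]

theorem trace_comm_𝔫 {ζ : C.𝔞} {X : 𝒢.𝔤}
    (hX : ∀ W ∈ C.𝔞, (X : Matrix (Fin n) (Fin n) ℝ) * W = W * X) {Y : 𝒢.𝔤} (hY : Y ∈ C.𝔫 ζ) :
    ((X : Matrix (Fin n) (Fin n) ℝ) * (Y : Matrix (Fin n) (Fin n) ℝ)).trace = 0 := by
  refine 𝔫_induction (p := fun Y => ((X : Matrix (Fin n) (Fin n) ℝ) *
    (Y : Matrix (Fin n) (Fin n) ℝ)).trace = 0) hY (fun β hβ Z hZ => ?_) (by simp)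
    fun Z Z' h h' => ?_
  · obtain ⟨W, hW⟩ : ∃ W, β W ≠ 0 := by
      by_contra! h0
      exact hβ.1.1 (LinearMap.ext h0)
    exact trace_mul_eq_zero hW (hX W W.2) (hZ W)
  · rw [Submodule.coe_add, mul_add, Matrix.trace_add, h, h', add_zero]

theorem trace_𝔫_𝔫 {ζ : C.𝔞} {Y Y' : 𝒢.𝔤} (hY : Y ∈ C.𝔫 ζ) (hY' : Y' ∈ C.𝔫 ζ) :
    ((Y : Matrix (Fin n) (Fin n) ℝ) * (Y' : Matrix (Fin n) (Fin n) ℝ)).trace = 0 := by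
  refine 𝔫_induction (p := fun Y => ((Y : Matrix (Fin n) (Fin n) ℝ) *
    (Y' : Matrix (Fin n) (Fin n) ℝ)).trace = 0) hY (fun β hβ Z hZ => ?_) (by simp)
    fun Z Z' h h' => ?_
  · refine 𝔫_induction (p := fun Y' => ((Z : Matrix (Fin n) (Fin n) ℝ) *
      (Y' : Matrix (Fin n) (Fin n) ℝ)).trace = 0) hY' (fun β' hβ' Z' hZ' => ?_) (by simp)
      fun Z₁ Z₂ h h' => ?_
    · have h1 := hZ ζ
      have h2 := hZ' ζ
      generalize (Z : Matrix (Fin n) (Fin n) ℝ) = z at *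
      generalize (Z' : Matrix (Fin n) (Fin n) ℝ) = z' at *
      generalize ((ζ : 𝒢.𝔤) : Matrix (Fin n) (Fin n) ℝ) = w at *
      have h3 : (β ζ + β' ζ) * (z * z').trace = 0 := by
        have e1 : β ζ * (z * z').trace = ((w * z - z * w) * z').trace := by
          rw [h1, Matrix.smul_mul, Matrix.trace_smul, smul_eq_mul]
        have e2 : β' ζ * (z * z').trace = (z * (w * z' - z' * w)).trace := by
          rw [h2, Matrix.mul_smul, Matrix.trace_smul, smul_eq_mul]
        rw [add_mul, e1, e2, ← Matrix.trace_add, sub_mul, mul_sub, ← mul_assoc z w,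
          sub_add_sub_cancel, Matrix.trace_sub, mul_assoc w, Matrix.trace_mul_comm w, mul_assoc z,
          sub_self]
      have h4 : β ζ + β' ζ ≠ 0 := (add_pos hβ.2 hβ'.2).ne'
      exact (mul_eq_zero.1 h3).resolve_left h4
    · rw [Submodule.coe_add, mul_add, Matrix.trace_add, h, h', add_zero]
  · rw [Submodule.coe_add, add_mul, Matrix.trace_add, h, h', add_zero]

/-- Root spaces of the compact torus for different weights are orthogonal. -/
theorem trace_weightSpace {𝔭 : Submodule ℝ 𝒢.𝔤} {α α' : C.𝔱M →ₗ[ℝ] ℂ} (hne : α ≠ α')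
    {Z Z' : 𝒢.𝔤ℂ} (hZ : Z ∈ 𝒢.weightSpace 𝔭 C.𝔱M α) (hZ' : Z' ∈ 𝒢.weightSpace 𝔭 C.𝔱M α') :
    ((Z : Matrix (Fin n) (Fin n) ℂ)ᴴ * (Z' : Matrix (Fin n) (Fin n) ℂ)).trace = 0 := by
  by_cases h0 : Z = 0
  · subst h0; simp
  obtain ⟨Y, hY⟩ : ∃ Y, α Y ≠ α' Y := by
    by_contra! h
    exact hne (LinearMap.ext h)
  refine trace_eq_zero_of_comm (d := -α Y) ?_ (hZ'.2.2 Y) ?_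
  · have h1 : (𝒢.toℂ Y : Matrix (Fin n) (Fin n) ℂ)ᴴ = -(𝒢.toℂ Y : Matrix (Fin n) (Fin n) ℂ) := by
      rw [coe_toℂ, conjTranspose_map_ofReal, transpose_𝔱M Y.2]
      ext i j; simp
    rw [h1, neg_mul, mul_neg, neg_smul, ← hZ.2.2 Y, neg_sub_neg, neg_sub]
  · rw [star_neg, ← starRingEnd_apply, conj_weight_𝔱M hZ h0, neg_neg]
    exact hY

variable {P : Set (C.𝔱M →ₗ[ℝ] ℂ)}

theorem parts_𝔪plus {Z : 𝒢.𝔤ℂ} (hZ : Z ∈ C.𝔪plus P) : 𝒢.rePart Z ∈ C.𝔪 ∧ 𝒢.imPart Z ∈ C.𝔪 := by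
  refine 𝔪plus_induction (p := fun Z => 𝒢.rePart Z ∈ C.𝔪 ∧ 𝒢.imPart Z ∈ C.𝔪) hZ
    (fun α _ X hX => ⟨hX.1, hX.2.1⟩) (by simp) fun X X' h h' => ?_
  rw [map_add, map_add]
  exact ⟨add_mem h.1 h'.1, add_mem h.2 h'.2⟩

theorem trace_conj_𝔪plus (hP : C.IsPositiveSystem P) {Z Z' : 𝒢.𝔤ℂ} (hZ : Z ∈ C.𝔪plus P)
    (hZ' : Z' ∈ C.𝔪plus P) :
    ((conj Z : Matrix (Fin n) (Fin n) ℂ)ᴴ * (Z' : Matrix (Fin n) (Fin n) ℂ)).trace = 0 := by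
  rw [coe_conj]
  let p : 𝒢.𝔤ℂ → Prop := fun Z => (((Z : Matrix (Fin n) (Fin n) ℂ).map (starRingEnd ℂ))ᴴ *
    (Z' : Matrix (Fin n) (Fin n) ℂ)).trace = 0
  have h1 : ∀ α ∈ P, ∀ X ∈ 𝒢.weightSpace C.𝔪 C.𝔱M α, p X := by
    intro α hα X hX
    by_cases h0 : X = 0
    · subst h0; simp [p]
    let q : 𝒢.𝔤ℂ → Prop := fun Z' => (((X : Matrix (Fin n) (Fin n) ℂ).map (starRingEnd ℂ))ᴴ *
      (Z' : Matrix (Fin n) (Fin n) ℂ)).trace = 0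
    refine 𝔪plus_induction (p := q) hZ' (fun α' hα' X' hX' => ?_) (by simp [q])
      fun X X' (h : _ = _) (h' : _ = _) => ?_
    · have h1 : conj X ∈ 𝒢.weightSpace C.𝔪 C.𝔱M (-α) := conj_mem_weightSpace hX fun Y => by
        rw [conj_weight_𝔱M hX h0, LinearMap.neg_apply]
      have h2 := trace_weightSpace (fun h : -α = α' => hP.not_neg_mem α hα (h ▸ hα')) h1 hX'
      rwa [coe_conj] at h2
    · change _ = _
      rw [Submodule.coe_add, mul_add, Matrix.trace_add, h, h', add_zero]
  refine 𝔪plus_induction (p := p) hZ h1 (by simp [p]) fun X X' (h : _ = _) (h' : _ = _) => ?_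
  change _ = _
  rw [Submodule.coe_add, Matrix.map_add _ (map_add _), Matrix.conjTranspose_add, add_mul,
    Matrix.trace_add, h, h', add_zero]

theorem orthProj_𝔪plus_toℂ_eq_zero {X : 𝒢.𝔤} (h : ∀ Y ∈ C.𝔪,
    ((X : Matrix (Fin n) (Fin n) ℝ)ᵀ * (Y : Matrix (Fin n) (Fin n) ℝ)).trace = 0) :
    orthProj (C.𝔪plus P) (𝒢.toℂ X) = 0 := by
  refine orthProj_eq_zero _ _ fun Z hZ => ?_
  obtain ⟨h1, h2⟩ := parts_𝔪plus hZ
  have h3 := h _ h1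
  have h4 := h _ h2
  rw [coe_toℂ, conjTranspose_map_ofReal]
  apply Complex.ext
  · rw [Complex.zero_re, ← h3]
    simp [Matrix.trace, Matrix.mul_apply]
  · rw [Complex.zero_im, ← h4]
    simp [Matrix.trace, Matrix.mul_apply]

theorem trace_θ_mul (X Y : 𝒢.𝔤) :
    ((𝒢.θ X : Matrix (Fin n) (Fin n) ℝ)ᵀ * (Y : Matrix (Fin n) (Fin n) ℝ)).trace =
      -((X : Matrix (Fin n) (Fin n) ℝ) * (Y : Matrix (Fin n) (Fin n) ℝ)).trace := by
  simp

theorem trace_mul_θ (X Y : 𝒢.𝔤) :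
    ((X : Matrix (Fin n) (Fin n) ℝ)ᵀ * (𝒢.θ Y : Matrix (Fin n) (Fin n) ℝ)).trace =
      -((X : Matrix (Fin n) (Fin n) ℝ) * (Y : Matrix (Fin n) (Fin n) ℝ)).trace := by
  rw [coe_θ, mul_neg, Matrix.trace_neg, ← Matrix.transpose_mul, Matrix.trace_transpose,
    Matrix.trace_mul_comm]

theorem orthProj_𝔫_eq_zero {ζ : C.𝔞} {X : 𝒢.𝔤}
    (hX : ∀ W ∈ C.𝔞, (X : Matrix (Fin n) (Fin n) ℝ) * W = W * X) :
    orthProj (C.𝔫 ζ) X = 0 ∧ orthProj (C.𝔫bar ζ) X = 0 := by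
  constructor <;> refine orthProj_eq_zero _ _ fun Z hZ => ?_ <;>
    rw [Matrix.conjTranspose_eq_transpose_of_trivial]
  · have := trace_comm_𝔫 (comm_θ hX) hZ
    rw [coe_θ, neg_mul, Matrix.trace_neg, neg_eq_zero] at this
    exact this
  · obtain ⟨Y, hY, rfl⟩ := hZ
    rw [trace_mul_θ, trace_comm_𝔫 hX hY, neg_zero]

theorem orthProj_𝔫 {ζ : C.𝔞} {Y : 𝒢.𝔤} (hY : Y ∈ C.𝔫 ζ) :
    (orthProj (C.𝔫 ζ) Y : 𝒢.𝔤) = Y ∧ orthProj (C.𝔫bar ζ) Y = 0 := by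
  constructor
  · exact orthProj_eq_of_trace _ _ hY fun Z _ => by simp
  · refine orthProj_eq_zero _ _ fun Z hZ => ?_
    rw [Matrix.conjTranspose_eq_transpose_of_trivial]
    obtain ⟨Y', hY', rfl⟩ := hZ
    rw [trace_mul_θ, trace_𝔫_𝔫 hY hY', neg_zero]

theorem orthProj_θ_𝔫 {ζ : C.𝔞} {Y : 𝒢.𝔤} (hY : Y ∈ C.𝔫 ζ) :
    orthProj (C.𝔫 ζ) (𝒢.θ Y) = 0 ∧ (orthProj (C.𝔫bar ζ) (𝒢.θ Y) : 𝒢.𝔤) = 𝒢.θ Y := by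
  constructor
  · refine orthProj_eq_zero _ _ fun Z hZ => ?_
    rw [Matrix.conjTranspose_eq_transpose_of_trivial, trace_θ_mul, trace_𝔫_𝔫 hY hZ, neg_zero]
  · exact orthProj_eq_of_trace _ _ ⟨Y, hY, rfl⟩ fun Z _ => by simp

/-- The values of `J` on the summands of `𝔤`. -/
theorem Jlift_decomp (hP : C.IsPositiveSystem P) (ζ : C.𝔞) {X₀ Y₁ Y₂ : 𝒢.𝔤} {Z : 𝒢.𝔤ℂ}
    (hX₀ : X₀ ∈ C.𝔥) (hZ : Z ∈ C.𝔪plus P) (hY₁ : Y₁ ∈ C.𝔫 ζ) (hY₂ : Y₂ ∈ C.𝔫 ζ) :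
    C.Jlift P ζ (X₀ + (2 : ℝ) • 𝒢.rePart Z + Y₁ + 𝒢.θ Y₂) =
      (2 : ℝ) • 𝒢.rePart (Complex.I • Z) + 𝒢.θ Y₁ - Y₂ := by
  have hm : ∀ Y ∈ C.𝔪, ∀ W ∈ C.𝔞, (Y : Matrix (Fin n) (Fin n) ℝ) * W = W * Y :=
    fun Y hY W hW => (hY W hW).1
  have h0 := C.Jlift_eq_zero P hP.subset ζ hX₀
  have h1 : C.Jlift P ζ ((2 : ℝ) • 𝒢.rePart Z) = (2 : ℝ) • 𝒢.rePart (Complex.I • Z) := by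
    have e1 : (orthProj (C.𝔪plus P) (𝒢.toℂ ((2 : ℝ) • 𝒢.rePart Z)) : 𝒢.𝔤ℂ) = Z := by
      refine orthProj_eq_of_trace _ _ hZ fun Z' hZ' => ?_
      rw [toℂ_two_rePart, add_sub_cancel_left]
      exact trace_conj_𝔪plus hP hZ hZ'
    have e2 := orthProj_𝔫_eq_zero (ζ := ζ) (hm _ (C.𝔪.smul_mem 2 (parts_𝔪plus hZ).1))
    simp only [Jlift, LinearMap.coe_mk, AddHom.coe_mk, e1, e2.1, e2.2]
    simp
  have h2 : C.Jlift P ζ Y₁ = 𝒢.θ Y₁ := by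
    have e1 : orthProj (C.𝔪plus P) (𝒢.toℂ Y₁) = 0 := by
      refine orthProj_𝔪plus_toℂ_eq_zero fun Y hY => ?_
      rw [← Matrix.trace_transpose, Matrix.transpose_mul, Matrix.transpose_transpose]
      have := trace_comm_𝔫 (comm_θ (hm Y hY)) hY₁
      rw [coe_θ, neg_mul, Matrix.trace_neg, neg_eq_zero] at this
      exact this
    have e2 := orthProj_𝔫 hY₁
    simp only [Jlift, LinearMap.coe_mk, AddHom.coe_mk, e1, e2.1, e2.2]
    simp
  have h3 : C.Jlift P ζ (𝒢.θ Y₂) = -Y₂ := by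
    have e1 : orthProj (C.𝔪plus P) (𝒢.toℂ (𝒢.θ Y₂)) = 0 := by
      refine orthProj_𝔪plus_toℂ_eq_zero fun Y hY => ?_
      rw [trace_θ_mul, Matrix.trace_mul_comm, trace_comm_𝔫 (hm Y hY) hY₂, neg_zero]
    have e2 := orthProj_θ_𝔫 hY₂
    simp only [Jlift, LinearMap.coe_mk, AddHom.coe_mk, e1, e2.1, e2.2]
    simp
  rw [map_add, map_add, map_add, h0, h1, h2, h3]
  abel

theorem Jlift_Jlift (hP : C.IsPositiveSystem P) (ζ : C.𝔞)
    (hζ : ∀ β ∈ C.restrictedRoots, β ζ ≠ 0) (X : 𝒢.𝔤) :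
    C.Jlift P ζ (C.Jlift P ζ X) + X ∈ C.𝔥 := by
  obtain ⟨X₀, hX₀, Z, hZ, Y₁, hY₁, Y₂, hY₂, rfl⟩ := exists_decomp hP ζ hζ X
  rw [Jlift_decomp hP ζ hX₀ hZ hY₁ hY₂]
  have e : (2 : ℝ) • 𝒢.rePart (Complex.I • Z) + 𝒢.θ Y₁ - Y₂ =
      0 + (2 : ℝ) • 𝒢.rePart (Complex.I • Z) + -Y₂ + 𝒢.θ Y₁ := by abel
  rw [e, Jlift_decomp hP ζ (zero_mem _) (Submodule.smul_mem _ _ hZ) (neg_mem hY₂) hY₁, smul_smul,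
    Complex.I_mul_I, neg_one_smul, map_neg, map_neg, smul_neg]
  convert hX₀ using 1
  abel

theorem Adℂ_mem_𝔪plus {h : 𝒢.Grp} (hh : h ∈ C.H) {Z : 𝒢.𝔤ℂ} (hZ : Z ∈ C.𝔪plus P) :
    Adℂ h Z ∈ C.𝔪plus P := by
  have hcomm : ∀ Y ∈ C.𝔥, 𝒢.mat h * (Y : Matrix (Fin n) (Fin n) ℝ) * 𝒢.mat h⁻¹ = Y :=
    fun Y hY => congrArg Subtype.val (hh Y hY)
  have hm : ∀ X ∈ C.𝔪, 𝒢.Ad h X ∈ C.𝔪 := by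
    intro X hX W hW
    have h1 := hcomm W hW.1
    have h2 := hX W hW
    have h3 : 𝒢.mat h⁻¹ * (W : Matrix (Fin n) (Fin n) ℝ) =
        (W : Matrix (Fin n) (Fin n) ℝ) * 𝒢.mat h⁻¹ := by
      conv_lhs => rw [← hcomm W hW.1, ← mul_assoc, ← mul_assoc, mat_inv_mul_mat, one_mul]
    have h4 : (W : Matrix (Fin n) (Fin n) ℝ) * 𝒢.mat h = 𝒢.mat h * W := by
      conv_lhs => rw [← hcomm W hW.1, mul_assoc, mat_inv_mul_mat, mul_one]
    simp only [coe_Ad]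
    constructor
    · rw [mul_assoc, h3, ← mul_assoc, ← mul_assoc, ← mul_assoc, h4, mul_assoc (𝒢.mat h), h2.1,
        mul_assoc (𝒢.mat h)]
      simp only [mul_assoc]
    · rw [mul_assoc, h3, mul_assoc, ← mul_assoc _ _ (𝒢.mat h⁻¹), Matrix.trace_mul_comm, mul_assoc,
        mat_inv_mul_mat, mul_one, h2.2]
  refine 𝔪plus_induction (p := fun Z => Adℂ h Z ∈ C.𝔪plus P) hZ (fun α hα X hX => ?_) ?_
    fun X X' h1 h2 => ?_
  · refine Submodule.mem_iSup_of_mem α (Submodule.mem_iSup_of_mem hα ⟨?_, ?_, fun Y => ?_⟩)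
    · rw [rePart_Adℂ]; exact hm _ hX.1
    · rw [imPart_Adℂ]; exact hm _ hX.2.1
    · have h1 : (𝒢.toℂ Y : Matrix (Fin n) (Fin n) ℂ) * (𝒢.mat h).map Complex.ofReal =
          (𝒢.mat h).map Complex.ofReal * (𝒢.toℂ Y : Matrix (Fin n) (Fin n) ℂ) := by
        rw [coe_toℂ, ← map_ofReal_mul, ← map_ofReal_mul]
        conv_lhs => rw [← hcomm Y Y.2.1, mul_assoc, mat_inv_mul_mat, mul_one]
      have h2 : (𝒢.mat h⁻¹).map Complex.ofReal * (𝒢.toℂ Y : Matrix (Fin n) (Fin n) ℂ) =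
          (𝒢.toℂ Y : Matrix (Fin n) (Fin n) ℂ) * (𝒢.mat h⁻¹).map Complex.ofReal := by
        rw [coe_toℂ, ← map_ofReal_mul, ← map_ofReal_mul]
        conv_lhs => rw [← hcomm Y Y.2.1, ← mul_assoc, ← mul_assoc, mat_inv_mul_mat, one_mul]
      rw [coe_Adℂ, ← mul_assoc, ← mul_assoc, h1, mul_assoc _ _ (𝒢.toℂ Y : Matrix (Fin n) (Fin n) ℂ),
          h2,
        ← Matrix.smul_mul, ← Matrix.mul_smul, ← hX.2.2 Y]
      simp only [mul_sub, sub_mul, mul_assoc]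
  · rw [show Adℂ h (0 : 𝒢.𝔤ℂ) = 0 from eq_of_parts (by simp) (by simp)]
    exact zero_mem _
  · rw [Adℂ_add]; exact add_mem h1 h2

theorem Ad_mem_𝔫 {ζ : C.𝔞} {h : 𝒢.Grp} (hh : h ∈ C.ZA) {Y : 𝒢.𝔤} (hY : Y ∈ C.𝔫 ζ) :
    𝒢.Ad h Y ∈ C.𝔫 ζ := by
  refine 𝔫_induction (p := fun Y => 𝒢.Ad h Y ∈ C.𝔫 ζ) hY (fun β hβ X hX => ?_) (by simp)
    fun X X' h1 h2 => ?_
  · refine Submodule.mem_iSup_of_mem β (Submodule.mem_iSup_of_mem hβ fun W => ?_)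
    have hW : 𝒢.mat h * ((W : 𝒢.𝔤) : Matrix (Fin n) (Fin n) ℝ) * 𝒢.mat h⁻¹ = (W : 𝒢.𝔤) :=
      congrArg Subtype.val (hh W W.2)
    have h1 := hX W
    rw [coe_Ad, ← Matrix.smul_mul, ← Matrix.mul_smul, ← h1]
    conv_lhs => rw [← hW]
    simp only [mul_sub, sub_mul, mul_assoc]
    simp only [← mul_assoc (𝒢.mat h⁻¹) (𝒢.mat h), mat_inv_mul_mat, one_mul]
  · rw [map_add]; exact add_mem h1 h2

theorem H_le_ZA : C.H ≤ C.ZA := fun _ hh X hX => hh X hX.1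

/-- `J` commutes with the adjoint action of `K ∩ H`. -/
theorem Jlift_Ad (hP : C.IsPositiveSystem P) (ζ : C.𝔞)
    (hζ : ∀ β ∈ C.restrictedRoots, β ζ ≠ 0) {t : 𝒢.Grp} (ht : t ∈ C.H) (htK : t ∈ 𝒢.K) (X : 𝒢.𝔤) :
    C.Jlift P ζ (𝒢.Ad t X) = 𝒢.Ad t (C.Jlift P ζ X) := by
  obtain ⟨X₀, hX₀, Z, hZ, Y₁, hY₁, Y₂, hY₂, rfl⟩ := exists_decomp hP ζ hζ X
  rw [Jlift_decomp hP ζ hX₀ hZ hY₁ hY₂]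
  simp only [map_add, map_sub, map_smul, ← θ_Ad htK, ← rePart_Adℂ, Adℂ_smul]
  rw [ht X₀ hX₀, ← map_smul (𝒢.rePart)]
  rw [map_smul (𝒢.rePart)]
  rw [← Jlift_decomp hP ζ hX₀ (Adℂ_mem_𝔪plus ht hZ) (Ad_mem_𝔫 (H_le_ZA ht) hY₁)
    (Ad_mem_𝔫 (H_le_ZA ht) hY₂)]
  simp only [map_add, map_smul]

end CartanSubalgebra

/-! ### Roots of the Cartan subalgebra -/

theorem eq_zero_of_trace_conjTranspose_mul_self {n : ℕ} {A : Matrix (Fin n) (Fin n) ℂ}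
    (h : (Aᴴ * A).trace = 0) : A = 0 := by
  open scoped ComplexOrder in
  exact Matrix.trace_conjTranspose_mul_self_eq_zero_iff.1 h

/-- The step `α(h) |e'|² = -|[e, e']|²` of the proof that root spaces are lines. -/
theorem eq_zero_of_commute_conjTranspose {n : ℕ} {e e' h : Matrix (Fin n) (Fin n) ℂ} {c : ℂ}
    (hh : h = e * eᴴ - eᴴ * e) (h0 : h ≠ 0) (hc : h * e - e * h = c • e)
    (hc' : h * e' - e' * h = c • e') (hcomm : eᴴ * e' = e' * eᴴ) : e' = 0 := by
  open scoped ComplexOrder in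
  have hherm : hᴴ = h := by
    rw [hh]; simp
  have h1 : (hᴴ * h).trace = c * (eᴴ * e).trace := by
    calc (hᴴ * h).trace = (h * (e * eᴴ - eᴴ * e)).trace := by rw [hherm, ← hh]
      _ = ((h * e - e * h) * eᴴ).trace := by
        rw [mul_sub, sub_mul, Matrix.trace_sub, Matrix.trace_sub, ← mul_assoc, ← mul_assoc,
          Matrix.trace_mul_comm (h * eᴴ) e, ← mul_assoc]
      _ = c * (eᴴ * e).trace := by
        rw [hc, Matrix.smul_mul, Matrix.trace_smul, smul_eq_mul, Matrix.trace_mul_comm]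
  have h2 : ((e * e' - e' * e)ᴴ * (e * e' - e' * e)).trace = -(c * (e'ᴴ * e').trace) := by
    have hcomm' : e'ᴴ * e = e * e'ᴴ := by
      have := congrArg Matrix.conjTranspose hcomm
      simpa using this
    have e1 : eᴴ * (e * e' - e' * e) - (e * e' - e' * e) * eᴴ = -(c • e') := by
      rw [← hc', hh]
      have : eᴴ * (e * e' - e' * e) - (e * e' - e' * e) * eᴴ + ((e * eᴴ - eᴴ * e) * e' -
          e' * (e * eᴴ - eᴴ * e)) = e * (eᴴ * e' - e' * eᴴ) - (eᴴ * e' - e' * eᴴ) * e := by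
        noncomm_ring
      rw [hcomm, sub_self, mul_zero, zero_mul, sub_zero] at this
      exact eq_neg_of_add_eq_zero_left this
    calc ((e * e' - e' * e)ᴴ * (e * e' - e' * e)).trace
        = (e'ᴴ * (eᴴ * (e * e' - e' * e) - (e * e' - e' * e) * eᴴ)).trace := by
          rw [Matrix.conjTranspose_sub, Matrix.conjTranspose_mul, Matrix.conjTranspose_mul,
            sub_mul, mul_sub e'ᴴ, Matrix.trace_sub, Matrix.trace_sub, mul_assoc, mul_assoc eᴴ,
            Matrix.trace_mul_comm eᴴ, mul_assoc]
      _ = _ := by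
        rw [e1, mul_neg, Matrix.trace_neg, Matrix.mul_smul, Matrix.trace_smul, smul_eq_mul]
  have p1 := (Matrix.posSemidef_conjTranspose_mul_self h).trace_nonneg
  have p2 := (Matrix.posSemidef_conjTranspose_mul_self e).trace_nonneg
  have p3 := (Matrix.posSemidef_conjTranspose_mul_self (e * e' - e' * e)).trace_nonneg
  have p4 := (Matrix.posSemidef_conjTranspose_mul_self e').trace_nonneg
  have q1 : (hᴴ * h).trace ≠ 0 := fun h => h0 (eq_zero_of_trace_conjTranspose_mul_self h)
  -- `|h|² = c |e|²` forces `c > 0`, and `|[e, e']|² = -c |e'|²` forces `e' = 0`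
  rw [h1] at p1 q1
  rw [h2] at p3
  by_contra hne
  have q4 : (e'ᴴ * e').trace ≠ 0 :=
    fun h => hne (eq_zero_of_trace_conjTranspose_mul_self h)
  have r1 := lt_of_le_of_ne p1 (Ne.symm q1)
  have r4 := lt_of_le_of_ne p4 (Ne.symm q4)
  have r2 := lt_of_le_of_ne p2 (fun h => q1 (by rw [← h, mul_zero]))
  have r5 : 0 < c := by
    have := mul_pos r1 (inv_pos.2 r2)
    rwa [mul_assoc, mul_inv_cancel₀ r2.ne', mul_one] at this
  have := mul_pos r5 r4
  have := add_pos_of_nonneg_of_pos p3 this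
  simp at this

namespace LinearReductiveGroup

variable {n : ℕ} {𝒢 : LinearReductiveGroup n}

theorem conjTranspose_mem_𝔤ℂ {Z : Matrix (Fin n) (Fin n) ℂ} (hZ : Z ∈ 𝒢.𝔤ℂ) : Zᴴ ∈ 𝒢.𝔤ℂ := by
  constructor
  · convert neg_mem (𝒢.neg_transpose_mem hZ.1) using 1
    ext i j; simp
  · convert 𝒢.neg_transpose_mem hZ.2 using 1
    ext i j; simp

theorem bracket_mem_𝔤ℂ {Z W : Matrix (Fin n) (Fin n) ℂ} (hZ : Z ∈ 𝒢.𝔤ℂ) (hW : W ∈ 𝒢.𝔤ℂ) :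
    Z * W - W * Z ∈ 𝒢.𝔤ℂ := by
  constructor
  · convert sub_mem (𝒢.bracket_mem hZ.1 hW.1) (𝒢.bracket_mem hZ.2 hW.2) using 1
    ext i j
    simp [Matrix.mul_apply, Finset.sum_sub_distrib]
    ring
  · convert add_mem (𝒢.bracket_mem hZ.1 hW.2) (𝒢.bracket_mem hZ.2 hW.1) using 1
    ext i j
    simp [Matrix.mul_apply, Finset.sum_add_distrib]
    ring

end LinearReductiveGroup

namespace CartanSubalgebra

variable {n : ℕ} {𝒢 : LinearReductiveGroup n} {C : CartanSubalgebra 𝒢}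

/-- Transposition on the Cartan subalgebra. -/
def tr𝔥 (X : C.𝔥) : C.𝔥 := ⟨-𝒢.θ X, neg_mem (C.θ_mem X X.2)⟩

theorem coe_tr𝔥 (X : C.𝔥) : ((tr𝔥 X : 𝒢.𝔤) : Matrix (Fin n) (Fin n) ℝ) =
    ((X : 𝒢.𝔤) : Matrix (Fin n) (Fin n) ℝ)ᵀ := by
  simp [tr𝔥]

theorem toℂ_tr𝔥 (X : C.𝔥) : (𝒢.toℂ (tr𝔥 X) : Matrix (Fin n) (Fin n) ℂ) =
    (𝒢.toℂ X : Matrix (Fin n) (Fin n) ℂ)ᴴ := by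
  rw [coe_toℂ, coe_toℂ, conjTranspose_map_ofReal, coe_tr𝔥]

theorem star_weight {α : C.𝔥 →ₗ[ℝ] ℂ} {Z : 𝒢.𝔤ℂ} (hZ : Z ∈ 𝒢.weightSpace ⊤ C.𝔥 α) (h0 : Z ≠ 0)
    (X : C.𝔥) : star (α (tr𝔥 X)) = α X := by
  refine star_eq_of_comm (fun h => h0 (Subtype.ext h)) ?_ (hZ.2.2 X)
  rw [← toℂ_tr𝔥]
  exact hZ.2.2 _

/-- Root spaces of the Cartan subalgebra for different roots are orthogonal. -/
theorem trace_rootSpace {α α' : C.𝔥 →ₗ[ℝ] ℂ} (hne : α ≠ α') {Z Z' : 𝒢.𝔤ℂ}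
    (hZ : Z ∈ 𝒢.weightSpace ⊤ C.𝔥 α) (hZ' : Z' ∈ 𝒢.weightSpace ⊤ C.𝔥 α') :
    ((Z : Matrix (Fin n) (Fin n) ℂ)ᴴ * (Z' : Matrix (Fin n) (Fin n) ℂ)).trace = 0 := by
  by_cases h0 : Z = 0
  · subst h0; simp
  obtain ⟨X, hX⟩ : ∃ X, α X ≠ α' X := by
    by_contra! h
    exact hne (LinearMap.ext h)
  refine trace_eq_zero_of_comm (d := α (tr𝔥 X)) ?_ (hZ'.2.2 X) (by rwa [star_weight hZ h0])
  rw [← toℂ_tr𝔥]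
  exact hZ.2.2 _

/-- Nonzero pairwise orthogonal matrices are linearly independent. -/
theorem linearIndependent_of_trace {ι : Type*} (e : ι → 𝒢.𝔤ℂ) (h0 : ∀ i, e i ≠ 0)
    (h : ∀ i j, i ≠ j →
      ((e i : Matrix (Fin n) (Fin n) ℂ)ᴴ * (e j : Matrix (Fin n) (Fin n) ℂ)).trace = 0) :
    LinearIndependent ℂ e := by
  have h1 : LinearIndependent ℂ fun i => vec ℂ n (e i) := by
    refine linearIndependent_of_ne_zero_of_inner_eq_zero (fun i hi => h0 i ?_) fun i j hij => ?_
    · exact Subtype.ext (vec_injective ℂ n (by simpa using hi))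
    · change inner ℂ _ _ = 0
      rw [inner_vec, h i j hij]
  exact LinearIndependent.of_comp (vec ℂ n ∘ₗ 𝒢.𝔤ℂ.subtype) h1

theorem finite_rootsG : C.rootsG.Finite := by
  have h : ∀ α : C.rootsG, ∃ Z : 𝒢.𝔤ℂ, Z ∈ 𝒢.weightSpace ⊤ C.𝔥 α ∧ Z ≠ 0 := fun α =>
    Submodule.exists_mem_ne_zero_of_ne_bot α.2.2
  choose e he h0 using h
  have := (linearIndependent_of_trace e h0 fun i j hij =>
    trace_rootSpace (fun h => hij (Subtype.ext h)) (he i) (he j)).finite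
  exact Set.toFinite _

/-- The root spaces of the Cartan subalgebra are lines. -/
theorem exists_smul_of_mem_rootSpace {α : C.𝔥 →ₗ[ℝ] ℂ} (hα : α ≠ 0) {e Z : 𝒢.𝔤ℂ}
    (he : e ∈ 𝒢.weightSpace ⊤ C.𝔥 α) (he0 : e ≠ 0) (hZ : Z ∈ 𝒢.weightSpace ⊤ C.𝔥 α) :
    ∃ c : ℂ, Z = c • e := by
  have hen : ((e : Matrix (Fin n) (Fin n) ℂ)ᴴ * (e : Matrix (Fin n) (Fin n) ℂ)).trace ≠ 0 :=
    fun h => he0 (Subtype.ext (eq_zero_of_trace_conjTranspose_mul_self h))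
  refine ⟨((e : Matrix (Fin n) (Fin n) ℂ)ᴴ * (e : Matrix (Fin n) (Fin n) ℂ)).trace⁻¹ *
    ((e : Matrix (Fin n) (Fin n) ℂ)ᴴ * (Z : Matrix (Fin n) (Fin n) ℂ)).trace, ?_⟩
  set c := ((e : Matrix (Fin n) (Fin n) ℂ)ᴴ * (e : Matrix (Fin n) (Fin n) ℂ)).trace⁻¹ *
    ((e : Matrix (Fin n) (Fin n) ℂ)ᴴ * (Z : Matrix (Fin n) (Fin n) ℂ)).trace with hc
  have hW : Z - c • e ∈ 𝒢.weightSpace ⊤ C.𝔥 α := sub_mem hZ (Submodule.smul_mem _ _ he)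
  have hperp : ((e : Matrix (Fin n) (Fin n) ℂ)ᴴ *
      ((Z - c • e : 𝒢.𝔤ℂ) : Matrix (Fin n) (Fin n) ℂ)).trace = 0 := by
    rw [Submodule.coe_sub, Submodule.coe_smul, mul_sub, Matrix.mul_smul, Matrix.trace_sub,
      Matrix.trace_smul, smul_eq_mul, hc]
    field_simp
    ring
  rw [← sub_eq_zero]
  generalize Z - c • e = W at hW hperp
  -- the adjoint of a root vector is a root vector for the opposite root
  have hst : ∀ X : C.𝔥, (𝒢.toℂ X : Matrix (Fin n) (Fin n) ℂ) * (e : Matrix (Fin n) (Fin n) ℂ)ᴴ -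
      (e : Matrix (Fin n) (Fin n) ℂ)ᴴ * (𝒢.toℂ X : Matrix (Fin n) (Fin n) ℂ) =
        -(α X • (e : Matrix (Fin n) (Fin n) ℂ)ᴴ) := by
    intro X
    have h1 := congrArg Matrix.conjTranspose (he.2.2 (tr𝔥 X))
    rw [toℂ_tr𝔥, Matrix.conjTranspose_sub, Matrix.conjTranspose_mul, Matrix.conjTranspose_mul,
      Matrix.conjTranspose_conjTranspose, Matrix.conjTranspose_smul, star_weight he he0] at h1
    rw [← h1, neg_sub]
  -- matrices of `𝔤ℂ` that commute with `𝔥` lie in the complexification of `𝔥`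
  have hpart : ∀ w : 𝒢.𝔤ℂ, (∀ X : C.𝔥, (𝒢.toℂ X : Matrix (Fin n) (Fin n) ℂ) *
      (w : Matrix (Fin n) (Fin n) ℂ) - (w : Matrix (Fin n) (Fin n) ℂ) *
        (𝒢.toℂ X : Matrix (Fin n) (Fin n) ℂ) = 0) → ∃ A B : C.𝔥, (w : Matrix (Fin n) (Fin n) ℂ) =
      (𝒢.toℂ A : Matrix (Fin n) (Fin n) ℂ) +
        Complex.I • (𝒢.toℂ B : Matrix (Fin n) (Fin n) ℂ) := by
    intro w hw
    refine ⟨⟨𝒢.rePart w, (C.mem_iff _).2 fun X hX => ?_⟩,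
      ⟨𝒢.imPart w, (C.mem_iff _).2 fun X hX => ?_⟩, ?_⟩
    · have h1 := map_re_bracket (X : Matrix (Fin n) (Fin n) ℝ) (w : Matrix (Fin n) (Fin n) ℂ)
      have h2 := hw ⟨X, hX⟩
      rw [coe_toℂ] at h2
      rw [h2, Matrix.map_zero _ Complex.zero_re] at h1
      exact (sub_eq_zero.1 h1.symm).symm
    · have h1 := map_im_bracket (X : Matrix (Fin n) (Fin n) ℝ) (w : Matrix (Fin n) (Fin n) ℂ)
      have h2 := hw ⟨X, hX⟩
      rw [coe_toℂ] at h2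
      rw [h2, Matrix.map_zero _ Complex.zero_im] at h1
      exact (sub_eq_zero.1 h1.symm).symm
    · ext i j
      apply Complex.ext <;> simp
  have hjac : ∀ x a b : Matrix (Fin n) (Fin n) ℂ, x * (a * b - b * a) - (a * b - b * a) * x =
      ((x * a - a * x) * b - b * (x * a - a * x)) +
        (a * (x * b - b * x) - (x * b - b * x) * a) := by
    intro x a b; noncomm_ring
  -- `[e*, W] = 0`, since it lies in `𝔥ℂ` and is orthogonal to `𝔥ℂ`
  have hcomm : (e : Matrix (Fin n) (Fin n) ℂ)ᴴ * (W : Matrix (Fin n) (Fin n) ℂ) =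
      (W : Matrix (Fin n) (Fin n) ℂ) * (e : Matrix (Fin n) (Fin n) ℂ)ᴴ := by
    rw [← sub_eq_zero]
    have hmem := bracket_mem_𝔤ℂ (conjTranspose_mem_𝔤ℂ e.2) W.2
    obtain ⟨A, B, hAB⟩ := hpart ⟨_, hmem⟩ fun X => by
      change _ * (_ - _) - (_ - _) * _ = _
      rw [hjac, hst X, hW.2.2 X]
      simp
    change _ * _ - _ * _ = _ at hAB
    have horth : ∀ X : C.𝔥, ((𝒢.toℂ X : Matrix (Fin n) (Fin n) ℂ) *
        ((e : Matrix (Fin n) (Fin n) ℂ)ᴴ * (W : Matrix (Fin n) (Fin n) ℂ) -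
          (W : Matrix (Fin n) (Fin n) ℂ) * (e : Matrix (Fin n) (Fin n) ℂ)ᴴ)).trace = 0 := by
      intro X
      have h1 := hst X
      have h2 : ∀ x a b : Matrix (Fin n) (Fin n) ℂ, (x * (a * b - b * a)).trace =
          ((x * a - a * x) * b).trace := by
        intro x a b
        rw [mul_sub, sub_mul, Matrix.trace_sub, Matrix.trace_sub, ← mul_assoc, ← mul_assoc,
          Matrix.trace_mul_comm (x * b) a, ← mul_assoc]
      rw [h2, h1, neg_mul, Matrix.smul_mul, Matrix.trace_neg, Matrix.trace_smul, hperp, smul_zero,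
        neg_zero]
    apply eq_zero_of_trace_conjTranspose_mul_self
    conv_lhs => rw [hAB]
    rw [Matrix.conjTranspose_add, Matrix.conjTranspose_smul, ← toℂ_tr𝔥, ← toℂ_tr𝔥, ← hAB, add_mul,
      Matrix.trace_add, horth, Matrix.smul_mul, Matrix.trace_smul, horth, smul_zero, add_zero]
  have hmem := bracket_mem_𝔤ℂ e.2 (conjTranspose_mem_𝔤ℂ e.2)
  obtain ⟨A, B, hAB⟩ := hpart ⟨_, hmem⟩ fun X => by
    change _ * (_ - _) - (_ - _) * _ = _
    rw [hjac, hst X, he.2.2 X]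
    simp
  change _ * _ - _ * _ = _ at hAB
  have hact : ∀ V ∈ 𝒢.weightSpace ⊤ C.𝔥 α,
      ((e : Matrix (Fin n) (Fin n) ℂ) * (e : Matrix (Fin n) (Fin n) ℂ)ᴴ -
        (e : Matrix (Fin n) (Fin n) ℂ)ᴴ * (e : Matrix (Fin n) (Fin n) ℂ)) * V -
      V * ((e : Matrix (Fin n) (Fin n) ℂ) * (e : Matrix (Fin n) (Fin n) ℂ)ᴴ -
        (e : Matrix (Fin n) (Fin n) ℂ)ᴴ * (e : Matrix (Fin n) (Fin n) ℂ)) =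
      (α A + Complex.I * α B) • (V : Matrix (Fin n) (Fin n) ℂ) := by
    intro V hV
    rw [hAB, add_mul, mul_add, Matrix.smul_mul, Matrix.mul_smul, add_sub_add_comm, ← smul_sub,
      hV.2.2 A, hV.2.2 B, add_smul, mul_smul]
  refine Subtype.ext (eq_zero_of_commute_conjTranspose rfl ?_ (hact e he) (hact W hW) hcomm)
  obtain ⟨X, hX⟩ : ∃ X, α X ≠ 0 := by
    by_contra! h
    exact hα (LinearMap.ext h)
  intro h0
  have h1 := congrArg Matrix.trace (congrArg ((𝒢.toℂ X : Matrix (Fin n) (Fin n) ℂ) * ·) h0)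
  have h2 : ∀ x a b : Matrix (Fin n) (Fin n) ℂ, (x * (a * b - b * a)).trace =
      ((x * a - a * x) * b).trace := by
    intro x a b
    rw [mul_sub, sub_mul, Matrix.trace_sub, Matrix.trace_sub, ← mul_assoc, ← mul_assoc,
      Matrix.trace_mul_comm (x * b) a, ← mul_assoc]
  simp only [mul_zero, Matrix.trace_zero] at h1
  rw [h2, he.2.2 X, Matrix.smul_mul, Matrix.trace_smul, Matrix.trace_mul_comm] at h1
  exact (mul_ne_zero hX hen) h1

end CartanSubalgebra

namespace CartanSubalgebra

variable {n : ℕ} {𝒢 : LinearReductiveGroup n} {C : CartanSubalgebra 𝒢}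

/-- The projection of the Cartan subalgebra onto its compact part. -/
def proj𝔱M (C : CartanSubalgebra 𝒢) : C.𝔥 →ₗ[ℝ] C.𝔱M where
  toFun X := ⟨(1 / 2 : ℝ) • (X + 𝒢.θ X), C.𝔥.smul_mem _ (add_mem X.2 (C.θ_mem X X.2)), by
    refine mem_𝔨_iff.2 ?_; simp⟩
  map_add' X Y := by
    ext1
    simp only [Submodule.coe_add, map_add, ← smul_add]
    congr 1
    abel
  map_smul' c X := by
    ext1
    simp only [Submodule.coe_smul, map_smul, ← smul_add, RingHom.id_apply]
    rw [smul_comm]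

theorem proj𝔱M_inclusion (Y : C.𝔱M) : C.proj𝔱M (Submodule.inclusion inf_le_left Y) = Y := by
  ext1; ext1
  change (1 / 2 : ℝ) • (((Y : 𝒢.𝔤) : Matrix (Fin n) (Fin n) ℝ) +
    -((Y : 𝒢.𝔤) : Matrix (Fin n) (Fin n) ℝ)ᵀ) = _
  rw [transpose_𝔱M Y.2, neg_neg, ← two_smul ℝ, smul_smul]
  norm_num

theorem proj𝔱M_𝔞 (W : C.𝔞) : C.proj𝔱M (Submodule.inclusion inf_le_left W) = 0 := by
  ext1; ext1
  change (1 / 2 : ℝ) • (((W : 𝒢.𝔤) : Matrix (Fin n) (Fin n) ℝ) +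
    -((W : 𝒢.𝔤) : Matrix (Fin n) (Fin n) ℝ)ᵀ) = 0
  rw [transpose_𝔞 W.2, add_neg_cancel, smul_zero]

theorem eq_inclusion_add (X : C.𝔥) : ∃ (Y : C.𝔱M) (W : C.𝔞),
    X = Submodule.inclusion inf_le_left Y + Submodule.inclusion inf_le_left W := by
  obtain ⟨Y, hY, W, hW, h⟩ := C.exists_𝔱M_𝔞 X.2
  exact ⟨⟨Y, hY⟩, ⟨W, hW⟩, Subtype.ext h⟩

theorem functional_ext {α α' : C.𝔥 →ₗ[ℝ] ℂ} (hT : C.resT α = C.resT α')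
    (hA : C.resA α = C.resA α') : α = α' := by
  refine LinearMap.ext fun X => ?_
  obtain ⟨Y, W, rfl⟩ := eq_inclusion_add X
  rw [map_add, map_add]
  exact congrArg₂ _ (LinearMap.congr_fun hT Y) (LinearMap.congr_fun hA W)

theorem resT_comp_proj (γ : C.𝔱M →ₗ[ℝ] ℂ) : C.resT (γ ∘ₗ C.proj𝔱M) = γ :=
  LinearMap.ext fun Y => congrArg γ (proj𝔱M_inclusion Y)

theorem resA_comp_proj (γ : C.𝔱M →ₗ[ℝ] ℂ) : C.resA (γ ∘ₗ C.proj𝔱M) = 0 :=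
  LinearMap.ext fun W => (congrArg γ (proj𝔱M_𝔞 W)).trans (map_zero γ)

theorem weightSpace_𝔪_le (γ : C.𝔱M →ₗ[ℝ] ℂ) :
    𝒢.weightSpace C.𝔪 C.𝔱M γ ≤ 𝒢.weightSpace ⊤ C.𝔥 (γ ∘ₗ C.proj𝔱M) := by
  refine fun Z hZ => ⟨trivial, trivial, fun X => ?_⟩
  obtain ⟨Y, W, rfl⟩ := eq_inclusion_add X
  have h1 := hZ.2.2 Y
  have h2 := weightSpace_𝔪_comm hZ W.2
  rw [LinearMap.comp_apply, map_add, proj𝔱M_inclusion, proj𝔱M_𝔞, add_zero, ← h1,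
    Submodule.coe_add, map_add, Submodule.coe_add, add_mul, mul_add, add_sub_add_comm]
  exact add_eq_left.2 h2

theorem comp_proj_mem_rootsG {γ : C.𝔱M →ₗ[ℝ] ℂ} (h : γ ∈ C.rootsM) :
    γ ∘ₗ C.proj𝔱M ∈ C.rootsG := by
  refine ⟨fun h0 => h.1 ?_, fun h0 => h.2 (le_bot_iff.1 (h0 ▸ weightSpace_𝔪_le γ))⟩
  rw [← resT_comp_proj γ, h0]
  rfl

theorem finite_rootsM : C.rootsM.Finite := by
  refine Set.Finite.of_injOn (f := fun γ => γ ∘ₗ C.proj𝔱M) (fun γ h => comp_proj_mem_rootsG h)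
    (fun γ _ γ' _ h => ?_) (finite_rootsG (C := C))
  rw [← resT_comp_proj γ, ← resT_comp_proj γ']
  exact congrArg C.resT h

theorem exists_basis_𝔪plus {P : Set (C.𝔱M →ₗ[ℝ] ℂ)} (hP : P ⊆ C.rootsM) :
    ∃ e : Module.Basis P ℂ (C.𝔪plus P), ∀ γ : P, (e γ : 𝒢.𝔤ℂ) ∈ 𝒢.weightSpace C.𝔪 C.𝔱M γ := by
  have h : ∀ γ : P, ∃ Z : 𝒢.𝔤ℂ, Z ∈ 𝒢.weightSpace C.𝔪 C.𝔱M γ ∧ Z ≠ 0 := fun γ =>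
    Submodule.exists_mem_ne_zero_of_ne_bot (hP γ.2).2
  choose e he h0 using h
  have hmem : ∀ γ : P, e γ ∈ C.𝔪plus P := fun γ =>
    Submodule.mem_iSup_of_mem γ.1 (Submodule.mem_iSup_of_mem γ.2 (he γ))
  have hli := linearIndependent_of_trace e h0 fun i j hij =>
    trace_weightSpace (fun h => hij (Subtype.ext h)) (he i) (he j)
  have hli' : LinearIndependent ℂ fun γ => (⟨e γ, hmem γ⟩ : C.𝔪plus P) :=
    LinearIndependent.of_comp (C.𝔪plus P).subtype hli
  have hspan : C.𝔪plus P ≤ Submodule.span ℂ (Set.range e) := by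
    refine iSup₂_le fun γ hγ Z hZ => ?_
    obtain ⟨c, hc⟩ := exists_smul_of_mem_rootSpace (comp_proj_mem_rootsG (hP hγ)).1
      (weightSpace_𝔪_le γ (he ⟨γ, hγ⟩)) (h0 _) (weightSpace_𝔪_le γ hZ)
    rw [hc]
    exact Submodule.smul_mem _ _ (Submodule.subset_span ⟨_, rfl⟩)
  refine ⟨Module.Basis.mk hli' fun Z _ => ?_, fun γ => ?_⟩
  · have h1 : (Z : 𝒢.𝔤ℂ) ∈ (Submodule.span ℂ (Set.range fun γ =>
        (⟨e γ, hmem γ⟩ : C.𝔪plus P))).map (C.𝔪plus P).subtype := by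
      rw [Submodule.map_span, ← Set.range_comp]
      exact hspan Z.2
    obtain ⟨W, hW, e⟩ := h1
    rwa [← Subtype.ext e]
  · rw [Module.Basis.mk_apply]
    exact he γ

/-- The complex conjugate of a functional. -/
def conjFunctional (α : C.𝔥 →ₗ[ℝ] ℂ) : C.𝔥 →ₗ[ℝ] ℂ := Complex.conjAe.toLinearMap ∘ₗ α

theorem conjFunctional_apply (α : C.𝔥 →ₗ[ℝ] ℂ) (X : C.𝔥) :
    conjFunctional α X = starRingEnd ℂ (α X) := rfl

theorem conjFunctional_conjFunctional (α : C.𝔥 →ₗ[ℝ] ℂ) :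
    conjFunctional (conjFunctional α) = α := by
  ext X; simp [conjFunctional_apply]

theorem conjFunctional_mem_rootsG {α : C.𝔥 →ₗ[ℝ] ℂ} (h : α ∈ C.rootsG) :
    conjFunctional α ∈ C.rootsG := by
  refine ⟨fun h0 => h.1 ?_, ?_⟩
  · rw [← conjFunctional_conjFunctional α, h0]
    ext X; simp [conjFunctional_apply]
  · obtain ⟨Z, hZ, h0⟩ := Submodule.exists_mem_ne_zero_of_ne_bot h.2
    refine (Submodule.ne_bot_iff _).2 ⟨conj Z, conj_mem_weightSpace hZ fun _ => rfl, fun h => h0 ?_⟩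
    apply eq_of_parts
    · rw [← rePart_conj, h]
    · have h1 := imPart_conj Z
      rw [h, map_zero] at h1
      rw [map_zero]
      exact neg_eq_zero.1 h1.symm

theorem resT_conjFunctional {α : C.𝔥 →ₗ[ℝ] ℂ} (h : α ∈ C.rootsG) :
    C.resT (conjFunctional α) = -C.resT α := by
  obtain ⟨Z, hZ, h0⟩ := Submodule.exists_mem_ne_zero_of_ne_bot h.2
  refine LinearMap.ext fun Y => ?_
  have hY : (Y : 𝒢.𝔤) ∈ C.𝔥 := Y.2.1
  have h1 := star_weight hZ h0 ⟨Y, hY⟩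
  have h2 : tr𝔥 (⟨Y, hY⟩ : C.𝔥) = -⟨Y, hY⟩ := by
    ext1; ext1
    rw [coe_tr𝔥]
    exact transpose_𝔱M Y.2
  have h3 : star (α (-⟨Y, hY⟩)) = -star (α ⟨Y, hY⟩) :=
    (congrArg star (map_neg α (⟨Y, hY⟩ : C.𝔥))).trans (star_neg _)
  rw [h2, h3] at h1
  exact neg_eq_iff_eq_neg.1 h1

/-- Roots that do not vanish on `𝔞` come in complex conjugate pairs, which have the same sign and
opposite restrictions to `𝔱_M`. -/
theorem ρGM_eq_zero {P : Set (C.𝔱M →ₗ[ℝ] ℂ)} (hP : P ⊆ C.rootsM) (ζ : C.𝔞) : C.ρGM P ζ = 0 := by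
  -- `A` consists of the positive roots that vanish on `𝔞`, and `B` of the others
  set A : Set (C.𝔥 →ₗ[ℝ] ℂ) := {α | α ∈ C.rootsG ∧ C.resA α = 0 ∧ C.resT α ∈ P} with hA
  set B : Set (C.𝔥 →ₗ[ℝ] ℂ) := {α | α ∈ C.rootsG ∧ (C.resA α ≠ 0 ∧
    ∃ β ∈ C.posRestrictedRoots ζ, ∀ Y, C.resA α Y = (β Y : ℂ))} with hB
  have hAf : A.Finite := (finite_rootsG (C := C)).subset fun _ h => h.1
  have hBf : B.Finite := (finite_rootsG (C := C)).subset fun _ h => h.1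
  have hAB : C.posRootsG P ζ = A ∪ B := by
    ext α
    simp only [posRootsG, hA, hB, Set.mem_union, Set.mem_ofPred_eq, ← and_or_left]
  have hdisj : Disjoint A B := Set.disjoint_left.2 fun α h1 h2 => h2.2.1 h1.2.1
  let r : (C.𝔥 →ₗ[ℝ] ℂ) →+ (C.𝔱M →ₗ[ℝ] ℂ) :=
    { toFun := C.resT, map_zero' := rfl, map_add' := fun _ _ => rfl }
  have h1 : C.resT (∑ᶠ α ∈ A ∪ B, α) = ∑ᶠ α ∈ A, C.resT α + ∑ᶠ α ∈ B, C.resT α := by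
    rw [← finsum_mem_union hdisj hAf hBf]
    exact r.map_finsum_mem _ (hAf.union hBf)
  -- the roots in `A` contribute `2ρ^M`
  have h2 : ∑ᶠ α ∈ A, C.resT α = ∑ᶠ γ ∈ P, γ := by
    refine finsum_mem_eq_of_bijOn C.resT ⟨fun α h => h.2.2, fun α h α' h' e => ?_, fun γ hγ => ?_⟩
      fun α _ => rfl
    · exact functional_ext e (h.2.1.trans h'.2.1.symm)
    · exact ⟨γ ∘ₗ C.proj𝔱M, ⟨comp_proj_mem_rootsG (hP hγ), resA_comp_proj γ,
        by rwa [resT_comp_proj]⟩, resT_comp_proj γ⟩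
  -- conjugation permutes `B` and changes the sign of the restriction to `𝔱_M`
  have h3 : ∑ᶠ α ∈ B, C.resT α = 0 := by
    have hmaps : Set.MapsTo conjFunctional B B := by
      rintro α ⟨h1, h2, β, hβ, h3⟩
      have e : C.resA (conjFunctional α) = C.resA α := by
        refine LinearMap.ext fun W => ?_
        have := h3 W
        change starRingEnd ℂ (C.resA α W) = C.resA α W
        rw [this, Complex.conj_ofReal]
      exact ⟨conjFunctional_mem_rootsG h1, by rwa [e], β, hβ, by rwa [e]⟩
    have h4 : ∑ᶠ α ∈ B, -C.resT α = ∑ᶠ α ∈ B, C.resT α := by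
      refine finsum_mem_eq_of_bijOn conjFunctional ⟨hmaps, fun α _ α' _ e => ?_, fun α h => ?_⟩
        fun α h => (resT_conjFunctional h.1).symm
      · rw [← conjFunctional_conjFunctional α, e, conjFunctional_conjFunctional]
      · exact ⟨_, hmaps h, conjFunctional_conjFunctional α⟩
    rw [finsum_mem_neg_distrib _ hBf] at h4
    refine LinearMap.ext fun Y => ?_
    have h5 := LinearMap.congr_fun h4 Y
    rw [LinearMap.neg_apply] at h5
    rw [LinearMap.zero_apply]
    linear_combination (-1 / 2 : ℂ) * h5
  have h4 : C.resT (C.ρG P ζ) = (1 / 2 : ℂ) • C.resT (∑ᶠ α ∈ A ∪ B, α) := by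
    rw [ρG, hAB]; rfl
  rw [ρGM, h4, h1, h2, h3, add_zero, ρM, sub_self]

theorem ρM_apply {P : Set (C.𝔱M →ₗ[ℝ] ℂ)} [Fintype P] (Y : C.𝔱M) :
    C.ρM P Y = (1 / 2 : ℂ) * ∑ γ : P, (γ : C.𝔱M →ₗ[ℝ] ℂ) Y := by
  rw [ρM, finsum_mem_eq_finite_toFinset_sum _ (Set.toFinite P), LinearMap.smul_apply,
    LinearMap.sum_apply, smul_eq_mul, ← Finset.sum_coe_sort]
  congr 1
  refine Fintype.sum_equiv (Equiv.subtypeEquivRight fun γ => by simp) _ _ fun γ => rfl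

end CartanSubalgebra

/-! ### Complex structures on real vector spaces -/

section ComplexStructure

variable {V : Type*} [AddCommGroup V] [Module ℝ V] {J : V →ₗ[ℝ] V}

/-- The projection of the complexification onto the `i`-eigenspace of a complex structure `J`. -/
def proj10 (J : V →ₗ[ℝ] V) : ℂ ⊗[ℝ] V →ₗ[ℂ] ℂ ⊗[ℝ] V :=
  (1 / 2 : ℂ) • (LinearMap.id - Complex.I • J.baseChange ℂ)

theorem baseChange_baseChange (hJ : ∀ v, J (J v) = -v) (x : ℂ ⊗[ℝ] V) :
    J.baseChange ℂ (J.baseChange ℂ x) = -x := by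
  induction x with
  | zero => simp
  | tmul a b => simp [hJ, TensorProduct.tmul_neg]
  | add a b ha hb => rw [map_add, map_add, ha, hb, neg_add]

theorem isProj_proj10 (hJ : ∀ v, J (J v) = -v) :
    LinearMap.IsProj (Module.End.eigenspace (J.baseChange ℂ) Complex.I) (proj10 J) where
  map_mem x := by
    rw [Module.End.mem_eigenspace_iff]
    simp only [proj10, LinearMap.smul_apply, LinearMap.sub_apply, LinearMap.id_apply, map_smul,
      map_sub, baseChange_baseChange hJ]
    rw [smul_comm]
    congr 1
    rw [smul_sub, smul_smul, Complex.I_mul_I, smul_neg, neg_one_smul]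
    abel
  map_id x hx := by
    rw [Module.End.mem_eigenspace_iff] at hx
    simp only [proj10, LinearMap.smul_apply, LinearMap.sub_apply, LinearMap.id_apply, hx, smul_smul,
      Complex.I_mul_I, neg_one_smul, sub_neg_eq_add]
    rw [← two_smul ℂ, smul_smul]
    norm_num

theorem baseChange_mem_eigenspace {f : V →ₗ[ℝ] V} (hf : ∀ v, f (J v) = J (f v)) {x : ℂ ⊗[ℝ] V}
    (hx : x ∈ Module.End.eigenspace (J.baseChange ℂ) Complex.I) :
    f.baseChange ℂ x ∈ Module.End.eigenspace (J.baseChange ℂ) Complex.I := by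
  rw [Module.End.mem_eigenspace_iff] at hx ⊢
  have h : f ∘ₗ J = J ∘ₗ f := LinearMap.ext hf
  rw [← LinearMap.comp_apply, ← LinearMap.baseChange_comp, ← h, LinearMap.baseChange_comp,
    LinearMap.comp_apply, hx, map_smul]

variable [FiniteDimensional ℝ V]

theorem two_mul_finrank_eigenspace (hJ : ∀ v, J (J v) = -v) :
    2 * Module.finrank ℂ (Module.End.eigenspace (J.baseChange ℂ) Complex.I) =
      Module.finrank ℝ V := by
  have h := (isProj_proj10 hJ).trace
  rw [proj10, map_smul, map_sub, map_smul, LinearMap.trace_id, LinearMap.trace_baseChange,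
    Module.finrank_baseChange] at h
  have h1 := congrArg Complex.re h
  simp at h1
  have h2 : ((2 * Module.finrank ℂ (Module.End.eigenspace (J.baseChange ℂ) Complex.I) : ℕ) : ℝ) =
      (Module.finrank ℝ V : ℝ) := by
    push_cast
    linarith
  exact_mod_cast h2

theorem trace_restrict_eigenspace (hJ : ∀ v, J (J v) = -v) {f : V →ₗ[ℝ] V}
    (hf : ∀ v, f (J v) = J (f v)) :
    LinearMap.trace ℂ _ ((f.baseChange ℂ).restrict fun _ => baseChange_mem_eigenspace hf) =
      (1 / 2 : ℂ) * (LinearMap.trace ℝ V f - Complex.I * LinearMap.trace ℝ V (f ∘ₗ J)) := by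
  have hP := isProj_proj10 hJ
  have h1 : ∀ x, (f.baseChange ℂ ∘ₗ proj10 J) x ∈
      Module.End.eigenspace (J.baseChange ℂ) Complex.I := fun x =>
    baseChange_mem_eigenspace hf (hP.map_mem x)
  have h2 := LinearMap.trace_restrict_eq_of_forall_mem _ _ h1
  have h3 : (f.baseChange ℂ ∘ₗ proj10 J).restrict (fun x _ => h1 x) =
      (f.baseChange ℂ).restrict fun _ => baseChange_mem_eigenspace hf := by
    refine LinearMap.ext fun x => Subtype.ext ?_
    change f.baseChange ℂ (proj10 J x) = f.baseChange ℂ x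
    rw [hP.map_id x x.2]
  rw [h3] at h2
  rw [h2, proj10, LinearMap.comp_smul, LinearMap.comp_sub, LinearMap.comp_id, LinearMap.comp_smul,
    ← LinearMap.baseChange_comp, map_smul, map_sub, map_smul, LinearMap.trace_baseChange,
    LinearMap.trace_baseChange]
  rfl

end ComplexStructure

section TopPower

variable {W : Type*} [AddCommGroup W] [Module ℂ W] [FiniteDimensional ℂ W] {d : ℕ}

/-- On the top exterior power, a linear map acts by its determinant. -/
theorem exteriorPower_map_eq_det (hd : Module.finrank ℂ W = d) (f : W →ₗ[ℂ] W) :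
    exteriorPower.map d f = LinearMap.det f • LinearMap.id := by
  let b := Module.finBasisOfFinrankEq ℂ W hd
  refine exteriorPower.linearMap_ext (AlternatingMap.ext fun v => ?_)
  rw [LinearMap.compAlternatingMap_apply, LinearMap.compAlternatingMap_apply,
    exteriorPower.map_apply_ιMulti, LinearMap.smul_apply, LinearMap.id_apply, ← sub_eq_zero,
    ← Module.forall_dual_apply_eq_zero_iff ℂ]
  intro φ
  have h := (φ.compAlternatingMap (exteriorPower.ιMulti ℂ d (M := W))).eq_smul_basis_det b
  have h1 := DFunLike.congr_fun h (f ∘ v)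
  have h2 := DFunLike.congr_fun h v
  rw [AlternatingMap.smul_apply, LinearMap.compAlternatingMap_apply] at h1 h2
  rw [map_sub, map_smul, h1, h2, Module.Basis.det_comp, smul_eq_mul, smul_eq_mul, smul_eq_mul]
  ring

theorem finrank_range_exteriorPower {E : Type*} [AddCommGroup E] [Module ℂ E]
    (S : Submodule ℂ E) [FiniteDimensional ℂ S] (hd : Module.finrank ℂ S = d) :
    Module.finrank ℂ (LinearMap.range (exteriorPower.map d S.subtype)) = 1 := by
  rw [LinearMap.finrank_range_of_inj (exteriorPower.map_injective_field S.injective_subtype),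
    exteriorPower.finrank_eq, hd, Nat.choose_self]

theorem exists_generator_of_finrank_eq_one {E : Type*} [AddCommGroup E] [Module ℂ E]
    (F : Submodule ℂ E) (hF : Module.finrank ℂ F = 1) :
    ∃ (e : E) (ℓ : E →ₗ[ℂ] ℂ), e ∈ F ∧ ℓ e = 1 ∧ ∀ u ∈ F, u = ℓ u • e := by
  obtain ⟨⟨e, heF⟩, he0, he⟩ := finrank_eq_one_iff'.1 hF
  have he0' : e ≠ 0 := fun h => he0 (Subtype.ext h)
  obtain ⟨φ, hφ⟩ : ∃ φ : Module.Dual ℂ E, φ e ≠ 0 := by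
    by_contra! h
    exact he0' ((Module.forall_dual_apply_eq_zero_iff ℂ _).1 h)
  have h1 : ((φ e)⁻¹ • φ) e = 1 := by
    rw [LinearMap.smul_apply, smul_eq_mul, inv_mul_cancel₀ hφ]
  refine ⟨e, (φ e)⁻¹ • φ, heF, h1, fun u hu => ?_⟩
  obtain ⟨c, hc⟩ := he ⟨u, hu⟩
  have hc' : c • e = u := congrArg Subtype.val hc
  rw [← hc', map_smul, h1, smul_eq_mul, mul_one]

theorem exteriorPower_map_mem_range {E : Type*} [AddCommGroup E] [Module ℂ E]
    {S S' : Submodule ℂ E} {A : E →ₗ[ℂ] E} (hA : ∀ x ∈ S, A x ∈ S') {x : ⋀[ℂ]^d E}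
    (hx : x ∈ LinearMap.range (exteriorPower.map d S.subtype)) :
    exteriorPower.map d A x ∈ LinearMap.range (exteriorPower.map d S'.subtype) := by
  obtain ⟨y, rfl⟩ := hx
  refine ⟨exteriorPower.map d (A.restrict hA) y, ?_⟩
  rw [← LinearMap.comp_apply, ← LinearMap.comp_apply, ← exteriorPower.map_comp,
    ← exteriorPower.map_comp]
  rfl

theorem exteriorPower_map_apply_range {E : Type*} [AddCommGroup E] [Module ℂ E]
    {S : Submodule ℂ E} [FiniteDimensional ℂ S] (hd : Module.finrank ℂ S = d) {A : E →ₗ[ℂ] E}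
    (hA : ∀ x ∈ S, A x ∈ S) {x : ⋀[ℂ]^d E}
    (hx : x ∈ LinearMap.range (exteriorPower.map d S.subtype)) :
    exteriorPower.map d A x = LinearMap.det (A.restrict hA) • x := by
  obtain ⟨y, rfl⟩ := hx
  rw [← map_smul]
  have h := LinearMap.congr_fun (exteriorPower_map_eq_det hd (A.restrict hA)) y
  rw [LinearMap.smul_apply, LinearMap.id_apply] at h
  rw [← h, ← LinearMap.comp_apply, ← LinearMap.comp_apply, ← exteriorPower.map_comp,
    ← exteriorPower.map_comp]
  rfl

end TopPower

namespace LinearReductiveGroup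

variable {n : ℕ} {𝒢 : LinearReductiveGroup n}

/-- The adjoint representation of `𝔤`. -/
def ad (X : 𝒢.𝔤) : 𝒢.𝔤 →ₗ[ℝ] 𝒢.𝔤 where
  toFun Y := ⟨(X : Matrix (Fin n) (Fin n) ℝ) * Y - Y * X, 𝒢.bracket_mem X.2 Y.2⟩
  map_add' Y Z := by ext1; simp [mul_add, add_mul]; abel
  map_smul' c Y := by ext1; simp [smul_sub]

@[simp] theorem coe_ad (X Y : 𝒢.𝔤) : (ad X Y : Matrix (Fin n) (Fin n) ℝ) =
    (X : Matrix (Fin n) (Fin n) ℝ) * Y - Y * X := rfl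

theorem θ_ad {X : 𝒢.𝔤} (hX : X ∈ 𝒢.𝔨) (Y : 𝒢.𝔤) : 𝒢.θ (ad X Y) = ad X (𝒢.θ Y) := by
  ext1
  simp only [coe_θ, coe_ad, Matrix.transpose_sub, Matrix.transpose_mul, mem_𝔨_iff.1 hX]
  simp

theorem hasDerivAt_Ad (L : 𝒢.𝔤 →ₗ[ℝ] ℂ) (X Y : 𝒢.𝔤) :
    HasDerivAt (fun s : ℝ => L (𝒢.Ad (𝒢.expG (s • X)) Y)) (L (ad X Y)) 0 := by
  let _ := Matrix.linftyOpNormedRing (n := Fin n) (α := ℝ)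
  let _ := Matrix.linftyOpNormedAlgebra (R := ℝ) (n := Fin n) (α := ℝ)
  obtain ⟨B, hB⟩ := L.exists_extend
  have h1 := hasDerivAt_exp_smul_const (𝕂 := ℝ) (X : Matrix (Fin n) (Fin n) ℝ) (0 : ℝ)
  have h2 := hasDerivAt_exp_smul_const (𝕂 := ℝ) (-X : Matrix (Fin n) (Fin n) ℝ) (0 : ℝ)
  have h3 := (h1.mul_const (Y : Matrix (Fin n) (Fin n) ℝ)).mul h2
  have h4 := (LinearMap.toContinuousLinearMap B).hasFDerivAt.comp_hasDerivAt (0 : ℝ) h3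
  have hL : ∀ Z : 𝒢.𝔤, L Z = B Z := fun Z => (LinearMap.congr_fun hB Z).symm
  have e1 : (fun s : ℝ => L (𝒢.Ad (𝒢.expG (s • X)) Y)) = LinearMap.toContinuousLinearMap B ∘
      ((fun s : ℝ => NormedSpace.exp (s • (X : Matrix (Fin n) (Fin n) ℝ)) *
        (Y : Matrix (Fin n) (Fin n) ℝ)) *
        fun s : ℝ => NormedSpace.exp (s • (-X : Matrix (Fin n) (Fin n) ℝ))) := by
    funext s
    rw [hL]
    simp only [coe_Ad, Function.comp_apply, LinearMap.coe_toContinuousLinearMap', Pi.mul_apply]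
    rw [← expG_neg, mat_expG, mat_expG]
    simp
  have e2 : L (ad X Y) = B ((X : Matrix (Fin n) (Fin n) ℝ) * Y - Y * X) := by
    rw [hL, coe_ad]
  rw [e1, e2]
  refine h4.congr_deriv ?_
  change B _ = B _
  congr 1
  simp [sub_eq_add_neg]

end LinearReductiveGroup

namespace CartanSubalgebra

variable {n : ℕ} {𝒢 : LinearReductiveGroup n} {C : CartanSubalgebra 𝒢}

instance : FiniteDimensional ℝ C.T := inferInstance

theorem expG_mem_H {X : 𝒢.𝔤} (hX : X ∈ C.𝔥) : 𝒢.expG X ∈ C.H := by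
  intro Y hY
  have hc : Commute (X : Matrix (Fin n) (Fin n) ℝ) (Y : Matrix (Fin n) (Fin n) ℝ) :=
    C.𝔥_comm hX hY
  let _ := Matrix.linftyOpNormedRing (n := Fin n) (α := ℝ)
  let _ := Matrix.linftyOpNormedAlgebra (R := ℝ) (n := Fin n) (α := ℝ)
  have h1 : Commute (NormedSpace.exp (X : Matrix (Fin n) (Fin n) ℝ))
      (Y : Matrix (Fin n) (Fin n) ℝ) := hc.exp_left
  ext1
  rw [coe_Ad, mat_expG, h1.eq, mul_assoc, ← mat_expG, mat_mul_mat_inv, mul_one]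

theorem ad_mem_𝔫 {ζ : C.𝔞} {X : 𝒢.𝔤} (hX : X ∈ C.𝔥) {Y : 𝒢.𝔤} (hY : Y ∈ C.𝔫 ζ) :
    ad X Y ∈ C.𝔫 ζ := by
  refine 𝔫_induction (p := fun Y => ad X Y ∈ C.𝔫 ζ) hY (fun β hβ Z hZ => ?_) (by simp)
    fun Z Z' h1 h2 => ?_
  · refine Submodule.mem_iSup_of_mem β (Submodule.mem_iSup_of_mem hβ fun W => ?_)
    have h1 := hZ W
    have h2 : (X : Matrix (Fin n) (Fin n) ℝ) * ((W : 𝒢.𝔤) : Matrix (Fin n) (Fin n) ℝ) =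
      ((W : 𝒢.𝔤) : Matrix (Fin n) (Fin n) ℝ) * X := C.𝔥_comm hX W.2.1
    rw [coe_ad, smul_sub, ← Matrix.mul_smul, ← Matrix.smul_mul, ← h1]
    generalize (X : Matrix (Fin n) (Fin n) ℝ) = x at *
    generalize ((W : 𝒢.𝔤) : Matrix (Fin n) (Fin n) ℝ) = w at *
    generalize (Z : Matrix (Fin n) (Fin n) ℝ) = z at *
    simp only [mul_sub, sub_mul, ← mul_assoc, h2]
    simp only [mul_assoc, h2]
    abel
  · rw [map_add]; exact add_mem h1 h2

theorem trace_ad {X : 𝒢.𝔤} (hX : X ∈ 𝒢.𝔨) : LinearMap.trace ℝ 𝒢.𝔤 (ad X) = 0 := by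
  let _ := frobeniusNormed ℝ n
  let _ := frobeniusInner ℝ n
  rw [LinearMap.trace_eq_sum_inner _ (stdOrthonormalBasis ℝ 𝒢.𝔤)]
  refine Finset.sum_eq_zero fun i _ => ?_
  generalize stdOrthonormalBasis ℝ 𝒢.𝔤 i = b
  change ((b : Matrix (Fin n) (Fin n) ℝ)ᴴ * (ad X b : Matrix (Fin n) (Fin n) ℝ)).trace = 0
  have h1 : ∀ S : Matrix (Fin n) (Fin n) ℝ, Sᵀ = S →
      ((X : Matrix (Fin n) (Fin n) ℝ) * S).trace = 0 := by
    intro S hS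
    have h := Matrix.trace_transpose ((X : Matrix (Fin n) (Fin n) ℝ) * S)
    rw [Matrix.transpose_mul, hS, mem_𝔨_iff.1 hX, mul_neg, Matrix.trace_neg,
      Matrix.trace_mul_comm] at h
    linarith
  rw [coe_ad, mul_sub, Matrix.trace_sub, Matrix.conjTranspose_eq_transpose_of_trivial,
    Matrix.trace_mul_comm, mul_assoc, h1 _ (by simp), ← mul_assoc, Matrix.trace_mul_comm,
    h1 _ (by simp), sub_zero]

/-- The trace of an endomorphism of `𝔤` that vanishes on `𝔥`, computed on `𝔤/𝔥`. -/
theorem trace_mapQ {F : 𝒢.𝔤 →ₗ[ℝ] 𝒢.𝔤} (hF : C.𝔥 ≤ LinearMap.ker F)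
    (h : C.𝔥 ≤ C.𝔥.comap F) :
    LinearMap.trace ℝ C.T (C.𝔥.mapQ C.𝔥 F h) = LinearMap.trace ℝ 𝒢.𝔤 F := by
  have h1 : C.𝔥.mapQ C.𝔥 F h = C.𝔥.mkQ ∘ₗ C.𝔥.liftQ F hF := by
    refine Submodule.linearMap_qext _ (LinearMap.ext fun X => ?_)
    simp
  rw [h1, LinearMap.trace_comp_comm', Submodule.liftQ_mkQ]

theorem ad_𝔥 {X : 𝒢.𝔤} (hX : X ∈ C.𝔥) : C.𝔥 ≤ LinearMap.ker (ad X) := by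
  intro Y hY
  rw [LinearMap.mem_ker]
  ext1
  rw [coe_ad, C.𝔥_comm hX hY, sub_self]
  rfl

/-- The action of `𝔥` on `𝔤/𝔥`. -/
def adT (C : CartanSubalgebra 𝒢) {X : 𝒢.𝔤} (hX : X ∈ C.𝔥) : C.T →ₗ[ℝ] C.T :=
  C.𝔥.mapQ C.𝔥 (ad X) fun Y hY => by
    rw [Submodule.mem_comap, LinearMap.mem_ker.1 (ad_𝔥 hX hY)]
    exact zero_mem _

theorem AdT_mk (h : C.H) (Y : 𝒢.𝔤) :
    C.AdT h (Submodule.Quotient.mk Y) = Submodule.Quotient.mk (𝒢.Ad h Y) := rfl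

theorem AdT_mul (h h' : C.H) : C.AdT (h * h') = C.AdT h ∘ₗ C.AdT h' := by
  refine Submodule.linearMap_qext _ (LinearMap.ext fun X => ?_)
  exact congrArg Submodule.Quotient.mk (𝒢.Ad_mul h h' X)

theorem AdT_one : C.AdT 1 = LinearMap.id := by
  refine Submodule.linearMap_qext _ (LinearMap.ext fun X => ?_)
  change Submodule.Quotient.mk (𝒢.Ad 1 X) = _
  rw [Ad_one]
  rfl

variable {P : Set (C.𝔱M →ₗ[ℝ] ℂ)} {ζ : C.𝔞}

theorem J_mk (hP : P ⊆ C.rootsM) (Y : 𝒢.𝔤) :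
    C.J P hP ζ (Submodule.Quotient.mk Y) = Submodule.Quotient.mk (C.Jlift P ζ Y) := rfl

theorem J_J (hP : C.IsPositiveSystem P) (hζ : ∀ β ∈ C.restrictedRoots, β ζ ≠ 0) (v : C.T) :
    C.J P hP.subset ζ (C.J P hP.subset ζ v) = -v := by
  obtain ⟨X, rfl⟩ := Submodule.Quotient.mk_surjective _ v
  rw [J_mk, J_mk, ← Submodule.Quotient.mk_neg, Submodule.Quotient.eq, sub_neg_eq_add]
  exact Jlift_Jlift hP ζ hζ X

theorem AdT_J (hP : C.IsPositiveSystem P) (hζ : ∀ β ∈ C.restrictedRoots, β ζ ≠ 0) {t : C.H}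
    (ht : (t : 𝒢.Grp) ∈ 𝒢.K) (v : C.T) :
    C.AdT t (C.J P hP.subset ζ v) = C.J P hP.subset ζ (C.AdT t v) := by
  obtain ⟨X, rfl⟩ := Submodule.Quotient.mk_surjective _ v
  rw [J_mk, AdT_mk, AdT_mk, J_mk, Jlift_Ad hP ζ hζ t.2 ht]

theorem expG_mem_K {X : 𝒢.𝔤} (hX : X ∈ 𝒢.𝔨) : 𝒢.expG X ∈ 𝒢.K := by
  change (𝒢.mat (𝒢.expG X))ᵀ * 𝒢.mat (𝒢.expG X) = 1
  rw [mat_expG, ← Matrix.exp_transpose, mem_𝔨_iff.1 hX, ← Matrix.exp_add_of_commute _ _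
    (Commute.neg_left (Commute.refl (X : Matrix (Fin n) (Fin n) ℝ)))]
  simp

/-- The derivative of the action of `exp 𝔥` on the complexification of `𝔤/𝔥`. -/
theorem hasDerivAt_AdT {X : 𝒢.𝔤} (hX : X ∈ C.𝔥) (φ : ℂ ⊗[ℝ] C.T →ₗ[ℂ] ℂ) (x : ℂ ⊗[ℝ] C.T) :
    HasDerivAt (fun s : ℝ => φ ((C.AdT ⟨𝒢.expG (s • X), expG_mem_H (C.𝔥.smul_mem s hX)⟩).baseChange
      ℂ x)) (φ ((C.adT hX).baseChange ℂ x)) 0 := by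
  induction x with
  | zero => simpa using hasDerivAt_const (0 : ℝ) (0 : ℂ)
  | tmul a v =>
    obtain ⟨Y, rfl⟩ := Submodule.Quotient.mk_surjective _ v
    exact hasDerivAt_Ad (φ.restrictScalars ℝ ∘ₗ TensorProduct.mk ℝ ℂ C.T a ∘ₗ C.𝔥.mkQ) X Y
  | add x y hx hy =>
    simp only [map_add]
    exact hx.add hy

theorem adT_J (hP : C.IsPositiveSystem P) (hζ : ∀ β ∈ C.restrictedRoots, β ζ ≠ 0) {X : 𝒢.𝔤}
    (hX : X ∈ C.𝔱M) (v : C.T) :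
    C.adT hX.1 (C.J P hP.subset ζ v) = C.J P hP.subset ζ (C.adT hX.1 v) := by
  obtain ⟨Y, rfl⟩ := Submodule.Quotient.mk_surjective _ v
  rw [← sub_eq_zero, ← Module.forall_dual_apply_eq_zero_iff ℝ]
  intro φ
  have h1 := hasDerivAt_Ad (Complex.ofRealCLM.toLinearMap ∘ₗ φ ∘ₗ C.𝔥.mkQ) X (C.Jlift P ζ Y)
  have h2 := hasDerivAt_Ad
    (Complex.ofRealCLM.toLinearMap ∘ₗ φ ∘ₗ C.J P hP.subset ζ ∘ₗ C.𝔥.mkQ) X Y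
  have h3 : (fun s : ℝ => (Complex.ofRealCLM.toLinearMap ∘ₗ φ ∘ₗ C.𝔥.mkQ)
      (𝒢.Ad (𝒢.expG (s • X)) (C.Jlift P ζ Y))) = fun s : ℝ =>
      (Complex.ofRealCLM.toLinearMap ∘ₗ φ ∘ₗ C.J P hP.subset ζ ∘ₗ C.𝔥.mkQ)
        (𝒢.Ad (𝒢.expG (s • X)) Y) := by
    ext s
    have h4 := AdT_J hP hζ (t := ⟨𝒢.expG (s • X), expG_mem_H (C.𝔥.smul_mem s hX.1)⟩)
      (expG_mem_K (𝒢.𝔨.smul_mem s hX.2)) (Submodule.Quotient.mk Y)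
    exact congrArg (fun v => ((φ v : ℝ) : ℂ)) h4
  rw [h3] at h1
  have h4 : ((φ _ : ℝ) : ℂ) = ((φ _ : ℝ) : ℂ) := h1.unique h2
  rw [map_sub, sub_eq_zero]
  exact Complex.ofReal_injective h4

/-- The trace of `J ad(X)` for `X ∈ 𝔱_M`: only the root spaces of `𝔪ℂ` contribute. -/
theorem trace_Jlift_ad (hP : C.IsPositiveSystem P) [Fintype P] (Y : C.𝔱M) :
    LinearMap.trace ℝ 𝒢.𝔤 (C.Jlift P ζ ∘ₗ ad (Y : 𝒢.𝔤)) =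
      ∑ γ : P, 2 * (Complex.I * (γ : C.𝔱M →ₗ[ℝ] ℂ) Y).re := by
  have hY𝔥 : (Y : 𝒢.𝔤) ∈ C.𝔥 := Y.2.1
  have hY𝔨 : (Y : 𝒢.𝔤) ∈ 𝒢.𝔨 := Y.2.2
  obtain ⟨e, he⟩ := exists_basis_𝔪plus hP.subset
  -- `F₁` is the contribution of `𝔪/𝔱_M`, a sum of maps of rank one; `F₂` and `F₃` are those of
  -- `𝔫` and `θ 𝔫`, which exchange the two spaces and have square zero
  let c : P → 𝒢.𝔤 →ₗ[ℝ] ℂ := fun γ => (Complex.I • ((e.coord γ) ∘ₗ orthProj (C.𝔪plus P))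
    ).restrictScalars ℝ ∘ₗ 𝒢.toℂ ∘ₗ ad (Y : 𝒢.𝔤)
  let F₁ : 𝒢.𝔤 →ₗ[ℝ] 𝒢.𝔤 := ∑ γ : P, ((2 : ℝ) • (Complex.reLm ∘ₗ c γ).smulRight
    (𝒢.rePart (e γ)) - (2 : ℝ) • (Complex.imLm ∘ₗ c γ).smulRight (𝒢.imPart (e γ)))
  let F₂ : 𝒢.𝔤 →ₗ[ℝ] 𝒢.𝔤 := 𝒢.θ ∘ₗ (C.𝔫 ζ).subtype ∘ₗ orthProj (C.𝔫 ζ) ∘ₗ ad (Y : 𝒢.𝔤)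
  let F₃ : 𝒢.𝔤 →ₗ[ℝ] 𝒢.𝔤 := 𝒢.θ ∘ₗ (C.𝔫bar ζ).subtype ∘ₗ orthProj (C.𝔫bar ζ) ∘ₗ
    ad (Y : 𝒢.𝔤)
  have hF : C.Jlift P ζ ∘ₗ ad (Y : 𝒢.𝔤) = F₁ + F₂ - F₃ := by
    refine LinearMap.ext fun X => ?_
    have h1 : (2 : ℝ) • 𝒢.rePart (Complex.I • (orthProj (C.𝔪plus P) (𝒢.toℂ (ad (Y : 𝒢.𝔤) X)) :
        𝒢.𝔤ℂ)) = F₁ X := by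
      have h2 := congrArg (C.𝔪plus P).subtype (e.sum_repr (orthProj (C.𝔪plus P)
        (𝒢.toℂ (ad (Y : 𝒢.𝔤) X))))
      rw [map_sum] at h2
      simp only [map_smul, Submodule.subtype_apply] at h2
      rw [← h2, Finset.smul_sum, map_sum, Finset.smul_sum, LinearMap.sum_apply]
      refine Finset.sum_congr rfl fun γ _ => ?_
      rw [smul_smul, rePart_smul, smul_sub]
      rfl
    have h2 : (F₁ + F₂ - F₃) X = F₁ X + F₂ X - F₃ X := rfl
    rw [h2, ← h1]
    rfl
  have h2 : LinearMap.trace ℝ 𝒢.𝔤 F₂ = 0 := by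
    refine (LinearMap.isNilpotent_trace_of_isNilpotent (R := ℝ) (f := F₂) ⟨2, ?_⟩).eq_zero
    refine LinearMap.ext fun X => ?_
    have h3 : ad (Y : 𝒢.𝔤) (F₂ X) = 𝒢.θ (ad (Y : 𝒢.𝔤) (orthProj (C.𝔫 ζ) (ad (Y : 𝒢.𝔤) X))) :=
      (θ_ad hY𝔨 _).symm
    change 𝒢.θ (orthProj (C.𝔫 ζ) (ad (Y : 𝒢.𝔤) (F₂ X)) : 𝒢.𝔤) = 0
    rw [h3, (orthProj_θ_𝔫 (ad_mem_𝔫 hY𝔥 (orthProj (C.𝔫 ζ) _).2)).1]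
    simp
  have h3 : LinearMap.trace ℝ 𝒢.𝔤 F₃ = 0 := by
    refine (LinearMap.isNilpotent_trace_of_isNilpotent (R := ℝ) (f := F₃) ⟨2, ?_⟩).eq_zero
    refine LinearMap.ext fun X => ?_
    obtain ⟨N, hN, hN'⟩ := (orthProj (C.𝔫bar ζ) (ad (Y : 𝒢.𝔤) X)).2
    have h4 : F₃ X = N := by
      change 𝒢.θ (orthProj (C.𝔫bar ζ) (ad (Y : 𝒢.𝔤) X) : 𝒢.𝔤) = N
      rw [← hN', θ_θ]
    change 𝒢.θ (orthProj (C.𝔫bar ζ) (ad (Y : 𝒢.𝔤) (F₃ X)) : 𝒢.𝔤) = 0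
    rw [h4, (orthProj_𝔫 (ad_mem_𝔫 hY𝔥 hN)).2]
    simp
  have hsub : ∀ f g : 𝒢.𝔤 →ₗ[ℝ] 𝒢.𝔤, LinearMap.trace ℝ 𝒢.𝔤 (f - g) =
      LinearMap.trace ℝ 𝒢.𝔤 f - LinearMap.trace ℝ 𝒢.𝔤 g := fun f g =>
    eq_sub_of_add_eq (by
      rw [← map_add]
      exact congrArg _ (LinearMap.ext fun X => sub_add_cancel (f X) (g X)))
  have h4 : LinearMap.trace ℝ 𝒢.𝔤 (F₁ + F₂ - F₃) = LinearMap.trace ℝ 𝒢.𝔤 F₁ +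
      LinearMap.trace ℝ 𝒢.𝔤 F₂ - LinearMap.trace ℝ 𝒢.𝔤 F₃ :=
    (hsub (F₁ + F₂) F₃).trans (congrArg (fun r : ℝ => r - LinearMap.trace ℝ 𝒢.𝔤 F₃)
      (LinearMap.map_add (LinearMap.trace ℝ 𝒢.𝔤) F₁ F₂))
  rw [hF, h4, h2, h3, add_zero, sub_zero, map_sum]
  refine Finset.sum_congr rfl fun γ _ => ?_
  rw [hsub, map_smul, map_smul, LinearMap.trace_smulRight, LinearMap.trace_smulRight,
    ← smul_sub, smul_eq_mul]
  congr 1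
  have h5 : c γ (𝒢.rePart (e γ)) + Complex.I * c γ (𝒢.imPart (e γ)) =
      Complex.I * (γ : C.𝔱M →ₗ[ℝ] ℂ) Y := by
    have h6 : 𝒢.toℂ (ad (Y : 𝒢.𝔤) (𝒢.rePart (e γ))) +
        Complex.I • 𝒢.toℂ (ad (Y : 𝒢.𝔤) (𝒢.imPart (e γ))) =
        (γ : C.𝔱M →ₗ[ℝ] ℂ) Y • (e γ : 𝒢.𝔤ℂ) := by
      have h7 := (he γ).2.2 Y
      rw [coe_toℂ] at h7
      have h8 := map_re_bracket ((Y : 𝒢.𝔤) : Matrix (Fin n) (Fin n) ℝ)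
        ((e γ : 𝒢.𝔤ℂ) : Matrix (Fin n) (Fin n) ℂ)
      have h9 := map_im_bracket ((Y : 𝒢.𝔤) : Matrix (Fin n) (Fin n) ℝ)
        ((e γ : 𝒢.𝔤ℂ) : Matrix (Fin n) (Fin n) ℂ)
      rw [h7] at h8 h9
      apply eq_of_parts
      · rw [map_add, rePart_smul, rePart_toℂ, rePart_toℂ, imPart_toℂ]
        simp only [Complex.I_re, Complex.I_im, zero_smul, smul_zero, sub_zero, add_zero]
        exact Subtype.ext h8.symm
      · rw [map_add, imPart_smul, rePart_toℂ, imPart_toℂ, imPart_toℂ]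
        simp only [Complex.I_re, Complex.I_im, zero_smul, zero_add, one_smul]
        exact Subtype.ext h9.symm
    have h10 : orthProj (C.𝔪plus P) (e γ : 𝒢.𝔤ℂ) = e γ :=
      Subtype.ext (orthProj_eq_of_trace _ _ (e γ).2 fun Z _ => by simp)
    have h11 := congrArg (fun Z => Complex.I * e.coord γ (orthProj (C.𝔪plus P) Z)) h6
    simp only [map_add, map_smul, h10, smul_eq_mul, mul_add] at h11
    have h12 : e.coord γ (e γ) = 1 := by simp
    rw [h12, mul_one] at h11
    rw [← h11]
    change Complex.I * _ + Complex.I * (Complex.I * _) = _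
    rfl
  rw [← h5]
  simp
  rfl

end CartanSubalgebra

/-! ### The fibre at the base point -/

namespace Datum

open CartanSubalgebra

variable {n : ℕ} {𝒢 : LinearReductiveGroup n} (D : Datum 𝒢)

theorem J₀_J₀ (v : D.T) : D.J₀ (D.J₀ v) = -v := J_J D.isPositiveSystem D.ζ_regular v

theorem AdT_J₀ {t : D.H} (ht : (t : 𝒢.Grp) ∈ 𝒢.K) (v : D.T) :
    D.AdT t (D.J₀ v) = D.J₀ (D.AdT t v) := AdT_J D.isPositiveSystem D.ζ_regular ht v

/-- The holomorphic tangent space at the base point. -/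
def T10₀ : Submodule ℂ (ℂ ⊗[ℝ] D.T) :=
  Module.End.eigenspace (D.J₀.baseChange ℂ) Complex.I

/-- The fibre of the determinant line bundle at the base point. -/
def F₀ : Submodule ℂ D.E := LinearMap.range (exteriorPower.map D.d D.T10₀.subtype)

theorem finrank_T10₀ : Module.finrank ℂ D.T10₀ = D.d := by
  have h := two_mul_finrank_eigenspace D.J₀_J₀
  rw [d, ← h, Nat.mul_div_cancel_left _ two_pos]
  rfl

/-- The fibre at the base point is a line: it has a generator and a dual functional. -/
theorem exists_generator : ∃ (e : D.E) (ℓ : D.E →ₗ[ℂ] ℂ), e ∈ D.F₀ ∧ ℓ e = 1 ∧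
    ∀ u ∈ D.F₀, u = ℓ u • e := 
  exists_generator_of_finrank_eq_one _ (finrank_range_exteriorPower D.T10₀ D.finrank_T10₀)

theorem act_apply (h : D.H) (u : D.E) :
    D.act h u = ((D.σ h : ℂ) ^ 2) • exteriorPower.map D.d ((D.AdT h).baseChange ℂ) u := rfl

theorem act_mul_apply (h h' : D.H) (u : D.E) : D.act (h * h') u = D.act h (D.act h' u) := by
  have h1 : exteriorPower.map D.d ((D.AdT (h * h')).baseChange ℂ) u =
      exteriorPower.map D.d ((D.AdT h).baseChange ℂ)
        (exteriorPower.map D.d ((D.AdT h').baseChange ℂ) u) := by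
    rw [AdT_mul, LinearMap.baseChange_comp, exteriorPower.map_comp, LinearMap.comp_apply]
  rw [act_apply, act_apply, act_apply, h1, map_mul, Circle.coe_mul, mul_pow, map_smul, smul_smul]

theorem act_one_apply (u : D.E) : D.act 1 u = u := by
  rw [act_apply, AdT_one, LinearMap.baseChange_id, exteriorPower.map_id, map_one]
  simp

theorem act_inv_act (h : D.H) (u : D.E) : D.act h⁻¹ (D.act h u) = u := by
  rw [← act_mul_apply, inv_mul_cancel, act_one_apply]

theorem act_act_inv (h : D.H) (u : D.E) : D.act h (D.act h⁻¹ u) = u := by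
  rw [← act_mul_apply, mul_inv_cancel, act_one_apply]

theorem act_mem_F₀ {t : D.H} (ht : (t : 𝒢.Grp) ∈ 𝒢.K) {u : D.E} (hu : u ∈ D.F₀) :
    D.act t u ∈ D.F₀ :=
  Submodule.smul_mem _ _ (exteriorPower_map_mem_range
    (fun _ hx => baseChange_mem_eigenspace (D.AdT_J₀ ht) hx) hu)

/-- The trace of `ad X` on `T^{1,0}` is `2ρ^M(X)`. For a real endomorphism commuting with `J` it
is `(tr f - i tr (f J)) / 2`. -/
theorem trace_adT {X : 𝒢.𝔤} (hX : X ∈ D.𝔱M) :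
    LinearMap.trace ℂ D.T10₀ (((D.adT hX.1).baseChange ℂ).restrict fun _ hx =>
      baseChange_mem_eigenspace (adT_J D.isPositiveSystem D.ζ_regular hX) hx) =
      2 * D.ρM D.RM ⟨X, hX⟩ := by
  have hfin : Finite D.RM := (finite_rootsM.subset D.isPositiveSystem.subset).to_subtype
  let _ : Fintype D.RM := Fintype.ofFinite _
  have h1 := trace_restrict_eigenspace D.J₀_J₀ (f := D.adT hX.1)
    (adT_J D.isPositiveSystem D.ζ_regular hX)
  refine h1.trans ?_
  have h2 : LinearMap.trace ℝ D.T (D.adT hX.1) = 0 :=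
    (trace_mapQ (ad_𝔥 hX.1) _).trans (trace_ad hX.2)
  have h3 : D.adT hX.1 ∘ₗ D.J₀ = D.𝔥.mapQ D.𝔥 (D.Jlift D.RM D.ζ ∘ₗ ad X) fun Y hY => by
      rw [Submodule.mem_comap, LinearMap.comp_apply, LinearMap.mem_ker.1 (ad_𝔥 hX.1 hY), map_zero]
      exact zero_mem _ := by
    refine LinearMap.ext fun v => (adT_J D.isPositiveSystem D.ζ_regular hX v).trans ?_
    obtain ⟨Y, rfl⟩ := Submodule.Quotient.mk_surjective _ v
    rfl
  have h4 : LinearMap.trace ℝ D.T (D.adT hX.1 ∘ₗ D.J₀) =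
      ∑ γ : D.RM, 2 * (Complex.I * (γ : D.𝔱M →ₗ[ℝ] ℂ) ⟨X, hX⟩).re := by
    rw [h3, trace_mapQ]
    · exact trace_Jlift_ad D.isPositiveSystem ⟨X, hX⟩
    · intro Y hY
      rw [LinearMap.mem_ker, LinearMap.comp_apply, LinearMap.mem_ker.1 (ad_𝔥 hX.1 hY), map_zero]
  have h5 : ∀ γ : D.RM, (((Complex.I * (γ : D.𝔱M →ₗ[ℝ] ℂ) ⟨X, hX⟩).re : ℝ) : ℂ) =
      Complex.I * (γ : D.𝔱M →ₗ[ℝ] ℂ) ⟨X, hX⟩ := by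
    intro γ
    obtain ⟨Z, hZ, h0⟩ := Submodule.exists_mem_ne_zero_of_ne_bot (D.isPositiveSystem.subset γ.2).2
    have h6 := congrArg Complex.re (conj_weight_𝔱M hZ h0 ⟨X, hX⟩)
    rw [Complex.conj_re, Complex.neg_re] at h6
    apply Complex.ext
    · simp
    · simp; linarith
  rw [h2, h4, ρM_apply]
  push_cast
  simp only [h5, ← Finset.mul_sum]
  linear_combination (-(∑ γ : D.RM, (γ : D.𝔱M →ₗ[ℝ] ℂ) ⟨X, hX⟩)) * Complex.I_mul_I

/-- `exp X` acts on the fibre of the top exterior power by `exp (2ρ^M(X))`: its determinant is a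
one-parameter group whose derivative is the trace. -/
theorem restrict_det_exp {X : 𝒢.𝔤} (hX : X ∈ D.𝔱M) {u : D.E} (hu : u ∈ D.F₀) :
    exteriorPower.map D.d ((D.AdT ⟨𝒢.expG X, expG_mem_H hX.1⟩).baseChange ℂ) u =
      Complex.exp (2 * D.ρM D.RM ⟨X, hX⟩) • u := by
  let h : ℝ → D.H := fun s => ⟨𝒢.expG (s • X), expG_mem_H (D.𝔥.smul_mem s hX.1)⟩
  have hK : ∀ s, (h s : 𝒢.Grp) ∈ 𝒢.K := fun s => expG_mem_K (𝒢.𝔨.smul_mem s hX.2)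
  have hmem : ∀ s, ∀ x ∈ D.T10₀, (D.AdT (h s)).baseChange ℂ x ∈ D.T10₀ := fun s x hx =>
    baseChange_mem_eigenspace (D.AdT_J₀ (hK s)) hx
  let A : ℝ → D.T10₀ →ₗ[ℂ] D.T10₀ := fun s => ((D.AdT (h s)).baseChange ℂ).restrict (hmem s)
  let B : D.T10₀ →ₗ[ℂ] D.T10₀ := ((D.adT hX.1).baseChange ℂ).restrict fun _ hx =>
      baseChange_mem_eigenspace (adT_J D.isPositiveSystem D.ζ_regular hX) hx
  have hmul : ∀ s t, h (s + t) = h s * h t := fun s t => Subtype.ext (expG_add_smul s t X)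
  have hA : ∀ s t, A (s + t) = A s ∘ₗ A t := by
    intro s t
    refine LinearMap.ext fun x => Subtype.ext ?_
    change (D.AdT (h (s + t))).baseChange ℂ x = (D.AdT (h s)).baseChange ℂ
      ((D.AdT (h t)).baseChange ℂ x)
    rw [hmul, AdT_mul, LinearMap.baseChange_comp, LinearMap.comp_apply]
  have h0 : h 0 = 1 := Subtype.ext (by
    change 𝒢.expG ((0 : ℝ) • X) = 1
    rw [zero_smul, expG_zero])
  have hA0 : A 0 = LinearMap.id := by
    refine LinearMap.ext fun x => Subtype.ext ?_
    change (D.AdT (h 0)).baseChange ℂ x = x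
    rw [h0, AdT_one, LinearMap.baseChange_id, LinearMap.id_apply]
  let b := Module.finBasis ℂ D.T10₀
  have hdet : HasDerivAt (fun s => LinearMap.det (A s)) (2 * D.ρM D.RM ⟨X, hX⟩) 0 := by
    have h1 : ∀ i j, HasDerivAt (fun s => LinearMap.toMatrix b b (A s) i j)
        (LinearMap.toMatrix b b B i j) 0 := by
      intro i j
      obtain ⟨φ, hφ⟩ := (b.coord i).exists_extend
      have h2 := hasDerivAt_AdT hX.1 φ (b j)
      have h3 : ∀ (f : D.T10₀ →ₗ[ℂ] D.T10₀), LinearMap.toMatrix b b f i j = φ (f (b j)) := by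
        intro f
        rw [LinearMap.toMatrix_apply]
        exact (LinearMap.congr_fun hφ (f (b j))).symm
      simp only [h3]
      exact h2
    have h2 := hasDerivAt_det (by rw [hA0, LinearMap.toMatrix_id]) h1
    simp only [LinearMap.det_toMatrix] at h2
    rw [← LinearMap.trace_eq_matrix_trace ℂ b, D.trace_adT hX] at h2
    exact h2
  have key := eq_exp_of_hasDerivAt (m := fun s => LinearMap.det (A s))
    (fun s t => by simp only [hA, LinearMap.det_comp]) (by simp only [hA0, LinearMap.det_id])
    hdet 1
  have h1 : h 1 = ⟨𝒢.expG X, expG_mem_H hX.1⟩ := Subtype.ext (by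
    change 𝒢.expG ((1 : ℝ) • X) = _
    rw [one_smul])
  rw [← h1, exteriorPower_map_apply_range D.finrank_T10₀ (hmem 1) hu]
  congr 1
  exact key.trans (by simp)

/-- The action of `exp 𝔱_M` on the fibre at the base point. The exponents `-2ρ^M` from `σ²` and
`2ρ^M` from the exterior power cancel. -/
theorem act_exp_𝔱M {X : 𝒢.𝔤} (hX : X ∈ D.𝔱M) {u : D.E} (hu : u ∈ D.F₀) :
    D.act ⟨𝒢.expG X, expG_mem_H hX.1⟩ u = Complex.exp (2 * D.lam ⟨X, hX⟩) • u := by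
  have h1 := D.σ_apply ⟨𝒢.expG X, expG_mem_H hX.1⟩ ⟨X, hX⟩ 1 0 (by simp)
  rw [act, LinearMap.smul_apply, D.restrict_det_exp hX hu, smul_smul, h1, map_one, Circle.coe_one,
    mul_one, ← Complex.exp_nat_mul, ← Complex.exp_add]
  congr 2
  push_cast
  ring

theorem σ_exp_𝔞 {W : 𝒢.𝔤} (hW : W ∈ D.𝔞) : (D.σ ⟨𝒢.expG W, expG_mem_H hW.1⟩ : ℂ) = 1 := by
  have h1 := D.σ_apply ⟨𝒢.expG W, expG_mem_H hW.1⟩ 0 1 ⟨W, hW⟩ (by simp)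
  rw [h1]
  simp

end Datum

/-! ### Principal minors of `gᵀ g` and the `A`-component -/

section Corner

variable {n : ℕ} {P A X k : Matrix (Fin n) (Fin n) ℝ}

/-- The Gram determinant of `A` on the image of an orthogonal projection `P`. -/
def corner (P A : Matrix (Fin n) (Fin n) ℝ) : ℝ := (P * (Aᵀ * A) * P + (1 - P)).det

theorem exp_mul_of_mul_eq (h : P * X * P = X * P) :
    NormedSpace.exp X * P = P * NormedSpace.exp (X * P) ∧
      (1 - P) * NormedSpace.exp (X * P) = 1 - P := by
  let _ := Matrix.linftyOpNormedRing (n := Fin n) (α := ℝ)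
  let _ := Matrix.linftyOpNormedAlgebra (R := ℝ) (n := Fin n) (α := ℝ)
  let _ : NormedAlgebra ℚ (Matrix (Fin n) (Fin n) ℝ) := NormedAlgebra.restrictScalars ℚ ℝ _
  constructor
  · have h1 : SemiconjBy P (X * P) X := by
      rw [SemiconjBy, ← mul_assoc, h]
    exact (h1.exp_right).symm
  · have h1 : SemiconjBy (1 - P) (X * P) 0 := by
      rw [SemiconjBy, sub_mul, one_mul, ← mul_assoc, h, sub_self, zero_mul]
    have h2 := h1.exp_right
    rw [NormedSpace.exp_zero] at h2
    exact h2.eq.trans (one_mul _)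

theorem corner_mul_exp (hPT : Pᵀ = P) (h : P * X * P = X * P) :
    corner P (A * NormedSpace.exp X) = corner P A * Real.exp (2 * (X * P).trace) := by
  obtain ⟨h1, h2⟩ := exp_mul_of_mul_eq h
  set E := NormedSpace.exp (X * P) with hE
  have h3 : P * (NormedSpace.exp X)ᵀ = Eᵀ * P := by
    have := congrArg Matrix.transpose h1
    simpa [hPT] using this
  have h4 : Eᵀ * (1 - P) = 1 - P := by
    have := congrArg Matrix.transpose h2
    simpa [hPT] using this
  have h5 : P * ((A * NormedSpace.exp X)ᵀ * (A * NormedSpace.exp X)) * P + (1 - P) =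
      Eᵀ * (P * (Aᵀ * A) * P + (1 - P)) * E := by
    have e1 : Eᵀ * (1 - P) * E = 1 - P := by rw [h4, h2]
    calc _ = (P * (NormedSpace.exp X)ᵀ) * (Aᵀ * A) * (NormedSpace.exp X * P) + (1 - P) := by
          rw [Matrix.transpose_mul]; simp only [mul_assoc]
      _ = Eᵀ * (P * (Aᵀ * A) * P) * E + Eᵀ * (1 - P) * E := by
          rw [h3, h1, e1]; simp only [mul_assoc]
      _ = _ := by rw [← add_mul, ← mul_add]
  rw [corner, h5, Matrix.det_mul, Matrix.det_mul, Matrix.det_transpose, hE, det_exp, corner,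
    two_mul, Real.exp_add]
  ring

theorem corner_mul_left (hk : kᵀ * k = 1) : corner P (k * A) = corner P A := by
  have h : (k * A)ᵀ * (k * A) = Aᵀ * A := by
    rw [Matrix.transpose_mul, mul_assoc, ← mul_assoc kᵀ, hk, one_mul]
  rw [corner, h, corner]

theorem corner_mul_right (hk : kᵀ * k = 1) (hkP : k * P = P * k) (hPT : Pᵀ = P) :
    corner P (A * k) = corner P A := by
  have h2 : P * kᵀ = kᵀ * P := by
    have := congrArg Matrix.transpose hkP
    simpa [hPT] using this
  have h : P * ((A * k)ᵀ * (A * k)) * P + (1 - P) = kᵀ * (P * (Aᵀ * A) * P + (1 - P)) * k := by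
    have e1 : kᵀ * (1 - P) * k = 1 - P := by
      rw [mul_sub, mul_one, sub_mul, hk, mul_assoc, ← hkP, ← mul_assoc, hk, one_mul]
    calc _ = (P * kᵀ) * (Aᵀ * A) * (k * P) + (1 - P) := by
          rw [Matrix.transpose_mul]; simp only [mul_assoc]
      _ = kᵀ * (P * (Aᵀ * A) * P) * k + kᵀ * (1 - P) * k := by
          rw [h2, hkP, e1]; simp only [mul_assoc]
      _ = _ := by rw [← add_mul, ← mul_add]
  rw [corner, h, Matrix.det_mul, Matrix.det_mul, mul_right_comm, ← Matrix.det_mul, hk,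
    Matrix.det_one, one_mul, corner]

theorem corner_ne_zero (hPT : Pᵀ = P) (hPP : P * P = P) (hA : IsUnit A.det) :
    corner P A ≠ 0 := by
  intro h
  obtain ⟨v, hv, h1⟩ := Matrix.exists_mulVec_eq_zero_iff.2 h
  have h2 : (A *ᵥ (P *ᵥ v)) ⬝ᵥ (A *ᵥ (P *ᵥ v)) + ((1 - P) *ᵥ v) ⬝ᵥ ((1 - P) *ᵥ v) = 0 := by
    have e1 : (A *ᵥ (P *ᵥ v)) ⬝ᵥ (A *ᵥ (P *ᵥ v)) = v ⬝ᵥ ((P * (Aᵀ * A) * P) *ᵥ v) := by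
      simp only [← Matrix.mulVec_mulVec]
      rw [Matrix.dotProduct_mulVec v P, ← Matrix.mulVec_transpose, hPT,
          Matrix.dotProduct_mulVec _ Aᵀ,
        ← Matrix.mulVec_transpose, Matrix.transpose_transpose]
    have e2 : ((1 - P) *ᵥ v) ⬝ᵥ ((1 - P) *ᵥ v) = v ⬝ᵥ ((1 - P) *ᵥ v) := by
      have : (1 - P) * (1 - P) = 1 - P := by
        rw [mul_sub, mul_one, sub_mul, hPP]; simp
      conv_rhs => rw [← this, ← Matrix.mulVec_mulVec, Matrix.dotProduct_mulVec,
        ← Matrix.mulVec_transpose, Matrix.transpose_sub, hPT, Matrix.transpose_one]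
    rw [e1, e2, ← dotProduct_add, ← Matrix.add_mulVec, h1, dotProduct_zero]
  have h3 : 0 ≤ (A *ᵥ (P *ᵥ v)) ⬝ᵥ (A *ᵥ (P *ᵥ v)) :=
    Finset.sum_nonneg fun i _ => mul_self_nonneg _
  have h4 : 0 ≤ ((1 - P) *ᵥ v) ⬝ᵥ ((1 - P) *ᵥ v) :=
    Finset.sum_nonneg fun i _ => mul_self_nonneg _
  have h5 : A *ᵥ (P *ᵥ v) = 0 := dotProduct_self_eq_zero.1 (by linarith)
  have h6 : (1 - P) *ᵥ v = 0 := dotProduct_self_eq_zero.1 (by linarith)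
  have h7 : P *ᵥ v = v := by
    rw [Matrix.sub_mulVec, Matrix.one_mulVec, sub_eq_zero] at h6
    exact h6.symm
  rw [h7] at h5
  exact hv (Matrix.eq_zero_of_mulVec_eq_zero hA.ne_zero h5)

end Corner

section Spectral

variable {n : ℕ} {U S A : Matrix (Fin n) (Fin n) ℝ} {μ : Fin n → ℝ}

theorem exists_diagonalization (hS : Sᵀ = S) :
    ∃ (U : Matrix (Fin n) (Fin n) ℝ) (μ : Fin n → ℝ), Uᵀ * U = 1 ∧ U * Uᵀ = 1 ∧
      S = U * Matrix.diagonal μ * Uᵀ := by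
  have h : S.IsHermitian := hS
  refine ⟨h.eigenvectorUnitary, h.eigenvalues, ?_, ?_, ?_⟩
  · exact Unitary.coe_star_mul_self h.eigenvectorUnitary
  · exact Unitary.coe_mul_star_self h.eigenvectorUnitary
  · exact h.spectral_theorem

/-- Matrices that map eigenvectors of `S = U μ Uᵀ` to sums of eigenvectors with at least the
same eigenvalue. -/
def IsUpper (U : Matrix (Fin n) (Fin n) ℝ) (μ : Fin n → ℝ) (A : Matrix (Fin n) (Fin n) ℝ) : Prop :=
  ∀ i j, μ i < μ j → (Uᵀ * A * U) i j = 0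

theorem IsUpper.add {A B : Matrix (Fin n) (Fin n) ℝ} (hA : IsUpper U μ A) (hB : IsUpper U μ B) :
    IsUpper U μ (A + B) := fun i j hij => by
  rw [mul_add, add_mul, Matrix.add_apply, hA i j hij, hB i j hij, add_zero]

/-- Entries of a commutator with `S` in an eigenbasis of `S`. -/
theorem bracket_entry (hU : Uᵀ * U = 1) (hS : S = U * Matrix.diagonal μ * Uᵀ) (i j : Fin n) :
    (Uᵀ * (S * A - A * S) * U) i j = (μ i - μ j) * (Uᵀ * A * U) i j := by
  have h : Uᵀ * (S * A - A * S) * U = Matrix.diagonal μ * (Uᵀ * A * U) -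
      (Uᵀ * A * U) * Matrix.diagonal μ := by
    have e1 : Uᵀ * S = Matrix.diagonal μ * Uᵀ := by
      rw [hS, mul_assoc, ← mul_assoc, hU, one_mul]
    have e2 : S * U = U * Matrix.diagonal μ := by
      rw [hS, mul_assoc, hU, mul_one]
    rw [mul_sub, sub_mul, ← mul_assoc, e1, mul_assoc Uᵀ, mul_assoc A, e2]
    simp only [mul_assoc]
  rw [h, Matrix.sub_apply, Matrix.diagonal_mul, Matrix.mul_diagonal]
  ring

theorem isUpper_of_bracket (hU : Uᵀ * U = 1) (hS : S = U * Matrix.diagonal μ * Uᵀ) {c : ℝ}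
    (hc : 0 ≤ c) (h : S * A - A * S = c • A) : IsUpper U μ A := by
  intro i j hij
  have h1 := bracket_entry hU hS (A := A) i j
  rw [h, Matrix.mul_smul, Matrix.smul_mul, Matrix.smul_apply, smul_eq_mul] at h1
  have h2 : (c + (μ j - μ i)) * (Uᵀ * A * U) i j = 0 := by linear_combination h1
  exact (mul_eq_zero.1 h2).resolve_left (by linarith)

/-- The spectral projection of `S = U μ Uᵀ` for the set of eigenvalues with indicator `f`. -/
def specProj (U : Matrix (Fin n) (Fin n) ℝ) (f : Fin n → ℝ) : Matrix (Fin n) (Fin n) ℝ :=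
  U * Matrix.diagonal f * Uᵀ

theorem specProj_transpose (f : Fin n → ℝ) : (specProj U f)ᵀ = specProj U f := by
  simp [specProj, mul_assoc]

theorem specProj_mul (hU : Uᵀ * U = 1) (f f' : Fin n → ℝ) :
    specProj U f * specProj U f' = specProj U (f * f') := by
  calc _ = U * Matrix.diagonal f * (Uᵀ * U) * Matrix.diagonal f' * Uᵀ := by
        simp only [specProj, mul_assoc]
    _ = _ := by
      rw [hU, mul_one, mul_assoc U, Matrix.diagonal_mul_diagonal]
      rfl

theorem IsUpper.specProj_mul_mul (hA : IsUpper U μ A) (hU' : U * Uᵀ = 1)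
    {f : Fin n → ℝ} (h01 : ∀ i, f i = 0 ∨ f i = 1) (hf : ∀ i j, f i = 0 → f j = 1 → μ i < μ j) :
    specProj U f * A * specProj U f = A * specProj U f := by
  have h1 : Matrix.diagonal f * (Uᵀ * A * U) * Matrix.diagonal f =
      (Uᵀ * A * U) * Matrix.diagonal f := by
    ext i j
    rw [Matrix.mul_diagonal, Matrix.mul_diagonal, Matrix.diagonal_mul]
    rcases h01 i with hi | hi <;> rcases h01 j with hj | hj <;> simp [hi, hj]
    exact (hA i j (hf i j hi hj)).symm ▸ rfl
  calc specProj U f * A * specProj U f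
      = U * (Matrix.diagonal f * (Uᵀ * A * U) * Matrix.diagonal f) * Uᵀ := by
        simp only [specProj, mul_assoc]
    _ = (U * Uᵀ) * A * specProj U f := by
        rw [h1]; simp only [specProj, mul_assoc]
    _ = _ := by rw [hU', one_mul]

end Spectral

/-! ### The projection of `G` to `𝔞` -/

section Spectral

variable {n : ℕ} {U S A X : Matrix (Fin n) (Fin n) ℝ} {μ : Fin n → ℝ}

theorem trace_mul_specProj (f : Fin n → ℝ) :
    (X * specProj U f).trace = ∑ i, (Uᵀ * X * U) i i * f i := by
  rw [specProj, ← mul_assoc, Matrix.trace_mul_comm, ← mul_assoc, ← mul_assoc]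
  simp [Matrix.trace, Matrix.mul_diagonal]

theorem specProj_comm (hU : Uᵀ * U = 1) (hU' : U * Uᵀ = 1)
    (hS : S = U * Matrix.diagonal μ * Uᵀ) (h : A * S = S * A) {f : Fin n → ℝ}
    (hf : ∀ i j, μ i = μ j → f i = f j) : A * specProj U f = specProj U f * A := by
  have h1 : ∀ i j, (μ i - μ j) * (Uᵀ * A * U) i j = 0 := fun i j => by
    rw [← bracket_entry hU hS, h, sub_self]; simp
  have h2 : Uᵀ * (specProj U f * A - A * specProj U f) * U = 0 := by
    ext i j
    rw [bracket_entry hU (rfl : specProj U f = _)]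
    by_cases hij : μ i = μ j
    · simp [hf i j hij]
    · rw [(mul_eq_zero.1 (h1 i j)).resolve_left (sub_ne_zero.2 hij)]; simp
  have h3 : specProj U f * A - A * specProj U f = 0 := by
    calc _ = (U * Uᵀ) * (specProj U f * A - A * specProj U f) * (U * Uᵀ) := by simp [hU']
      _ = U * (Uᵀ * (specProj U f * A - A * specProj U f) * U) * Uᵀ := by
        simp only [mul_assoc]
      _ = 0 := by rw [h2]; simp
  exact (sub_eq_zero.1 h3).symm

end Spectral

section Smooth

variable {n : ℕ} {𝒢 : LinearReductiveGroup n}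

theorem smoothMap_mat {W : Type*} [NormedAddCommGroup W] [NormedSpace ℝ W]
    (B : Matrix (Fin n) (Fin n) ℝ →ₗ[ℝ] W) : SmoothMap fun g : 𝒢.Grp => B (𝒢.mat g) := by
  let _ := Matrix.linftyOpNormedRing (n := Fin n) (α := ℝ)
  let _ := Matrix.linftyOpNormedAlgebra (R := ℝ) (n := Fin n) (α := ℝ)
  intro g m X
  let S := Fintype.linearCombination ℝ fun i => (X i : Matrix (Fin n) (Fin n) ℝ)
  have hS : ContDiff ℝ ∞ fun c : Fin m → ℝ => S c :=
    (LinearMap.toContinuousLinearMap S).contDiff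
  have he : ContDiff ℝ ∞ fun Z : Matrix (Fin n) (Fin n) ℝ => NormedSpace.exp Z :=
    contDiff_iff_contDiffAt.2 fun Z => (NormedSpace.exp_analytic (𝕂 := ℝ) Z).contDiffAt
  have h1 := (LinearMap.toContinuousLinearMap (B ∘ₗ LinearMap.mulLeft ℝ (𝒢.mat g))).contDiff
    (n := ∞) |>.comp (he.comp hS)
  refine (congrArg (ContDiff ℝ ∞) (funext fun c => ?_)).mpr h1
  have h2 : ((∑ i, c i • X i : 𝒢.𝔤) : Matrix (Fin n) (Fin n) ℝ) = S c := by
    simp [S, Fintype.linearCombination_apply]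
  change B (𝒢.mat (g * _)) = B (𝒢.mat g * NormedSpace.exp (S c))
  rw [mat_mul, mat_expG, h2]

theorem smoothMap_det {m : ℕ} (F : Fin m → Fin m → 𝒢.Grp → ℝ) (hF : ∀ i j, SmoothMap (F i j)) :
    SmoothMap fun g => (Matrix.of fun i j => F i j g).det := by
  simp only [Matrix.det_apply']
  refine SmoothMap.sum fun σ _ => (SmoothMap.const _).mul ?_
  have : ∀ s : Finset (Fin m), SmoothMap fun g => ∏ i ∈ s, F (σ i) i g := by
    intro s
    induction s using Finset.induction_on with
    | empty => simpa using SmoothMap.const _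
    | insert a s ha ih =>
      simp only [Finset.prod_insert ha]
      exact (hF _ _).mul ih
  simpa using this Finset.univ

theorem smoothMap_corner (P : Matrix (Fin n) (Fin n) ℝ) :
    SmoothMap fun g : 𝒢.Grp => corner P (𝒢.mat g) := by
  have hent : ∀ i j, SmoothMap fun g : 𝒢.Grp => 𝒢.mat g i j := fun i j =>
    smoothMap_mat (Matrix.entryLinearMap ℝ ℝ i j)
  refine smoothMap_det (fun i j g => (P * ((𝒢.mat g)ᵀ * 𝒢.mat g) * P + (1 - P)) i j) ?_
  intro i j
  simp only [Matrix.add_apply, Matrix.mul_apply, Matrix.transpose_apply]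
  refine SmoothMap.add ?_ (SmoothMap.const _)
  refine SmoothMap.sum fun k _ => SmoothMap.mul (SmoothMap.sum fun l _ => ?_) (SmoothMap.const _)
  exact (SmoothMap.const _).mul (SmoothMap.sum fun r _ => (hent _ _).mul (hent _ _))

end Smooth

namespace CartanSubalgebra

variable {n : ℕ} {𝒢 : LinearReductiveGroup n} {C : CartanSubalgebra 𝒢}

/-- There is a smooth function on `G` which behaves like the `S`-coordinate `tr (S ·)` of the
logarithm of the `A`-component for the decomposition `G = K exp(𝔰_M) N A`. -/
def HasCoordinate (C : CartanSubalgebra 𝒢) (ζ : C.𝔞) (S : 𝒢.𝔤) : Prop :=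
  ∃ u : 𝒢.Grp → ℝ, SmoothMap u ∧ (∀ k ∈ 𝒢.K, ∀ g, u (k * g) = u g) ∧
    (∀ t ∈ 𝒢.K, t ∈ C.ZA → ∀ g, u (g * t) = u g) ∧
    ∀ g X, (X ∈ C.𝔞 ∨ X ∈ C.𝔪 ∨ X ∈ C.𝔫 ζ) →
      u (g * 𝒢.expG X) =
        u g + ((X : Matrix (Fin n) (Fin n) ℝ) * (S : Matrix (Fin n) (Fin n) ℝ)).trace

theorem HasCoordinate.add {ζ : C.𝔞} {S S' : 𝒢.𝔤} (h : C.HasCoordinate ζ S)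
    (h' : C.HasCoordinate ζ S') : C.HasCoordinate ζ (S + S') := by
  obtain ⟨u, h1, h2, h3, h4⟩ := h
  obtain ⟨u', h1', h2', h3', h4'⟩ := h'
  refine ⟨fun g => u g + u' g, h1.add h1', fun k hk g => ?_, fun t ht ht' g => ?_,
    fun g X hX => ?_⟩
  · simp only [h2 k hk, h2' k hk]
  · simp only [h3 t ht ht', h3' t ht ht']
  · simp only [h4 g X hX, h4' g X hX, Submodule.coe_add, mul_add, Matrix.trace_add]
    ring

theorem HasCoordinate.smul {ζ : C.𝔞} {S : 𝒢.𝔤} (h : C.HasCoordinate ζ S) (c : ℝ) :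
    C.HasCoordinate ζ (c • S) := by
  obtain ⟨u, h1, h2, h3, h4⟩ := h
  refine ⟨fun g => c * u g, (SmoothMap.const c).mul h1, fun k hk g => ?_, fun t ht ht' g => ?_,
    fun g X hX => ?_⟩
  · simp only [h2 k hk]
  · simp only [h3 t ht ht']
  · simp only [h4 g X hX, Submodule.coe_smul, Matrix.mul_smul, Matrix.trace_smul, smul_eq_mul]
    ring

theorem isUpper_𝔫 {ζ : C.𝔞} {S : 𝒢.𝔤} (hS : S ∈ C.𝔞)
    (hpos : ∀ β ∈ C.posRestrictedRoots ζ, 0 < β ⟨S, hS⟩) {U : Matrix (Fin n) (Fin n) ℝ}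
    {μ : Fin n → ℝ} (hU : Uᵀ * U = 1)
    (hd : (S : Matrix (Fin n) (Fin n) ℝ) = U * Matrix.diagonal μ * Uᵀ) {X : 𝒢.𝔤}
    (hX : X ∈ C.𝔫 ζ) : IsUpper U μ X := by
  refine 𝔫_induction (p := fun X : 𝒢.𝔤 => IsUpper U μ X) hX (fun β hβ X hX => ?_) ?_
    fun X X' h h' => ?_
  · exact isUpper_of_bracket hU hd (hpos β hβ).le (hX ⟨S, hS⟩)
  · intro i j _; simp
  · exact h.add h'

theorem isUpper_of_comm {S X : Matrix (Fin n) (Fin n) ℝ} {U : Matrix (Fin n) (Fin n) ℝ}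
    {μ : Fin n → ℝ} (hU : Uᵀ * U = 1) (hd : S = U * Matrix.diagonal μ * Uᵀ)
    (hX : X * S = S * X) : IsUpper U μ X :=
  isUpper_of_bracket hU hd le_rfl (by rw [hX, sub_self, zero_smul])

/-- The coordinates come from the principal minors of `gᵀ g` for the flag of spectral subspaces
of `S`, as in the computation of the Iwasawa `A`-component. -/
theorem hasCoordinate_of_pos {ζ : C.𝔞} {S : 𝒢.𝔤} (hS : S ∈ C.𝔞)
    (hpos : ∀ β ∈ C.posRestrictedRoots ζ, 0 < β ⟨S, hS⟩) : C.HasCoordinate ζ S := by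
  obtain ⟨U, μ, hU, hU', hd⟩ := exists_diagonalization (transpose_𝔞 hS)
  let f : ℝ → Fin n → ℝ := fun x i => if x ≤ μ i then 1 else 0
  let f' : ℝ → Fin n → ℝ := fun x i => if x < μ i then 1 else 0
  -- functions which are admissible as indicators of a spectral flag
  let ok : (Fin n → ℝ) → Prop := fun f => (∀ i, f i = 0 ∨ f i = 1) ∧
    (∀ i j, f i = 0 → f j = 1 → μ i < μ j) ∧ ∀ i j, μ i = μ j → f i = f j
  have hf : ∀ x, ok (f x) := by
    refine fun x => ⟨fun i => ?_, fun i j => ?_, fun i j hij => by simp only [f, hij]⟩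
    · simp only [f]; split_ifs <;> simp
    · simp only [f]; split_ifs <;> simp; linarith
  have hf' : ∀ x, ok (f' x) := by
    refine fun x => ⟨fun i => ?_, fun i j => ?_, fun i j hij => by simp only [f', hij]⟩
    · simp only [f']; split_ifs <;> simp
    · simp only [f']; split_ifs <;> simp; linarith
  let v : (Fin n → ℝ) → 𝒢.Grp → ℝ := fun f g => Real.log (corner (specProj U f) (𝒢.mat g)) / 2
  have hPP : ∀ f, ok f → specProj U f * specProj U f = specProj U f := fun f hf => by
    rw [specProj_mul hU]
    congr 1
    ext i
    rcases hf.1 i with h | h <;> simp [h]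
  have hne : ∀ f, ok f → ∀ g, corner (specProj U f) (𝒢.mat g) ≠ 0 := fun f hf g =>
    corner_ne_zero (specProj_transpose f) (hPP f hf) (isUnit_det_mat g)
  have v1 : ∀ f, ok f → SmoothMap (v f) := fun f hf => by
    have := (smoothMap_corner (𝒢 := 𝒢) (specProj U f)).comp (F := Real.log)
      fun g => Real.contDiffAt_log.2 (hne f hf g)
    simpa only [v, div_eq_mul_inv] using this.mul (SmoothMap.const (2 : ℝ)⁻¹)
  have v2 : ∀ f, ∀ k ∈ 𝒢.K, ∀ g, v f (k * g) = v f g := fun f k hk g => by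
    simp only [v, mat_mul]
    rw [corner_mul_left hk]
  have v3 : ∀ f, ok f → ∀ t ∈ 𝒢.K, t ∈ C.ZA → ∀ g, v f (g * t) = v f g := by
    intro f hf t ht ht' g
    have h1 : 𝒢.mat t * (S : Matrix (Fin n) (Fin n) ℝ) = S * 𝒢.mat t := by
      have h2 := congrArg (fun X : 𝒢.𝔤 => (X : Matrix (Fin n) (Fin n) ℝ) * 𝒢.mat t) (ht' S hS)
      simpa [coe_Ad, mul_assoc] using h2
    simp only [v, mat_mul]
    rw [corner_mul_right ht (specProj_comm hU hU' hd h1 hf.2.2) (specProj_transpose f)]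
  have v4 : ∀ f, ok f → ∀ g X, (X ∈ C.𝔞 ∨ X ∈ C.𝔪 ∨ X ∈ C.𝔫 ζ) → v f (g * 𝒢.expG X) =
      v f g + ((X : Matrix (Fin n) (Fin n) ℝ) * specProj U f).trace := by
    intro f hf g X hX
    have hup : IsUpper U μ X := by
      rcases hX with hX | hX | hX
      · exact isUpper_of_comm hU hd (C.𝔥_comm hX.1 hS.1)
      · exact isUpper_of_comm hU hd (hX S hS).1
      · exact isUpper_𝔫 hS hpos hU hd hX
    simp only [v, mat_mul, mat_expG]
    rw [corner_mul_exp (specProj_transpose f) (hup.specProj_mul_mul hU' hf.1 hf.2.1),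
      Real.log_mul (hne f hf g) (Real.exp_ne_zero _), Real.log_exp]
    ring
  refine ⟨fun g => ∑ x ∈ Finset.univ.image μ, x * (v (f x) g + -1 * v (f' x) g),
    SmoothMap.sum fun x _ => (SmoothMap.const x).mul
      ((v1 _ (hf x)).add ((SmoothMap.const _).mul (v1 _ (hf' x)))), fun k hk g => ?_,
    fun t ht ht' g => ?_, fun g X hX => ?_⟩
  · simp only [v2 _ k hk]
  · exact Finset.sum_congr rfl fun x _ => by rw [v3 _ (hf x) t ht ht', v3 _ (hf' x) t ht ht']
  · have h1 : ((X : Matrix (Fin n) (Fin n) ℝ) * (S : Matrix (Fin n) (Fin n) ℝ)).trace =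
        ∑ x ∈ Finset.univ.image μ, x * (((X : Matrix (Fin n) (Fin n) ℝ) * specProj U (f x)).trace -
          ((X : Matrix (Fin n) (Fin n) ℝ) * specProj U (f' x)).trace) := by
      have hS' : (S : Matrix (Fin n) (Fin n) ℝ) = specProj U μ := hd
      simp only [hS', trace_mul_specProj, ← Finset.sum_sub_distrib, ← mul_sub, Finset.mul_sum]
      rw [Finset.sum_comm]
      refine Finset.sum_congr rfl fun i _ => ?_
      rw [Finset.sum_eq_single (μ i)]
      · simp [f, f']; ring
      · intro x _ hx
        rcases lt_or_gt_of_ne hx with h | h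
        · simp [f, f', h, h.le]
        · simp [f, f', not_le.2 h, not_lt.2 h.le]
      · intro h
        exact absurd (Finset.mem_image_of_mem μ (Finset.mem_univ i)) h
    rw [h1, ← Finset.sum_add_distrib]
    refine Finset.sum_congr rfl fun x _ => ?_
    rw [v4 _ (hf x) g X hX, v4 _ (hf' x) g X hX]
    ring

theorem finite_restrictedRoots : C.restrictedRoots.Finite := by
  have h : ∀ β : C.restrictedRoots, ∃ Z : 𝒢.𝔤, Z ∈ C.restrictedRootSpace β ∧ Z ≠ 0 := fun β =>
    Submodule.exists_mem_ne_zero_of_ne_bot β.2.2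
  choose e he h0 using h
  have hinj : ∀ X : 𝒢.𝔤, 𝒢.toℂ X = 0 → X = 0 := fun X hX => by
    ext i j
    have := congrArg (fun Z : 𝒢.𝔤ℂ => (Z : Matrix (Fin n) (Fin n) ℂ) i j) hX
    exact Complex.ofReal_injective this
  have := (linearIndependent_of_trace (fun β => 𝒢.toℂ (e β))
    (fun β hβ => h0 β (hinj _ hβ)) fun β β' hne => ?_).finite
  · exact Set.toFinite _
  obtain ⟨Y, hY⟩ : ∃ Y, (β : C.𝔞 →ₗ[ℝ] ℝ) Y ≠ (β' : C.𝔞 →ₗ[ℝ] ℝ) Y := by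
    by_contra! h
    exact hne (Subtype.ext (LinearMap.ext h))
  have h1 : (((e β : 𝒢.𝔤) : Matrix (Fin n) (Fin n) ℝ)ᴴ *
      ((e β' : 𝒢.𝔤) : Matrix (Fin n) (Fin n) ℝ)).trace = 0 := by
    refine trace_eq_zero_of_comm (Y := (Y : 𝒢.𝔤)) (d := (β : C.𝔞 →ₗ[ℝ] ℝ) Y) ?_ (he β' Y)
      (by simpa using hY)
    rw [Matrix.conjTranspose_eq_transpose_of_trivial, transpose_𝔞 Y.2]
    exact he β Y
  have h2 : (𝒢.toℂ (e β) : Matrix (Fin n) (Fin n) ℂ)ᴴ * (𝒢.toℂ (e β') : Matrix (Fin n) (Fin n) ℂ) =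
      (((e β : 𝒢.𝔤) : Matrix (Fin n) (Fin n) ℝ)ᴴ *
        ((e β' : 𝒢.𝔤) : Matrix (Fin n) (Fin n) ℝ)).map Complex.ofReal := by
    rw [map_ofReal_mul,
      Matrix.conjTranspose_eq_transpose_of_trivial (e β : Matrix (Fin n) (Fin n) ℝ),
      ← conjTranspose_map_ofReal]
    rfl
  rw [h2]
  have h3 := congrArg Complex.ofReal h1
  simpa [Matrix.trace] using h3

/-- The elements of `𝔞` on which all positive restricted roots are positive form an open cone,
so that they span `𝔞`. -/
theorem exists_pos_add_smul (ζ W : C.𝔞) :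
    ∀ᶠ ε in 𝓝 (0 : ℝ), ∀ β ∈ C.posRestrictedRoots ζ, 0 < β (ζ + ε • W) := by
  refine (Set.Finite.eventually_all (finite_restrictedRoots.subset fun β hβ => hβ.1)).2
    fun β hβ => ?_
  have h1 : Continuous fun ε : ℝ => β (ζ + ε • W) := by
    simp only [map_add, map_smul, smul_eq_mul]
    fun_prop
  have h2 := h1.tendsto 0
  simp only [zero_smul, add_zero] at h2
  exact h2.eventually (lt_mem_nhds hβ.2)

theorem hasCoordinate {ζ : C.𝔞} (W : C.𝔞) : C.HasCoordinate ζ W := by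
  -- `W` is a multiple of a difference of two elements of the positive chamber
  obtain ⟨ε, hε, hε0⟩ : ∃ ε : ℝ, (∀ β ∈ C.posRestrictedRoots ζ, 0 < β (ζ + ε • W)) ∧ ε ≠ 0 := by
    have h1 := ((exists_pos_add_smul ζ W).filter_mono nhdsWithin_le_nhds).and
      (self_mem_nhdsWithin (s := {0}ᶜ) (a := (0 : ℝ)))
    exact h1.exists
  have h1 := hasCoordinate_of_pos (ζ + ε • W : C.𝔞).2 hε
  have h2 := hasCoordinate_of_pos (ζ := ζ) ζ.2 fun β hβ => hβ.2
  have h3 := (h1.add (h2.smul (-1))).smul ε⁻¹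
  convert h3 using 1
  rw [Submodule.coe_add, Submodule.coe_smul, neg_one_smul ℝ (ζ : 𝒢.𝔤), add_neg_cancel_comm,
    smul_smul,
    inv_mul_cancel₀ hε0, one_smul]

/-- The projection of `G` to `𝔞`, in coordinates given by a linear map to `𝔞`. -/
theorem exists_projection (ζ : C.𝔞) : ∃ (m : ℕ) (u : 𝒢.Grp → Fin m → ℝ)
    (L : (Fin m → ℝ) →ₗ[ℝ] C.𝔞), SmoothMap u ∧ L (u 1) = 0 ∧
      (∀ k ∈ 𝒢.K, ∀ g, L (u (k * g)) = L (u g)) ∧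
      (∀ t ∈ 𝒢.K, t ∈ C.ZA → ∀ g, L (u (g * t)) = L (u g)) ∧
      (∀ g X, (X ∈ C.𝔪 ∨ X ∈ C.𝔫 ζ) → L (u (g * 𝒢.expG X)) = L (u g)) ∧
      ∀ g (W : C.𝔞), L (u (g * 𝒢.expG W)) = L (u g) + W := by
  have _ : Module.Free ℝ C.𝔞 := Module.Free.of_divisionRing ℝ C.𝔞
  have _ : Module.Finite ℝ C.𝔞 := FiniteDimensional.finiteDimensional_submodule _
  let b := Module.finBasis ℝ C.𝔞
  choose u u1 u2 u3 u4 using fun i => hasCoordinate (ζ := ζ) (b i)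
  -- `φ` is injective since the trace form is positive definite on `𝔞`
  let φ : C.𝔞 →ₗ[ℝ] (Fin (Module.finrank ℝ C.𝔞) → ℝ) := LinearMap.pi fun i =>
    Matrix.traceLinearMap (Fin n) ℝ ℝ ∘ₗ LinearMap.mulRight ℝ (((b i : C.𝔞) : 𝒢.𝔤) :
      Matrix (Fin n) (Fin n) ℝ) ∘ₗ 𝒢.𝔤.subtype ∘ₗ C.𝔞.subtype
  have hφ : ∀ W i, φ W i = ((((W : C.𝔞) : 𝒢.𝔤) : Matrix (Fin n) (Fin n) ℝ) *
      (((b i : C.𝔞) : 𝒢.𝔤) : Matrix (Fin n) (Fin n) ℝ)).trace := fun _ _ => rfl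
  have hinj : LinearMap.ker φ = ⊥ := by
    refine LinearMap.ker_eq_bot'.2 fun W hW => ?_
    refine Subtype.ext (C.eq_zero_of_trace_𝔞 W.2 ?_)
    let f : C.𝔞 →ₗ[ℝ] ℝ := Matrix.traceLinearMap (Fin n) ℝ ℝ ∘ₗ LinearMap.mulLeft ℝ
      ((W : 𝒢.𝔤) : Matrix (Fin n) (Fin n) ℝ) ∘ₗ 𝒢.𝔤.subtype ∘ₗ C.𝔞.subtype
    have hf : f = 0 := b.ext fun i => congrFun hW i
    exact LinearMap.congr_fun hf W
  obtain ⟨e, he⟩ :=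
    LinearMap.exists_leftInverse_of_injective (V := C.𝔞) (K := ℝ) φ hinj
  -- the constants normalise the value at `1`
  refine ⟨_, fun g i => u i g + -u i 1, e,
    SmoothMap.pi fun i => (u1 i).add (SmoothMap.const _), ?_, fun k hk g => ?_,
    fun t ht ht' g => ?_, fun g X hX => ?_, fun g W => ?_⟩
  · have : (fun i => u i 1 + -u i 1) = 0 := by ext i; simp
    exact (congrArg e this).trans (map_zero e)
  · simp only [u2 _ k hk]
  · simp only [u3 _ t ht ht']
  · have h0 : ∀ i, ((X : Matrix (Fin n) (Fin n) ℝ) *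
        (((b i : C.𝔞) : 𝒢.𝔤) : Matrix (Fin n) (Fin n) ℝ)).trace = 0 := by
      intro i
      rcases hX with hX | hX
      · exact (hX _ (b i).2).2
      · rw [Matrix.trace_mul_comm]
        exact trace_comm_𝔫 (fun W hW => C.𝔥_comm (b i).2.1 hW.1) hX
    have h1 : ∀ i, u i (g * 𝒢.expG X) = u i g := fun i => by
      rw [u4 i g X (Or.inr hX), h0, add_zero]
    simp only [h1]
  · have h1 : ∀ i, u i (g * 𝒢.expG W) = u i g + φ W i := fun i => by
      rw [u4 i g W (Or.inl W.2), hφ]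
    have h2 : (fun i => u i (g * 𝒢.expG W) + -u i 1) = (fun i => u i g + -u i 1) + φ W := by
      ext i
      rw [h1, Pi.add_apply]; ring
    refine (congrArg e h2).trans ((map_add e _ _).trans ?_)
    exact congrArg _ (LinearMap.congr_fun he W)

end CartanSubalgebra

/-! ### Local parametrisations of `G` -/

section Local

attribute [local instance] Matrix.linftyOpNormedRing Matrix.linftyOpNormedAlgebra

variable {n : ℕ} {𝒢 : LinearReductiveGroup n} {V : Type*} [NormedAddCommGroup V]
  [NormedSpace ℝ V] {f : V → Matrix (Fin n) (Fin n) ℝ}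
  {f' : V →L[ℝ] Matrix (Fin n) (Fin n) ℝ}

/-- A map to `G` whose derivative at `0` is onto `𝔤` has a neighbourhood of `f 0 = 1` as image. -/
theorem eventually_mem_range_of_surjective [CompleteSpace V] (h0 : f 0 = 1)
    (hf : HasStrictFDerivAt f f' 0)
    (hG : ∀ v, ∃ g : 𝒢.Grp, 𝒢.mat g = f v) (hs : ∀ X ∈ 𝒢.𝔤, ∃ v, f' v = X) :
    ∀ᶠ g in 𝓝 (1 : 𝒢.Grp), ∃ v, f v = 𝒢.mat g := by
  obtain ⟨lg, h1, -, h2, h3, -⟩ := exists_local_log (Matrix (Fin n) (Fin n) ℝ)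
  have hcl := eventually_mem_of_expGL_mem 𝒢.toSubgroup 𝒢.isClosed 𝒢.𝔤 fun X => Iff.rfl
  -- coordinates of the logarithm; `p` extends them from `𝔤` to all matrices
  let B := Module.finBasis ℝ 𝒢.𝔤
  obtain ⟨p, hp⟩ := B.equivFun.toLinearMap.exists_extend
  have hp' : ∀ X : 𝒢.𝔤, p X = B.equivFun X := fun X => LinearMap.congr_fun hp X
  let p' := LinearMap.toContinuousLinearMap p
  let F : V → Fin (Module.finrank ℝ 𝒢.𝔤) → ℝ := fun v => p' (lg (f v))
  have hlf : HasStrictFDerivAt (fun v => lg (f v)) f' 0 := by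
    have : HasStrictFDerivAt lg (ContinuousLinearMap.id ℝ _) (f 0) := by rw [h0]; exact h2
    exact this.comp (0 : V) hf
  have hF : HasStrictFDerivAt F (p'.comp f') 0 := p'.hasStrictFDerivAt.comp (0 : V) hlf
  have hF0 : F 0 = 0 := by simp [F, h0, h1]
  have hsurj : (p'.comp f').range = ⊤ := by
    refine LinearMap.range_eq_top.2 fun c => ?_
    obtain ⟨v, hv⟩ := hs (B.equivFun.symm c : 𝒢.𝔤) (B.equivFun.symm c : 𝒢.𝔤).2
    refine ⟨v, ?_⟩
    change p (f' v) = c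
    rw [hv, hp', LinearEquiv.apply_symm_apply]
  have hmap := hF.map_nhds_eq_of_surj hsurj
  rw [hF0] at hmap
  have hlc : Tendsto (fun v => lg (f v)) (𝓝 0) (𝓝 0) := by
    have := hlf.continuousAt.tendsto
    rwa [h0, h1] at this
  have hfc : Tendsto f (𝓝 0) (𝓝 1) := by
    have := hf.continuousAt.tendsto
    rwa [h0] at this
  have hW : {v | NormedSpace.exp (lg (f v)) = f v ∧ lg (f v) ∈ 𝒢.𝔤} ∈ 𝓝 (0 : V) := by
    filter_upwards [hfc.eventually h3, hlc.eventually hcl] with v hv hv'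
    refine ⟨hv, hv' ?_⟩
    obtain ⟨g, hg⟩ := hG v
    have he : expGL (lg (f v)) = (g : GL (Fin n) ℝ) := by
      ext1; exact hv.trans hg.symm
    rw [he]; exact g.2
  have hU : p ⁻¹' (F '' {v | NormedSpace.exp (lg (f v)) = f v ∧ lg (f v) ∈ 𝒢.𝔤}) ∈
      𝓝 (0 : Matrix (Fin n) (Fin n) ℝ) := by
    have hpc : Tendsto p (𝓝 0) (𝓝 0) := by
      have := p'.continuous.tendsto 0
      rwa [map_zero] at this
    refine hpc ?_
    rw [← hmap]
    exact image_mem_map hW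
  filter_upwards [eventually_exists_expG (𝒢 := 𝒢) hU]
  rintro g ⟨X, ⟨v, ⟨hv, hv'⟩, hvX⟩, rfl⟩
  refine ⟨v, ?_⟩
  have h4 : B.equivFun ⟨_, hv'⟩ = B.equivFun X := by
    rw [← hp', ← hp']; exact hvX
  have h5 := congrArg (Subtype.val) (B.equivFun.injective h4)
  rw [mat_expG, ← hv, ← h5]

/-- The derivative of a map to `G` has values in `𝔤`. -/
theorem fderiv_mem (h0 : f 0 = 1) (hf : HasStrictFDerivAt f f' 0)
    (hG : ∀ v, ∃ g : 𝒢.Grp, 𝒢.mat g = f v) (v : V) : f' v ∈ 𝒢.𝔤 := by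
  obtain ⟨lg, h1, -, h2, h3, -⟩ := exists_local_log (Matrix (Fin n) (Fin n) ℝ)
  have hcl := eventually_mem_of_expGL_mem 𝒢.toSubgroup 𝒢.isClosed 𝒢.𝔤 fun X => Iff.rfl
  have hlf : HasStrictFDerivAt (fun v => lg (f v)) f' ((0 : ℝ) • v) := by
    have : HasStrictFDerivAt lg (ContinuousLinearMap.id ℝ _) (f 0) := by rw [h0]; exact h2
    rw [zero_smul]
    exact this.comp (0 : V) hf
  have hd : HasDerivAt (fun t : ℝ => lg (f (t • v))) (f' v) 0 := by
    have h4 : HasDerivAt (fun t : ℝ => t • v) v 0 := by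
      simpa using (hasDerivAt_id (0 : ℝ)).smul_const v
    exact hlf.hasFDerivAt.comp_hasDerivAt (0 : ℝ) h4
  have h5 := hd.tendsto_slope_zero
  have hsv : Tendsto (fun t : ℝ => t • v) (𝓝[≠] 0) (𝓝 0) := by
    have : Continuous fun t : ℝ => t • v := by fun_prop
    have := this.tendsto 0
    rw [zero_smul] at this
    exact this.mono_left nhdsWithin_le_nhds
  have hlc : Tendsto (fun v => lg (f v)) (𝓝 0) (𝓝 0) := by
    have := hlf.continuousAt.tendsto
    rwa [zero_smul, h0, h1] at this
  have hfc : Tendsto f (𝓝 0) (𝓝 1) := by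
    have := hf.continuousAt.tendsto
    rwa [h0] at this
  refine isClosed_𝔤.mem_of_tendsto h5 ?_
  filter_upwards [(hfc.comp hsv).eventually h3, (hlc.comp hsv).eventually hcl] with t ht ht'
  simp only [Function.comp, zero_add, zero_smul, h0, h1, sub_zero] at ht ht' ⊢
  refine Submodule.smul_mem _ _ (ht' ?_)
  obtain ⟨g, hg⟩ := hG (t • v)
  have he : expGL (lg (f (t • v))) = (g : GL (Fin n) ℝ) := by
    ext1; exact ht.trans hg.symm
  rw [he]; exact g.2

/-- A map to `G` with injective derivative at `0`, from a space of dimension `dim G`, has a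
neighbourhood of `f 0 = 1` as image. -/
theorem eventually_mem_range_of_injective [FiniteDimensional ℝ V] (h0 : f 0 = 1)
    (hf : HasStrictFDerivAt f f' 0) (hG : ∀ v, ∃ g : 𝒢.Grp, 𝒢.mat g = f v)
    (hi : ∀ v, f' v = 0 → v = 0) (hd : Module.finrank ℝ V = Module.finrank ℝ 𝒢.𝔤) :
    ∀ᶠ g in 𝓝 (1 : 𝒢.Grp), ∃ v, f v = 𝒢.mat g := by
  have := FiniteDimensional.complete ℝ V
  refine eventually_mem_range_of_surjective h0 hf hG ?_
  let φ : V →ₗ[ℝ] 𝒢.𝔤 := f'.toLinearMap.codRestrict 𝒢.𝔤 fun v => fderiv_mem h0 hf hG v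
  have hφ : Function.Injective φ := LinearMap.ker_eq_bot.1 (LinearMap.ker_eq_bot'.2 fun v hv =>
    hi v (congrArg Subtype.val hv))
  have hφ' := (LinearMap.injective_iff_surjective_of_finrank_eq_finrank hd).1 hφ
  intro X hX
  obtain ⟨v, hv⟩ := hφ' ⟨X, hX⟩
  exact ⟨v, congrArg Subtype.val hv⟩

end Local

/-! ### The polar decomposition `G = K exp 𝔰` -/

section Symmetric

variable {n : ℕ} {U S A X : Matrix (Fin n) (Fin n) ℝ} {μ : Fin n → ℝ}

theorem exp_diagonalized (hU : Uᵀ * U = 1) (hU' : U * Uᵀ = 1)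
    (hS : S = U * Matrix.diagonal μ * Uᵀ) :
    NormedSpace.exp S = U * Matrix.diagonal (fun i => Real.exp (μ i)) * Uᵀ := by
  have h : IsUnit U := ⟨⟨U, Uᵀ, hU', hU⟩, rfl⟩
  have h1 : Uᵀ = U⁻¹ := (Matrix.inv_eq_right_inv hU').symm
  rw [hS, h1, Matrix.exp_conj U _ h, Matrix.exp_diagonal]
  congr 3
  ext i
  rw [Pi.coe_exp, Real.exp_eq_exp_ℝ]

/-- Matrices that commute with the exponential of a symmetric matrix commute with the matrix. -/
theorem comm_of_comm_exp (hS : Sᵀ = S)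
    (h : A * NormedSpace.exp S = NormedSpace.exp S * A) : A * S = S * A := by
  obtain ⟨U, μ, hU, hU', hd⟩ := exists_diagonalization hS
  have h1 := specProj_comm (f := μ) hU hU' (exp_diagonalized hU hU' hd) h fun i j hij =>
    Real.exp_injective hij
  rwa [specProj, ← hd] at h1

theorem transpose_exp_of_symm (hS : Sᵀ = S) : (NormedSpace.exp S)ᵀ = NormedSpace.exp S := by
  rw [← Matrix.exp_transpose, hS]

theorem exp_mul_exp_neg (S : Matrix (Fin n) (Fin n) ℝ) :
    NormedSpace.exp S * NormedSpace.exp (-S) = 1 := (expGL S).val_inv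

theorem exp_neg_mul_exp (S : Matrix (Fin n) (Fin n) ℝ) :
    NormedSpace.exp (-S) * NormedSpace.exp S = 1 := (expGL S).inv_val

theorem exp_two_smul (S : Matrix (Fin n) (Fin n) ℝ) :
    NormedSpace.exp ((2 : ℝ) • S) = NormedSpace.exp S * NormedSpace.exp S := by
  rw [two_smul, Matrix.exp_add_of_commute _ _ (Commute.refl S)]

theorem eq_zero_of_trace_transpose_mul_self (h : (Aᵀ * A).trace = 0) : A = 0 :=
  Matrix.trace_conjTranspose_mul_self_eq_zero_iff.1
    (by rwa [Matrix.conjTranspose_eq_transpose_of_trivial])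

theorem trace_transpose_mul_self_nonneg (A : Matrix (Fin n) (Fin n) ℝ) :
    0 ≤ (Aᵀ * A).trace := by
  simp only [Matrix.trace, Matrix.diag_apply, Matrix.mul_apply, Matrix.transpose_apply]
  exact Finset.sum_nonneg fun i _ => Finset.sum_nonneg fun j _ => mul_self_nonneg (A j i)

/-- The equation `e^S A + A e^S = 0` has only the zero solution, as `e^S` is positive. -/
theorem eq_zero_of_exp_anticomm (hS : Sᵀ = S)
    (h : NormedSpace.exp S * A + A * NormedSpace.exp S = 0) : A = 0 := by
  set R := NormedSpace.exp ((2 : ℝ)⁻¹ • S) with hR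
  have hRR : NormedSpace.exp S = R * R := by
    rw [hR, ← exp_two_smul, smul_smul]; norm_num
  have hRT : Rᵀ = R := transpose_exp_of_symm (by rw [Matrix.transpose_smul, hS])
  have h1 : ((R * A)ᵀ * (R * A)).trace + ((A * R)ᵀ * (A * R)).trace = 0 := by
    have h2 : (Aᵀ * (NormedSpace.exp S * A + A * NormedSpace.exp S)).trace = 0 := by
      rw [h]; simp
    rw [← h2, hRR, mul_add, Matrix.trace_add, Matrix.transpose_mul, Matrix.transpose_mul, hRT]
    congr 1
    · simp only [mul_assoc]
    · rw [Matrix.trace_mul_comm (R * Aᵀ), ← mul_assoc, Matrix.trace_mul_comm]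
      simp only [mul_assoc]
  have h3 := trace_transpose_mul_self_nonneg (R * A)
  have h4 := trace_transpose_mul_self_nonneg (A * R)
  have h5 := eq_zero_of_trace_transpose_mul_self (A := R * A) (by linarith)
  calc A = NormedSpace.exp (-((2 : ℝ)⁻¹ • S)) * (R * A) := by
        rw [← mul_assoc, hR, exp_neg_mul_exp, one_mul]
    _ = 0 := by rw [h5, mul_zero]

theorem trace_mul_self_le (hS : Sᵀ = S) :
    (S * S).trace ≤ (NormedSpace.exp ((2 : ℝ) • S) + NormedSpace.exp (-((2 : ℝ) • S))).trace := by
  obtain ⟨U, μ, hU, hU', hd⟩ := exists_diagonalization hS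
  have htr : ∀ f : Fin n → ℝ, (U * Matrix.diagonal f * Uᵀ).trace = ∑ i, f i := fun f => by
    rw [Matrix.trace_mul_comm, ← mul_assoc, hU, one_mul, Matrix.trace_diagonal]
  have h2 : (2 : ℝ) • S = U * Matrix.diagonal (fun i => 2 * μ i) * Uᵀ := by
    rw [hd, ← Matrix.smul_mul, ← Matrix.mul_smul, ← Matrix.diagonal_smul]
    rfl
  have h3 : -((2 : ℝ) • S) = U * Matrix.diagonal (fun i => -(2 * μ i)) * Uᵀ := by
    rw [h2, ← neg_mul, ← mul_neg, Matrix.diagonal_neg]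
  have h4 : S * S = U * Matrix.diagonal (fun i => μ i * μ i) * Uᵀ := by
    have := specProj_mul hU μ μ
    rw [specProj, ← hd] at this
    exact this
  rw [Matrix.trace_add, exp_diagonalized hU hU' h2, exp_diagonalized hU hU' h3, h4, htr, htr, htr,
    ← Finset.sum_add_distrib]
  refine Finset.sum_le_sum fun i _ => ?_
  have h5 : ∀ x : ℝ, 0 ≤ x → x * x ≤ Real.exp (2 * x) := fun x hx => by
    have h6 : x ≤ Real.exp x := by linarith [Real.add_one_le_exp x]
    rw [two_mul, Real.exp_add]
    exact mul_le_mul h6 h6 hx (Real.exp_pos _).le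
  rcases le_total 0 (μ i) with h | h
  · linarith [h5 _ h, Real.exp_pos (-(2 * μ i))]
  · have := h5 (-μ i) (by linarith)
    rw [neg_mul_neg, mul_neg] at this
    linarith [Real.exp_pos (2 * μ i)]

end Symmetric

section Derivative

attribute [local instance] Matrix.linftyOpNormedRing Matrix.linftyOpNormedAlgebra

variable {n : ℕ} {S₀ S A : Matrix (Fin n) (Fin n) ℝ}

theorem hasStrictFDerivAt_matrix_exp (S₀ : Matrix (Fin n) (Fin n) ℝ) :
    HasStrictFDerivAt (NormedSpace.exp : Matrix (Fin n) (Fin n) ℝ → _)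
      (fderiv ℝ NormedSpace.exp S₀) S₀ :=
  (NormedSpace.exp_analytic (𝕂 := ℝ) S₀).hasStrictFDerivAt

theorem hasDerivAt_exp_line (S₀ S : Matrix (Fin n) (Fin n) ℝ) :
    HasDerivAt (fun t : ℝ => NormedSpace.exp (S₀ + t • S)) (fderiv ℝ NormedSpace.exp S₀ S) 0 := by
  have h1 : HasDerivAt (fun t : ℝ => S₀ + t • S) S 0 := by
    have h0 := (hasDerivAt_id (0 : ℝ)).smul_const S
    rw [one_smul] at h0
    exact h0.const_add S₀
  have h2 : HasFDerivAt (NormedSpace.exp : Matrix (Fin n) (Fin n) ℝ → _)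
      (fderiv ℝ NormedSpace.exp S₀) (S₀ + (0 : ℝ) • S) := by
    rw [zero_smul, add_zero]
    exact (hasStrictFDerivAt_matrix_exp S₀).hasFDerivAt
  exact h2.comp_hasDerivAt (0 : ℝ) h1

theorem transpose_fderiv_exp (hS₀ : S₀ᵀ = S₀) (hS : Sᵀ = S) :
    (fderiv ℝ NormedSpace.exp S₀ S)ᵀ = fderiv ℝ NormedSpace.exp S₀ S := by
  have h1 := hasDerivAt_exp_line S₀ S
  have h2 := (LinearMap.toContinuousLinearMap
    (Matrix.transposeLinearEquiv (Fin n) (Fin n) ℝ ℝ).toLinearMap).hasFDerivAt.comp_hasDerivAt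
      (0 : ℝ) h1
  refine h2.unique (h1.congr_of_eventuallyEq (Eventually.of_forall fun t => ?_))
  exact transpose_exp_of_symm (by simp [hS₀, hS])

/-- The exponential map is injective to first order on symmetric matrices. -/
theorem eq_zero_of_fderiv_exp (hS₀ : S₀ᵀ = S₀) (h : fderiv ℝ NormedSpace.exp S₀ S = 0) : S = 0 := by
  have h1 := hasDerivAt_exp_line S₀ S
  rw [h] at h1
  have hl : HasDerivAt (fun t : ℝ => S₀ + t • S) S 0 := by
    have h0 := (hasDerivAt_id (0 : ℝ)).smul_const S
    rw [one_smul] at h0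
    exact h0.const_add S₀
  have hcomm : S * NormedSpace.exp S₀ = NormedSpace.exp S₀ * S := by
    have h2 := h1.mul hl
    have h3 := hl.mul h1
    simp only [zero_smul, add_zero, zero_mul, mul_zero, zero_add] at h2 h3
    refine h3.unique (h2.congr_of_eventuallyEq (Eventually.of_forall fun t => ?_))
    let _ : NormedAlgebra ℚ (Matrix (Fin n) (Fin n) ℝ) := NormedAlgebra.restrictScalars ℚ ℝ _
    exact ((Commute.refl (S₀ + t • S)).exp_right).eq
  have hc := comm_of_comm_exp hS₀ hcomm
  have h4 : HasDerivAt (fun t : ℝ => NormedSpace.exp (S₀ + t • S)) (NormedSpace.exp S₀ * S) 0 := by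
    have h5 := (hasDerivAt_exp_smul_const (𝕂 := ℝ) S (0 : ℝ)).const_mul (NormedSpace.exp S₀)
    simp only [zero_smul, NormedSpace.exp_zero, one_mul] at h5
    refine h5.congr_of_eventuallyEq (Eventually.of_forall fun t => ?_)
    exact Matrix.exp_add_of_commute _ _ ((show Commute S₀ S from hc.symm).smul_right t)
  have h6 := h4.unique h1
  calc S = NormedSpace.exp (-S₀) * (NormedSpace.exp S₀ * S) := by
        rw [← mul_assoc, exp_neg_mul_exp, one_mul]
    _ = 0 := by rw [h6, mul_zero]

end Derivative

namespace LinearReductiveGroup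

variable {n : ℕ} {𝒢 : LinearReductiveGroup n}

theorem isEmbedding_mat : IsEmbedding 𝒢.mat :=
  (isEmbedding_GL_val n).comp IsEmbedding.subtypeVal

theorem continuous_mat : Continuous 𝒢.mat := isEmbedding_mat.continuous

theorem isClosed_of_mat {s : Set (Matrix (Fin n) (Fin n) ℝ)} (hs : IsClosed s) :
    IsClosed {g : 𝒢.Grp | 𝒢.mat g ∈ s} := hs.preimage continuous_mat

instance : ConnectedSpace 𝒢.Grp := isConnected_iff_connectedSpace.1 𝒢.isConnected

theorem mat_inv_of_mem_K {k : 𝒢.Grp} (hk : k ∈ 𝒢.K) : 𝒢.mat k⁻¹ = (𝒢.mat k)ᵀ := by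
  calc 𝒢.mat k⁻¹ = ((𝒢.mat k)ᵀ * 𝒢.mat k) * 𝒢.mat k⁻¹ := by
        rw [show (𝒢.mat k)ᵀ * 𝒢.mat k = 1 from hk, one_mul]
    _ = _ := by rw [mul_assoc, mat_mul_mat_inv, mul_one]

theorem isCompact_orthogonal :
    IsCompact {A : Matrix (Fin n) (Fin n) ℝ | Aᵀ * A = 1} := by
  have hcl : IsClosed {A : Matrix (Fin n) (Fin n) ℝ | Aᵀ * A = 1} :=
    isClosed_eq (by fun_prop) continuous_const
  refine IsCompact.of_isClosed_subset (isCompact_univ_pi fun _ : Fin n =>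
    isCompact_univ_pi fun _ : Fin n => isCompact_Icc (a := (-1 : ℝ)) (b := 1)) hcl ?_
  intro A hA i _ j _
  have h1 : (Aᵀ * A) j j = 1 := by
    rw [show Aᵀ * A = 1 from hA, Matrix.one_apply_eq]
  have h2 : A i j * A i j ≤ 1 := by
    rw [← h1, Matrix.mul_apply]
    exact Finset.single_le_sum (f := fun k => Aᵀ j k * A k j) (fun k _ => mul_self_nonneg (A k j))
      (Finset.mem_univ i)
  exact abs_le.1 (abs_le_one_iff_mul_self_le_one.2 h2)

theorem isCompact_K : IsCompact (𝒢.K : Set 𝒢.Grp) := by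
  rw [isEmbedding_mat.isCompact_iff]
  let O := {A : Matrix (Fin n) (Fin n) ℝ | Aᵀ * A = 1}
  have _ : CompactSpace O := isCompact_iff_compactSpace.1 isCompact_orthogonal
  let φ : O → GL (Fin n) ℝ := fun A => ⟨A.1, A.1ᵀ, mul_eq_one_comm.1 A.2, A.2⟩
  have hφ : Continuous φ := (isEmbedding_GL_val n).continuous_iff.2 continuous_subtype_val
  have h1 : IsCompact (φ ⁻¹' (𝒢.toSubgroup : Set (GL (Fin n) ℝ))) :=
    (𝒢.isClosed.preimage hφ).isCompact
  have h2 := h1.image continuous_subtype_val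
  convert h2 using 1
  ext A
  constructor
  · rintro ⟨g, hg, rfl⟩
    refine ⟨⟨𝒢.mat g, hg⟩, ?_, rfl⟩
    have : φ ⟨𝒢.mat g, hg⟩ = (g : GL (Fin n) ℝ) := by ext1; rfl
    rw [Set.mem_preimage, this]
    exact g.2
  · rintro ⟨A, hA, rfl⟩
    exact ⟨⟨φ A, hA⟩, A.2, rfl⟩

/-- The set `K exp 𝔰` is open: at `exp S₀` the map `(A, S) ↦ exp(A) exp(S₀ + S)` from `𝔨 × 𝔰` is
a local diffeomorphism. -/
theorem eventually_polar {S₀ : 𝒢.𝔤} (hS₀ : S₀ ∈ 𝒢.𝔰) :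
    ∀ᶠ g in 𝓝 (1 : 𝒢.Grp), ∃ k ∈ 𝒢.K, ∃ S ∈ 𝒢.𝔰, g * 𝒢.expG S₀ = k * 𝒢.expG S := by
  let _ := Matrix.linftyOpNormedRing (n := Fin n) (α := ℝ)
  let _ := Matrix.linftyOpNormedAlgebra (R := ℝ) (n := Fin n) (α := ℝ)
  let 𝔨' : Submodule ℝ (Matrix (Fin n) (Fin n) ℝ) := 𝒢.𝔨.map 𝒢.𝔤.subtype
  let 𝔰' : Submodule ℝ (Matrix (Fin n) (Fin n) ℝ) := 𝒢.𝔰.map 𝒢.𝔤.subtype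
  let V := 𝔨' × 𝔰'
  let E := (NormedSpace.exp : Matrix (Fin n) (Fin n) ℝ → Matrix (Fin n) (Fin n) ℝ)
  let pA : V →L[ℝ] Matrix (Fin n) (Fin n) ℝ := 𝔨'.subtypeL.comp (ContinuousLinearMap.fst ℝ 𝔨' 𝔰')
  let pS : V →L[ℝ] Matrix (Fin n) (Fin n) ℝ := 𝔰'.subtypeL.comp (ContinuousLinearMap.snd ℝ 𝔨' 𝔰')
  let f : V → Matrix (Fin n) (Fin n) ℝ := fun v => E (pA v) * (E (S₀ + pS v) * E (-S₀))
  have hsym : (S₀ : Matrix (Fin n) (Fin n) ℝ)ᵀ = S₀ := mem_𝔰_iff.1 hS₀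
  have h0 : f 0 = 1 := by
    simp only [f, map_zero, add_zero, E]
    rw [NormedSpace.exp_zero, one_mul, exp_mul_exp_neg]
  have hpA : HasStrictFDerivAt (fun v => E (pA v)) pA 0 := by
    have h1 : HasStrictFDerivAt E (ContinuousLinearMap.id ℝ _) (pA 0) := by
      rw [map_zero]; exact hasStrictFDerivAt_exp_zero
    exact h1.comp (0 : V) pA.hasStrictFDerivAt
  have hpS : HasStrictFDerivAt (fun v => E (S₀ + pS v)) ((fderiv ℝ E S₀).comp pS) 0 := by
    have h1 : HasStrictFDerivAt E (fderiv ℝ E S₀)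
        ((S₀ : Matrix (Fin n) (Fin n) ℝ) + pS 0) := by
      rw [map_zero, add_zero]; exact hasStrictFDerivAt_matrix_exp _
    exact h1.comp (0 : V) (pS.hasStrictFDerivAt.const_add _)
  obtain ⟨f', hf, hval⟩ : ∃ f' : V →L[ℝ] Matrix (Fin n) (Fin n) ℝ, HasStrictFDerivAt f f' 0 ∧
      ∀ v, f' v = pA v + fderiv ℝ E S₀ (pS v) * E (-S₀) := by
    refine ⟨_, hpA.mul' (hpS.mul_const' (E (-S₀))), fun v => ?_⟩
    have e1 : E (pA 0) = 1 := by simp only [map_zero, E]; exact NormedSpace.exp_zero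
    have e2 : E (S₀ + pS 0) * E (-S₀) = 1 := by
      rw [map_zero, add_zero]; exact exp_mul_exp_neg _
    change E (pA 0) * (fderiv ℝ E S₀ (pS v) * E (-S₀)) + pA v * (E (S₀ + pS 0) * E (-S₀)) = _
    rw [e1, e2, one_mul, mul_one, add_comm]
  have hmem : ∀ v : V, ∃ A ∈ 𝒢.𝔨, ∃ S ∈ 𝒢.𝔰, (A : Matrix (Fin n) (Fin n) ℝ) = pA v ∧
      (S : Matrix (Fin n) (Fin n) ℝ) = pS v := by
    rintro ⟨⟨_, A, hA, rfl⟩, ⟨_, S, hS, rfl⟩⟩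
    exact ⟨A, hA, S, hS, rfl, rfl⟩
  have hG : ∀ v, ∃ g : 𝒢.Grp, 𝒢.mat g = f v := by
    intro v
    obtain ⟨A, hA, S, hS, hAv, hSv⟩ := hmem v
    refine ⟨𝒢.expG A * (𝒢.expG (S₀ + S) * 𝒢.expG (-S₀)), ?_⟩
    simp only [mat_mul, mat_expG, f, ← hAv, ← hSv]
    rfl
  -- in the kernel the symmetric derivative `D` of `exp` equals `-A e^S₀` and its transpose
  -- `e^S₀ A`, which forces `A = 0`
  have hinj : ∀ v, f' v = 0 → v = 0 := by
    intro v hv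
    obtain ⟨A, hA, S, hS, hAv, hSv⟩ := hmem v
    rw [hval, ← hAv, ← hSv] at hv
    have hAT := mem_𝔨_iff.1 hA
    have hST := mem_𝔰_iff.1 hS
    set D := fderiv ℝ E S₀ S with hD
    have h1 : D = -((A : Matrix (Fin n) (Fin n) ℝ) * E S₀) := by
      have h2 : (A + D * E (-S₀)) * E S₀ = 0 := by rw [hv, zero_mul]
      rw [add_mul, mul_assoc, exp_neg_mul_exp, mul_one] at h2
      exact eq_neg_of_add_eq_zero_right h2
    have h3 : D = E S₀ * (A : Matrix (Fin n) (Fin n) ℝ) := by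
      have h4 : Dᵀ = D := transpose_fderiv_exp hsym hST
      rw [← h4, h1, Matrix.transpose_neg, Matrix.transpose_mul, hAT, mul_neg, neg_neg]
      rw [transpose_exp_of_symm hsym]
    have hA0 : (A : Matrix (Fin n) (Fin n) ℝ) = 0 :=
      eq_zero_of_exp_anticomm hsym (by rw [← h3, h1, neg_add_cancel])
    have hS0 : (S : Matrix (Fin n) (Fin n) ℝ) = 0 :=
      eq_zero_of_fderiv_exp hsym (h3.trans (by rw [hA0, mul_zero]))
    exact Prod.ext (Subtype.ext (hAv.symm.trans hA0)) (Subtype.ext (hSv.symm.trans hS0))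
  have hdim : Module.finrank ℝ V = Module.finrank ℝ 𝒢.𝔤 := by
    rw [Module.finrank_prod, Submodule.finrank_map_subtype_eq, Submodule.finrank_map_subtype_eq]
    refine Submodule.finrank_add_eq_of_isCompl (IsCompl.of_eq ?_ ?_)
    · refine (Submodule.eq_bot_iff _).2 fun X hX => ?_
      have h1 := mem_𝔨_iff.1 hX.1
      rw [mem_𝔰_iff.1 hX.2, eq_neg_iff_add_eq_zero, ← two_smul ℝ] at h1
      exact Subtype.ext ((smul_eq_zero.1 h1).resolve_left two_ne_zero)
    · refine eq_top_iff.2 fun X _ => ?_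
      have h1 : X = (2 : ℝ)⁻¹ • (X + 𝒢.θ X) + (2 : ℝ)⁻¹ • (X - 𝒢.θ X) := by
        rw [← smul_add, add_add_sub_cancel, ← two_smul ℝ, smul_smul, inv_mul_cancel₀ two_ne_zero,
          one_smul]
      rw [h1]
      refine Submodule.add_mem_sup (Submodule.smul_mem _ _ ?_) (Submodule.smul_mem _ _ ?_)
      · refine mem_𝔨_iff.2 ?_
        simp [coe_θ]
      · refine mem_𝔰_iff.2 ?_
        simp [coe_θ, add_comm]
  filter_upwards [eventually_mem_range_of_injective h0 hf hG hinj hdim] with g hg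
  obtain ⟨v, hv⟩ := hg
  obtain ⟨A, hA, S, hS, hAv, hSv⟩ := hmem v
  refine ⟨𝒢.expG A, CartanSubalgebra.expG_mem_K hA, S₀ + S, add_mem hS₀ hS, mat_injective ?_⟩
  rw [mat_mul, mat_mul, ← hv, mat_expG, mat_expG, mat_expG, Submodule.coe_add, hAv, hSv]
  simp only [f, mul_assoc]
  rw [exp_neg_mul_exp, mul_one]

/-- The polar decomposition `G = K exp 𝔰`: the product set is open and closed, and `G` is
connected. -/
theorem exists_polar (g : 𝒢.Grp) : ∃ k ∈ 𝒢.K, ∃ S ∈ 𝒢.𝔰, g = k * 𝒢.expG S := by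
  let P : Set 𝒢.Grp := {g | ∃ k ∈ 𝒢.K, ∃ S ∈ 𝒢.𝔰, g = k * 𝒢.expG S}
  have hopen : IsOpen P := by
    rw [isOpen_iff_mem_nhds]
    rintro _ ⟨k, hk, S₀, hS₀, rfl⟩
    have hc : Continuous fun g : 𝒢.Grp => k⁻¹ * g * (𝒢.expG S₀)⁻¹ := by fun_prop
    have h1 := hc.tendsto (k * 𝒢.expG S₀)
    have e : k⁻¹ * (k * 𝒢.expG S₀) * (𝒢.expG S₀)⁻¹ = 1 := by group
    rw [e] at h1
    filter_upwards [h1.eventually (eventually_polar hS₀)]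
    rintro g ⟨k', hk', S, hS, h⟩
    refine ⟨k * k', mul_mem hk hk', S, hS, ?_⟩
    rw [mul_assoc, ← h]
    group
  have hclosed : IsClosed P := by
    -- near a given point the factors in `exp 𝔰` stay in a compact set
    refine isClosed_of_closure_subset fun g₀ hg₀ => ?_
    let R : 𝒢.Grp → ℝ := fun g =>
      ((𝒢.mat g)ᵀ * 𝒢.mat g + 𝒢.mat g⁻¹ * (𝒢.mat g⁻¹)ᵀ).trace
    have hR : Continuous R := by
      have h1 := continuous_mat (𝒢 := 𝒢)
      have h2 : Continuous fun g : 𝒢.Grp => 𝒢.mat g⁻¹ := h1.comp continuous_inv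
      fun_prop
    have hRv : ∀ k ∈ 𝒢.K, ∀ S ∈ 𝒢.𝔰, ((S : Matrix (Fin n) (Fin n) ℝ) *
        (S : Matrix (Fin n) (Fin n) ℝ)).trace ≤ R (k * 𝒢.expG S) := by
      intro k hk S hS
      have hST := mem_𝔰_iff.1 hS
      have hST' : (-(S : Matrix (Fin n) (Fin n) ℝ))ᵀ = -(S : Matrix (Fin n) (Fin n) ℝ) := by
        rw [Matrix.transpose_neg, hST]
      refine (trace_mul_self_le hST).trans_eq ?_
      have e1 : (𝒢.mat (k * 𝒢.expG S))ᵀ * 𝒢.mat (k * 𝒢.expG S) =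
          NormedSpace.exp ((2 : ℝ) • (S : Matrix (Fin n) (Fin n) ℝ)) := by
        rw [mat_mul, Matrix.transpose_mul, mul_assoc, ← mul_assoc _ (𝒢.mat k),
          show (𝒢.mat k)ᵀ * 𝒢.mat k = 1 from hk, one_mul, mat_expG, transpose_exp_of_symm hST,
          exp_two_smul]
      have e2 : 𝒢.mat (k * 𝒢.expG S)⁻¹ * (𝒢.mat (k * 𝒢.expG S)⁻¹)ᵀ =
          NormedSpace.exp (-((2 : ℝ) • (S : Matrix (Fin n) (Fin n) ℝ))) := by
        rw [mul_inv_rev, ← expG_neg, mat_mul, mat_inv_of_mem_K hk, Matrix.transpose_mul,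
          Matrix.transpose_transpose, mul_assoc, ← mul_assoc _ (𝒢.mat k),
          show (𝒢.mat k)ᵀ * 𝒢.mat k = 1 from hk, one_mul, mat_expG, Submodule.coe_neg,
          transpose_exp_of_symm hST', ← exp_two_smul, smul_neg]
      simp only [R, e1, e2]
    let r := R g₀ + 1
    let B : Set (Matrix (Fin n) (Fin n) ℝ) := {S | S ∈ 𝒢.𝔤 ∧ Sᵀ = S ∧ (S * S).trace ≤ r}
    have hB : IsCompact B := by
      have hcl : IsClosed B := by
        refine IsClosed.inter isClosed_𝔤 (IsClosed.inter ?_ ?_)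
        · exact isClosed_eq (continuous_id.matrix_transpose) continuous_id
        · exact isClosed_le (continuous_id.matrix_mul continuous_id).matrix_trace continuous_const
      refine IsCompact.of_isClosed_subset (isCompact_univ_pi fun _ : Fin n =>
        isCompact_univ_pi fun _ : Fin n => isCompact_Icc (a := -(r + 1)) (b := r + 1)) hcl ?_
      rintro S ⟨-, hST, hr⟩ i _ j _
      have h1 : S i j * S i j ≤ r := by
        refine le_trans ?_ hr
        have e : (S * S).trace = ∑ i, ∑ j, S i j * S i j := by
          simp only [Matrix.trace, Matrix.diag_apply, Matrix.mul_apply]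
          refine Finset.sum_congr rfl fun i _ => Finset.sum_congr rfl fun j _ => ?_
          rw [← Matrix.transpose_apply S i j, hST]
        rw [e]
        exact (Finset.single_le_sum (f := fun j => S i j * S i j)
          (fun j _ => mul_self_nonneg _) (Finset.mem_univ j)).trans
          (Finset.single_le_sum (f := fun i => ∑ j, S i j * S i j)
            (fun i _ => Finset.sum_nonneg fun j _ => mul_self_nonneg _) (Finset.mem_univ i))
      refine abs_le.1 (abs_le_of_sq_le_sq ?_ ?_) <;> nlinarith [mul_self_nonneg (S i j)]
    have hKB := (isCompact_K (𝒢 := 𝒢).image (continuous_mat (𝒢 := 𝒢))).prod hB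
      |>.image_of_continuousOn
      (f := fun p : Matrix (Fin n) (Fin n) ℝ × Matrix (Fin n) (Fin n) ℝ =>
        p.1 * NormedSpace.exp p.2)
      (Continuous.continuousOn (continuous_fst.mul ((continuous_matrix_exp n).comp continuous_snd)))
    have h1 : g₀ ∈ closure (P ∩ {g | R g < r}) := by
      refine mem_closure_iff_nhds.2 fun s hs => ?_
      have h2 : {g | R g < r} ∈ 𝓝 g₀ := hR.continuousAt.eventually_lt_const (lt_add_one _)
      obtain ⟨g, hg, hgP⟩ := mem_closure_iff_nhds.1 hg₀ _ (inter_mem hs h2)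
      exact ⟨g, hg.1, hgP, hg.2⟩
    have h3 := (hKB.isClosed.preimage continuous_mat).closure_subset_iff.2 (by
      rintro _ ⟨⟨k, hk, S, hS, rfl⟩, hr⟩
      exact ⟨(𝒢.mat k, S), ⟨⟨k, hk, rfl⟩, S.2, mem_𝔰_iff.1 hS,
        (hRv k hk S hS).trans hr.le⟩, rfl⟩) h1
    obtain ⟨⟨_, S⟩, ⟨⟨k, hk, rfl⟩, hS, hST, -⟩, h⟩ := h3
    exact ⟨k, hk, ⟨S, hS⟩, mem_𝔰_iff.2 hST, mat_injective h.symm⟩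
  have h1 : P = Set.univ := IsClopen.eq_univ ⟨hclosed, hopen⟩
    ⟨1, 1, one_mem _, 0, zero_mem _, by rw [expG_zero, mul_one]⟩
  have h2 : g ∈ P := h1 ▸ Set.mem_univ g
  exact h2

end LinearReductiveGroup

/-! ### Polar decomposition of centralisers -/

namespace CartanSubalgebra

variable {n : ℕ} {𝒢 : LinearReductiveGroup n} {C : CartanSubalgebra 𝒢}

theorem mem_fixer_iff {𝔟 : Submodule ℝ 𝒢.𝔤} {g : 𝒢.Grp} :
    g ∈ fixer 𝔟 ↔ ∀ X ∈ 𝔟, 𝒢.mat g * (X : Matrix (Fin n) (Fin n) ℝ) = X * 𝒢.mat g := by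
  refine forall₂_congr fun X _ => ?_
  rw [Subtype.ext_iff, coe_Ad]
  constructor
  · intro h
    calc _ = 𝒢.mat g * X * 𝒢.mat g⁻¹ * 𝒢.mat g := by
          rw [mul_assoc _ _ (𝒢.mat g), mat_inv_mul_mat, mul_one]
      _ = _ := by rw [h]
  · intro h
    rw [h, mul_assoc, mat_mul_mat_inv, mul_one]

/-- The centraliser of a `θ`-stable subspace inherits the polar decomposition: for `g = k e^S` in
it, `gᵀ g = e^{2S}` commutes with the subspace, hence so does its logarithm. -/
theorem exists_polar_fixer {𝔟 : Submodule ℝ 𝒢.𝔤} (hθ : ∀ X ∈ 𝔟, 𝒢.θ X ∈ 𝔟) {g : 𝒢.Grp}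
    (hg : g ∈ fixer 𝔟) : ∃ k ∈ 𝒢.K, k ∈ fixer 𝔟 ∧ ∃ S ∈ 𝒢.𝔰,
      (∀ X ∈ 𝔟, (S : Matrix (Fin n) (Fin n) ℝ) * X = X * S) ∧ g = k * 𝒢.expG S := by
  obtain ⟨k, hk, S, hS, rfl⟩ := exists_polar g
  have hST := mem_𝔰_iff.1 hS
  have h2 : (𝒢.mat (k * 𝒢.expG S))ᵀ * 𝒢.mat (k * 𝒢.expG S) =
      NormedSpace.exp ((2 : ℝ) • (S : Matrix (Fin n) (Fin n) ℝ)) := by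
    rw [mat_mul, Matrix.transpose_mul, mul_assoc, ← mul_assoc _ (𝒢.mat k),
      show (𝒢.mat k)ᵀ * 𝒢.mat k = 1 from hk, one_mul, mat_expG, transpose_exp_of_symm hST,
      exp_two_smul]
  have hcS : ∀ X ∈ 𝔟, (S : Matrix (Fin n) (Fin n) ℝ) * X = X * S := by
    intro X hX
    have h3 := mem_fixer_iff.1 hg X hX
    have h4 : (X : Matrix (Fin n) (Fin n) ℝ) * (𝒢.mat (k * 𝒢.expG S))ᵀ =
        (𝒢.mat (k * 𝒢.expG S))ᵀ * X := by
      have h5 := congrArg Matrix.transpose (mem_fixer_iff.1 hg _ (hθ X hX))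
      simpa [coe_θ] using h5
    have h6 : (X : Matrix (Fin n) (Fin n) ℝ) *
          NormedSpace.exp ((2 : ℝ) • (S : Matrix (Fin n) (Fin n) ℝ)) =
        NormedSpace.exp ((2 : ℝ) • (S : Matrix (Fin n) (Fin n) ℝ)) * X := by
      rw [← h2, ← mul_assoc, h4, mul_assoc, ← h3, mul_assoc]
    have h7 := comm_of_comm_exp (by rw [Matrix.transpose_smul, hST]) h6
    rw [Matrix.mul_smul, Matrix.smul_mul] at h7
    exact (smul_right_injective _ (two_ne_zero (α := ℝ)) h7).symm
  refine ⟨k, hk, ?_, S, hS, hcS, rfl⟩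
  have h8 : 𝒢.expG S ∈ fixer 𝔟 := mem_fixer_iff.2 fun X hX => by
    let _ := Matrix.linftyOpNormedRing (n := Fin n) (α := ℝ)
    let _ := Matrix.linftyOpNormedAlgebra (R := ℝ) (n := Fin n) (α := ℝ)
    let _ : NormedAlgebra ℚ (Matrix (Fin n) (Fin n) ℝ) := NormedAlgebra.restrictScalars ℚ ℝ _
    rw [mat_expG]
    exact (Commute.exp_left (show Commute (S : Matrix (Fin n) (Fin n) ℝ) X from hcS X hX)).eq
  exact (Subgroup.mul_mem_cancel_right _ h8).1 hg

theorem θ_mem_𝔞 {W : 𝒢.𝔤} (hW : W ∈ C.𝔞) : 𝒢.θ W ∈ C.𝔞 := by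
  have h : 𝒢.θ W = -W := by
    ext1
    rw [coe_θ, transpose_𝔞 hW]; rfl
  rw [h]
  exact neg_mem hW

theorem exists_polar_ZA {g : 𝒢.Grp} (hg : g ∈ C.ZA) : ∃ k ∈ 𝒢.K, ∃ X ∈ C.𝔰M, ∃ W ∈ C.𝔞,
    g = k * 𝒢.expG X * 𝒢.expG W := by
  obtain ⟨k, hk, -, S, hS, hcS, rfl⟩ := exists_polar_fixer (fun X hX => θ_mem_𝔞 hX) hg
  obtain ⟨X, hX, W, hW, rfl⟩ := C.exists_𝔪_𝔞 hcS
  refine ⟨k, hk, X, ⟨hX, ?_⟩, W, hW, ?_⟩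
  · have := sub_mem hS hW.2
    rwa [add_sub_cancel_right] at this
  · rw [mul_assoc, ← expG_add_of_comm (hX W hW).1]

theorem exists_polar_H {h : 𝒢.Grp} (hh : h ∈ C.H) : ∃ t ∈ 𝒢.K, t ∈ C.H ∧ ∃ W ∈ C.𝔞,
    h = t * 𝒢.expG W := by
  obtain ⟨k, hk, hk', S, hS, hcS, rfl⟩ := exists_polar_fixer C.θ_mem hh
  exact ⟨k, hk, hk', S, ⟨(C.mem_iff S).2 hcS, hS⟩, rfl⟩

/-! ### A generic element of `𝔞` -/

/-- An element of `𝔞` in the positive chamber whose centraliser in the full matrix algebra is the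
centraliser of `𝔞`. -/
theorem exists_generic (ζ : C.𝔞) : ∃ S₀ : C.𝔞, (∀ β ∈ C.posRestrictedRoots ζ, 0 < β S₀) ∧
    ∀ A : Matrix (Fin n) (Fin n) ℝ, A * (S₀ : 𝒢.𝔤) = (S₀ : 𝒢.𝔤) * A →
      ∀ W : C.𝔞, A * (W : 𝒢.𝔤) = (W : 𝒢.𝔤) * A := by
  let a : C.𝔞 → Matrix (Fin n) (Fin n) ℝ := fun W => (W : 𝒢.𝔤)
  let a' : C.𝔞 →ₗ[ℝ] Matrix (Fin n) (Fin n) ℝ := 𝒢.𝔤.subtype ∘ₗ C.𝔞.subtype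
  have hsymm : ∀ W, (a W)ᴴ = a W := fun W => by
    rw [Matrix.conjTranspose_eq_transpose_of_trivial]; exact transpose_𝔞 W.2
  have hcomm : ∀ W W', a W * a W' = a W' * a W := fun W W' => C.𝔥_comm W.2.1 W'.2.1
  -- `F` is the finite set of nonzero weights of `𝔞` on all matrices; generic means that no
  -- element of `F` vanishes
  let F : Set (C.𝔞 →ₗ[ℝ] ℝ) := {χ | χ ≠ 0 ∧ ∃ Z, Z ≠ 0 ∧ ∀ W, a W * Z - Z * a W = χ W • Z}
  have hF : F.Finite := by
    choose e he0 he using fun χ : F => χ.2.2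
    have hli : LinearIndependent ℝ fun χ : F => vec ℝ n (e χ) := by
      refine linearIndependent_of_ne_zero_of_inner_eq_zero (𝕜 := ℝ)
        (fun χ h => he0 χ (vec_injective ℝ n (h.trans (map_zero _).symm))) fun χ χ' hne => ?_
      obtain ⟨Y, hY⟩ : ∃ Y, (χ : C.𝔞 →ₗ[ℝ] ℝ) Y ≠ (χ' : C.𝔞 →ₗ[ℝ] ℝ) Y := by
        by_contra! h
        exact hne (Subtype.ext (LinearMap.ext h))
      rw [inner_vec]
      refine trace_eq_zero_of_comm (Y := a Y) (d := (χ : C.𝔞 →ₗ[ℝ] ℝ) Y) ?_ (he χ' Y)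
        (by simpa using hY)
      rw [hsymm]; exact he χ Y
    have := hli.finite
    exact Set.toFinite _
  obtain ⟨W₀, hW₀⟩ : ∃ W₀, ∀ χ ∈ F, χ W₀ ≠ 0 := by
    have _ : Finite F := hF
    obtain ⟨W, hW⟩ := Module.Dual.exists_forall_ne_zero_of_forall_exists (K := ℝ) (M := C.𝔞)
      (fun χ : F => (χ : C.𝔞 →ₗ[ℝ] ℝ)) fun χ => by
        by_contra! h
        exact χ.2.1 (LinearMap.ext h)
    exact ⟨W, fun χ hχ => hW ⟨χ, hχ⟩⟩
  have hev : ∀ᶠ ε in 𝓝[≠] (0 : ℝ), ∀ χ ∈ F, χ (ζ + ε • W₀) ≠ 0 := by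
    refine (Set.Finite.eventually_all hF).2 fun χ hχ => ?_
    have e : ∀ ε : ℝ, χ (ζ + ε • W₀) = χ ζ + ε * χ W₀ := fun ε => by
      rw [map_add, map_smul, smul_eq_mul]
    simp only [e]
    by_cases h0 : χ ζ = 0
    · filter_upwards [self_mem_nhdsWithin] with ε hε
      rw [h0, zero_add]
      exact mul_ne_zero hε (hW₀ χ hχ)
    · have hc : Continuous fun ε : ℝ => χ ζ + ε * χ W₀ := by fun_prop
      have h1 := hc.tendsto 0
      simp only [zero_mul, add_zero] at h1
      exact (h1.mono_left nhdsWithin_le_nhds).eventually_ne h0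
  obtain ⟨ε, hε, hε'⟩ :=
    (((exists_pos_add_smul ζ W₀).filter_mono nhdsWithin_le_nhds).and hev).exists
  refine ⟨ζ + ε • W₀, hε, fun A hA W => ?_⟩
  set S₀ : C.𝔞 := ζ + ε • W₀
  -- the commutator of `A` with `W` is orthogonal to all weight spaces
  set B := A * a W - a W * A with hB
  have hBS : B * a S₀ = a S₀ * B := by
    have h1 : A * a S₀ = a S₀ * A := hA
    rw [hB, sub_mul, mul_sub, mul_assoc, hcomm W S₀, ← mul_assoc, h1, mul_assoc (a W), h1]
    simp only [← mul_assoc]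
    rw [hcomm W S₀]
  have hall : ∀ Z : Matrix (Fin n) (Fin n) ℝ, (Bᴴ * Z).trace = 0 := by
    intro Z
    have hZ : Z ∈ ⨆ χ : C.𝔞 → ℝ, jointSpace a ⊤ χ :=
      le_iSup_jointSpace a hsymm hcomm ⊤ (fun _ _ _ => trivial) trivial
    refine Submodule.iSup_induction _ (motive := fun Z => (Bᴴ * Z).trace = 0) hZ ?_ (by simp) ?_
    · rintro χ Z ⟨-, hZ⟩
      by_cases hZ0 : Z = 0
      · simp [hZ0]
      obtain ⟨β, hβ⟩ := exists_linear_weight a' hZ0 (χ := χ) hZ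
      by_cases hβ0 : β = 0
      · have h1 : a W * Z = Z * a W := by
          rw [← sub_eq_zero, hZ W, ← hβ, hβ0]; simp
        rw [hB, Matrix.conjTranspose_sub, Matrix.conjTranspose_mul, Matrix.conjTranspose_mul, hsymm,
          sub_mul, Matrix.trace_sub, mul_assoc Aᴴ, h1, ← mul_assoc, Matrix.trace_mul_comm (Aᴴ * Z),
          mul_assoc, sub_self]
      · have h1 : β S₀ ≠ 0 := hε' β ⟨hβ0, Z, hZ0, fun W => by rw [hZ W, hβ]⟩
        refine trace_eq_zero_of_comm (Y := a S₀) (d := 0) (c := β S₀) ?_ ?_ ?_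
        · rw [hsymm, hBS, sub_self, zero_smul]
        · rw [hZ S₀, hβ]
        · simpa using h1.symm
    · intro Z Z' h h'
      rw [mul_add, Matrix.trace_add, h, h', add_zero]
  have hB0 := eq_zero_of_trace_transpose_mul_self (A := B)
    (by rw [← Matrix.conjTranspose_eq_transpose_of_trivial]; exact hall B)
  exact sub_eq_zero.1 hB0

end CartanSubalgebra

/-! ### Contraction by a one-parameter group of symmetric matrices -/

section Flow

variable {n : ℕ} {U S A B X : Matrix (Fin n) (Fin n) ℝ} {μ : Fin n → ℝ}

/-- Conjugation by `exp (-s S)`. -/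
def flow (S A : Matrix (Fin n) (Fin n) ℝ) (s : ℝ) : Matrix (Fin n) (Fin n) ℝ :=
  NormedSpace.exp (-(s • S)) * A * NormedSpace.exp (s • S)

theorem flow_mul (s : ℝ) : flow S (A * B) s = flow S A s * flow S B s := by
  have h := exp_mul_exp_neg (s • S)
  calc _ = NormedSpace.exp (-(s • S)) * A * 1 * B * NormedSpace.exp (s • S) := by
        simp only [flow, mul_one, mul_assoc]
    _ = _ := by rw [← h]; simp only [flow, mul_assoc]

theorem flow_of_comm (h : A * S = S * A) (s : ℝ) : flow S A s = A := by
  let _ := Matrix.linftyOpNormedRing (n := Fin n) (α := ℝ)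
  let _ := Matrix.linftyOpNormedAlgebra (R := ℝ) (n := Fin n) (α := ℝ)
  let _ : NormedAlgebra ℚ (Matrix (Fin n) (Fin n) ℝ) := NormedAlgebra.restrictScalars ℚ ℝ _
  have h1 : A * NormedSpace.exp (s • S) = NormedSpace.exp (s • S) * A :=
    (Commute.exp_right ((show Commute A S from h).smul_right s)).eq
  rw [flow, mul_assoc, h1, ← mul_assoc, exp_neg_mul_exp, one_mul]

theorem flow_exp (s : ℝ) : flow S (NormedSpace.exp X) s = NormedSpace.exp (flow S X s) :=
  (Matrix.exp_units_conj' (expGL (s • S)) X).symm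

theorem det_flow (s : ℝ) : (flow S A s).det = A.det := by
  rw [flow, Matrix.det_mul, Matrix.det_mul, mul_right_comm, ← Matrix.det_mul, exp_neg_mul_exp,
    Matrix.det_one, one_mul]

theorem flow_entry (hU : Uᵀ * U = 1) (hU' : U * Uᵀ = 1) (hS : S = U * Matrix.diagonal μ * Uᵀ)
    (s : ℝ) (i j : Fin n) :
    (Uᵀ * flow S A s * U) i j = Real.exp (s * (μ j - μ i)) * (Uᵀ * A * U) i j := by
  have h1 : s • S = U * Matrix.diagonal (fun i => s * μ i) * Uᵀ := by
    rw [hS, ← Matrix.smul_mul, ← Matrix.mul_smul, ← Matrix.diagonal_smul]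
    rfl
  have h2 : -(s • S) = U * Matrix.diagonal (fun i => -(s * μ i)) * Uᵀ := by
    rw [h1, ← neg_mul, ← mul_neg, Matrix.diagonal_neg]
  have h3 : Uᵀ * flow S A s * U = Matrix.diagonal (fun i => Real.exp (-(s * μ i))) *
      (Uᵀ * A * U) * Matrix.diagonal (fun i => Real.exp (s * μ i)) := by
    rw [flow, exp_diagonalized hU hU' h1, exp_diagonalized hU hU' h2]
    calc _ = (Uᵀ * U) * Matrix.diagonal (fun i => Real.exp (-(s * μ i))) * (Uᵀ * A * U) *
          Matrix.diagonal (fun i => Real.exp (s * μ i)) * (Uᵀ * U) := by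
            simp only [mul_assoc]
      _ = _ := by rw [hU, one_mul, mul_one]
  rw [h3, Matrix.mul_diagonal, Matrix.diagonal_mul, mul_right_comm, ← Real.exp_add]
  congr 2
  ring

theorem tendsto_of_entries (hU' : U * Uᵀ = 1) {F : ℝ → Matrix (Fin n) (Fin n) ℝ} {l : Filter ℝ}
    (h : ∀ i j, Tendsto (fun s => (Uᵀ * F s * U) i j) l (𝓝 ((Uᵀ * B * U) i j))) :
    Tendsto F l (𝓝 B) := by
  have h1 : Tendsto (fun s => Uᵀ * F s * U) l (𝓝 (Uᵀ * B * U)) :=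
    tendsto_pi_nhds.2 fun i => tendsto_pi_nhds.2 fun j => h i j
  have hc : Continuous fun A : Matrix (Fin n) (Fin n) ℝ => U * A * Uᵀ := by fun_prop
  have h2 := (hc.tendsto _).comp h1
  have e : ∀ A : Matrix (Fin n) (Fin n) ℝ, U * (Uᵀ * A * U) * Uᵀ = A := fun A => by
    calc _ = (U * Uᵀ) * A * (U * Uᵀ) := by simp only [mul_assoc]
      _ = A := by rw [hU', one_mul, mul_one]
  simpa only [Function.comp_def, e] using h2

theorem tendsto_entry (h : Tendsto (flow S A) atTop (𝓝 B)) (i j : Fin n) :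
    Tendsto (fun s => (Uᵀ * flow S A s * U) i j) atTop (𝓝 ((Uᵀ * B * U) i j)) := by
  have hc : Continuous fun A : Matrix (Fin n) (Fin n) ℝ => (Uᵀ * A * U) i j := by fun_prop
  exact (hc.tendsto _).comp h

theorem tendsto_exp_mul {c : ℝ} (hc : c < 0) :
    Tendsto (fun s : ℝ => Real.exp (s * c)) atTop (𝓝 0) :=
  Real.tendsto_exp_atBot.comp (tendsto_id.atTop_mul_const_of_neg hc)

theorem IsUpper.exists_tendsto (hU : Uᵀ * U = 1) (hU' : U * Uᵀ = 1)
    (hS : S = U * Matrix.diagonal μ * Uᵀ) (hA : IsUpper U μ A) :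
    ∃ B, Tendsto (flow S A) atTop (𝓝 B) := by
  refine ⟨U * Matrix.of (fun i j => if μ i = μ j then (Uᵀ * A * U) i j else 0) * Uᵀ,
    tendsto_of_entries hU' fun i j => ?_⟩
  have e : ∀ D : Matrix (Fin n) (Fin n) ℝ, Uᵀ * (U * D * Uᵀ) * U = D := fun D => by
    calc _ = (Uᵀ * U) * D * (Uᵀ * U) := by simp only [mul_assoc]
      _ = D := by rw [hU, one_mul, mul_one]
  simp only [e, flow_entry hU hU' hS, Matrix.of_apply]
  rcases lt_trichotomy (μ i) (μ j) with h | h | h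
  · simp [hA i j h, h.ne]
  · simp [h]
  · rw [if_neg h.ne']
    simpa using (tendsto_exp_mul (sub_neg.2 h)).mul_const ((Uᵀ * A * U) i j)

theorem isUpper_of_tendsto (hU : Uᵀ * U = 1) (hU' : U * Uᵀ = 1)
    (hS : S = U * Matrix.diagonal μ * Uᵀ) (h : Tendsto (flow S A) atTop (𝓝 B)) : IsUpper U μ A := by
  intro i j hij
  have h1 := tendsto_entry (U := U) h i j
  simp only [flow_entry hU hU' hS] at h1
  have h2 : Tendsto (fun s : ℝ => Real.exp (s * (μ i - μ j))) atTop (𝓝 0) :=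
    tendsto_exp_mul (sub_neg.2 hij)
  have h3 := h2.mul h1
  rw [zero_mul] at h3
  refine (tendsto_nhds_unique h3 (tendsto_const_nhds.congr fun s => ?_)).symm
  rw [← mul_assoc, ← Real.exp_add]
  have : s * (μ i - μ j) + s * (μ j - μ i) = 0 := by ring
  rw [this, Real.exp_zero, one_mul]

theorem comm_of_tendsto (hU : Uᵀ * U = 1) (hU' : U * Uᵀ = 1)
    (hS : S = U * Matrix.diagonal μ * Uᵀ) (h : Tendsto (flow S A) atTop (𝓝 B)) :
    B * S = S * B := by
  have hA := isUpper_of_tendsto hU hU' hS h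
  have h0 : Uᵀ * (S * B - B * S) * U = 0 := by
    ext i j
    rw [bracket_entry hU hS, Matrix.zero_apply]
    rcases lt_trichotomy (μ i) (μ j) with hij | hij | hij
    · have h1 := tendsto_entry (U := U) h i j
      simp only [flow_entry hU hU' hS, hA i j hij, mul_zero] at h1
      rw [tendsto_nhds_unique h1 tendsto_const_nhds, mul_zero]
    · rw [hij, sub_self, zero_mul]
    · have h1 := tendsto_entry (U := U) h i j
      simp only [flow_entry hU hU' hS] at h1
      have h2 := (tendsto_exp_mul (sub_neg.2 hij)).mul_const ((Uᵀ * A * U) i j)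
      rw [zero_mul] at h2
      rw [tendsto_nhds_unique h1 h2, mul_zero]
  have h1 : S * B - B * S = U * (Uᵀ * (S * B - B * S) * U) * Uᵀ := by
    calc _ = (U * Uᵀ) * (S * B - B * S) * (U * Uᵀ) := by rw [hU', one_mul, mul_one]
      _ = _ := by simp only [mul_assoc]
  rw [h0, mul_zero, zero_mul, sub_eq_zero] at h1
  exact h1.symm

theorem tendsto_flow_zero_iff (hU : Uᵀ * U = 1) (hU' : U * Uᵀ = 1)
    (hS : S = U * Matrix.diagonal μ * Uᵀ) :
    Tendsto (flow S A) atTop (𝓝 0) ↔ ∀ i j, μ i ≤ μ j → (Uᵀ * A * U) i j = 0 := by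
  constructor
  · intro h i j hij
    rcases hij.lt_or_eq with h1 | h1
    · exact isUpper_of_tendsto hU hU' hS h i j h1
    · have h2 := tendsto_entry (U := U) h i j
      simp only [flow_entry hU hU' hS, h1, sub_self, mul_zero, Real.exp_zero, one_mul] at h2
      simpa using tendsto_nhds_unique tendsto_const_nhds h2
  · intro h
    refine tendsto_of_entries hU' fun i j => ?_
    simp only [flow_entry hU hU' hS, mul_zero, zero_mul, Matrix.zero_apply]
    rcases le_or_gt (μ i) (μ j) with hij | hij
    · simp [h i j hij]
    · simpa using (tendsto_exp_mul (sub_neg.2 hij)).mul_const ((Uᵀ * A * U) i j)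

theorem tendsto_flow_one_iff : Tendsto (flow S A) atTop (𝓝 1) ↔
    Tendsto (flow S (A - 1)) atTop (𝓝 0) := by
  have h : ∀ s, flow S (A - 1) s = flow S A s - 1 := fun s => by
    rw [flow, flow, mul_sub, sub_mul, mul_one, exp_neg_mul_exp]
  constructor
  · intro h1
    have := h1.sub_const 1
    rw [sub_self] at this
    exact this.congr fun s => (h s).symm
  · intro h1
    have := h1.add_const 1
    simpa only [h, sub_add_cancel, zero_add] using this

/-- The invertible matrices which are contracted to `1` by conjugation with `exp (-s S)` as
`s → ∞`. -/
def contracted (S : Matrix (Fin n) (Fin n) ℝ) : Subgroup (GL (Fin n) ℝ) where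
  carrier := {g | Tendsto (fun s : ℝ => (expGL (s • S))⁻¹ * g * expGL (s • S)) atTop (𝓝 1)}
  mul_mem' := by
    intro g h hg hh
    have := Tendsto.mul hg hh
    rw [one_mul] at this
    refine this.congr fun s => ?_
    group
  one_mem' := by
    refine tendsto_const_nhds.congr fun s => ?_
    group
  inv_mem' := by
    intro g hg
    have := Tendsto.inv hg
    rw [inv_one] at this
    refine this.congr fun s => ?_
    group

theorem mem_contracted_iff {g : GL (Fin n) ℝ} : g ∈ contracted S ↔
    Tendsto (flow S (g : Matrix (Fin n) (Fin n) ℝ)) atTop (𝓝 1) :=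
  (isEmbedding_GL_val n).tendsto_nhds_iff

/-- The Lie algebra of the group `contracted S`. -/
def contractedLie (U : Matrix (Fin n) (Fin n) ℝ) (μ : Fin n → ℝ) :
    Submodule ℝ (Matrix (Fin n) (Fin n) ℝ) where
  carrier := {A | ∀ i j, μ i ≤ μ j → (Uᵀ * A * U) i j = 0}
  add_mem' := by
    intro A B hA hB i j hij
    rw [mul_add, add_mul, Matrix.add_apply, hA i j hij, hB i j hij, add_zero]
  zero_mem' := by intro i j _; simp
  smul_mem' := by
    intro c A hA i j hij
    rw [Matrix.mul_smul, Matrix.smul_mul, Matrix.smul_apply, hA i j hij, smul_zero]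

theorem isClosed_contracted (hU : Uᵀ * U = 1) (hU' : U * Uᵀ = 1)
    (hS : S = U * Matrix.diagonal μ * Uᵀ) : IsClosed (contracted S : Set (GL (Fin n) ℝ)) := by
  have h1 : (contracted S : Set (GL (Fin n) ℝ)) = (fun g : GL (Fin n) ℝ =>
      (g : Matrix (Fin n) (Fin n) ℝ) - 1) ⁻¹' (contractedLie U μ) := by
    ext g
    rw [SetLike.mem_coe, mem_contracted_iff, tendsto_flow_one_iff, tendsto_flow_zero_iff hU hU' hS]
    rfl
  rw [h1]
  refine IsClosed.preimage ((isEmbedding_GL_val n).continuous.sub continuous_const) ?_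
  exact Submodule.closed_of_finiteDimensional _

theorem mem_contractedLie_iff (hU : Uᵀ * U = 1) (hU' : U * Uᵀ = 1)
    (hS : S = U * Matrix.diagonal μ * Uᵀ) :
    X ∈ contractedLie U μ ↔ ∀ t : ℝ, expGL (t • X) ∈ contracted S := by
  let _ := Matrix.linftyOpNormedRing (n := Fin n) (α := ℝ)
  let _ := Matrix.linftyOpNormedAlgebra (R := ℝ) (n := Fin n) (α := ℝ)
  constructor
  · intro hX t
    have h1 := (tendsto_flow_zero_iff hU hU' hS).2 ((contractedLie U μ).smul_mem t hX)
    have h2 := ((continuous_matrix_exp n).tendsto 0).comp h1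
    rw [NormedSpace.exp_zero] at h2
    rw [mem_contracted_iff]
    exact h2.congr fun s => (flow_exp s).symm
  · intro h
    have h1 := (hasDerivAt_exp_smul_const (𝕂 := ℝ) X (0 : ℝ)).tendsto_slope_zero
    simp only [zero_smul, NormedSpace.exp_zero, one_mul, zero_add] at h1
    refine (Submodule.closed_of_finiteDimensional (contractedLie U μ)).mem_of_tendsto h1
      (Eventually.of_forall fun t => Submodule.smul_mem _ _ ?_)
    have h2 := h t
    rw [mem_contracted_iff, tendsto_flow_one_iff, tendsto_flow_zero_iff hU hU' hS] at h2
    exact h2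

theorem IsUpper.mul (hU' : U * Uᵀ = 1) (hA : IsUpper U μ A) (hB : IsUpper U μ B) :
    IsUpper U μ (A * B) := by
  intro i j hij
  have h1 : Uᵀ * (A * B) * U = (Uᵀ * A * U) * (Uᵀ * B * U) := by
    calc _ = Uᵀ * A * 1 * B * U := by simp only [mul_one, mul_assoc]
      _ = _ := by rw [← hU']; simp only [mul_assoc]
  rw [h1, Matrix.mul_apply]
  refine Finset.sum_eq_zero fun k _ => ?_
  rcases lt_or_ge (μ i) (μ k) with h | h
  · rw [hA i k h, zero_mul]
  · rw [hB k j (h.trans_lt hij), mul_zero]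

theorem isUpper_exp (hU : Uᵀ * U = 1) (hU' : U * Uᵀ = 1)
    (hS : S = U * Matrix.diagonal μ * Uᵀ) (hA : IsUpper U μ A) :
    IsUpper U μ (NormedSpace.exp A) := by
  obtain ⟨B, hB⟩ := hA.exists_tendsto hU hU' hS
  refine isUpper_of_tendsto hU hU' hS (B := NormedSpace.exp B) ?_
  exact (((continuous_matrix_exp n).tendsto B).comp hB).congr fun s => (flow_exp s).symm

theorem isClosed_isUpper : IsClosed {A : Matrix (Fin n) (Fin n) ℝ | IsUpper U μ A} := by
  simp only [IsUpper, Set.ofPred_forall]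
  refine isClosed_iInter fun i => isClosed_iInter fun j => isClosed_iInter fun _ => ?_
  exact isClosed_eq (by fun_prop) continuous_const

end Flow

/-! ### The decomposition `G = K exp(𝔰_M) N A` -/

namespace CartanSubalgebra

variable {n : ℕ} {𝒢 : LinearReductiveGroup n} {C : CartanSubalgebra 𝒢}
  {U : Matrix (Fin n) (Fin n) ℝ} {μ : Fin n → ℝ} {ζ : C.𝔞} {S₀ : C.𝔞}

theorem mat_flow (g : 𝒢.Grp) (S : 𝒢.𝔤) (s : ℝ) :
    𝒢.mat ((𝒢.expG (s • S))⁻¹ * g * 𝒢.expG (s • S)) = flow S (𝒢.mat g) s := by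
  rw [← expG_neg, mat_mul, mat_mul, mat_expG, mat_expG]
  rfl

/-- In an eigenbasis of an element of the positive chamber, `𝔫` consists of strictly block upper
triangular matrices. -/
theorem strictUpper_𝔫 (hpos : ∀ β ∈ C.posRestrictedRoots ζ, 0 < β S₀) (hU : Uᵀ * U = 1)
    (hS : ((S₀ : 𝒢.𝔤) : Matrix (Fin n) (Fin n) ℝ) = U * Matrix.diagonal μ * Uᵀ) {Y : 𝒢.𝔤}
    (hY : Y ∈ C.𝔫 ζ) : (Y : Matrix (Fin n) (Fin n) ℝ) ∈ contractedLie U μ := by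
  refine 𝔫_induction (p := fun X : 𝒢.𝔤 => (X : Matrix (Fin n) (Fin n) ℝ) ∈ contractedLie U μ) hY
    (fun β hβ X hX => ?_) (zero_mem _) fun X X' h h' => add_mem h h'
  intro i j hij
  have h1 := bracket_entry hU hS (A := (X : Matrix (Fin n) (Fin n) ℝ)) i j
  rw [hX S₀, Matrix.mul_smul, Matrix.smul_mul, Matrix.smul_apply, smul_eq_mul] at h1
  have h2 : (β S₀ + (μ j - μ i)) * (Uᵀ * X * U) i j = 0 := by linear_combination h1
  exact (mul_eq_zero.1 h2).resolve_left (by linarith [hpos β hβ])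

/-- The elements of `𝔤` which are contracted by a generic element of the positive chamber
form `𝔫`. -/
theorem mem_𝔫_of_mem_contractedLie (hζ : ∀ β ∈ C.restrictedRoots, β ζ ≠ 0)
    (hpos : ∀ β ∈ C.posRestrictedRoots ζ, 0 < β S₀) (hU : Uᵀ * U = 1) (hU' : U * Uᵀ = 1)
    (hS : ((S₀ : 𝒢.𝔤) : Matrix (Fin n) (Fin n) ℝ) = U * Matrix.diagonal μ * Uᵀ) {Y : 𝒢.𝔤}
    (hY : (Y : Matrix (Fin n) (Fin n) ℝ) ∈ contractedLie U μ) : Y ∈ C.𝔫 ζ := by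
  -- the components in the centraliser of `𝔞`, in `𝔫` and in `θ 𝔫` are block diagonal, strictly
  -- upper and strictly lower triangular
  obtain ⟨X₀, hX₀, Y₁, hY₁, Y₂, hY₂, rfl⟩ := exists_decomp_restricted ζ hζ Y
  have e0 : ∀ i j, μ i ≠ μ j → (Uᵀ * (X₀ : Matrix (Fin n) (Fin n) ℝ) * U) i j = 0 := by
    intro i j hij
    have h1 := bracket_entry hU hS (A := (X₀ : Matrix (Fin n) (Fin n) ℝ)) i j
    rw [hX₀ S₀ S₀.2, sub_self] at h1
    have h2 : (μ i - μ j) * (Uᵀ * X₀ * U) i j = 0 := by rw [← h1]; simp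
    exact (mul_eq_zero.1 h2).resolve_left (sub_ne_zero.2 hij)
  have e1 := strictUpper_𝔫 hpos hU hS hY₁
  have e2 : ∀ i j, μ j ≤ μ i → (Uᵀ * (𝒢.θ Y₂ : Matrix (Fin n) (Fin n) ℝ) * U) i j = 0 := by
    intro i j hij
    have h1 : Uᵀ * (𝒢.θ Y₂ : Matrix (Fin n) (Fin n) ℝ) * U =
        -(Uᵀ * (Y₂ : Matrix (Fin n) (Fin n) ℝ) * U)ᵀ := by
      rw [coe_θ]; simp [mul_assoc]
    rw [h1, Matrix.neg_apply, Matrix.transpose_apply, strictUpper_𝔫 hpos hU hS hY₂ j i hij,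
      neg_zero]
  have hsum : ∀ i j, μ i ≤ μ j → (Uᵀ * (X₀ : Matrix (Fin n) (Fin n) ℝ) * U) i j +
      (Uᵀ * (𝒢.θ Y₂ : Matrix (Fin n) (Fin n) ℝ) * U) i j = 0 := by
    intro i j hij
    have h1 := hY i j hij
    rw [Submodule.coe_add, Submodule.coe_add, mul_add, mul_add, add_mul, add_mul, Matrix.add_apply,
      Matrix.add_apply, e1 i j hij, add_zero] at h1
    exact h1
  have hz : ∀ A : 𝒢.𝔤, Uᵀ * (A : Matrix (Fin n) (Fin n) ℝ) * U = 0 → A = 0 := by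
    intro A hA
    ext1
    calc (A : Matrix (Fin n) (Fin n) ℝ) = (U * Uᵀ) * A * (U * Uᵀ) := by rw [hU', one_mul, mul_one]
      _ = U * (Uᵀ * A * U) * Uᵀ := by simp only [mul_assoc]
      _ = 0 := by rw [hA]; simp
  have h1 : X₀ = 0 := by
    refine hz _ ?_
    ext i j
    by_cases hij : μ i = μ j
    · have := hsum i j hij.le
      rw [e2 i j hij.ge, add_zero] at this
      exact this
    · exact e0 i j hij
  have h2 : 𝒢.θ Y₂ = 0 := by
    refine hz _ ?_
    ext i j
    rcases le_or_gt (μ j) (μ i) with hij | hij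
    · exact e2 i j hij
    · have := hsum i j hij.le
      rw [e0 i j hij.ne, zero_add] at this
      exact this
  rw [h1, h2, zero_add, add_zero]
  exact hY₁

/-- The Levi decomposition of the parabolic subgroup of block upper triangular elements, obtained
by contraction with `exp (-s S₀)`. -/
theorem exists_levi (hζ : ∀ β ∈ C.restrictedRoots, β ζ ≠ 0)
    (hpos : ∀ β ∈ C.posRestrictedRoots ζ, 0 < β S₀)
    (hgen : ∀ A : Matrix (Fin n) (Fin n) ℝ, A * (S₀ : 𝒢.𝔤) = (S₀ : 𝒢.𝔤) * A →
      ∀ W : C.𝔞, A * (W : 𝒢.𝔤) = (W : 𝒢.𝔤) * A) (hU : Uᵀ * U = 1) (hU' : U * Uᵀ = 1)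
    (hS : ((S₀ : 𝒢.𝔤) : Matrix (Fin n) (Fin n) ℝ) = U * Matrix.diagonal μ * Uᵀ) {q : 𝒢.Grp}
    (hq : IsUpper U μ (𝒢.mat q)) : ∃ l ∈ C.ZA, ∃ Y ∈ C.𝔫 ζ, q = l * 𝒢.expG Y := by
  obtain ⟨B, hB⟩ := hq.exists_tendsto hU hU' hS
  have hdet : B.det = (𝒢.mat q).det := by
    have h1 : Continuous fun A : Matrix (Fin n) (Fin n) ℝ => A.det := by fun_prop
    have h2 := (h1.tendsto B).comp hB
    simp only [Function.comp_def, det_flow] at h2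
    exact tendsto_nhds_unique h2 tendsto_const_nhds
  have hBu : IsUnit B.det := by rw [hdet]; exact isUnit_det_mat q
  -- the limit of the contracted elements lies in `G`
  let b : GL (Fin n) ℝ := Matrix.GeneralLinearGroup.mk'' B hBu
  let c : ℝ → 𝒢.Grp := fun s => (𝒢.expG (s • (S₀ : 𝒢.𝔤)))⁻¹ * q * 𝒢.expG (s • (S₀ : 𝒢.𝔤))
  have hc : Tendsto (fun s => (c s : GL (Fin n) ℝ)) atTop (𝓝 b) := by
    refine (isEmbedding_GL_val n).tendsto_nhds_iff.2 ?_
    exact hB.congr fun s => (mat_flow q S₀ s).symm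
  let l : 𝒢.Grp := ⟨b, 𝒢.isClosed.mem_of_tendsto hc (Eventually.of_forall fun s => (c s).2)⟩
  have hlB : 𝒢.mat l = B := rfl
  have hl : l ∈ C.ZA := mem_fixer_iff.2 fun W hW =>
    hgen B (comm_of_tendsto hU hU' hS hB) ⟨W, hW⟩
  have hlS : 𝒢.mat l⁻¹ * ((S₀ : 𝒢.𝔤) : Matrix (Fin n) (Fin n) ℝ) = (S₀ : 𝒢.𝔤) * 𝒢.mat l⁻¹ :=
    mem_fixer_iff.1 (inv_mem hl) S₀ S₀.2
  have hn : Tendsto (flow (S₀ : 𝒢.𝔤) (𝒢.mat (l⁻¹ * q))) atTop (𝓝 1) := by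
    have h1 := hB.const_mul (𝒢.mat l⁻¹)
    rw [← hlB, mat_inv_mul_mat] at h1
    refine h1.congr fun s => ?_
    rw [mat_mul, flow_mul, flow_of_comm hlS]
  let ν : ℝ → 𝒢.Grp := fun s =>
    (𝒢.expG (s • (S₀ : 𝒢.𝔤)))⁻¹ * (l⁻¹ * q) * 𝒢.expG (s • (S₀ : 𝒢.𝔤))
  have hν : Tendsto ν atTop (𝓝 1) := by
    refine isEmbedding_mat.tendsto_nhds_iff.2 ?_
    rw [mat_one]
    exact hn.congr fun s => (mat_flow _ _ s).symm
  have hcl := eventually_mem_of_expGL_mem _ (isClosed_contracted hU hU' hS) (contractedLie U μ)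
    fun X => mem_contractedLie_iff hU hU' hS
  -- a contracted element is eventually close to `1`, so that its logarithm is defined
  obtain ⟨s, X, hX, hXs⟩ := (hν.eventually (eventually_exists_expG hcl)).exists
  have hmem : ∀ s : ℝ, expGL (s • ((S₀ : 𝒢.𝔤) : Matrix (Fin n) (Fin n) ℝ)) =
      ((𝒢.expG (s • (S₀ : 𝒢.𝔤)) : 𝒢.Grp) : GL (Fin n) ℝ) := fun s => rfl
  have hνmem : ((ν s : 𝒢.Grp) : GL (Fin n) ℝ) ∈
      contracted ((S₀ : 𝒢.𝔤) : Matrix (Fin n) (Fin n) ℝ) := by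
    rw [mem_contracted_iff]
    have h1 := hn.comp (tendsto_atTop_add_const_left atTop s tendsto_id)
    refine h1.congr fun r => ?_
    have e : 𝒢.mat (ν s) = flow (S₀ : 𝒢.𝔤) (𝒢.mat (l⁻¹ * q)) s := mat_flow _ _ s
    have e2 : ∀ r : ℝ, (𝒢.expG ((s + r) • (S₀ : 𝒢.𝔤))) =
        𝒢.expG (s • (S₀ : 𝒢.𝔤)) * 𝒢.expG (r • (S₀ : 𝒢.𝔤)) := fun r => expG_add_smul s r _
    change flow (S₀ : 𝒢.𝔤) (𝒢.mat (l⁻¹ * q)) (s + r) = flow (S₀ : 𝒢.𝔤) (𝒢.mat (ν s)) r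
    rw [← mat_flow, ← mat_flow, e2]
    congr 1
    simp only [ν]
    group
  have hXn : X ∈ C.𝔫 ζ := by
    refine mem_𝔫_of_mem_contractedLie hζ hpos hU hU' hS (hX ?_)
    have e : expGL (X : Matrix (Fin n) (Fin n) ℝ) = ((ν s : 𝒢.Grp) : GL (Fin n) ℝ) := by
      rw [hXs]; rfl
    rw [e]
    exact hνmem
  have hZA : 𝒢.expG (s • (S₀ : 𝒢.𝔤)) ∈ C.ZA :=
    H_le_ZA (expG_mem_H (C.𝔥.smul_mem s S₀.2.1))
  refine ⟨l, hl, 𝒢.Ad (𝒢.expG (s • (S₀ : 𝒢.𝔤))) X, Ad_mem_𝔫 hZA hXn, ?_⟩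
  rw [expG_Ad, ← hXs]
  simp only [ν]
  group

open scoped Pointwise in
/-- Every element of `G` is the product of an element of `K` and a block upper triangular one. -/
theorem exists_K_upper (hζ : ∀ β ∈ C.restrictedRoots, β ζ ≠ 0)
    (hpos : ∀ β ∈ C.posRestrictedRoots ζ, 0 < β S₀) (hU : Uᵀ * U = 1) (hU' : U * Uᵀ = 1)
    (hS : ((S₀ : 𝒢.𝔤) : Matrix (Fin n) (Fin n) ℝ) = U * Matrix.diagonal μ * Uᵀ) (g : 𝒢.Grp) :
    ∃ k ∈ 𝒢.K, ∃ q, IsUpper U μ (𝒢.mat q) ∧ g = k * q := by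
  let Q : Set 𝒢.Grp := {q | IsUpper U μ (𝒢.mat q)}
  let P : Set 𝒢.Grp := (𝒢.K : Set 𝒢.Grp) * Q
  have hclosed : IsClosed P :=
    (isClosed_of_mat isClosed_isUpper).mul_left_of_isCompact isCompact_K
  have hnhd : ∀ᶠ g in 𝓝 (1 : 𝒢.Grp), ∃ k ∈ 𝒢.K, ∃ q ∈ Q, g = k * q := by
    let _ := Matrix.linftyOpNormedRing (n := Fin n) (α := ℝ)
    let _ := Matrix.linftyOpNormedAlgebra (R := ℝ) (n := Fin n) (α := ℝ)
    let 𝔨' : Submodule ℝ (Matrix (Fin n) (Fin n) ℝ) := 𝒢.𝔨.map 𝒢.𝔤.subtype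
    let 𝔮 : Submodule ℝ (Matrix (Fin n) (Fin n) ℝ) :=
      { carrier := {A | A ∈ 𝒢.𝔤 ∧ IsUpper U μ A}
        add_mem' := fun hA hB => ⟨add_mem hA.1 hB.1, hA.2.add hB.2⟩
        zero_mem' := ⟨zero_mem _, fun i j _ => by simp⟩
        smul_mem' := fun c A hA => ⟨Submodule.smul_mem _ c hA.1, fun i j hij => by
          rw [Matrix.mul_smul, Matrix.smul_mul, Matrix.smul_apply, hA.2 i j hij, smul_zero]⟩ }
    let V := 𝔨' × 𝔮
    let E := (NormedSpace.exp : Matrix (Fin n) (Fin n) ℝ → Matrix (Fin n) (Fin n) ℝ)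
    let pA : V →L[ℝ] Matrix (Fin n) (Fin n) ℝ := 𝔨'.subtypeL.comp (ContinuousLinearMap.fst ℝ 𝔨' 𝔮)
    let pB : V →L[ℝ] Matrix (Fin n) (Fin n) ℝ := 𝔮.subtypeL.comp (ContinuousLinearMap.snd ℝ 𝔨' 𝔮)
    let f : V → Matrix (Fin n) (Fin n) ℝ := fun v => E (pA v) * E (pB v)
    have hE : ∀ p : V →L[ℝ] Matrix (Fin n) (Fin n) ℝ,
        HasStrictFDerivAt (fun v => E (p v)) p 0 := by
      intro p
      have h1 : HasStrictFDerivAt E (ContinuousLinearMap.id ℝ _) (p 0) := by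
        rw [map_zero]; exact hasStrictFDerivAt_exp_zero
      exact h1.comp (0 : V) p.hasStrictFDerivAt
    have hE0 : ∀ p : V →L[ℝ] Matrix (Fin n) (Fin n) ℝ, E (p 0) = 1 := fun p => by
      rw [map_zero]; exact NormedSpace.exp_zero
    obtain ⟨f', hf, hval⟩ : ∃ f' : V →L[ℝ] Matrix (Fin n) (Fin n) ℝ, HasStrictFDerivAt f f' 0 ∧
        ∀ v, f' v = pA v + pB v := by
      refine ⟨_, (hE pA).mul' (hE pB), fun v => ?_⟩
      change E (pA 0) * pB v + pA v * E (pB 0) = _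
      rw [hE0, hE0, one_mul, mul_one, add_comm]
    have hmem : ∀ v : V, ∃ A ∈ 𝒢.𝔨, ∃ B : 𝒢.𝔤, IsUpper U μ B ∧
        (A : Matrix (Fin n) (Fin n) ℝ) = pA v ∧ (B : Matrix (Fin n) (Fin n) ℝ) = pB v := by
      rintro ⟨⟨_, A, hA, rfl⟩, ⟨B, hB, hB'⟩⟩
      exact ⟨A, hA, ⟨B, hB⟩, hB', rfl, rfl⟩
    have hfv : ∀ v A B, (A : 𝒢.𝔤) = pA v → (B : 𝒢.𝔤) = pB v →
        𝒢.mat (𝒢.expG A * 𝒢.expG B) = f v := by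
      intro v A B hA hB
      rw [mat_mul, mat_expG, mat_expG, hA, hB]
    have hev := eventually_mem_range_of_surjective (𝒢 := 𝒢) (f := f) (f' := f')
      (by simp only [f, hE0, one_mul]) hf (fun v => by
        obtain ⟨A, -, B, -, hA, hB⟩ := hmem v
        exact ⟨_, hfv v A B hA hB⟩) (fun X hX => by
        obtain ⟨X₀, hX₀, Y₁, hY₁, Y₂, hY₂, h⟩ := exists_decomp_restricted ζ hζ ⟨X, hX⟩
        -- `X = (Y₂ + θ Y₂) + (X₀ + Y₁ - Y₂)` is a sum of an element of `𝔨` and an upper one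
        have hk : Y₂ + 𝒢.θ Y₂ ∈ 𝒢.𝔨 := by
          refine mem_𝔨_iff.2 ?_
          simp [coe_θ]
        have hX₀' : IsUpper U μ (X₀ : Matrix (Fin n) (Fin n) ℝ) :=
          isUpper_of_comm hU hS (hX₀ S₀ S₀.2)
        have hup : IsUpper U μ ((X₀ + (Y₁ - Y₂) : 𝒢.𝔤) : Matrix (Fin n) (Fin n) ℝ) :=
          hX₀'.add (isUpper_𝔫 S₀.2 hpos hU hS (sub_mem hY₁ hY₂))
        refine ⟨⟨⟨_, _, hk, rfl⟩, ⟨_, (X₀ + (Y₁ - Y₂) : 𝒢.𝔤).2, hup⟩⟩, ?_⟩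
        refine (hval _).trans ?_
        have h2 := congrArg (Subtype.val) h
        refine Eq.trans ?_ h2.symm
        change ((Y₂ + 𝒢.θ Y₂ : 𝒢.𝔤) : Matrix (Fin n) (Fin n) ℝ) +
          ((X₀ + (Y₁ - Y₂) : 𝒢.𝔤) : Matrix (Fin n) (Fin n) ℝ) = _
        rw [← Submodule.coe_add]
        congr 1
        abel)
    filter_upwards [hev] with g hg
    obtain ⟨v, hv⟩ := hg
    obtain ⟨A, hA, B, hB, hAv, hBv⟩ := hmem v
    refine ⟨𝒢.expG A, expG_mem_K hA, 𝒢.expG B, ?_, mat_injective ?_⟩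
    · change IsUpper U μ (𝒢.mat (𝒢.expG B))
      rw [mat_expG]
      exact isUpper_exp hU hU' hS hB
    · rw [← hv, hfv v A B hAv hBv]
  have hopen : IsOpen P := by
    rw [isOpen_iff_mem_nhds]
    rintro _ ⟨k, hk, q, hq, rfl⟩
    have hc : Continuous fun g : 𝒢.Grp => k⁻¹ * g * q⁻¹ := by fun_prop
    have h1 := hc.tendsto (k * q)
    have e : k⁻¹ * (k * q) * q⁻¹ = 1 := by group
    rw [e] at h1
    filter_upwards [h1.eventually hnhd]
    rintro g ⟨k', hk', q', hq', h⟩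
    refine ⟨k * k', mul_mem hk hk', q' * q, ?_, ?_⟩
    · change IsUpper U μ (𝒢.mat (q' * q))
      rw [mat_mul]
      exact IsUpper.mul hU' hq' hq
    · change k * k' * (q' * q) = g
      rw [mul_assoc, ← mul_assoc k', ← h]
      group
  have h1 : P = Set.univ := IsClopen.eq_univ ⟨hclosed, hopen⟩
    ⟨1, 1, one_mem _, 1, by
      change IsUpper U μ (𝒢.mat 1)
      rw [mat_one]
      intro i j hij
      rw [mul_one, hU, Matrix.one_apply_ne]
      rintro rfl
      exact lt_irrefl _ hij, by simp⟩
  obtain ⟨k, hk, q, hq, h⟩ : g ∈ P := h1 ▸ Set.mem_univ g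
  exact ⟨k, hk, q, hq, h.symm⟩

/-- The Iwasawa type decomposition `G = K exp(𝔰_M) N A`. -/
theorem exists_iwasawa (hζ : ∀ β ∈ C.restrictedRoots, β ζ ≠ 0) (g : 𝒢.Grp) :
    ∃ k ∈ 𝒢.K, ∃ X ∈ C.𝔰M, ∃ Y ∈ C.𝔫 ζ, ∃ W ∈ C.𝔞,
      g = k * 𝒢.expG X * 𝒢.expG Y * 𝒢.expG W := by
  obtain ⟨S₀, hpos, hgen⟩ := exists_generic ζ
  obtain ⟨U, μ, hU, hU', hS⟩ := exists_diagonalization (transpose_𝔞 S₀.2)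
  obtain ⟨k, hk, q, hq, rfl⟩ := exists_K_upper hζ hpos hU hU' hS g
  obtain ⟨l, hl, Y, hY, rfl⟩ := exists_levi hζ hpos hgen hU hU' hS hq
  obtain ⟨k', hk', X, hX, W, hW, rfl⟩ := exists_polar_ZA hl
  have hWZ : 𝒢.expG W ∈ C.ZA := H_le_ZA (expG_mem_H hW.1)
  refine ⟨k * k', mul_mem hk hk', X, hX, _, Ad_mem_𝔫 hWZ hY, W, hW, ?_⟩
  rw [expG_Ad]
  group

end CartanSubalgebra

/-! ### The almost complex structure and the fibres of the determinant line bundle -/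

namespace Datum

open CartanSubalgebra

variable {n : ℕ} {𝒢 : LinearReductiveGroup n} (D : Datum 𝒢)

/-- The number of coordinates used for the projection to `𝔞`. -/
def coordDim : ℕ := (exists_projection D.ζ).choose

/-- Smooth coordinates of the projection to `𝔞`. -/
def coord : 𝒢.Grp → Fin D.coordDim → ℝ := (exists_projection D.ζ).choose_spec.choose

/-- The linear map from the coordinates to `𝔞`. -/
def coordMap : (Fin D.coordDim → ℝ) →ₗ[ℝ] D.𝔞 :=
  (exists_projection D.ζ).choose_spec.choose_spec.choose

/-- The projection `k exp(X) exp(Y) exp(W) ↦ W` of `G = K exp(𝔰_M) N A` to `𝔞`. -/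
def Z (g : 𝒢.Grp) : D.𝔞 := D.coordMap (D.coord g)

theorem smoothMap_coord : SmoothMap D.coord :=
  (exists_projection D.ζ).choose_spec.choose_spec.choose_spec.1

theorem Z_one : D.Z 1 = 0 :=
  (exists_projection D.ζ).choose_spec.choose_spec.choose_spec.2.1

theorem Z_K_mul {k : 𝒢.Grp} (hk : k ∈ 𝒢.K) (g : 𝒢.Grp) : D.Z (k * g) = D.Z g :=
  (exists_projection D.ζ).choose_spec.choose_spec.choose_spec.2.2.1 k hk g

theorem Z_mul_K {t : 𝒢.Grp} (ht : t ∈ 𝒢.K) (ht' : t ∈ D.ZA) (g : 𝒢.Grp) :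
    D.Z (g * t) = D.Z g :=
  (exists_projection D.ζ).choose_spec.choose_spec.choose_spec.2.2.2.1 t ht ht' g

theorem Z_mul_exp (g : 𝒢.Grp) {X : 𝒢.𝔤} (hX : X ∈ D.𝔪 ∨ X ∈ D.𝔫 D.ζ) :
    D.Z (g * 𝒢.expG X) = D.Z g :=
  (exists_projection D.ζ).choose_spec.choose_spec.choose_spec.2.2.2.2.1 g X hX

theorem Z_mul_exp_𝔞 (g : 𝒢.Grp) (W : D.𝔞) : D.Z (g * 𝒢.expG W) = D.Z g + W :=
  (exists_projection D.ζ).choose_spec.choose_spec.choose_spec.2.2.2.2.2 g W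

theorem Z_exp_𝔞 (W : D.𝔞) : D.Z (𝒢.expG W) = W := by
  rw [← one_mul (𝒢.expG W), Z_mul_exp_𝔞, Z_one, zero_add]

/-- The elements `exp W` of `A ⊆ H`. -/
def expA (W : D.𝔞) : D.H := ⟨𝒢.expG W, expG_mem_H W.2.1⟩

theorem expA_add (W W' : D.𝔞) : D.expA (W + W') = D.expA W * D.expA W' :=
  Subtype.ext (expG_add_of_comm (D.𝔥_comm W.2.1 W'.2.1))

theorem expA_zero : D.expA 0 = 1 := Subtype.ext expG_zero

theorem expA_neg (W : D.𝔞) : D.expA (-W) = (D.expA W)⁻¹ := Subtype.ext (expG_neg _)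

/-- `A` is central in `H`. -/
theorem expA_comm (h : D.H) (W : D.𝔞) : h * D.expA W = D.expA W * h := by
  refine Subtype.ext ?_
  change (h : 𝒢.Grp) * 𝒢.expG W = 𝒢.expG W * h
  have h1 := expG_Ad (h : 𝒢.Grp) (W : 𝒢.𝔤)
  rw [h.2 W W.2.1] at h1
  rw [h1, inv_mul_cancel_right, ← h1]

theorem exists_eq_mul_expA (h : D.H) : ∃ t : D.H, (t : 𝒢.Grp) ∈ 𝒢.K ∧ h = t * D.expA (D.Z h) := by
  obtain ⟨t, ht, ht', W, hW, e⟩ := exists_polar_H h.2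
  have hZ : D.Z h = ⟨W, hW⟩ := by
    rw [e]
    have h1 := D.Z_mul_exp_𝔞 t ⟨W, hW⟩
    have h2 := D.Z_mul_K ht (H_le_ZA ht') 1
    rw [one_mul, Z_one] at h2
    rwa [h2, zero_add] at h1
  refine ⟨⟨t, ht'⟩, ht, Subtype.ext ?_⟩
  rw [hZ]
  exact e

theorem Z_mul_H (g : 𝒢.Grp) (h : D.H) : D.Z (g * h) = D.Z g + D.Z h := by
  obtain ⟨t, ht, e⟩ := D.exists_eq_mul_expA h
  have e' : (h : 𝒢.Grp) = t * 𝒢.expG (D.Z h) := congrArg Subtype.val e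
  conv_lhs => rw [e', ← mul_assoc, Z_mul_exp_𝔞, D.Z_mul_K ht (H_le_ZA t.2)]

/-- The `A`-component of an element of `G`. -/
def a (g : 𝒢.Grp) : D.H := D.expA (D.Z g)

theorem a_K_mul {k : 𝒢.Grp} (hk : k ∈ 𝒢.K) (g : 𝒢.Grp) : D.a (k * g) = D.a g := by
  rw [a, Z_K_mul D hk, a]

theorem a_mul_H (g : 𝒢.Grp) (h : D.H) : D.a (g * h) = D.a g * D.a h := by
  rw [a, Z_mul_H, expA_add, a, a]

/-- The projection of `H = (H ∩ K) A` to `H ∩ K`. -/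
def tpart (h : D.H) : D.H := h * (D.a h)⁻¹

theorem tpart_mem_K (h : D.H) : (D.tpart h : 𝒢.Grp) ∈ 𝒢.K := by
  obtain ⟨t, ht, e⟩ := D.exists_eq_mul_expA h
  have : D.tpart h = t := by
    rw [tpart, a]
    nth_rewrite 1 [e]
    rw [mul_inv_cancel_right]
  rwa [this]

theorem tpart_mul (h h' : D.H) : D.tpart (h * h') = D.tpart h * D.tpart h' := by
  have h1 : D.a ((h * h' : D.H) : 𝒢.Grp) = D.a h * D.a h' := D.a_mul_H h h'
  have h2 : ∀ x : D.H, x * (D.a h)⁻¹ = (D.a h)⁻¹ * x := fun x => by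
    rw [a, ← expA_neg, expA_comm]
  rw [tpart, h1, tpart, tpart, mul_inv_rev]
  calc h * h' * ((D.a h')⁻¹ * (D.a h)⁻¹) = h * (h' * (D.a h')⁻¹ * (D.a h)⁻¹) := by group
    _ = _ := by rw [h2]; group

theorem a_of_mem_K {t : D.H} (ht : (t : 𝒢.Grp) ∈ 𝒢.K) : D.a t = 1 := by
  have h2 := D.Z_mul_K ht (H_le_ZA t.2) 1
  rw [one_mul, Z_one] at h2
  rw [a, h2, expA_zero]

theorem tpart_of_mem_K {t : D.H} (ht : (t : 𝒢.Grp) ∈ 𝒢.K) : D.tpart t = t := by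
  rw [tpart, D.a_of_mem_K ht, inv_one, mul_one]

theorem AdT_AdT_inv (h : D.H) (v : D.T) : D.AdT h (D.AdT h⁻¹ v) = v := by
  rw [← LinearMap.comp_apply, ← AdT_mul, mul_inv_cancel, AdT_one, LinearMap.id_apply]

theorem AdT_inv_AdT (h : D.H) (v : D.T) : D.AdT h⁻¹ (D.AdT h v) = v := by
  rw [← LinearMap.comp_apply, ← AdT_mul, inv_mul_cancel, AdT_one, LinearMap.id_apply]

/-- The almost complex structure in terms of the `A`-component. -/
theorem acs_apply (g : 𝒢.Grp) (v : D.T) :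
    D.acs g v = D.AdT (D.a g)⁻¹ (D.J₀ (D.AdT (D.a g) v)) := by
  have hd : ∃ h : D.H, ∃ k ∈ 𝒢.K, ∃ X ∈ D.𝔰M, ∃ Y ∈ D.𝔫 D.ζ,
      g = k * 𝒢.expG X * 𝒢.expG Y * h := by
    obtain ⟨k, hk, X, hX, Y, hY, W, hW, e⟩ := exists_iwasawa D.ζ_regular g
    exact ⟨⟨𝒢.expG W, expG_mem_H hW.1⟩, k, hk, X, hX, Y, hY, e⟩
  rw [acs, dif_pos hd]
  obtain ⟨k, hk, X, hX, Y, hY, e⟩ := hd.choose_spec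
  set h := hd.choose
  have hZ : D.Z g = D.Z h := by
    have h1 : D.Z (k * 𝒢.expG X * 𝒢.expG Y) = 0 := by
      rw [Z_mul_exp D _ (Or.inr hY), Z_mul_exp D _ (Or.inl hX.1), ← mul_one k, Z_K_mul D hk, Z_one]
    rw [e, Z_mul_H, h1, zero_add]
  have ha : D.a g = D.a h := by rw [a, a, hZ]
  have hh : h = D.tpart h * D.a h := by rw [tpart, inv_mul_cancel_right]
  rw [ha]
  change D.AdT h⁻¹ (D.J₀ (D.AdT h v)) = _
  have h1 : ∀ v, D.AdT h v = D.AdT (D.tpart h) (D.AdT (D.a h) v) := fun v => by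
    conv_lhs => rw [hh, AdT_mul]
    rfl
  have h2 : ∀ v, D.AdT h⁻¹ v = D.AdT (D.a h)⁻¹ (D.AdT (D.tpart h)⁻¹ v) := fun v => by
    conv_lhs => rw [hh, mul_inv_rev, AdT_mul]
    rfl
  rw [h1, h2, ← D.AdT_J₀ (D.tpart_mem_K h), AdT_inv_AdT]

theorem AdT_a_mem_T10₀ {g : 𝒢.Grp} {x : ℂ ⊗[ℝ] D.T} (hx : x ∈ D.T10 g) :
    (D.AdT (D.a g)).baseChange ℂ x ∈ D.T10₀ := by
  rw [T10, Module.End.mem_eigenspace_iff] at hx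
  rw [T10₀, Module.End.mem_eigenspace_iff]
  have h1 : D.J₀ ∘ₗ D.AdT (D.a g) = D.AdT (D.a g) ∘ₗ D.acs g := LinearMap.ext fun v => by
    rw [LinearMap.comp_apply, LinearMap.comp_apply, acs_apply, AdT_AdT_inv]
  have h2 := LinearMap.congr_fun (congrArg (LinearMap.baseChange ℂ) h1) x
  rw [LinearMap.baseChange_comp, LinearMap.baseChange_comp, LinearMap.comp_apply,
    LinearMap.comp_apply, hx, map_smul] at h2
  exact h2

theorem AdT_a_inv_mem_T10 {g : 𝒢.Grp} {x : ℂ ⊗[ℝ] D.T} (hx : x ∈ D.T10₀) :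
    (D.AdT (D.a g)⁻¹).baseChange ℂ x ∈ D.T10 g := by
  rw [T10₀, Module.End.mem_eigenspace_iff] at hx
  rw [T10, Module.End.mem_eigenspace_iff]
  have h1 : D.acs g ∘ₗ D.AdT (D.a g)⁻¹ = D.AdT (D.a g)⁻¹ ∘ₗ D.J₀ := LinearMap.ext fun v => by
    rw [LinearMap.comp_apply, LinearMap.comp_apply, acs_apply, AdT_AdT_inv]
  have h2 := LinearMap.congr_fun (congrArg (LinearMap.baseChange ℂ) h1) x
  rw [LinearMap.baseChange_comp, LinearMap.baseChange_comp, LinearMap.comp_apply,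
    LinearMap.comp_apply, hx, map_smul] at h2
  exact h2

theorem act_a_mem_F₀ {g : 𝒢.Grp} {u : D.E} (hu : u ∈ D.fibre g) : D.act (D.a g) u ∈ D.F₀ :=
  Submodule.smul_mem _ _ (exteriorPower_map_mem_range (fun _ hx => D.AdT_a_mem_T10₀ hx) hu)

theorem act_a_inv_mem_fibre (g : 𝒢.Grp) {u : D.E} (hu : u ∈ D.F₀) :
    D.act (D.a g)⁻¹ u ∈ D.fibre g :=
  Submodule.smul_mem _ _ (exteriorPower_map_mem_range (fun _ hx => D.AdT_a_inv_mem_T10 hx) hu)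

/-- A generator of the fibre at the base point. -/
def e₀ : D.E := D.exists_generator.choose

/-- A functional that gives the coordinate with respect to `e₀`. -/
def ℓ₀ : D.E →ₗ[ℂ] ℂ := D.exists_generator.choose_spec.choose

theorem e₀_mem : D.e₀ ∈ D.F₀ := D.exists_generator.choose_spec.choose_spec.1

theorem ℓ₀_e₀ : D.ℓ₀ D.e₀ = 1 := D.exists_generator.choose_spec.choose_spec.2.1

theorem eq_ℓ₀_smul {u : D.E} (hu : u ∈ D.F₀) : u = D.ℓ₀ u • D.e₀ :=
  D.exists_generator.choose_spec.choose_spec.2.2 u hu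

/-- The smooth frame of the line bundle, pulled back to `G`, which is `e₀` on `K exp(𝔰_M) N` and
equivariant under `A`. -/
def frame (g : 𝒢.Grp) : D.E := D.act (D.a g)⁻¹ D.e₀

/-- The coefficient of an element of the fibre with respect to `frame`. -/
def coef (g : 𝒢.Grp) : D.E →ₗ[ℂ] ℂ := D.ℓ₀ ∘ₗ D.act (D.a g)

theorem frame_mem (g : 𝒢.Grp) : D.frame g ∈ D.fibre g := D.act_a_inv_mem_fibre g D.e₀_mem

theorem coef_frame (g : 𝒢.Grp) : D.coef g (D.frame g) = 1 := by
  rw [coef, LinearMap.comp_apply, frame, act_act_inv, ℓ₀_e₀]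

theorem eq_coef_smul {g : 𝒢.Grp} {u : D.E} (hu : u ∈ D.fibre g) : u = D.coef g u • D.frame g := by
  have h1 := D.eq_ℓ₀_smul (D.act_a_mem_F₀ hu)
  have h2 := congrArg (D.act (D.a g)⁻¹) h1
  rw [act_inv_act, map_smul] at h2
  exact h2

/-- The character of `H`, trivial on `A`, by which `H` acts on the fibre at the base point. -/
def δ (h : D.H) : ℂ := D.ℓ₀ (D.act (D.tpart h) D.e₀)

theorem act_tpart (h : D.H) : D.act (D.tpart h) D.e₀ = D.δ h • D.e₀ :=
  D.eq_ℓ₀_smul (D.act_mem_F₀ (D.tpart_mem_K h) D.e₀_mem)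

theorem δ_mul (h h' : D.H) : D.δ (h * h') = D.δ h * D.δ h' := by
  rw [δ, tpart_mul, act_mul_apply, act_tpart, map_smul, act_tpart, map_smul, map_smul, ℓ₀_e₀,
    smul_eq_mul, smul_eq_mul, mul_one, mul_comm]

theorem tpart_one : D.tpart 1 = 1 := D.tpart_of_mem_K (one_mem _)

theorem δ_one : D.δ 1 = 1 := by rw [δ, tpart_one, act_one_apply, ℓ₀_e₀]

theorem δ_inv_mul (h : D.H) : D.δ h⁻¹ * D.δ h = 1 := by
  rw [← δ_mul, inv_mul_cancel, δ_one]

theorem δ_ne_zero (h : D.H) : D.δ h ≠ 0 := right_ne_zero_of_mul_eq_one (D.δ_inv_mul h)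

theorem δ_inv (h : D.H) : D.δ h⁻¹ = (D.δ h)⁻¹ := eq_inv_of_mul_eq_one_left (D.δ_inv_mul h)

theorem δ_tpart (h : D.H) : D.δ (D.tpart h) = D.δ h := by
  rw [δ, D.tpart_of_mem_K (D.tpart_mem_K h), δ]

theorem act_inv_frame (g : 𝒢.Grp) (h : D.H) :
    D.act h⁻¹ (D.frame g) = (D.δ h)⁻¹ • D.frame (g * h) := by
  have h1 : h⁻¹ * (D.a g)⁻¹ = (D.a (g * h))⁻¹ * (D.tpart h)⁻¹ := by
    have h2 : h * D.a g = D.a g * h := by rw [a, expA_comm]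
    rw [← mul_inv_rev, ← mul_inv_rev, a_mul_H, tpart]
    congr 1
    have h3 : (D.a h)⁻¹ * (D.a g * D.a h) = D.a g := by
      have h4 := D.expA_comm (D.a g) (D.Z h)
      change D.a g * D.a h = D.a h * D.a g at h4
      rw [h4, inv_mul_cancel_left]
    rw [mul_assoc, h3, h2]
  have h5 : D.act (D.tpart h)⁻¹ D.e₀ = (D.δ h)⁻¹ • D.e₀ := by
    have h6 := congrArg (D.act (D.tpart h)⁻¹) (D.act_tpart h)
    rw [act_inv_act, map_smul] at h6
    rw [h6, smul_smul, inv_mul_cancel₀ (D.δ_ne_zero h), one_smul]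
    exact congrArg _ h6.symm
  rw [frame, ← act_mul_apply, h1, act_mul_apply, h5, map_smul, frame]

theorem coef_act_inv {g : 𝒢.Grp} (h : D.H) {u : D.E} (hu : u ∈ D.fibre g) :
    D.coef (g * h) (D.act h⁻¹ u) = (D.δ h)⁻¹ * D.coef g u := by
  have h1 := congrArg (D.act h⁻¹) (D.eq_coef_smul hu)
  rw [map_smul, act_inv_frame] at h1
  rw [h1, map_smul, map_smul, coef_frame, smul_eq_mul, smul_eq_mul, mul_one, mul_comm]

theorem δ_exp_𝔱M {X : 𝒢.𝔤} (hX : X ∈ D.𝔱M) :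
    D.δ ⟨𝒢.expG X, expG_mem_H hX.1⟩ = Complex.exp (2 * D.lam ⟨X, hX⟩) := by
  rw [δ, tpart_of_mem_K, act_exp_𝔱M D hX D.e₀_mem, map_smul, ℓ₀_e₀, smul_eq_mul, mul_one]
  exact expG_mem_K hX.2

end Datum

/-! ### Characters of compact groups -/

section CompactGroup

variable {Γ : Type*} [Group Γ] [TopologicalSpace Γ] [CompactSpace Γ]

theorem norm_eq_one_of_multiplicative {χ : Γ → ℂ} (hχ : Continuous χ) (h1 : χ 1 = 1)
    (hmul : ∀ s t, χ (s * t) = χ s * χ t) (t : Γ) : ‖χ t‖ = 1 := by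
  have hinv : ∀ t, ‖χ t‖ * ‖χ t⁻¹‖ = 1 := fun t => by
    rw [← norm_mul, ← hmul, mul_inv_cancel, h1, norm_one]
  have hle : ∀ t, ‖χ t‖ ≤ 1 := by
    intro t
    by_contra! hlt
    obtain ⟨B, hB⟩ := (isCompact_range hχ).isBounded.exists_norm_le
    obtain ⟨m, hm⟩ := pow_unbounded_of_one_lt B hlt
    have hpow : ∀ m : ℕ, χ (t ^ m) = χ t ^ m := fun m => by
      induction m with
      | zero => rw [pow_zero, pow_zero, h1]
      | succ m ih => rw [pow_succ, pow_succ, hmul, ih]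
    have := hB (χ (t ^ m)) ⟨_, rfl⟩
    rw [hpow, norm_pow] at this
    linarith
  refine le_antisymm (hle t) ?_
  have h2 := hle t⁻¹
  have h3 := hinv t
  nlinarith [norm_nonneg (χ t)]

/-- The normalised invariant integral on a compact group. -/
theorem exists_invariant_mean [IsTopologicalGroup Γ] : ∃ I : C(Γ, ℂ) →L[ℂ] ℂ, I 1 = 1 ∧
    ∀ (f : C(Γ, ℂ)) (s : Γ), I (f.comp (ContinuousMap.mulLeft s)) = I f := by
  let _ : MeasurableSpace Γ := borel Γ
  have _ : BorelSpace Γ := ⟨rfl⟩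
  let K₀ : TopologicalSpace.PositiveCompacts Γ := ⊤
  let μ := MeasureTheory.Measure.haarMeasure K₀
  have hμ : μ Set.univ = 1 := by
    have := MeasureTheory.Measure.haarMeasure_self (K₀ := K₀)
    rwa [TopologicalSpace.PositiveCompacts.coe_top] at this
  have _ : MeasureTheory.IsProbabilityMeasure μ := ⟨hμ⟩
  have hint : ∀ f : C(Γ, ℂ), MeasureTheory.Integrable f μ := fun f =>
    f.continuous.integrable_of_hasCompactSupport (HasCompactSupport.of_compactSpace f)
  let I : C(Γ, ℂ) →ₗ[ℂ] ℂ :=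
    { toFun := fun f => ∫ t, f t ∂μ
      map_add' := fun f f' => MeasureTheory.integral_add (hint f) (hint f')
      map_smul' := fun c f => MeasureTheory.integral_const_mul c f }
  refine ⟨I.mkContinuous 1 fun f => ?_, ?_, fun f s => ?_⟩
  · have := MeasureTheory.norm_integral_le_of_norm_le_const (μ := μ) (f := f) (C := ‖f‖)
      (Eventually.of_forall fun t => f.norm_coe_le_norm t)
    rw [MeasureTheory.probReal_univ, mul_one] at this
    rw [one_mul]
    exact this
  · change ∫ _, (1 : ℂ) ∂μ = 1
    simp
  · exact MeasureTheory.integral_mul_left_eq_self (fun t => f t) s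

end CompactGroup

/-! ### The character of `H` on the fibre is unitary -/

section

variable {n : ℕ} {𝒢 : LinearReductiveGroup n} {C : CartanSubalgebra 𝒢}

open CartanSubalgebra

theorem hasDerivAt_exp_smul (X : Matrix (Fin n) (Fin n) ℝ)
    (B : Matrix (Fin n) (Fin n) ℝ →ₗ[ℝ] Matrix (Fin n) (Fin n) ℝ) (i j : Fin n) :
    HasDerivAt (fun t : ℝ => B (NormedSpace.exp (t • X)) i j) (B X i j) 0 := by
  let _ := Matrix.linftyOpNormedRing (n := Fin n) (α := ℝ)
  let _ := Matrix.linftyOpNormedAlgebra (R := ℝ) (n := Fin n) (α := ℝ)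
  have h1 := hasDerivAt_exp_smul_const (𝕂 := ℝ) X (0 : ℝ)
  rw [zero_smul, NormedSpace.exp_zero, one_mul] at h1
  exact (LinearMap.toContinuousLinearMap
    (Matrix.entryLinearMap ℝ ℝ i j ∘ₗ B)).hasFDerivAt.comp_hasDerivAt (0 : ℝ) h1

theorem isClosed_H : IsClosed (C.H : Set 𝒢.Grp) := by
  have h : (C.H : Set 𝒢.Grp) = ⋂ X ∈ C.𝔥, {g | 𝒢.mat g ∈ {A : Matrix (Fin n) (Fin n) ℝ |
      A * (X : Matrix (Fin n) (Fin n) ℝ) = X * A}} := by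
    ext g
    simp only [Set.mem_iInter]
    exact mem_fixer_iff
  rw [h]
  exact isClosed_biInter fun X _ => isClosed_of_mat
    (isClosed_eq (continuous_id.mul continuous_const) (continuous_const.mul continuous_id))

/-- The Lie algebra of the compact group `H ∩ K` is `𝔱_M`. -/
theorem mem_𝔱M_iff (X : 𝒢.𝔤) : X ∈ C.𝔱M ↔ ∀ t : ℝ, 𝒢.expG (t • X) ∈ 𝒢.K ⊓ C.H := by
  refine ⟨fun hX t => ⟨expG_mem_K (𝒢.𝔨.smul_mem t hX.2), expG_mem_H (C.𝔥.smul_mem t hX.1)⟩,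
    fun h => ⟨(C.mem_iff X).2 fun Y hY => ?_, mem_𝔨_iff.2 ?_⟩⟩
  · ext i j
    have h1 := hasDerivAt_exp_smul (X : Matrix (Fin n) (Fin n) ℝ) (LinearMap.mulRight ℝ Y) i j
    have h2 := hasDerivAt_exp_smul (X : Matrix (Fin n) (Fin n) ℝ) (LinearMap.mulLeft ℝ Y) i j
    refine h1.unique (h2.congr_of_eventuallyEq (Eventually.of_forall fun t => ?_))
    exact congrFun (congrFun (mem_fixer_iff.1 (h t).2 Y hY) i) j
  · ext i j
    have h1 := hasDerivAt_exp_smul (X : Matrix (Fin n) (Fin n) ℝ)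
      (Matrix.transposeLinearEquiv (Fin n) (Fin n) ℝ ℝ).toLinearMap i j
    have h2 := hasDerivAt_exp_smul (-(X : Matrix (Fin n) (Fin n) ℝ)) LinearMap.id i j
    refine h1.unique (h2.congr_of_eventuallyEq (Eventually.of_forall fun t => ?_))
    have h3 := mat_inv_of_mem_K (h t).1
    rw [← expG_neg, mat_expG, mat_expG] at h3
    have h4 : t • -(X : Matrix (Fin n) (Fin n) ℝ) =
        ((-(t • X) : 𝒢.𝔤) : Matrix (Fin n) (Fin n) ℝ) := by
      simp
    change (NormedSpace.exp (t • (X : Matrix (Fin n) (Fin n) ℝ)))ᵀ i j =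
      NormedSpace.exp (t • -(X : Matrix (Fin n) (Fin n) ℝ)) i j
    rw [h4, h3]
    rfl

theorem isCompact_T : IsCompact ((𝒢.K ⊓ C.H : Subgroup 𝒢.Grp) : Set 𝒢.Grp) :=
  isCompact_K.inter_right isClosed_H

theorem eventually_exists_𝔱M {U : Set (Matrix (Fin n) (Fin n) ℝ)} (hU : U ∈ 𝓝 0) :
    ∀ᶠ g in 𝓝 (1 : 𝒢.Grp), g ∈ 𝒢.K ⊓ C.H →
      ∃ X ∈ C.𝔱M, (X : Matrix (Fin n) (Fin n) ℝ) ∈ U ∧ g = 𝒢.expG X := by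
  let S : Subgroup (GL (Fin n) ℝ) := (𝒢.K ⊓ C.H).map 𝒢.toSubgroup.subtype
  have hS : IsClosed (S : Set (GL (Fin n) ℝ)) := by
    rw [Subgroup.coe_map]
    exact 𝒢.isClosed.isClosedEmbedding_subtypeVal.isClosedMap _ isCompact_T.isClosed
  have key := eventually_mem_of_expGL_mem S hS (C.𝔱M.map 𝒢.𝔤.subtype) (by
    intro X
    constructor
    · rintro ⟨X, hX, rfl⟩ t
      exact ⟨_, (mem_𝔱M_iff X).1 hX t, rfl⟩
    · intro h
      have hX : X ∈ 𝒢.𝔤 := fun t => by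
        obtain ⟨g, -, hg⟩ := h t
        rw [← hg]
        exact g.2
      refine ⟨⟨X, hX⟩, (mem_𝔱M_iff _).2 fun t => ?_, rfl⟩
      obtain ⟨g, hg, e⟩ := h t
      have : 𝒢.expG (t • ⟨X, hX⟩) = g := Subtype.ext e.symm
      rwa [this])
  filter_upwards [eventually_exists_expG (𝒢 := 𝒢) (Filter.inter_mem hU key)] with g hg hgT
  obtain ⟨X, ⟨hXU, hX⟩, rfl⟩ := hg
  obtain ⟨X', hX', e⟩ := hX ⟨_, hgT, rfl⟩
  have : X' = X := Subtype.ext e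
  exact ⟨X, this ▸ hX', hXU, rfl⟩

end

namespace Datum

open CartanSubalgebra

variable {n : ℕ} {𝒢 : LinearReductiveGroup n} (D : Datum 𝒢)

/-- The compact group `H ∩ K`. -/
abbrev TT : Subgroup 𝒢.Grp := 𝒢.K ⊓ D.H

instance : CompactSpace D.TT := isCompact_iff_compactSpace.1 isCompact_T

/-- The inclusion of `H ∩ K` into `H`. -/
def TTtoH : D.TT →* D.H := Subgroup.inclusion inf_le_right

/-- Near the identity of `H ∩ K` the character `δ` is `exp (2 λ)`. -/
theorem continuous_δ : Continuous fun t : D.TT => D.δ (D.TTtoH t) := by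
  obtain ⟨L, hL⟩ := (D.lam).exists_extend
  obtain ⟨L', hL'⟩ := L.exists_extend
  have hval : ∀ X : 𝒢.𝔤, ∀ hX : X ∈ D.𝔱M, L' X = D.lam ⟨X, hX⟩ := fun X hX =>
    (LinearMap.congr_fun hL' X).trans (LinearMap.congr_fun hL ⟨X, hX⟩)
  have hc : Continuous fun A : Matrix (Fin n) (Fin n) ℝ => Complex.exp (2 * L' A) :=
    Complex.continuous_exp.comp (continuous_const.mul L'.continuous_of_finiteDimensional)
  have h1 : ContinuousAt (fun t : D.TT => D.δ (D.TTtoH t)) 1 := by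
    rw [ContinuousAt, map_one, δ_one]
    intro V hV
    have hU : (fun A : Matrix (Fin n) (Fin n) ℝ => Complex.exp (2 * L' A)) ⁻¹' V ∈ 𝓝 0 := by
      refine hc.continuousAt.preimage_mem_nhds ?_
      rwa [map_zero, mul_zero, Complex.exp_zero]
    have hs : Tendsto (fun t : D.TT => (t : 𝒢.Grp)) (𝓝 1) (𝓝 1) :=
      continuous_subtype_val.tendsto 1
    change ∀ᶠ t : D.TT in 𝓝 1, D.δ (D.TTtoH t) ∈ V
    filter_upwards [hs.eventually (eventually_exists_𝔱M (C := D.toCartanSubalgebra) hU)] with t ht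
    obtain ⟨X, hX, hXU, e⟩ := ht t.2
    have h2 : D.TTtoH t = ⟨𝒢.expG X, expG_mem_H hX.1⟩ := Subtype.ext e
    rw [Set.mem_preimage, hval X hX, ← D.δ_exp_𝔱M hX, ← h2] at hXU
    exact hXU
  have h2 : (fun t : D.TT => D.δ (D.TTtoH t)) =
      fun t => (Units.coeHom ℂ).comp (MonoidHom.toHomUnits
        { toFun := fun t : D.TT => D.δ (D.TTtoH t)
          map_one' := by rw [map_one, δ_one]
          map_mul' := fun s t => by rw [map_mul, δ_mul] }) t := rfl
  rw [h2]
  exact continuous_of_continuousAt_one _ h1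

theorem norm_δ (h : D.H) : ‖D.δ h‖ = 1 := by
  have h1 := norm_eq_one_of_multiplicative D.continuous_δ (by rw [map_one, δ_one])
    (fun s t => by rw [map_mul, δ_mul]) ⟨D.tpart h, D.tpart_mem_K h, (D.tpart h).2⟩
  rw [← δ_tpart]
  exact h1

theorem conj_δ_mul (h : D.H) : starRingEnd ℂ (D.δ h) * D.δ h = 1 := by
  rw [← Complex.normSq_eq_conj_mul_self, Complex.normSq_eq_norm_sq, norm_δ]
  simp

end Datum

/-! ### Smoothness of the frame -/

section

variable {E : Type*} [AddCommGroup E] [Module ℂ E] [FiniteDimensional ℂ E]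

/-- If the matrix coefficients of a family of linear maps lie in an algebra of functions, then so
do those of the induced maps on exterior powers. -/
theorem exteriorPower_map_mem_subalgebra {X : Type*} (𝒮 : Subalgebra ℂ (X → ℂ)) (d : ℕ)
    (A : X → E →ₗ[ℂ] E) (hA : ∀ (ℓ : E →ₗ[ℂ] ℂ) (w : E), (fun x => ℓ (A x w)) ∈ 𝒮)
    (ℓ : ⋀[ℂ]^d E →ₗ[ℂ] ℂ) (y : ⋀[ℂ]^d E) :
    (fun x => ℓ (exteriorPower.map d (A x) y)) ∈ 𝒮 := by
  have hy : y ∈ Submodule.span ℂ (Set.range (exteriorPower.ιMulti ℂ d (M := E))) := by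
    rw [exteriorPower.ιMulti_span]; trivial
  induction hy using Submodule.span_induction with
  | zero =>
    simp only [map_zero]
    exact zero_mem 𝒮
  | add y z _ _ hy hz =>
    simp only [map_add]
    exact add_mem hy hz
  | smul c y _ hy =>
    simp only [map_smul]
    exact 𝒮.smul_mem hy c
  | mem y hy =>
    obtain ⟨w, rfl⟩ := hy
    -- expand the factors in a basis
    let b := Module.finBasis ℂ E
    let f : MultilinearMap ℂ (fun _ : Fin d => E) ℂ :=
      ℓ.compMultilinearMap (exteriorPower.ιMulti ℂ d (M := E)).toMultilinearMap
    have h1 : (fun x => ℓ (exteriorPower.map d (A x) (exteriorPower.ιMulti ℂ d w))) =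
        ∑ r : Fin d → Fin (Module.finrank ℂ E),
          f (fun i => b (r i)) • ∏ i, fun x => b.coord (r i) (A x (w i)) := by
      funext x
      rw [exteriorPower.map_apply_ιMulti]
      have h2 : (A x ∘ w) = fun i => ∑ j, b.coord j (A x (w i)) • b j := by
        funext i
        exact (b.sum_repr _).symm
      change f (A x ∘ w) = _
      rw [h2, MultilinearMap.map_sum, Finset.sum_apply]
      refine Finset.sum_congr rfl fun r _ => ?_
      rw [MultilinearMap.map_smul_univ, Pi.smul_apply, Finset.prod_apply, smul_eq_mul, smul_eq_mul,
        mul_comm]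
    rw [h1]
    exact sum_mem fun r _ => 𝒮.smul_mem (prod_mem fun i _ => hA _ _) _

end

variable {n : ℕ} {𝒢 : LinearReductiveGroup n}

/-- The algebra of smooth complex functions on `G`. -/
def smoothSubalgebra (𝒢 : LinearReductiveGroup n) : Subalgebra ℂ (𝒢.Grp → ℂ) where
  carrier := {f | SmoothMap f}
  mul_mem' hf hf' := hf.mul hf'
  add_mem' hf hf' := hf.add hf'
  algebraMap_mem' c := SmoothMap.const c

theorem IsSmooth.smoothMap {f : 𝒢.Grp → ℂ} (hf : IsSmooth ℂ f) : SmoothMap f :=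
  fun g m X => hf LinearMap.id g m X

theorem SmoothMap.isSmooth {f : 𝒢.Grp → ℂ} (hf : SmoothMap f) : IsSmooth ℂ f := by
  intro ℓ g m X
  have h : ∀ z, ℓ z = z * ℓ 1 := fun z => by
    rw [← smul_eq_mul, ← map_smul, smul_eq_mul, mul_one]
  refine (congrArg (ContDiff ℝ ∞) (funext fun c => ?_)).mpr
    ((hf.mul (SmoothMap.const (ℓ 1))) g m X)
  exact h _

theorem SmoothMap.apply_apply {E : Type*} [AddCommGroup E] [Module ℂ E] [FiniteDimensional ℂ E]
    {c : 𝒢.Grp → E →ₗ[ℂ] ℂ} {s : 𝒢.Grp → E} (hc : ∀ u, SmoothMap fun g => c g u)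
    (hs : ∀ ℓ : E →ₗ[ℂ] ℂ, SmoothMap fun g => ℓ (s g)) : SmoothMap fun g => c g (s g) := by
  let b := Module.finBasis ℂ E
  have h : ∀ g, c g (s g) = ∑ j, b.coord j (s g) * c g (b j) := fun g => by
    conv_lhs => rw [← b.sum_repr (s g), map_sum]
    refine Finset.sum_congr rfl fun j _ => ?_
    rw [map_smul]
    rfl
  simp only [h]
  exact SmoothMap.sum fun j _ => (hs _).mul (hc _)

namespace Datum

open CartanSubalgebra

variable (D : Datum 𝒢)

theorem smoothMap_AdT (s : (Fin D.coordDim → ℝ) →ₗ[ℝ] D.𝔞) (φ : ℂ ⊗[ℝ] D.T →ₗ[ℂ] ℂ)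
    (x : ℂ ⊗[ℝ] D.T) :
    SmoothMap fun g => φ ((D.AdT (D.expA (s (D.coord g)))).baseChange ℂ x) := by
  induction x with
  | zero => simpa using SmoothMap.const (𝒢 := 𝒢) (0 : ℂ)
  | add x y hx hy =>
    simp only [map_add]
    exact hx.add hy
  | tmul c v =>
    obtain ⟨Y, rfl⟩ := Submodule.Quotient.mk_surjective _ v
    let _ := Matrix.linftyOpNormedRing (n := Fin n) (α := ℝ)
    let _ := Matrix.linftyOpNormedAlgebra (R := ℝ) (n := Fin n) (α := ℝ)
    obtain ⟨B, hB⟩ := (φ.restrictScalars ℝ ∘ₗ TensorProduct.mk ℝ ℂ D.T c ∘ₗ D.𝔥.mkQ).exists_extend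
    let S : (Fin D.coordDim → ℝ) →ₗ[ℝ] Matrix (Fin n) (Fin n) ℝ :=
      𝒢.𝔤.subtype ∘ₗ D.𝔞.subtype ∘ₗ s
    have hS : ContDiff ℝ ∞ fun c => S c := (LinearMap.toContinuousLinearMap S).contDiff
    have he : ContDiff ℝ ∞ fun Z : Matrix (Fin n) (Fin n) ℝ => NormedSpace.exp Z :=
      contDiff_iff_contDiffAt.2 fun Z => (NormedSpace.exp_analytic (𝕂 := ℝ) Z).contDiffAt
    have h1 : ContDiff ℝ ∞ fun c => NormedSpace.exp (S c) * (Y : Matrix (Fin n) (Fin n) ℝ) *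
        NormedSpace.exp (-S c) := ((he.comp hS).mul contDiff_const).mul (he.comp hS.neg)
    have h2 := (LinearMap.toContinuousLinearMap B).contDiff (n := ∞) |>.comp h1
    have h3 := D.smoothMap_coord.comp fun g => h2.contDiffAt
    refine fun g m X => (congrArg (ContDiff ℝ ∞) (funext fun c => ?_)).mpr (h3 g m X)
    set W := s (D.coord (g * 𝒢.expG (∑ i, c i • X i))) with hW
    have h4 := LinearMap.congr_fun hB (𝒢.Ad (𝒢.expG W) Y)
    refine h4.symm.trans ?_
    change B _ = B _
    congr 1

theorem act_expA (W : D.𝔞) (u : D.E) :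
    D.act (D.expA W) u = exteriorPower.map D.d ((D.AdT (D.expA W)).baseChange ℂ) u := by
  rw [act_apply]
  have h := D.σ_exp_𝔞 W.2
  have h' : (D.σ (D.expA W) : ℂ) = 1 := h
  rw [h', one_pow, one_smul]

theorem smoothMap_act (s : (Fin D.coordDim → ℝ) →ₗ[ℝ] D.𝔞) (ℓ : D.E →ₗ[ℂ] ℂ) (u : D.E) :
    SmoothMap fun g => ℓ (D.act (D.expA (s (D.coord g))) u) := by
  have key : SmoothMap fun g => ℓ (exteriorPower.map D.d
      ((D.AdT (D.expA (s (D.coord g)))).baseChange ℂ) u) :=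
    exteriorPower_map_mem_subalgebra (E := ℂ ⊗[ℝ] D.T) (smoothSubalgebra 𝒢) D.d
      (fun g => (D.AdT (D.expA (s (D.coord g)))).baseChange ℂ) (D.smoothMap_AdT s) ℓ u
  refine fun g m X => (congrArg (ContDiff ℝ ∞) (funext fun c => ?_)).mpr (key g m X)
  exact congrArg ℓ (D.act_expA _ u)

theorem smoothMap_coef (u : D.E) : SmoothMap fun g => D.coef g u :=
  D.smoothMap_act D.coordMap D.ℓ₀ u

theorem smoothMap_frame (ℓ : D.E →ₗ[ℂ] ℂ) : SmoothMap fun g => ℓ (D.frame g) := by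
  have h := D.smoothMap_act (D.coordMap ∘ₗ (-LinearMap.id)) ℓ D.e₀
  have h1 : ∀ g, D.frame g =
      D.act (D.expA ((D.coordMap ∘ₗ (-LinearMap.id)) (D.coord g))) D.e₀ := fun g => by
    have h2 : D.expA (D.coordMap (-D.coord g)) = (D.a g)⁻¹ := by
      refine eq_inv_of_mul_eq_one_left ((D.expA_add _ _).symm.trans ?_)
      refine (congrArg D.expA ((D.coordMap.map_add (-D.coord g) (D.coord g)).symm.trans ?_)).trans
        D.expA_zero
      rw [neg_add_cancel]
      exact D.coordMap.map_zero
    exact congrArg (fun h => D.act h D.e₀) h2.symm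
  exact fun g m X => (congrArg (ContDiff ℝ ∞) (funext fun c => congrArg ℓ (h1 _))).mpr (h g m X)

/-- The function on `G` that describes a section in the frame. -/
def coefFun (s : D.Sect) (g : 𝒢.Grp) : ℂ := D.coef g (s.1 g)

theorem smoothMap_coefFun (s : D.Sect) : SmoothMap (D.coefFun s) :=
  SmoothMap.apply_apply D.smoothMap_coef s.2.1

theorem coefFun_mul (s : D.Sect) (g : 𝒢.Grp) (h : D.H) :
    D.coefFun s (g * h) = (D.δ h)⁻¹ * D.coefFun s g := by
  rw [coefFun, s.2.2.2, D.coef_act_inv h (s.2.2.1 g), coefFun]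

theorem eq_coefFun_smul (s : D.Sect) (g : 𝒢.Grp) : s.1 g = D.coefFun s g • D.frame g :=
  D.eq_coef_smul (s.2.2.1 g)

/-- The section described by a function on `G` that transforms by the character `δ`. -/
def ofCoef (φ : 𝒢.Grp → ℂ) (h1 : SmoothMap φ) (h2 : ∀ (g : 𝒢.Grp) (h : D.H),
    φ (g * h) = (D.δ h)⁻¹ * φ g) : D.Sect :=
  ⟨fun g => φ g • D.frame g, fun ℓ g m X => by
      simp only [map_smul]
      exact (h1.mul (D.smoothMap_frame ℓ)) g m X,
    fun g => Submodule.smul_mem _ _ (D.frame_mem g), fun g h => by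
      rw [map_smul, act_inv_frame, smul_smul, mul_comm, ← h2]⟩

theorem coefFun_ofCoef (φ : 𝒢.Grp → ℂ) (h1 : SmoothMap φ) (h2 : ∀ (g : 𝒢.Grp) (h : D.H),
    φ (g * h) = (D.δ h)⁻¹ * φ g) : D.coefFun (D.ofCoef φ h1 h2) = φ := by
  funext g
  change D.coef g (φ g • D.frame g) = _
  rw [map_smul, coef_frame, smul_eq_mul, mul_one]

end Datum

/-! ### Sections that do not vanish at a given point -/

namespace Datum

open CartanSubalgebra

variable {n : ℕ} {𝒢 : LinearReductiveGroup n} (D : Datum 𝒢)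

/-- The projection of `G = (K exp(𝔰_M) N) A` to the first factor. -/
def q (g : 𝒢.Grp) : 𝒢.Grp := g * ((D.a g)⁻¹ : D.H)

theorem q_mul (g : 𝒢.Grp) (h : D.H) : D.q (g * h) = D.q g * D.tpart h := by
  have h1 : (D.a (g * h))⁻¹ = (D.a h)⁻¹ * (D.a g)⁻¹ := by rw [a_mul_H, mul_inv_rev]
  have h2 : h * ((D.a h)⁻¹ * (D.a g)⁻¹) = (D.a g)⁻¹ * D.tpart h := by
    have h3 : D.tpart h * (D.a g)⁻¹ = (D.a g)⁻¹ * D.tpart h := by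
      rw [a, ← expA_neg, expA_comm]
    rw [← h3, tpart, mul_assoc]
  rw [q, q, h1, mul_assoc, mul_assoc]
  congr 1
  exact congrArg Subtype.val h2

theorem smoothMap_q (i j : Fin n) : SmoothMap fun g => 𝒢.mat (D.q g) i j := by
  let _ := Matrix.linftyOpNormedRing (n := Fin n) (α := ℝ)
  let _ := Matrix.linftyOpNormedAlgebra (R := ℝ) (n := Fin n) (α := ℝ)
  have he : ContDiff ℝ ∞ fun Z : Matrix (Fin n) (Fin n) ℝ => NormedSpace.exp Z :=
    contDiff_iff_contDiffAt.2 fun Z => (NormedSpace.exp_analytic (𝕂 := ℝ) Z).contDiffAt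
  let S : (Fin D.coordDim → ℝ) →ₗ[ℝ] Matrix (Fin n) (Fin n) ℝ :=
      𝒢.𝔤.subtype ∘ₗ D.𝔞.subtype ∘ₗ D.coordMap
  have hS : ContDiff ℝ ∞ fun c => S c := (LinearMap.toContinuousLinearMap S).contDiff
  have h1 : SmoothMap fun g => NormedSpace.exp (-S (D.coord g)) :=
    D.smoothMap_coord.comp fun g => (he.comp hS.neg).contDiffAt
  have h2 : SmoothMap fun g : 𝒢.Grp => 𝒢.mat g :=
    fun g m X => smoothMap_mat (𝒢 := 𝒢) (W := Matrix (Fin n) (Fin n) ℝ) LinearMap.id g m X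
  have h3 := (h2.mul h1).clm (LinearMap.toContinuousLinearMap (Matrix.entryLinearMap ℝ ℝ i j))
  refine fun g m X => (congrArg (ContDiff ℝ ∞) (funext fun c => ?_)).mpr (h3 g m X)
  have h4 : ∀ g, 𝒢.mat (D.q g) = 𝒢.mat g * NormedSpace.exp (-S (D.coord g)) := fun g => by
    rw [q, mat_mul, a, ← expA_neg]
    rfl
  exact congrArg (fun A : Matrix (Fin n) (Fin n) ℝ => A i j) (h4 _)

/-- The functions `P` on `G` for which `P (q(g) t)` is a finite sum of products of smooth functions
of `g` and continuous functions of `t ∈ H ∩ K`. -/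
def IsSeparated (P : 𝒢.Grp → ℂ) : Prop :=
  ∃ (ι : Type) (_ : Fintype ι) (α : ι → 𝒢.Grp → ℂ) (w : ι → C(D.TT, ℂ)),
    (∀ i, SmoothMap (α i)) ∧ ∀ (g : 𝒢.Grp) (t : D.TT), P (D.q g * t) = ∑ i, α i g * w i t

variable {D}

theorem IsSeparated.const (c : ℂ) : D.IsSeparated fun _ => c :=
  ⟨Unit, inferInstance, fun _ _ => c, fun _ => 1, fun _ => SmoothMap.const c, fun _ _ => by simp⟩

theorem IsSeparated.add {P Q : 𝒢.Grp → ℂ} (hP : D.IsSeparated P) (hQ : D.IsSeparated Q) :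
    D.IsSeparated fun g => P g + Q g := by
  obtain ⟨ι, _, α, w, h1, h2⟩ := hP
  obtain ⟨κ, _, β, v, h3, h4⟩ := hQ
  refine ⟨ι ⊕ κ, inferInstance, Sum.elim α β, Sum.elim w v, ?_, fun g t => ?_⟩
  · rintro (i | i)
    exacts [h1 i, h3 i]
  · simp only [h2, h4, Fintype.sum_sum_type, Sum.elim_inl, Sum.elim_inr]

theorem IsSeparated.mul {P Q : 𝒢.Grp → ℂ} (hP : D.IsSeparated P) (hQ : D.IsSeparated Q) :
    D.IsSeparated fun g => P g * Q g := by
  obtain ⟨ι, _, α, w, h1, h2⟩ := hP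
  obtain ⟨κ, _, β, v, h3, h4⟩ := hQ
  refine ⟨ι × κ, inferInstance, fun p g => α p.1 g * β p.2 g, fun p => w p.1 * v p.2,
    fun p => (h1 p.1).mul (h3 p.2), fun g t => ?_⟩
  simp only [h2, h4, Fintype.sum_prod_type, Finset.sum_mul_sum, ContinuousMap.mul_apply]
  refine Finset.sum_congr rfl fun i _ => Finset.sum_congr rfl fun j _ => ?_
  ring

theorem IsSeparated.conj {P : 𝒢.Grp → ℂ} (hP : D.IsSeparated P) :
    D.IsSeparated fun g => starRingEnd ℂ (P g) := by
  obtain ⟨ι, _, α, w, h1, h2⟩ := hP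
  refine ⟨ι, inferInstance, fun i g => starRingEnd ℂ (α i g), fun i => star (w i),
    fun i => (h1 i).clm Complex.conjCLE.toContinuousLinearMap, fun g t => ?_⟩
  simp only [h2, map_sum, map_mul]
  rfl

theorem IsSeparated.mat (i j : Fin n) : D.IsSeparated fun g => (𝒢.mat g i j : ℂ) := by
  refine ⟨Fin n, inferInstance, fun k g => (𝒢.mat (D.q g) i k : ℂ),
    fun k => ⟨fun t => (𝒢.mat t k j : ℂ), ?_⟩, fun k => (D.smoothMap_q i k).ofReal, fun g t => ?_⟩
  · exact Complex.continuous_ofReal.comp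
      ((continuous_mat.comp continuous_subtype_val).matrix_elem k j)
  · change (𝒢.mat (D.q g * t) i j : ℂ) = ∑ k, (𝒢.mat (D.q g) i k : ℂ) * (𝒢.mat t k j : ℂ)
    rw [mat_mul, Matrix.mul_apply]
    push_cast
    rfl

variable (D)

/-- The algebra of functions on `H ∩ K` obtained from separated functions at a point of `G`. -/
def separatedAlgebra (g : 𝒢.Grp) : StarSubalgebra ℂ C(D.TT, ℂ) where
  carrier := {p | ∃ P, D.IsSeparated P ∧ ∀ t : D.TT, p t = P (D.q g * t)}
  mul_mem' := by
    rintro p p' ⟨P, hP, h⟩ ⟨P', hP', h'⟩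
    exact ⟨_, hP.mul hP', fun t => by rw [ContinuousMap.mul_apply, h, h']⟩
  add_mem' := by
    rintro p p' ⟨P, hP, h⟩ ⟨P', hP', h'⟩
    exact ⟨_, hP.add hP', fun t => by rw [ContinuousMap.add_apply, h, h']⟩
  algebraMap_mem' c := ⟨_, IsSeparated.const c, fun t => rfl⟩
  star_mem' := by
    rintro p ⟨P, hP, h⟩
    exact ⟨_, hP.conj, fun t => by rw [← h]; rfl⟩

theorem separatesPoints_separatedAlgebra (g : 𝒢.Grp) :
    (D.separatedAlgebra g).SeparatesPoints := by
  intro s t hst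
  have h1 : 𝒢.mat (D.q g * s) ≠ 𝒢.mat (D.q g * t) := fun h =>
    hst (Subtype.ext (mul_left_cancel (mat_injective h)))
  obtain ⟨i, j, hij⟩ : ∃ i j, 𝒢.mat (D.q g * s) i j ≠ 𝒢.mat (D.q g * t) i j := by
    by_contra! h
    exact h1 (Matrix.ext h)
  refine ⟨fun t => (𝒢.mat (D.q g * t) i j : ℂ), ⟨⟨_, ?_⟩, ⟨_, IsSeparated.mat i j, fun t => rfl⟩,
    rfl⟩, ?_⟩
  · exact Complex.continuous_ofReal.comp
      ((continuous_mat.comp (continuous_const.mul continuous_subtype_val)).matrix_elem i j)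
  · exact fun h => hij (Complex.ofReal_injective h)

/-- The character `δ` on `H ∩ K`. -/
def δT : C(D.TT, ℂ) := ⟨fun t => D.δ (D.TTtoH t), D.continuous_δ⟩

/-- Averaging over `H ∩ K` against `δ` turns a separated function into a section. -/
theorem exists_sect_of_isSeparated {I : C(D.TT, ℂ) →L[ℂ] ℂ}
    (hI : ∀ (f : C(D.TT, ℂ)) (s : D.TT), I (f.comp (ContinuousMap.mulLeft s)) = I f)
    {P : 𝒢.Grp → ℂ} (hP : D.IsSeparated P) (g : 𝒢.Grp) {p : C(D.TT, ℂ)}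
    (hp : ∀ t : D.TT, p t = P (D.q g * t)) : ∃ s : D.Sect, D.coefFun s g = I (D.δT * p) := by
  obtain ⟨ι, _, α, w, h1, h2⟩ := hP
  -- `f g` is the function `t ↦ δ(t) P(q(g) t)` on `H ∩ K`, whose mean is the coefficient
  -- of the section
  let f : 𝒢.Grp → C(D.TT, ℂ) := fun g => D.δT * ∑ i, α i g • w i
  have hf : ∀ g t, f g t = D.δT t * P (D.q g * t) := fun g t => by
    rw [h2]
    simp [f, ContinuousMap.sum_apply]
  have hφ : SmoothMap fun g => I (f g) := by
    have h3 : ∀ g, I (f g) = ∑ i, α i g * I (D.δT * w i) := fun g => by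
      simp only [f, Finset.mul_sum, map_sum, mul_smul_comm, map_smul, smul_eq_mul]
    simp only [h3]
    exact SmoothMap.sum fun i _ => (h1 i).mul (SmoothMap.const _)
  have heq : ∀ (g : 𝒢.Grp) (h : D.H), I (f (g * h)) = (D.δ h)⁻¹ * I (f g) := by
    intro g h
    let s : D.TT := ⟨D.tpart h, D.tpart_mem_K h, (D.tpart h).2⟩
    have hs : D.δT s = D.δ h := D.δ_tpart h
    have h4 : f (g * h) = (D.δ h)⁻¹ • (f g).comp (ContinuousMap.mulLeft s) := by
      ext t
      rw [ContinuousMap.smul_apply, ContinuousMap.comp_apply, ContinuousMap.coe_mulLeft, hf, hf,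
        q_mul]
      have h5 : D.δT (s * t) = D.δT s * D.δT t := by
        change D.δ (D.TTtoH (s * t)) = _
        rw [map_mul, δ_mul]
        rfl
      rw [h5, hs, smul_eq_mul, ← mul_assoc, ← mul_assoc, inv_mul_cancel₀ (D.δ_ne_zero h), one_mul,
        mul_assoc (D.q g)]
      rfl
    rw [h4, map_smul, hI, smul_eq_mul]
  refine ⟨D.ofCoef _ hφ heq, ?_⟩
  rw [coefFun_ofCoef]
  congr 1
  ext t
  rw [hf, ContinuousMap.mul_apply, hp]

/-- By the Stone-Weierstrass theorem a separated function has a nonzero average against `δ`. -/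
theorem exists_coefFun_ne_zero (g : 𝒢.Grp) : ∃ s : D.Sect, D.coefFun s g ≠ 0 := by
  obtain ⟨I, hI1, hI⟩ := exists_invariant_mean (Γ := D.TT)
  by_contra! h0
  have hcl : IsClosed {p : C(D.TT, ℂ) | I (D.δT * p) = 0} :=
    isClosed_eq (I.continuous.comp (continuous_const.mul continuous_id)) continuous_const
  have hsub : ((D.separatedAlgebra g : StarSubalgebra ℂ C(D.TT, ℂ)) : Set C(D.TT, ℂ)) ⊆
      {p : C(D.TT, ℂ) | I (D.δT * p) = 0} := by
    rintro p ⟨P, hP, hp⟩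
    obtain ⟨s, hs⟩ := D.exists_sect_of_isSeparated hI hP g hp
    exact hs.symm.trans (h0 s)
  have hd := ContinuousMap.starSubalgebra_topologicalClosure_eq_top_of_separatesPoints
    (D.separatedAlgebra g) (D.separatesPoints_separatedAlgebra g)
  have hmem : star D.δT ∈ (D.separatedAlgebra g).topologicalClosure := by
    rw [hd]; trivial
  have h1 := closure_minimal hsub hcl hmem
  have h2 : D.δT * star D.δT = 1 := by
    ext t
    rw [mul_comm]
    exact D.conj_δ_mul _
  rw [Set.mem_ofPred_eq, h2, hI1] at h1
  exact one_ne_zero h1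

end Datum

/-! ### Invariant Hermitian metrics -/

namespace SmoothMap

variable {n : ℕ} {𝒢 : LinearReductiveGroup n}

/-- A locally defined quotient of smooth functions is smooth. -/
theorem of_mul {f : 𝒢.Grp → ℂ} (h : ∀ g, ∃ r p : 𝒢.Grp → ℂ, SmoothMap r ∧ SmoothMap p ∧ r g ≠ 0 ∧
    ∀ g, r g * f g = p g) : SmoothMap f := by
  intro g m X
  rw [contDiff_iff_contDiffAt]
  intro c
  obtain ⟨r, p, hr, hp, h0, h1⟩ := h (g * 𝒢.expG (∑ i, c i • X i))
  have h2 := (hr g m X).continuous.continuousAt.eventually_ne h0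
  refine (((hr g m X).contDiffAt.inv h0).mul (hp g m X).contDiffAt).congr_of_eventuallyEq ?_
  filter_upwards [h2] with c' hc'
  rw [← h1]
  exact (inv_mul_cancel_left₀ hc' _).symm

end SmoothMap

section

variable {V : Type*} [AddCommMonoid V] [Module ℂ V] (F : Submodule ℂ V)

/-- The Hermitian form `(u, v) ↦ conj (c u) (c v)` on a subspace, for a linear functional `c`. -/
def conjForm (c : V →ₗ[ℂ] ℂ) : F →ₗ⋆[ℂ] F →ₗ[ℂ] ℂ :=
  LinearMap.mk₂'ₛₗ (starRingEnd ℂ) (RingHom.id ℂ) (fun u v => starRingEnd ℂ (c u) * c v)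
    (fun u u' v => by rw [Submodule.coe_add, map_add, map_add, add_mul])
    (fun a u v => by
      rw [Submodule.coe_smul, map_smul, smul_eq_mul, map_mul, smul_eq_mul, mul_assoc])
    (fun u v v' => by rw [Submodule.coe_add, map_add, mul_add])
    (fun a u v => by
      rw [Submodule.coe_smul, map_smul, smul_eq_mul, RingHom.id_apply, smul_eq_mul, mul_left_comm])

variable {F}

theorem form_eq_mul (B : F →ₗ⋆[ℂ] F →ₗ[ℂ] ℂ) {c : V →ₗ[ℂ] ℂ} {e : V} (he : e ∈ F)
    (hc : ∀ u ∈ F, u = c u • e) (u v : F) :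
    B u v = starRingEnd ℂ (c u) * c v * B ⟨e, he⟩ ⟨e, he⟩ := by
  have hu : ∀ u : F, u = c u • (⟨e, he⟩ : F) := fun u => Subtype.ext (hc u u.2)
  conv_lhs => rw [hu u, hu v]
  rw [(B (c u • ⟨e, he⟩)).map_smul, B.map_smulₛₗ, LinearMap.smul_apply, smul_eq_mul, smul_eq_mul]
  ring

end

namespace Datum

open CartanSubalgebra

variable {n : ℕ} {𝒢 : LinearReductiveGroup n} (D : Datum 𝒢)

theorem frame_K_mul {k : 𝒢.Grp} (hk : k ∈ 𝒢.K) (g : 𝒢.Grp) : D.frame (k * g) = D.frame g := by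
  rw [frame, D.a_K_mul hk, frame]

theorem coef_K_mul {k : 𝒢.Grp} (hk : k ∈ 𝒢.K) (g : 𝒢.Grp) : D.coef (k * g) = D.coef g := by
  rw [coef, D.a_K_mul hk, coef]

/-- The `K`-invariant Hermitian metric for which `frame` has length one. -/
def frameMetric : D.KInvariantMetric where
  form g := conjForm (D.fibre g) (D.coef g)
  conj_symm g u v := by
    change starRingEnd ℂ (starRingEnd ℂ (D.coef g u) * D.coef g v) =
      starRingEnd ℂ (D.coef g v) * D.coef g u
    rw [map_mul, Complex.conj_conj, mul_comm]
  pos g u hu := by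
    change 0 < (starRingEnd ℂ (D.coef g u) * D.coef g u).re
    have h0 : D.coef g u ≠ 0 := fun h0 => hu (Subtype.ext (by
      rw [D.eq_coef_smul u.2, h0, zero_smul]; rfl))
    rw [← Complex.normSq_eq_conj_mul_self, Complex.ofReal_re]
    exact Complex.normSq_pos.2 h0
  equivariant g h u v u' v' hu hv := by
    change starRingEnd ℂ (D.coef (g * h) u') * D.coef (g * h) v' =
      starRingEnd ℂ (D.coef g u) * D.coef g v
    rw [hu, hv, D.coef_act_inv h u.2, D.coef_act_inv h v.2, map_mul, mul_mul_mul_comm, ← δ_inv,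
      conj_δ_mul, one_mul]
  smooth s t := by
    change D.IsSmoothFunction ℂ fun g => starRingEnd ℂ (D.coefFun s g) * D.coefFun t g
    refine ⟨SmoothMap.isSmooth (((D.smoothMap_coefFun s).clm
      Complex.conjCLE.toContinuousLinearMap).mul (D.smoothMap_coefFun t)), fun g h => ?_⟩
    change starRingEnd ℂ (D.coefFun s (g * h)) * D.coefFun t (g * h) = _
    rw [coefFun_mul, coefFun_mul, map_mul, mul_mul_mul_comm, ← δ_inv, conj_δ_mul, one_mul]
  invariant k hk g u v u' v' hu hv := by
    change starRingEnd ℂ (D.coef (k * g) u') * D.coef (k * g) v' =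
      starRingEnd ℂ (D.coef g u) * D.coef g v
    rw [hu, hv, D.coef_K_mul hk]

variable {D} (b : D.KInvariantMetric)

namespace KInvariantMetric

/-- The squared length of `frame`. -/
def density (g : 𝒢.Grp) : ℝ := (b.form g ⟨D.frame g, D.frame_mem g⟩ ⟨D.frame g, D.frame_mem g⟩).re

theorem density_pos (g : 𝒢.Grp) : 0 < b.density g := by
  refine b.pos g _ fun h => one_ne_zero (α := ℂ) ?_
  rw [← D.coef_frame g, show D.frame g = 0 from congrArg Subtype.val h, map_zero]

theorem form_eq (g : 𝒢.Grp) (u v : D.fibre g) :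
    b.form g u v = starRingEnd ℂ (D.coef g u) * D.coef g v * b.density g := by
  have h1 : b.form g ⟨D.frame g, D.frame_mem g⟩ ⟨D.frame g, D.frame_mem g⟩ = b.density g :=
    (Complex.conj_eq_iff_re.1 (b.conj_symm g _ _)).symm
  rw [← h1]
  exact form_eq_mul (b.form g) (D.frame_mem g) (fun u hu => D.eq_coef_smul hu) u v

theorem pair_eq (s t : D.Sect) (g : 𝒢.Grp) :
    b.pair s t g = starRingEnd ℂ (D.coefFun s g) * D.coefFun t g * b.density g := b.form_eq g _ _

theorem density_K_mul {k : 𝒢.Grp} (hk : k ∈ 𝒢.K) (g : 𝒢.Grp) :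
    b.density (k * g) = b.density g :=
  congrArg Complex.re (b.invariant k hk g _ _ _ _ (D.frame_K_mul hk g) (D.frame_K_mul hk g))

theorem density_mul_H (g : 𝒢.Grp) (h : D.H) : b.density (g * h) = b.density g := by
  obtain ⟨s, hs⟩ := D.exists_coefFun_ne_zero g
  have h1 := (b.smooth s s).2 g h
  change b.pair s s (g * h) = b.pair s s g at h1
  rw [pair_eq, pair_eq, D.coefFun_mul, map_mul, mul_mul_mul_comm (starRingEnd ℂ (D.δ h)⁻¹),
    ← D.δ_inv, D.conj_δ_mul, one_mul] at h1
  have h0 : starRingEnd ℂ (D.coefFun s g) * D.coefFun s g ≠ 0 :=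
    mul_ne_zero ((map_ne_zero _).2 hs) hs
  exact Complex.ofReal_injective (mul_left_cancel₀ h0 h1)

theorem smoothMap_density : SmoothMap b.density := by
  have h : SmoothMap fun g => (b.density g : ℂ) := by
    refine SmoothMap.of_mul fun g => ?_
    obtain ⟨s, hs⟩ := D.exists_coefFun_ne_zero g
    exact ⟨fun g => starRingEnd ℂ (D.coefFun s g) * D.coefFun s g, b.pair s s,
      ((D.smoothMap_coefFun s).clm Complex.conjCLE.toContinuousLinearMap).mul
        (D.smoothMap_coefFun s), (b.smooth s s).1.smoothMap,
      mul_ne_zero ((map_ne_zero _).2 hs) hs, fun g => (b.pair_eq s s g).symm⟩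
  exact h.clm Complex.reCLM

/-- The factor by which `frame` is multiplied to obtain a frame of length one that transforms
under `A` by the character `2i ζ'`. -/
def unitFactor (ζ' : Module.Dual ℝ D.𝔞) (g : 𝒢.Grp) : ℂ :=
  Complex.exp (2 * Complex.I * ζ' (D.Z g)) * ((√(b.density g))⁻¹ : ℝ)

variable (ζ' : Module.Dual ℝ D.𝔞)

theorem unitFactor_ne_zero (g : 𝒢.Grp) : b.unitFactor ζ' g ≠ 0 :=
  mul_ne_zero (Complex.exp_ne_zero _)
    (Complex.ofReal_ne_zero.2 (inv_ne_zero (Real.sqrt_pos.2 (b.density_pos g)).ne'))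

theorem conj_unitFactor_mul (g : 𝒢.Grp) :
    starRingEnd ℂ (b.unitFactor ζ' g) * b.unitFactor ζ' g * b.density g = 1 := by
  have h1 : ∀ x : ℝ, Complex.normSq (Complex.exp (2 * Complex.I * x)) = 1 := fun x => by
    rw [Complex.normSq_eq_norm_sq, Complex.norm_exp]
    simp
  have h2 : ((√(b.density g))⁻¹ * (√(b.density g))⁻¹) * b.density g = 1 := by
    rw [← mul_inv, Real.mul_self_sqrt (b.density_pos g).le, inv_mul_cancel₀ (b.density_pos g).ne']
  rw [← Complex.normSq_eq_conj_mul_self, unitFactor, map_mul, h1, one_mul, Complex.normSq_ofReal,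
    ← Complex.ofReal_mul, h2, Complex.ofReal_one]

theorem unitFactor_K_mul {k : 𝒢.Grp} (hk : k ∈ 𝒢.K) (g : 𝒢.Grp) :
    b.unitFactor ζ' (k * g) = b.unitFactor ζ' g := by
  rw [unitFactor, D.Z_K_mul hk, b.density_K_mul hk, unitFactor]

theorem unitFactor_mul_H (g : 𝒢.Grp) (h : D.H) :
    b.unitFactor ζ' (g * h) = Complex.exp (2 * Complex.I * ζ' (D.Z h)) * b.unitFactor ζ' g := by
  have h1 : ζ' (D.Z (g * h)) = ζ' (D.Z h) + ζ' (D.Z g) := by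
    rw [D.Z_mul_H, add_comm]
    exact ζ'.map_add _ _
  rw [unitFactor, h1, b.density_mul_H, unitFactor, Complex.ofReal_add, mul_add, Complex.exp_add,
    mul_assoc]

theorem smoothMap_unitFactor : SmoothMap (b.unitFactor ζ') := by
  have h1 : SmoothMap fun g => ζ' (D.Z g) :=
    D.smoothMap_coord.clm (LinearMap.toContinuousLinearMap (ζ' ∘ₗ D.coordMap))
  have h2 : SmoothMap fun g => Complex.exp (2 * Complex.I * ζ' (D.Z g)) :=
    ((SmoothMap.const (2 * Complex.I)).mul h1.ofReal).comp fun _ => Complex.contDiff_exp.contDiffAt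
  have h3 : SmoothMap fun g => (√(b.density g))⁻¹ :=
    b.smoothMap_density.comp fun g => (Real.contDiffAt_sqrt (b.density_pos g).ne').inv
      (Real.sqrt_pos.2 (b.density_pos g)).ne'
  exact h2.mul h3.ofReal

/-- The function on `G` that describes a section in the frame `unitFactor • frame`. -/
def unitCoef (s : D.Sect) (g : 𝒢.Grp) : ℂ := (b.unitFactor ζ' g)⁻¹ * D.coefFun s g

theorem smoothMap_unitCoef (s : D.Sect) : SmoothMap (b.unitCoef ζ' s) :=
  ((b.smoothMap_unitFactor ζ').comp fun g => contDiffAt_inv ℝ (b.unitFactor_ne_zero ζ' g)).mul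
    (D.smoothMap_coefFun s)

theorem coefFun_eq (s : D.Sect) (g : 𝒢.Grp) :
    D.coefFun s g = b.unitFactor ζ' g * b.unitCoef ζ' s g := by
  rw [unitCoef, mul_inv_cancel_left₀ (b.unitFactor_ne_zero ζ' g)]

theorem pair_eq_unitCoef (s t : D.Sect) (g : 𝒢.Grp) :
    b.pair s t g = starRingEnd ℂ (b.unitCoef ζ' s g) * b.unitCoef ζ' t g := by
  rw [pair_eq, b.coefFun_eq ζ', b.coefFun_eq ζ', map_mul]
  linear_combination (starRingEnd ℂ (b.unitCoef ζ' s g) * b.unitCoef ζ' t g) *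
    b.conj_unitFactor_mul ζ' g

/-- The character of `H` by which the frame `unitFactor • frame` transforms. -/
def unitChar {D : Datum 𝒢} (ζ' : Module.Dual ℝ D.𝔞) (h : D.H) : ℂ :=
  Complex.exp (2 * Complex.I * ζ' (D.Z h)) * D.δ h

theorem unitCoef_mul_H (s : D.Sect) (g : 𝒢.Grp) (h : D.H) :
    b.unitCoef ζ' s (g * h) = (unitChar ζ' h)⁻¹ * b.unitCoef ζ' s g := by
  rw [unitCoef, unitFactor_mul_H, D.coefFun_mul, unitChar, unitCoef, mul_inv, mul_inv]
  ring

end KInvariantMetric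

end Datum

/-! ### The functional `ξ + ζ'` and the character of `H` -/

section

variable {n : ℕ} {𝒢 : LinearReductiveGroup n} {C : CartanSubalgebra 𝒢}

open CartanSubalgebra

theorem trace_transpose_Ad_mul {h : 𝒢.Grp} (hh : h ∈ C.H) (X : 𝒢.𝔤) {Z : 𝒢.𝔤} (hZ : Z ∈ C.𝔥) :
    ((𝒢.Ad h X : Matrix (Fin n) (Fin n) ℝ)ᵀ * (Z : Matrix (Fin n) (Fin n) ℝ)).trace =
      ((X : Matrix (Fin n) (Fin n) ℝ)ᵀ * (Z : Matrix (Fin n) (Fin n) ℝ)).trace := by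
  have h1 : (Z : Matrix (Fin n) (Fin n) ℝ)ᵀ * 𝒢.mat h =
      𝒢.mat h * (Z : Matrix (Fin n) (Fin n) ℝ)ᵀ := by
    have h2 := mem_fixer_iff.1 hh _ (C.θ_mem Z hZ)
    rw [coe_θ, mul_neg, neg_mul, neg_inj] at h2
    exact h2.symm
  have h3 : ∀ A : Matrix (Fin n) (Fin n) ℝ, (Aᵀ * (Z : Matrix (Fin n) (Fin n) ℝ)).trace =
      ((Z : Matrix (Fin n) (Fin n) ℝ)ᵀ * A).trace := fun A => by
    rw [← Matrix.trace_transpose, Matrix.transpose_mul, Matrix.transpose_transpose]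
  rw [h3, h3, coe_Ad, ← mul_assoc, ← mul_assoc, h1, Matrix.trace_mul_comm, ← mul_assoc, ← mul_assoc,
    mat_inv_mul_mat, one_mul]

theorem orthProj_Ad_of_le {S : Submodule ℝ 𝒢.𝔤} (hS : S ≤ C.𝔥) {h : 𝒢.Grp} (hh : h ∈ C.H)
    (X : 𝒢.𝔤) : orthProj S (𝒢.Ad h X) = orthProj S X := by
  refine Subtype.ext (orthProj_eq_of_trace S _ (orthProj S X).2 fun Z hZ => ?_)
  have h1 := trace_sub_orthProj S X hZ
  rw [Matrix.conjTranspose_eq_transpose_of_trivial, Submodule.coe_sub, Matrix.transpose_sub,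
    sub_mul, Matrix.trace_sub] at h1 ⊢
  rw [trace_transpose_Ad_mul hh X (hS hZ)]
  exact h1

theorem orthProj_𝔱M_add {Y W : 𝒢.𝔤} (hY : Y ∈ C.𝔱M) (hW : W ∈ C.𝔞) :
    orthProj C.𝔱M (Y + W) = ⟨Y, hY⟩ := by
  refine Subtype.ext (orthProj_eq_of_trace _ _ hY fun Z hZ => ?_)
  rw [add_sub_cancel_left, Matrix.conjTranspose_eq_transpose_of_trivial, transpose_𝔞 hW,
    Matrix.trace_mul_comm, C.trace_𝔱M_𝔞 hZ hW]

theorem orthProj_𝔞_add {Y W : 𝒢.𝔤} (hY : Y ∈ C.𝔱M) (hW : W ∈ C.𝔞) :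
    orthProj C.𝔞 (Y + W) = ⟨W, hW⟩ := by
  refine Subtype.ext (orthProj_eq_of_trace _ _ hW fun Z hZ => ?_)
  rw [add_sub_cancel_right, Matrix.conjTranspose_eq_transpose_of_trivial, transpose_𝔱M hY,
    neg_mul, Matrix.trace_neg, C.trace_𝔱M_𝔞 hY hZ, neg_zero]

end

namespace Datum

open CartanSubalgebra KInvariantMetric

variable {n : ℕ} {𝒢 : LinearReductiveGroup n} {D : Datum 𝒢} (ζ' : Module.Dual ℝ D.𝔞)

theorem extend_Ad (h : D.H) (X : 𝒢.𝔤) : D.extend ζ' (𝒢.Ad h X) = D.extend ζ' X := by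
  have h1 : orthProj D.𝔱M (𝒢.Ad h X) = orthProj D.𝔱M X := orthProj_Ad_of_le inf_le_left h.2 X
  have h2 : orthProj D.𝔞 (𝒢.Ad h X) = orthProj D.𝔞 X := orthProj_Ad_of_le inf_le_left h.2 X
  change D.ξ (orthProj D.𝔱M (𝒢.Ad h X)) + ζ' (orthProj D.𝔞 (𝒢.Ad h X)) = _
  rw [h1, h2]
  rfl

/-- The values of `ξ` on `𝔱_M`, where the contribution of `ρ^{G,M}` vanishes. -/
theorem I_mul_ξ (Y : D.𝔱M) : Complex.I * D.ξ Y = D.lam Y := by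
  have h : D.ξ Y = (D.lam Y).im := by
    change (Complex.I⁻¹ * (D.lam Y + D.ρGM D.RM D.ζ Y)).re = _
    rw [ρGM_eq_zero D.isPositiveSystem.subset]
    simp
  rw [h]
  apply Complex.ext
  · simp [D.lam_imaginary]
  · simp

theorem extend_add {Y W : 𝒢.𝔤} (hY : Y ∈ D.𝔱M) (hW : W ∈ D.𝔞) :
    D.extend ζ' (Y + W) = D.ξ ⟨Y, hY⟩ + ζ' ⟨W, hW⟩ := by
  change D.ξ (orthProj D.𝔱M (Y + W)) + ζ' (orthProj D.𝔞 (Y + W)) = _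
  rw [orthProj_𝔱M_add hY hW, orthProj_𝔞_add hY hW]

theorem δ_expA (W : D.𝔞) : D.δ (D.expA W) = 1 := by
  have h : D.tpart (D.expA W) = 1 := by
    have h1 : D.a (D.expA W) = D.expA W := by
      have h2 : D.Z (D.expA W) = W := D.Z_exp_𝔞 W
      rw [a, h2]
    rw [tpart, h1, mul_inv_cancel]
  rw [← δ_tpart, h, δ_one]

/-- The differential of the character `unitChar ζ'` is `2i (ξ + ζ')`. -/
theorem unitChar_exp {X : 𝒢.𝔤} (hX : X ∈ D.𝔥) :
    unitChar ζ' ⟨𝒢.expG X, expG_mem_H hX⟩ = Complex.exp (2 * Complex.I * D.extend ζ' X) := by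
  obtain ⟨Y, hY, W, hW, rfl⟩ := D.exists_𝔱M_𝔞 hX
  have h1 : (⟨𝒢.expG (Y + W), expG_mem_H hX⟩ : D.H) =
      ⟨𝒢.expG Y, expG_mem_H hY.1⟩ * D.expA ⟨W, hW⟩ :=
    Subtype.ext (expG_add_of_comm (D.𝔥_comm hY.1 hW.1))
  have h2 : D.Z (𝒢.expG (Y + W)) = ⟨W, hW⟩ := by
    have h3 := D.Z_mul_exp_𝔞 (𝒢.expG Y) ⟨W, hW⟩
    have h4 : D.Z (𝒢.expG Y) = 0 := by
      have h5 := D.Z_K_mul (expG_mem_K hY.2) 1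
      rwa [mul_one, Z_one] at h5
    rw [h4, zero_add] at h3
    rw [expG_add_of_comm (D.𝔥_comm hY.1 hW.1)]
    exact h3
  rw [unitChar, h2, h1, δ_mul, D.δ_exp_𝔱M hY, δ_expA, mul_one, ← Complex.exp_add,
    extend_add ζ' hY hW, ← I_mul_ξ]
  push_cast
  congr 1
  ring

end Datum

/-! ### The connection -/

namespace SmoothMap

variable {n : ℕ} {𝒢 : LinearReductiveGroup n} {f f' : 𝒢.Grp → ℂ}

theorem dirDeriv_add_fun (hf : SmoothMap f) (hf' : SmoothMap f') (g : 𝒢.Grp) (X : 𝒢.𝔤) :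
    Datum.dirDeriv (fun g => f g + f' g) g X = Datum.dirDeriv f g X + Datum.dirDeriv f' g X :=
  ((hf.hasDerivAt g X).add (hf'.hasDerivAt g X)).deriv

theorem dirDeriv_mul_fun (hf : SmoothMap f) (hf' : SmoothMap f') (g : 𝒢.Grp) (X : 𝒢.𝔤) :
    Datum.dirDeriv (fun g => f g * f' g) g X =
      Datum.dirDeriv f g X * f' g + f g * Datum.dirDeriv f' g X := by
  have h := ((hf.hasDerivAt g X).mul (hf'.hasDerivAt g X)).deriv
  simp only [zero_smul, expG_zero, mul_one] at h
  exact h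

theorem dirDeriv_conj (hf : SmoothMap f) (g : 𝒢.Grp) (X : 𝒢.𝔤) :
    Datum.dirDeriv (fun g => starRingEnd ℂ (f g)) g X = starRingEnd ℂ (Datum.dirDeriv f g X) :=
  (Complex.conjCLE.toContinuousLinearMap.hasFDerivAt.comp_hasDerivAt (0 : ℝ)
    (hf.hasDerivAt g X)).deriv

end SmoothMap

namespace Datum

open CartanSubalgebra KInvariantMetric

variable {n : ℕ} {𝒢 : LinearReductiveGroup n} {D : Datum 𝒢} (ζ' : Module.Dual ℝ D.𝔞)

/-- The covariant derivative in the direction of `X ∈ 𝔤` of a function on `G` that transforms by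
the character `unitChar ζ'`. -/
def cov (ψ : 𝒢.Grp → ℂ) (g : 𝒢.Grp) (X : 𝒢.𝔤) : ℂ :=
  dirDeriv ψ g X + 2 * Complex.I * D.extend ζ' X * ψ g

theorem cov_add {ψ : 𝒢.Grp → ℂ} (hψ : SmoothMap ψ) (g : 𝒢.Grp) (X Y : 𝒢.𝔤) :
    cov ζ' ψ g (X + Y) = cov ζ' ψ g X + cov ζ' ψ g Y := by
  rw [cov, hψ.dirDeriv_add, map_add, cov, cov]
  push_cast
  ring

theorem cov_smul {ψ : 𝒢.Grp → ℂ} (hψ : SmoothMap ψ) (g : 𝒢.Grp) (c : ℝ) (X : 𝒢.𝔤) :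
    cov ζ' ψ g (c • X) = c * cov ζ' ψ g X := by
  rw [cov, hψ.dirDeriv_smul, map_smul, cov, smul_eq_mul]
  push_cast
  ring

theorem cov_add_fun {ψ ψ' : 𝒢.Grp → ℂ} (hψ : SmoothMap ψ) (hψ' : SmoothMap ψ') (g : 𝒢.Grp)
    (X : 𝒢.𝔤) : cov ζ' (fun g => ψ g + ψ' g) g X = cov ζ' ψ g X + cov ζ' ψ' g X := by
  rw [cov, hψ.dirDeriv_add_fun hψ', cov, cov]
  ring

theorem cov_mul_fun {f ψ : 𝒢.Grp → ℂ} (hf : SmoothMap f) (hψ : SmoothMap ψ) (g : 𝒢.Grp)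
    (X : 𝒢.𝔤) : cov ζ' (fun g => f g * ψ g) g X = dirDeriv f g X * ψ g + f g * cov ζ' ψ g X := by
  rw [cov, hf.dirDeriv_mul_fun hψ, cov]
  ring

theorem cov_const_mul {ψ : 𝒢.Grp → ℂ} (hψ : SmoothMap ψ) (c : ℂ) (g : 𝒢.Grp) (X : 𝒢.𝔤) :
    cov ζ' (fun g => c * ψ g) g X = c * cov ζ' ψ g X := by
  have h : dirDeriv (fun _ : 𝒢.Grp => c) g X = 0 := deriv_const _ _
  rw [cov_mul_fun ζ' (SmoothMap.const c) hψ, h, zero_mul, zero_add]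

theorem cov_left_mul (ψ : 𝒢.Grp → ℂ) (k g : 𝒢.Grp) (X : 𝒢.𝔤) :
    cov ζ' (fun g => ψ (k * g)) g X = cov ζ' ψ (k * g) X := by
  simp only [cov, dirDeriv, mul_assoc]

/-- The covariant derivative is compatible with right translation by `H`, as the functional
`ξ + ζ'` is `H`-invariant. -/
theorem cov_mul_H {ψ : 𝒢.Grp → ℂ}
    (heq : ∀ (g : 𝒢.Grp) (h : D.H), ψ (g * h) = (unitChar ζ' h)⁻¹ * ψ g) (g : 𝒢.Grp) (h : D.H)
    (X : 𝒢.𝔤) : cov ζ' ψ (g * h) X = (unitChar ζ' h)⁻¹ * cov ζ' ψ g (𝒢.Ad h X) := by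
  have h1 : (fun t : ℝ => ψ (g * h * 𝒢.expG (t • X))) =
      fun t : ℝ => (unitChar ζ' h)⁻¹ * ψ (g * 𝒢.expG (t • 𝒢.Ad h X)) := by
    funext t
    rw [← heq, ← map_smul, expG_Ad]
    congr 1
    group
  rw [cov, dirDeriv, h1, deriv_const_mul_field, heq, cov, extend_Ad, dirDeriv]
  ring

/-- The covariant derivative in the direction of `𝔥` vanishes. -/
theorem cov_𝔥 {ψ : 𝒢.Grp → ℂ}
    (heq : ∀ (g : 𝒢.Grp) (h : D.H), ψ (g * h) = (unitChar ζ' h)⁻¹ * ψ g) (g : 𝒢.Grp)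
    {X : 𝒢.𝔤} (hX : X ∈ D.𝔥) : cov ζ' ψ g X = 0 := by
  have h1 : (fun t : ℝ => ψ (g * 𝒢.expG (t • X))) =
      fun t : ℝ => Complex.exp (t * (-(2 * Complex.I * D.extend ζ' X))) * ψ g := by
    funext t
    have h2 := heq g ⟨𝒢.expG (t • X), expG_mem_H (D.𝔥.smul_mem t hX)⟩
    rw [unitChar_exp ζ' (D.𝔥.smul_mem t hX), ← Complex.exp_neg] at h2
    refine h2.trans ?_
    rw [map_smul, smul_eq_mul]
    push_cast
    congr 2
    ring
  have h3 : HasDerivAt (fun t : ℝ => Complex.exp (t * (-(2 * Complex.I * D.extend ζ' X))) * ψ g)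
      (-(2 * Complex.I * D.extend ζ' X) * ψ g) 0 := by
    have h4 : HasDerivAt (fun t : ℝ => (t : ℂ) * (-(2 * Complex.I * D.extend ζ' X)))
        (-(2 * Complex.I * D.extend ζ' X)) 0 := by
      simpa using (Complex.ofRealCLM.hasDerivAt (x := (0 : ℝ))).mul_const
        (-(2 * Complex.I * D.extend ζ' X))
    simpa using h4.cexp.mul_const (ψ g)
  rw [cov, dirDeriv, h1, h3.deriv]
  ring

/-- The covariant derivative only depends on the tangent vector in `𝔤/𝔥`. -/
theorem cov_congr {ψ : 𝒢.Grp → ℂ} (hψ : SmoothMap ψ)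
    (heq : ∀ (g : 𝒢.Grp) (h : D.H), ψ (g * h) = (unitChar ζ' h)⁻¹ * ψ g) (g : 𝒢.Grp) {X Y : 𝒢.𝔤}
    (h : (Submodule.Quotient.mk X : D.T) = Submodule.Quotient.mk Y) :
    cov ζ' ψ g X = cov ζ' ψ g Y := by
  have h1 := cov_add ζ' hψ g (X - Y) Y
  rwa [sub_add_cancel, cov_𝔥 ζ' heq g ((Submodule.Quotient.eq _).1 h), zero_add] at h1

variable (D) in
/-- A linear right inverse of the projection `𝔤 → 𝔤/𝔥`. -/
def lift : D.T →ₗ[ℝ] 𝒢.𝔤 :=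
  (D.𝔥.mkQ.exists_rightInverse_of_surjective D.𝔥.range_mkQ).choose

theorem mk_lift (v : D.T) : (Submodule.Quotient.mk (D.lift v) : D.T) = v :=
  LinearMap.congr_fun
    (D.𝔥.mkQ.exists_rightInverse_of_surjective D.𝔥.range_mkQ).choose_spec v

theorem smoothMap_cov {ψ : 𝒢.Grp → ℂ} (hψ : SmoothMap ψ) (v : D.VectorField) :
    SmoothMap fun g => cov ζ' ψ g (D.lift (v.1 g)) := by
  let B := Module.finBasis ℝ 𝒢.𝔤
  have h1 : ∀ g, cov ζ' ψ g (D.lift (v.1 g)) =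
      ∑ j, (B.coord j (D.lift (v.1 g)) : ℂ) * cov ζ' ψ g (B j) := fun g => by
    have h2 : ∀ c : Fin (Module.finrank ℝ 𝒢.𝔤) → ℝ,
        cov ζ' ψ g (∑ j, c j • B j) = ∑ j, (c j : ℂ) * cov ζ' ψ g (B j) := fun c => by
      let F : 𝒢.𝔤 →+ ℂ := AddMonoidHom.mk' (cov ζ' ψ g) (cov_add ζ' hψ g)
      refine (map_sum F _ _).trans (Finset.sum_congr rfl fun j _ => cov_smul ζ' hψ g _ _)
    conv_lhs => rw [← B.sum_repr (D.lift (v.1 g))]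
    exact h2 _
  simp only [h1]
  refine SmoothMap.sum fun j _ => SmoothMap.mul (SmoothMap.ofReal ?_)
    ((hψ.dirDeriv _).add ((SmoothMap.const _).mul hψ))
  exact fun g m X => v.2.1 (B.coord j ∘ₗ D.lift) g m X

variable (b : D.KInvariantMetric)

theorem sect_ext {s t : D.Sect} (h : ∀ g, b.unitCoef ζ' s g = b.unitCoef ζ' t g) : s = t :=
  Subtype.ext (funext fun g => by
    rw [D.eq_coefFun_smul, D.eq_coefFun_smul t, b.coefFun_eq ζ', h, ← b.coefFun_eq ζ'])

/-- The covariant derivative of a section along a vector field. -/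
def covSect (v : D.VectorField) (s : D.Sect) : D.Sect :=
  D.ofCoef (fun g => b.unitFactor ζ' g * cov ζ' (b.unitCoef ζ' s) g (D.lift (v.1 g)))
    ((b.smoothMap_unitFactor ζ').mul (smoothMap_cov ζ' (b.smoothMap_unitCoef ζ' s) v))
    fun g h => by
      have h1 : cov ζ' (b.unitCoef ζ' s) g (𝒢.Ad h (D.lift (v.1 (g * h)))) =
          cov ζ' (b.unitCoef ζ' s) g (D.lift (v.1 g)) := by
        refine cov_congr ζ' (b.smoothMap_unitCoef ζ' s) (b.unitCoef_mul_H ζ' s) g ?_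
        rw [mk_lift, ← AdT_mk, mk_lift, v.2.2, AdT_AdT_inv]
      rw [cov_mul_H ζ' (b.unitCoef_mul_H ζ' s), h1, b.unitFactor_mul_H, unitChar, mul_inv]
      have h2 := Complex.exp_ne_zero (2 * Complex.I * ζ' (D.Z h))
      field_simp

theorem unitCoef_covSect (v : D.VectorField) (s : D.Sect) (g : 𝒢.Grp) :
    b.unitCoef ζ' (covSect ζ' b v s) g = cov ζ' (b.unitCoef ζ' s) g (D.lift (v.1 g)) := by
  rw [unitCoef, covSect, coefFun_ofCoef, inv_mul_cancel_left₀ (b.unitFactor_ne_zero ζ' g)]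

theorem unitCoef_covSect_of_mk (v : D.VectorField) (s : D.Sect) (g : 𝒢.Grp) {X : 𝒢.𝔤}
    (hX : v.1 g = Submodule.Quotient.mk X) :
    b.unitCoef ζ' (covSect ζ' b v s) g = cov ζ' (b.unitCoef ζ' s) g X := by
  rw [unitCoef_covSect]
  exact cov_congr ζ' (b.smoothMap_unitCoef ζ' s) (b.unitCoef_mul_H ζ' s) g ((mk_lift _).trans hX)

theorem unitCoef_add (s t : D.Sect) (g : 𝒢.Grp) :
    b.unitCoef ζ' (s + t) g = b.unitCoef ζ' s g + b.unitCoef ζ' t g := by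
  have h : D.coefFun (s + t) g = D.coefFun s g + D.coefFun t g := (D.coef g).map_add _ _
  rw [unitCoef, h, mul_add, unitCoef, unitCoef]

theorem unitCoef_of_eq_smul {s t : D.Sect} {g : 𝒢.Grp} {c : ℂ} (h : t.1 g = c • s.1 g) :
    b.unitCoef ζ' t g = c * b.unitCoef ζ' s g := by
  rw [unitCoef, coefFun, h, map_smul, smul_eq_mul, unitCoef, coefFun, mul_left_comm]

theorem eq_unitCoef_smul (s : D.Sect) (g : 𝒢.Grp) :
    s.1 g = b.unitCoef ζ' s g • b.unitFactor ζ' g • D.frame g := by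
  rw [smul_smul, mul_comm, ← b.coefFun_eq ζ']
  exact D.eq_coefFun_smul s g

/-- The connection for which the frame `unitFactor • frame` of length one has the connection form
`2i (ξ + ζ')`. -/
def frameConnection : D.Connection where
  toFun v :=
    { toFun := covSect ζ' b v
      map_add' := fun s t => sect_ext ζ' b fun g => by
        have h : b.unitCoef ζ' (s + t) = fun g => b.unitCoef ζ' s g + b.unitCoef ζ' t g :=
          funext fun g => unitCoef_add ζ' b s t g
        rw [unitCoef_add, unitCoef_covSect, unitCoef_covSect, unitCoef_covSect, h,
          cov_add_fun ζ' (b.smoothMap_unitCoef ζ' s) (b.smoothMap_unitCoef ζ' t)]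
      map_smul' := fun c s => sect_ext ζ' b fun g => by
        have h : b.unitCoef ζ' (c • s) = fun g => c * b.unitCoef ζ' s g :=
          funext fun g => unitCoef_of_eq_smul ζ' b rfl
        refine Eq.trans ?_ (unitCoef_of_eq_smul ζ' b (c := c) (s := covSect ζ' b v s) rfl).symm
        rw [unitCoef_covSect, unitCoef_covSect, h, cov_const_mul ζ' (b.smoothMap_unitCoef ζ' s)] }
  add_field v w s := sect_ext ζ' b fun g => by
    refine (unitCoef_covSect ζ' b (v + w) s g).trans ?_
    refine Eq.trans ?_ (unitCoef_add ζ' b (covSect ζ' b v s) (covSect ζ' b w s) g).symm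
    rw [unitCoef_covSect, unitCoef_covSect, ← cov_add ζ' (b.smoothMap_unitCoef ζ' s)]
    exact congrArg _ (D.lift.map_add _ _)
  smul_field f hf v w hfv s g := by
    change (covSect ζ' b w s).1 g = (f g : ℂ) • (covSect ζ' b v s).1 g
    rw [eq_unitCoef_smul ζ' b, eq_unitCoef_smul ζ' b (covSect ζ' b v s), unitCoef_covSect,
      unitCoef_covSect, hfv, map_smul, cov_smul ζ' (b.smoothMap_unitCoef ζ' s), mul_smul]
  leibniz f hf s t hst v g X hX := by
    change (covSect ζ' b v t).1 g = dirDeriv f g X • s.1 g + f g • (covSect ζ' b v s).1 g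
    have h : b.unitCoef ζ' t = fun g => f g * b.unitCoef ζ' s g :=
      funext fun g => unitCoef_of_eq_smul ζ' b (hst g)
    rw [eq_unitCoef_smul ζ' b, eq_unitCoef_smul ζ' b (covSect ζ' b v s), eq_unitCoef_smul ζ' b s,
      unitCoef_covSect_of_mk ζ' b v t g hX, unitCoef_covSect_of_mk ζ' b v s g hX, h,
      cov_mul_fun ζ' hf.1.smoothMap (b.smoothMap_unitCoef ζ' s), add_smul, mul_smul, mul_smul]

theorem isHermitian_frameConnection : (frameConnection ζ' b).IsHermitian b := by
  intro v s t g X hX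
  change _ = b.pair (covSect ζ' b v s) t g + b.pair s (covSect ζ' b v t) g
  have h : b.pair s t = fun g => starRingEnd ℂ (b.unitCoef ζ' s g) * b.unitCoef ζ' t g :=
    funext fun g => b.pair_eq_unitCoef ζ' s t g
  have hs := b.smoothMap_unitCoef ζ' s
  have hc : SmoothMap fun g => starRingEnd ℂ (b.unitCoef ζ' s g) :=
    hs.clm Complex.conjCLE.toContinuousLinearMap
  rw [h, hc.dirDeriv_mul_fun (b.smoothMap_unitCoef ζ' t), b.pair_eq_unitCoef ζ',
    b.pair_eq_unitCoef ζ',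
    unitCoef_covSect_of_mk ζ' b v s g hX, unitCoef_covSect_of_mk ζ' b v t g hX, cov, cov,
    hs.dirDeriv_conj g X]
  simp only [map_add, map_mul, Complex.conj_I, Complex.conj_ofReal, Complex.conj_ofNat]
  ring

theorem unitCoef_K_translate {k : 𝒢.Grp} (hk : k ∈ 𝒢.K) {s s' : D.Sect}
    (h : ∀ g, s'.1 g = s.1 (k * g)) (g : 𝒢.Grp) :
    b.unitCoef ζ' s' g = b.unitCoef ζ' s (k * g) := by
  rw [unitCoef, unitCoef, b.unitFactor_K_mul ζ' hk, coefFun, coefFun, D.coef_K_mul hk, h]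

theorem isKInvariant_frameConnection : (frameConnection ζ' b).IsKInvariant := by
  intro k hk v v' s s' hv hs g
  change (covSect ζ' b v' s').1 g = (covSect ζ' b v s).1 (k⁻¹ * g)
  have hk' := inv_mem hk
  have h : b.unitCoef ζ' s' = fun g => b.unitCoef ζ' s (k⁻¹ * g) :=
    funext fun g => unitCoef_K_translate ζ' b hk' hs g
  rw [eq_unitCoef_smul ζ' b, eq_unitCoef_smul ζ' b (covSect ζ' b v s), b.unitFactor_K_mul ζ' hk',
    D.frame_K_mul hk', unitCoef_covSect, unitCoef_covSect, h, cov_left_mul, hv]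

/-- The moment map of `frameConnection`. -/
def momentMap : 𝒢.Grp ⧸ D.H → Module.Dual ℝ 𝒢.𝔨 :=
  Quotient.lift (fun g : 𝒢.Grp => D.extend ζ' ∘ₗ 𝒢.Ad g⁻¹ ∘ₗ 𝒢.𝔨.subtype) fun g g' hg => by
    refine LinearMap.ext fun X => ?_
    let h : D.H := ⟨g⁻¹ * g', QuotientGroup.leftRel_apply.1 hg⟩
    have h1 := extend_Ad ζ' h (𝒢.Ad g'⁻¹ X)
    rw [← 𝒢.Ad_mul, show (h : 𝒢.Grp) * g'⁻¹ = g⁻¹ from mul_inv_cancel_right _ _] at h1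
    exact h1

theorem momentMap_mk (g : 𝒢.Grp) (X : 𝒢.𝔨) :
    momentMap ζ' (g : 𝒢.Grp ⧸ D.H) X = D.extend ζ' (𝒢.Ad g⁻¹ X) := rfl

theorem isMomentMap_momentMap : (frameConnection ζ' b).IsMomentMap (momentMap ζ') := by
  intro X s g ℓ
  rw [momentMap_mk]
  change HasDerivAt _ (ℓ ((covSect ζ' b (D.inducedField X) s).1 g + _)) 0
  have h1 : ∀ t : ℝ, 𝒢.expG (-(t • (X : 𝒢.𝔤))) * g = g * 𝒢.expG (t • -𝒢.Ad g⁻¹ X) := fun t => by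
    have h2 : t • -𝒢.Ad g⁻¹ X = 𝒢.Ad g⁻¹ (-(t • (X : 𝒢.𝔤))) := by
      rw [map_neg, map_smul, smul_neg]
    rw [h2, expG_Ad]
    group
  -- in the invariant frame the Lie derivative is the derivative of the coefficient, so that
  -- only the connection form remains
  have h3 : ∀ t : ℝ, ℓ (s.1 (𝒢.expG (-(t • (X : 𝒢.𝔤))) * g)) =
      b.unitCoef ζ' s (g * 𝒢.expG (t • -𝒢.Ad g⁻¹ X)) * ℓ (b.unitFactor ζ' g • D.frame g) := by
    intro t
    have hk : 𝒢.expG (-(t • (X : 𝒢.𝔤))) ∈ 𝒢.K := expG_mem_K (neg_mem (𝒢.𝔨.smul_mem t X.2))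
    rw [eq_unitCoef_smul ζ' b, b.unitFactor_K_mul ζ' hk, D.frame_K_mul hk, h1, map_smul,
      smul_eq_mul]
  simp only [h3]
  have h4 := ((b.smoothMap_unitCoef ζ' s).hasDerivAt g (-𝒢.Ad g⁻¹ X)).mul_const
    (ℓ (b.unitFactor ζ' g • D.frame g))
  refine h4.congr_deriv ?_
  rw [eq_unitCoef_smul ζ' b (covSect ζ' b (D.inducedField X) s), eq_unitCoef_smul ζ' b s,
    unitCoef_covSect_of_mk ζ' b _ s g (X := -𝒢.Ad g⁻¹ X) rfl]
  simp only [map_add, map_smul, smul_eq_mul, cov, map_neg]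
  push_cast
  ring

end Datum

end SpincMoment

end

theorem mainTheorem10 {n : ℕ} (𝒢 : SpincMoment.LinearReductiveGroup n)
    (D : SpincMoment.Datum 𝒢) (ζ' : Module.Dual ℝ D.𝔞) :
    Nonempty D.KInvariantMetric ∧
      ∀ b : D.KInvariantMetric, ∃ nabla : D.Connection,
        nabla.IsKInvariant ∧ nabla.IsHermitian b ∧
          ∃ Φ : 𝒢.Grp ⧸ D.H → Module.Dual ℝ 𝒢.𝔨, nabla.IsMomentMap Φ ∧
            ∀ (g : 𝒢.Grp) (X : 𝒢.𝔨), Φ (g : 𝒢.Grp ⧸ D.H) X = D.extend ζ' (𝒢.Ad g⁻¹ X) := by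
  refine ⟨⟨D.frameMetric⟩, fun b => ⟨SpincMoment.Datum.frameConnection ζ' b,
    SpincMoment.Datum.isKInvariant_frameConnection ζ' b,
    SpincMoment.Datum.isHermitian_frameConnection ζ' b, SpincMoment.Datum.momentMap ζ',
    SpincMoment.Datum.isMomentMap_momentMap ζ' b, fun g X => rfl⟩⟩
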